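/- Let $M$ be a smooth manifold (finite-dimensional, Hausdorff, $\sigma$-compact, without boundary) and let $\pi:A\to M$ be a smooth real vector bundle of finite rank with the structure of a \emph{pre-Lie algebroid}: a vector bundle map $\rho:A\to TM$ over the identity and an antisymmetric $\mathbb R$-bilinear bracket on $\Gamma(A)$ with $[\alpha,f\beta]=f[\alpha,\beta]+\mathcal L_{\rho(\alpha)}(f)\beta$ and $\rho([\alpha,\beta])=[\rho(\alpha),\rho(\beta)]$ (the Jacobi identity is not assumed). Let $\overline\nabla:\Gamma(A)\times\Gamma(A)\to\Gamma(A)$ be an $A$-connection on $A$, i.e. an $\mathbb R$-bilinear map with $\overline\nabla_{f\alpha}s=f\overline\nabla_\alpha s$ and $\overline\nabla_\alpha(fs)=f\overline\nabla_\alpha s+\mathcal L_{\rho(\alpha)}(f)s$. A geodesic is a curve $g$ in $A$ with base curve $\gamma=\pi\circ g$ such that $\rho(g)=\dot\gamma$ and $\overline\nabla_g g=0$; here $(\overline\nabla_g u)(t)=(\overline\nabla_{g(t)}\xi^t)(x)+\frac{d\xi^t}{dt}(x)$, $x=\gamma(t)$, for any time-dependent section $\xi$ with $\xi^t(\gamma(t))=u(t)$.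 For $a\in A$ let $g_a$ be the maximal geodesic with $g_a(0)=a$ and let $\gamma_a$ be its base curve. Let $A_0\subset A$ be an open neighbourhood of the zero section that is star-shaped in each fibre ($a\in A_0$, $t\in[0,1]$ imply $ta\in A_0$) and such that $g_a$ is defined up to at least time $1$ for all $a\in A_0$. Put $\exp(a)=g_a(1)$ and $\tau=\pi\circ\exp$ on $A_0$. Let $\Omega^k_\pi(A_0;\tau^*A)$ be the space of smooth $k$-forms along the $\pi$-fibres with values in $\tau^*A$; vertical vectors at $a\in (A_0)_x$ are identified with elements of $A_x$. For a vector bundle connection $\nabla$ on $A$ and $\phi\in\Omega^1_\pi(A_0;\tau^*A)$ let $\mathrm{MC}_\phi=d_{\tau^*\nabla}\phi+\frac12[\phi,\phi]_\nabla\in\Omega^2_\pi(A_0;\tau^*A)$, where $[\alpha,\beta]_\nabla=[\alpha,\beta]-\nabla_{\rho(\alpha)}\beta+\nabla_{\rho(\beta)}\alpha$; if $\rho\circ\phi=d\tau$, this does not depend on $\nabla$. Then there is one and only one $\phi\in\Omega^1_\pi(A_0;\tau^*A)$ such that $$(\mathrm{MC}_\phi)_a(a,b)=0\quad (x\in M,\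 a\in (A_0)_x,\ b\in A_x),\qquad \rho\circ\phi=d\tau,\qquad \phi_a(a)=\exp(a)\quad (a\in A_0).$$ (In particular the first two equations have a solution.) There is an open neighbourhood $U\subset A_0$ of the zero section such that $\phi_a:A_x\to A_{\tau(a)}$ is an isomorphism for all $x\in M$, $a\in U\cap A_x$. Moreover $\phi$ is given by the following formula. Let $x\in M$, $a\in(A_0)_x$, $b\in A_x$. There exist $\delta>0$, with $a+\epsilon b\in A_0$ for all $|\epsilon|<\delta$, and a smooth map $\xi:[0,1]\times(-\delta,\delta)\times M\to A$ such that each $\xi^t_\epsilon=\xi(t,\epsilon,\cdot)$ is a section of $A$ and $\xi^t_\epsilon(\gamma_{a+\epsilon b}(t))=g_{a+\epsilon b}(t)$ for all $(t,\epsilon)$. For every such $\delta$ and $\xi$, $\gamma_a$ is an integral curve of $\rho(\xi_0)$ on $[0,1]$, the infinitesimal flow $\psi^{t,s}_{\xi_0}:A_{\gamma_a(s)}\to A_{\gamma_a(t)}$ of $\xi_0$ along $\gamma_a$ exists, i.e. linear maps with $\psi^{s,s}_{\xi_0}=\mathrm{id}$, $\psi^{u,t}_{\xi_0}\circ\psi^{t,s}_{\xi_0}=\psi^{u,s}_{\xi_0}$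 and $\frac{d}{dt}\big|_{t=s}\psi^{s,t}_{\xi_0}\alpha(\gamma_a(t))=[\xi_0^s,\alpha](\gamma_a(s))$ for all $\alpha\in\Gamma(A)$, $s\in[0,1]$, and for any such maps $$\phi_a(b)=\int_0^1\psi^{1,t}_{\xi_0}\,\frac{d}{d\epsilon}\Big|_{\epsilon=0}\xi^t_\epsilon(\gamma_a(t))\,dt .$$ -/

import Mathlib

open Bundle Set Filter MeasureTheory
open scoped Manifold ContDiff Topology

noncomputable section

namespace PreLie

variable {EM : Type*} [NormedAddCommGroup EM] [NormedSpace ℝ EM]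
  {M : Type*} [TopologicalSpace M] [ChartedSpace EM M]
  [IsManifold 𝓘(ℝ, EM) ∞ M]
  {F : Type*} [NormedAddCommGroup F] [NormedSpace ℝ F]
  {E : M → Type*} [TopologicalSpace (TotalSpace F E)]
  [∀ x, AddCommGroup (E x)] [∀ x, Module ℝ (E x)] [∀ x, TopologicalSpace (E x)]
  [∀ x, IsTopologicalAddGroup (E x)] [∀ x, ContinuousSMul ℝ (E x)]
  [FiberBundle F E] [VectorBundle ℝ F E]

/-- The product `f β` of a smooth function and a smooth section. -/
def smulSection (f : C^∞⟮𝓘(ℝ, EM), M; ℝ⟯) (β : Cₛ^∞⟮𝓘(ℝ, EM); F, E⟯) :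
    Cₛ^∞⟮𝓘(ℝ, EM); F, E⟯ where
  toFun x := f x • β x
  contMDiff_toFun := ContMDiff.smul_section (s := ⇑β) f.contMDiff β.contMDiff

/-- The derivative of the smooth function `f` in the direction of the tangent vector `v`. -/
def dirDeriv (f : C^∞⟮𝓘(ℝ, EM), M; ℝ⟯) {x : M} (v : TangentSpace 𝓘(ℝ, EM) x) : ℝ :=
  mvfderiv 𝓘(ℝ, EM) (fun y => f y) x v

variable (EM F E) in
/-- A pre-Lie algebroid structure on the smooth vector bundle `E` over `M`: a smooth bundle map
`anchor : E → TM` over the identity and an antisymmetric `ℝ`-bilinear bracket on smooth sections,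
with the Leibniz rule and such that the anchor preserves brackets. -/
structure PreLieAlgebroid where
  anchor : (x : M) → E x →ₗ[ℝ] TangentSpace 𝓘(ℝ, EM) x
  contMDiff_anchor : ContMDiff (𝓘(ℝ, EM).prod 𝓘(ℝ, F)) 𝓘(ℝ, EM).tangent ∞
    (fun a : TotalSpace F E => (⟨a.1, anchor a.1 a.2⟩ : TangentBundle 𝓘(ℝ, EM) M))
  bracket : Cₛ^∞⟮𝓘(ℝ, EM); F, E⟯ →ₗ[ℝ] Cₛ^∞⟮𝓘(ℝ, EM); F, E⟯ →ₗ[ℝ] Cₛ^∞⟮𝓘(ℝ, EM); F, E⟯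
  antisymm : ∀ α β, bracket α β = -bracket β α
  leibniz : ∀ α β (f : C^∞⟮𝓘(ℝ, EM), M; ℝ⟯) (x : M),
    bracket α (smulSection f β) x
      = f x • bracket α β x + dirDeriv f (anchor x (α x)) • β x
  anchor_bracket : ∀ α β (x : M),
    anchor x (bracket α β x) =
      VectorField.mlieBracket 𝓘(ℝ, EM) (fun y => anchor y (α y)) (fun y => anchor y (β y)) x

/-- An `A`-connection on `A` itself, where `A` is the pre-Lie algebroid `L`. -/
structure AConnection (L : PreLieAlgebroid EM F E) where
  toFun : Cₛ^∞⟮𝓘(ℝ, EM); F, E⟯ →ₗ[ℝ] Cₛ^∞⟮𝓘(ℝ, EM); F, E⟯ →ₗ[ℝ] Cₛ^∞⟮𝓘(ℝ, EM); F, E⟯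
  smul_left : ∀ (f : C^∞⟮𝓘(ℝ, EM), M; ℝ⟯) α s (x : M),
    toFun (smulSection f α) s x = f x • toFun α s x
  leibniz : ∀ (f : C^∞⟮𝓘(ℝ, EM), M; ℝ⟯) α s (x : M),
    toFun α (smulSection f s) x
      = f x • toFun α s x + dirDeriv f (L.anchor x (α x)) • s x

/-- Smoothness on `T × M` of a time dependent section `ξ`. -/
def IsSmoothTimeDepSection (ξ : ℝ → Cₛ^∞⟮𝓘(ℝ, EM); F, E⟯) (T : Set ℝ) : Prop :=
  ContMDiffOn (𝓘(ℝ, ℝ).prod 𝓘(ℝ, EM)) (𝓘(ℝ, EM).prod 𝓘(ℝ, F)) ∞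
    (fun p : ℝ × M => (⟨p.2, ξ p.1 p.2⟩ : TotalSpace F E)) (T ×ˢ univ)

/-- The value `w` of a covariant derivative at time `t₀` of a curve `u` covering the base curve
`γ`, computed with a time dependent section `ξ` such that `ξ^t (γ t) = u t` for `t` near `t₀`:
`w = D (ξ^{t₀}) + d/dt ξ^t (x)` at `t = t₀`, where `x = γ t₀` and `D` is the covariant derivative of
sections at `x` in the direction under consideration. -/
def HasCovDerivAlong (γ : ℝ → M) (u : (t : ℝ) → E (γ t)) (t₀ : ℝ) (x : M)
    (D : Cₛ^∞⟮𝓘(ℝ, EM); F, E⟯ → E x) (w : E x) : Prop :=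
  ∃ (ξ : ℝ → Cₛ^∞⟮𝓘(ℝ, EM); F, E⟯) (δ : ℝ), 0 < δ ∧
    IsSmoothTimeDepSection ξ (Ioo (t₀ - δ) (t₀ + δ)) ∧
    (∀ t ∈ Ioo (t₀ - δ) (t₀ + δ), ξ t (γ t) = u t) ∧
    w = D (ξ t₀) + deriv (fun t => ξ t x) t₀

section Geodesics

variable {L : PreLieAlgebroid EM F E}

/-- `w` is the covariant derivative `(∇̄_g u)(t)` of a curve `u` covering the base curve of `g`. -/
def AConnection.HasCovDerivAt (C : AConnection L) (g : ℝ → TotalSpace F E)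
    (u : (t : ℝ) → E (g t).1) (t : ℝ) (w : E (g t).1) : Prop :=
  ∃ α : Cₛ^∞⟮𝓘(ℝ, EM); F, E⟯, α (g t).1 = (g t).2 ∧
    HasCovDerivAlong (fun r => (g r).1) u t (g t).1 (fun σ => C.toFun α σ (g t).1) w

variable (L) in
/-- `g` is a smooth `A`-path on the open set of times `J`. -/
def IsAPathOn (g : ℝ → TotalSpace F E) (J : Set ℝ) : Prop :=
  ContMDiffOn 𝓘(ℝ, ℝ) (𝓘(ℝ, EM).prod 𝓘(ℝ, F)) ∞ g J ∧
  ∀ t ∈ J, HasMFDerivAt 𝓘(ℝ, ℝ) 𝓘(ℝ, EM) (fun r => (g r).1) t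
    ((1 : ℝ →L[ℝ] ℝ).smulRight (L.anchor (g t).1 (g t).2))

/-- `g` is a geodesic on the open set of times `J`. -/
def AConnection.IsGeodesicOn (C : AConnection L) (g : ℝ → TotalSpace F E) (J : Set ℝ) : Prop :=
  IsAPathOn L g J ∧ ∀ t ∈ J, C.HasCovDerivAt g (fun r => (g r).2) t 0

/-- `g` is a geodesic with `g 0 = a` on some open interval that contains `0` and `t`. -/
def AConnection.IsGeodesicFromTo (C : AConnection L) (a : TotalSpace F E) (t : ℝ)
    (g : ℝ → TotalSpace F E) : Prop :=
  g 0 = a ∧ ∃ J : Set ℝ, IsOpen J ∧ J.OrdConnected ∧ 0 ∈ J ∧ t ∈ J ∧ C.IsGeodesicOn g J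

/-- The domain `I_a` of the maximal geodesic starting at `a`. -/
def AConnection.geodesicDomain (C : AConnection L) (a : TotalSpace F E) : Set ℝ :=
  {t | ∃ g, C.IsGeodesicFromTo a t g}

open Classical in
/-- The maximal geodesic `g_a` starting at `a` (with a junk value outside of `I_a`). -/
def AConnection.geodesic (C : AConnection L) (a : TotalSpace F E) (t : ℝ) : TotalSpace F E :=
  if h : ∃ g, C.IsGeodesicFromTo a t g then h.choose t else ⟨a.1, 0⟩

/-- The base curve `γ_a` of `g_a`. -/
def AConnection.baseCurve (C : AConnection L) (a : TotalSpace F E) (t : ℝ) : M :=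
  (C.geodesic a t).1

/-- The exponential map `exp a = g_a 1`. -/
def AConnection.exp (C : AConnection L) (a : TotalSpace F E) : TotalSpace F E :=
  C.geodesic a 1

/-- The target map `τ = π ∘ exp`. -/
def AConnection.target (C : AConnection L) (a : TotalSpace F E) : M :=
  (C.exp a).1

/-- An open neighbourhood `A₀` of the zero section, star-shaped in each fibre, all of whose
elements `a` have a geodesic `g_a` that is defined up to at least time `1`. -/
structure AConnection.IsExpDomain (C : AConnection L) (A₀ : Set (TotalSpace F E)) : Prop where
  isOpen : IsOpen A₀
  zero_mem : ∀ x : M, (⟨x, 0⟩ : TotalSpace F E) ∈ A₀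
  smul_mem : ∀ a ∈ A₀, ∀ t ∈ Icc (0 : ℝ) 1, (⟨a.1, t • a.2⟩ : TotalSpace F E) ∈ A₀
  one_mem : ∀ a ∈ A₀, (1 : ℝ) ∈ C.geodesicDomain a

end Geodesics

section Forms

/-- `φ` is a (smooth) element of `Ω¹_π(U; τ^*A)`. Vertical tangent vectors at `a` are identified
with elements of the fibre `E a.1`; smoothness is tested on the vertical vector fields given by
smooth sections of `A`, which generate all vertical vector fields. -/
def IsFoliatedOneForm (U : Set (TotalSpace F E)) (τ : TotalSpace F E → M)
    (φ : (a : TotalSpace F E) → E a.1 →ₗ[ℝ] E (τ a)) : Prop :=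
  ∀ β : Cₛ^∞⟮𝓘(ℝ, EM); F, E⟯,
    ContMDiffOn (𝓘(ℝ, EM).prod 𝓘(ℝ, F)) (𝓘(ℝ, EM).prod 𝓘(ℝ, F)) ∞
      (fun a : TotalSpace F E => (⟨τ a, φ a (β a.1)⟩ : TotalSpace F E)) U

/-- The derivative at `v` in the direction `b` of a map `f` from the fibre `E x` to `M`, that is,
the velocity at `ε = 0` of the curve `f (v + ε b)`. -/
def fiberDeriv {x : M} (f : E x → M) (v b : E x) : TangentSpace 𝓘(ℝ, EM) (f v) :=
  (mfderiv 𝓘(ℝ, ℝ) 𝓘(ℝ, EM) (fun ε : ℝ => f (v + ε • b)) 0 (1 : ℝ) : EM)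

/-- The vertical derivative `(dτ)_a (b)`. -/
def vertDeriv (τ : TotalSpace F E → M) (a : TotalSpace F E) (b : E a.1) :
    TangentSpace 𝓘(ℝ, EM) (τ a) :=
  fiberDeriv (fun v : E a.1 => τ ⟨a.1, v⟩) a.2 b

open Classical in
/-- The covariant derivative `((f^*∇)_b s)(v)` of a section `s` of `f^*A`, where `f` is a map from
the fibre `E x` to `M`; it is the covariant derivative at `ε = 0` of the curve `s (v + ε b)` that
covers `f (v + ε b)`. -/
def pullbackCovDeriv (nab : CovariantDerivative 𝓘(ℝ, EM) F E) {x : M} (f : E x → M)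
    (s : (v : E x) → E (f v)) (v b : E x) : E (f v) :=
  if h : ∃ w : E (f v), HasCovDerivAlong (EM := EM) (F := F) (fun ε : ℝ => f (v + ε • b))
      (fun ε => s (v + ε • b)) 0 (f v) (fun σ => nab σ (f v) (fiberDeriv f v b)) w
  then h.choose else 0

/-- The foliated differential `(d_{τ^*∇} φ)_a (b, c)`, by the Koszul formula for the vertical vector
fields that are constant equal to `b` and `c` on the fibre of `a` and hence commute. -/
def foliatedDiff (nab : CovariantDerivative 𝓘(ℝ, EM) F E) (τ : TotalSpace F E → M)
    (φ : (a : TotalSpace F E) → E a.1 →ₗ[ℝ] E (τ a)) (a : TotalSpace F E) (b c : E a.1) :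
    E (τ a) :=
  pullbackCovDeriv nab (fun v : E a.1 => τ ⟨a.1, v⟩) (fun v => φ ⟨a.1, v⟩ c) a.2 b
    - pullbackCovDeriv nab (fun v : E a.1 => τ ⟨a.1, v⟩) (fun v => φ ⟨a.1, v⟩ b) a.2 c

open Classical in
/-- A smooth section through the vector `b`. -/
def sectionThrough {x : M} (b : E x) : Cₛ^∞⟮𝓘(ℝ, EM); F, E⟯ :=
  if h : ∃ α : Cₛ^∞⟮𝓘(ℝ, EM); F, E⟯, α x = b then h.choose else 0

/-- The torsion `[b, c]_∇` of `∇` at two vectors, where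
`[α, β]_∇ = [α, β] - ∇_{ρ α} β + ∇_{ρ β} α` on sections. -/
def torsion (L : PreLieAlgebroid EM F E) (nab : CovariantDerivative 𝓘(ℝ, EM) F E) {x : M}
    (b c : E x) : E x :=
  L.bracket (sectionThrough b) (sectionThrough c) x
    - nab (sectionThrough (EM := EM) (F := F) c) x (L.anchor x b)
    + nab (sectionThrough (EM := EM) (F := F) b) x (L.anchor x c)

/-- The Maurer-Cartan 2-form `(MC_φ)_a (b, c)`, with `MC_φ = d_{τ^*∇} φ + 1/2 [φ, φ]_∇`. The second
summand is written out as a sum over the two `(1,1)`-shuffles. -/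
def maurerCartan (L : PreLieAlgebroid EM F E) (nab : CovariantDerivative 𝓘(ℝ, EM) F E)
    (τ : TotalSpace F E → M) (φ : (a : TotalSpace F E) → E a.1 →ₗ[ℝ] E (τ a))
    (a : TotalSpace F E) (b c : E a.1) : E (τ a) :=
  foliatedDiff nab τ φ a b c
    + (1 / 2 : ℝ) • (torsion L nab (φ a b) (φ a c) - torsion L nab (φ a c) (φ a b))

/-- `ρ ∘ φ = dτ` on `U`. -/
def IsAnchored (L : PreLieAlgebroid EM F E) (U : Set (TotalSpace F E)) (τ : TotalSpace F E → M)
    (φ : (a : TotalSpace F E) → E a.1 →ₗ[ℝ] E (τ a)) : Prop :=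
  ∀ a ∈ U, ∀ b : E a.1, L.anchor (τ a) (φ a b) = vertDeriv τ a b

end Forms

section Formula

variable {L : PreLieAlgebroid EM F E}

variable (L) in
/-- `ψ t s : A_{c s} → A_{c t}` is the infinitesimal flow `ψ^{t,s}_ξ` of the time dependent section
`ξ` along the integral curve `c` of the time dependent vector field `ρ(ξ)` on the interval `J`, so
that `c t = φ^{t,s}_{ρ(ξ)} (c s)` for `s, t ∈ J`. -/
structure IsInfinitesimalFlow (ξ : ℝ → Cₛ^∞⟮𝓘(ℝ, EM); F, E⟯) (J : Set ℝ) (c : ℝ → M)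
    (ψ : (t s : ℝ) → E (c s) →ₗ[ℝ] E (c t)) : Prop where
  integralCurve : ∀ t ∈ J, HasMFDerivWithinAt 𝓘(ℝ, ℝ) 𝓘(ℝ, EM) c J t
    ((1 : ℝ →L[ℝ] ℝ).smulRight (L.anchor (c t) (ξ t (c t))))
  refl : ∀ s ∈ J, ψ s s = LinearMap.id
  comp : ∀ s ∈ J, ∀ t ∈ J, ∀ u ∈ J, (ψ u t) ∘ₗ (ψ t s) = ψ u s
  deriv : ∀ s ∈ J, ∀ α : Cₛ^∞⟮𝓘(ℝ, EM); F, E⟯,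
    HasDerivWithinAt (fun t => ψ s t (α (c t))) (L.bracket (ξ s) α (c s)) J s

/-- `ξ : [0,1] × (-δ,δ) × M → A`, `ξ t ε = ξ^t_ε`, is smooth, each `ξ^t_ε` is a section, and
`ξ^t_ε (γ_{a+εb} t) = g_{a+εb} t`, where all `a + ε b` lie in `A₀`. Values of `ξ t ε` for other
`(t, ε)` play no role. -/
structure AConnection.IsGeodesicExtension (C : AConnection L) (A₀ : Set (TotalSpace F E))
    (a : TotalSpace F E) (b : E a.1) (δ : ℝ) (ξ : ℝ → ℝ → Cₛ^∞⟮𝓘(ℝ, EM); F, E⟯) : Prop where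
  pos : 0 < δ
  mem : ∀ ε ∈ Ioo (-δ) δ, (⟨a.1, a.2 + ε • b⟩ : TotalSpace F E) ∈ A₀
  contMDiffOn : ContMDiffOn (𝓘(ℝ, ℝ).prod (𝓘(ℝ, ℝ).prod 𝓘(ℝ, EM))) (𝓘(ℝ, EM).prod 𝓘(ℝ, F)) ∞
    (fun p : ℝ × ℝ × M => (⟨p.2.2, ξ p.1 p.2.1 p.2.2⟩ : TotalSpace F E))
    (Icc 0 1 ×ˢ Ioo (-δ) δ ×ˢ univ)
  extends_geodesic : ∀ t ∈ Icc (0 : ℝ) 1, ∀ ε ∈ Ioo (-δ) δ,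
    ξ t ε (C.baseCurve ⟨a.1, a.2 + ε • b⟩ t) = (C.geodesic ⟨a.1, a.2 + ε • b⟩ t).2

/-- `w = ∫₀¹ f(t) dt` in a finite-dimensional vector space (tested on all linear functionals). -/
def HasIntegral {V : Type*} [AddCommGroup V] [Module ℝ V] (f : ℝ → V) (w : V) : Prop :=
  ∀ l : V →ₗ[ℝ] ℝ, IntervalIntegrable (fun t => l (f t)) volume 0 1 ∧
    ∫ t in (0 : ℝ)..1, l (f t) = l w

end Formula

end PreLie

end

/-!
The one-form is constructed from the variation of geodesics. Fix `a ∈ A₀` and `b ∈ A_x`, and write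
`G(t, ε) = g_{a+εb}(t)`, an `A`-path in `t` for each `ε`. If `e_k` are sections that span the fibres
near the curve `γ_a`, and `u_k(t)` are the coordinates of `g_a(t)` in the `e_k`, the *variation
equation*

  `V_k' = ∂_ε (coordinates of G)_k - ∑ u_i V_j [e_i, e_j]_k`,  `V_k(0) = 0`,

is linear, hence has a unique solution on `[0, 1]`, and one puts `φ_a(b) = ∑ V_k(1) e_k(τ(a))`
(`AConnection.IsExpForm`, `AConnection.exists_expForm`). The geodesics are the integral curves of
the geodesic spray; their smooth dependence on `a` comes from the smoothness of local flows
(`exists_contDiffOn_flow`, an inverse function argument for the Picard operator). For the linear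
variation equation, smooth dependence is that of its fundamental solution on the coefficients
(`contDiff_resolvent_of_contDiff`), which makes `φ` smooth.

*Partial frames.* To avoid patching local frames along `γ_a`, finitely many global sections `e_k`
are used together with smooth coordinate functionals that reproduce the vectors over a
neighbourhood of the curve. The `e_k` need not be linearly independent, so the variation equation
depends on choices; its solution does not, because the equation can be restated in an invariant
way, as the transport equation `AConnection.IsTransport`.

*The integral formula.* Let `ψ` be the infinitesimal flow of `ξ₀`. For a solution `V` of the
transport equation, `t ↦ ψ^{1,t} ∑ V_k(t) e_k(γ_a(t))` has derivative
`ψ^{1,t} (d/dε) ξ^t_ε(γ_a(t))` at `ε = 0`: the bracket term in the derivative of the flow cancels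
against the one in the transport equation, and the derivative of the base point is accounted for
by the anchor (`IsGeodesicExtension.hasIntegral`). Integration over `[0, 1]` gives the formula, and
since the integral does not involve the frame, it also shows that all solutions of transport
equations for `(a, b)` have the same value at time `1` (`AConnection.IsExpForm.eq_sum`).

*Anchor.* The difference of `ρ(∑ V_k e_k)` and of the variation field `∂_ε γ_{a+εb}` solves a
homogeneous linear differential equation, since `ρ` preserves brackets, and it vanishes at `t = 0`
(`IsAPathFamily.anchorDefect_eq_zero`). At `t = 1` this is `ρ ∘ φ = dτ`.

*The Maurer-Cartan equation.* Given `ρ ∘ φ = dτ` and `φ_a(a) = exp a`, the terms with the auxiliary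
connection cancel in `MC_φ(a, b)`, and `MC_φ = 0` at `(sa, sb)` for `0 < s < 1` says precisely that
the coordinates of `s ↦ φ_{sa}(sb)` solve the transport equation of `(a, b)` on `[0, 1]`
(`AConnection.maurerCartan_eq`, `AConnection.maurerCartan_smul_eq_zero_iff`). Solutions of the
variation equation are compatible with rescaling because `g_{sa}(t) = s g_a(st)`. Thus the form
constructed above satisfies the equation, every other solution has the same values at `s = 1`, and
both existence and uniqueness follow.
-/

namespace PreLie

set_option linter.unusedSectionVars false

/-! ### Smooth dependence of solutions of differential equations on parameters -/

section Postcomposition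

set_option synthInstance.maxHeartbeats 200000

variable {K : Type*} [TopologicalSpace K] [CompactSpace K]

/-- Pointwise application of a continuous family of operators, as a bounded bilinear map. -/
noncomputable def pointwiseApply (K : Type*) [TopologicalSpace K] [CompactSpace K]
    (V H : Type*) [NormedAddCommGroup V] [NormedSpace ℝ V]
    [NormedAddCommGroup H] [NormedSpace ℝ H] :
    C(K, V →L[ℝ] H) →L[ℝ] C(K, V) →L[ℝ] C(K, H) :=
  LinearMap.mkContinuous₂
    (LinearMap.mk₂ ℝ (fun (u : C(K, V →L[ℝ] H)) (h : C(K, V)) =>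
      (⟨fun t => u t (h t), by fun_prop⟩ : C(K, H)))
      (fun _ _ _ => by ext; simp) (fun _ _ _ => by ext; simp)
      (fun _ _ _ => by ext; simp) (fun _ _ _ => by ext; simp)) 1
    (fun u h => by
      rw [one_mul]
      refine (ContinuousMap.norm_le _ (by positivity)).2 fun t => ?_
      exact ((u t).le_opNorm _).trans
        (mul_le_mul (u.norm_coe_le_norm t) (h.norm_coe_le_norm t) (by positivity) (by positivity)))

/-- The first derivative of postcomposition. Uniform continuity of the derivative of `f` near the
compact set `range c` makes the remainder uniformly small. -/
lemma hasFDerivAt_postcomp {V H : Type*} [NormedAddCommGroup V] [NormedSpace ℝ V]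
    [NormedAddCommGroup H] [NormedSpace ℝ H] {f : V → H} (hf : ContDiff ℝ ∞ f) (c : C(K, V)) :
    HasFDerivAt (fun c : C(K, V) => (⟨f, hf.continuous⟩ : C(V, H)).comp c)
      (pointwiseApply K V H ((⟨fderiv ℝ f, hf.continuous_fderiv (by simp)⟩ :
        C(V, V →L[ℝ] H)).comp c)) c := by
  rw [hasFDerivAt_iff_isLittleO_nhds_zero, Asymptotics.isLittleO_iff]
  intro ε hε
  have hcomp : IsCompact (range c) := isCompact_range c.continuous
  have hunif := hcomp.uniformContinuousAt_of_continuousAt (fderiv ℝ f)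
    (fun x _ => (hf.continuous_fderiv (by simp)).continuousAt) (Metric.dist_mem_uniformity hε)
  obtain ⟨δ, hδ, hδ'⟩ := Metric.mem_uniformity_dist.1 hunif
  filter_upwards [Metric.ball_mem_nhds (0 : C(K, V)) hδ] with h hh
  rw [mem_ball_zero_iff] at hh
  refine (ContinuousMap.norm_le _ (by positivity)).2 fun t => ?_
  have hht : ‖h t‖ ≤ ‖h‖ := h.norm_coe_le_norm t
  have key : ‖f (c t + h t) - f (c t) - fderiv ℝ f (c t) (c t + h t - c t)‖
      ≤ ε * ‖c t + h t - c t‖ := by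
    refine (convex_ball (c t) δ).norm_image_sub_le_of_norm_hasFDerivWithin_le'
      (f' := fderiv ℝ f) (fun x _ => (hf.differentiable (by simp) x).hasFDerivAt.hasFDerivWithinAt)
      (fun x hx => ?_) (Metric.mem_ball_self hδ) ?_
    · have := @hδ' (c t) x (by rwa [dist_comm]) (mem_range_self t)
      rw [← dist_eq_norm, dist_comm]
      exact this.le
    · rw [Metric.mem_ball, dist_eq_norm]
      simpa using hht.trans_lt hh
  simp only [add_sub_cancel_left] at key
  exact key.trans (by gcongr)

universe u

lemma contDiff_postcomp_nat {V : Type u} [NormedAddCommGroup V] [NormedSpace ℝ V] (n : ℕ) :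
    ∀ {H : Type u} [NormedAddCommGroup H] [NormedSpace ℝ H] {f : V → H} (hf : ContDiff ℝ ∞ f),
      ContDiff ℝ n (fun c : C(K, V) => (⟨f, hf.continuous⟩ : C(V, H)).comp c) := by
  induction n with
  | zero =>
    intro H _ _ f hf
    exact contDiff_zero.2 (continuous_iff_continuousAt.2 fun c =>
      (hasFDerivAt_postcomp hf c).continuousAt)
  | succ n ih =>
    intro H _ _ f hf
    rw [Nat.cast_add, Nat.cast_one, contDiff_succ_iff_hasFDerivAt]
    exact ⟨_, (pointwiseApply K V H).contDiff.comp
      (ih (hf.fderiv_right (m := ∞) (by simp))), hasFDerivAt_postcomp hf⟩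

/-- Postcomposition with a smooth map is a smooth map between spaces of continuous functions on a
compact space. -/
theorem contDiff_postcomp {V H : Type*} [NormedAddCommGroup V] [NormedSpace ℝ V]
    [NormedAddCommGroup H] [NormedSpace ℝ H] {f : V → H} (hf : ContDiff ℝ ∞ f) :
    ContDiff ℝ ∞ (fun c : C(K, V) => (⟨f, hf.continuous⟩ : C(V, H)).comp c) := by
  -- The induction on the order of differentiability needs source and target in one universe;
  -- the map `(v, h) ↦ (0, f v)` of `V × H` reduces to that case.
  have hg : ContDiff ℝ ∞ (fun p : V × H => ((0 : V), f p.1)) :=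
    contDiff_const.prodMk (hf.comp contDiff_fst)
  have h1 : ContDiff ℝ ∞ (fun c : C(K, V × H) =>
      (⟨_, hg.continuous⟩ : C(V × H, V × H)).comp c) :=
    contDiff_infty.2 fun n => contDiff_postcomp_nat n hg
  have h2 := ((ContinuousLinearMap.snd ℝ V H).compLeftContinuous ℝ K).contDiff.comp
    (h1.comp ((ContinuousLinearMap.inl ℝ V H).compLeftContinuous ℝ K).contDiff (n := ∞))
  exact h2

end Postcomposition

section Cutoff

/-- A map that is smooth on an open set agrees near a compact subset with a compactly supported
smooth map of the whole space. -/
lemma exists_contDiff_eventuallyEq_nhdsSet {V H : Type*} [NormedAddCommGroup V] [NormedSpace ℝ V]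
    [FiniteDimensional ℝ V] [NormedAddCommGroup H] [NormedSpace ℝ H] {f : V → H} {S Ω : Set V}
    (hS : IsCompact S) (hΩ : IsOpen Ω) (hSΩ : S ⊆ Ω) (hf : ContDiffOn ℝ ∞ f Ω) :
    ∃ g : V → H, ContDiff ℝ ∞ g ∧ HasCompactSupport g ∧ ∀ᶠ x in 𝓝ˢ S, g x = f x := by
  obtain ⟨T, hT, hST, hTΩ⟩ := exists_compact_between hS hΩ hSΩ
  obtain ⟨χ, hχ1, hχ0, -⟩ := exists_contMDiffMap_one_nhds_of_subset_interior (n := ⊤) 𝓘(ℝ, V)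
    hS.isClosed hST
  have hχ : ContDiff ℝ ∞ χ := χ.contMDiff.contDiff
  refine ⟨fun x => χ x • f x, contDiff_iff_contDiffAt.2 fun x => ?_, ?_, ?_⟩
  · by_cases hx : x ∈ T
    · exact hχ.contDiffAt.smul ((hf x (hTΩ hx)).contDiffAt (hΩ.mem_nhds (hTΩ hx)))
    · refine contDiffAt_const (c := (0 : H)) |>.congr_of_eventuallyEq ?_
      filter_upwards [hT.isClosed.isOpen_compl.mem_nhds hx] with y hy
      simp [hχ0 y hy]
  · exact HasCompactSupport.intro hT fun x hx => by simp [hχ0 x hx]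
  · filter_upwards [hχ1] with x hx
    simp [hx]

end Cutoff

section Flow

set_option synthInstance.maxHeartbeats 200000

variable {V : Type*} [NormedAddCommGroup V] [NormedSpace ℝ V]

/-- The compact time interval on which differential equations are solved. It is symmetric and
contains `[0, 1]` in its interior, so that solutions have two-sided derivatives there. -/
abbrev TimeInterval : Type := Icc (-2 : ℝ) 2

/-- The extension of a curve on the compact time interval to all times, constant outside. -/
noncomputable def extendCurve (c : C(TimeInterval, V)) : ℝ → V := IccExtend (by norm_num) c

lemma continuous_extendCurve (c : C(TimeInterval, V)) : Continuous (extendCurve c) :=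
  c.continuous.Icc_extend'

lemma extendCurve_of_mem (c : C(TimeInterval, V)) {t : ℝ} (ht : t ∈ Icc (-2 : ℝ) 2) :
    extendCurve c t = c ⟨t, ht⟩ := IccExtend_of_mem _ _ ht

lemma norm_extendCurve_le (c : C(TimeInterval, V)) (t : ℝ) : ‖extendCurve c t‖ ≤ ‖c‖ :=
  c.norm_coe_le_norm _

/-- Integration from `0`, as a bounded operator on continuous curves. -/
noncomputable def integralOp (V : Type*) [NormedAddCommGroup V] [NormedSpace ℝ V] :
    C(TimeInterval, V) →L[ℝ] C(TimeInterval, V) :=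
  LinearMap.mkContinuous
    { toFun := fun c => ⟨fun t => ∫ s in (0 : ℝ)..t, extendCurve c s,
        (intervalIntegral.continuous_primitive
          (fun _ _ => (continuous_extendCurve c).intervalIntegrable _ _) 0).comp
          continuous_subtype_val⟩
      map_add' := fun c d => by
        ext t
        simp only [ContinuousMap.coe_mk, ContinuousMap.add_apply]
        rw [← intervalIntegral.integral_add ((continuous_extendCurve c).intervalIntegrable _ _)
          ((continuous_extendCurve d).intervalIntegrable _ _)]
        rfl
      map_smul' := fun r c => by
        ext t
        simp only [ContinuousMap.coe_mk, ContinuousMap.smul_apply, RingHom.id_apply]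
        rw [← intervalIntegral.integral_smul]
        rfl } 2
    (fun c => by
      refine (ContinuousMap.norm_le _ (by positivity)).2 fun t => ?_
      refine (intervalIntegral.norm_integral_le_of_norm_le_const
        (fun s _ => norm_extendCurve_le c s)).trans ?_
      rw [mul_comm]
      gcongr
      rw [sub_zero, abs_le]
      exact t.2)

lemma integralOp_apply (c : C(TimeInterval, V)) (t : TimeInterval) :
    integralOp V c t = ∫ s in (0 : ℝ)..t, extendCurve c s := rfl

lemma hasDerivAt_integral_extendCurve [CompleteSpace V] (c : C(TimeInterval, V)) (t : ℝ) :
    HasDerivAt (fun t => ∫ s in (0 : ℝ)..t, extendCurve c s) (extendCurve c t) t :=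
  intervalIntegral.integral_hasDerivAt_right ((continuous_extendCurve c).intervalIntegrable _ _)
    ((continuous_extendCurve c).stronglyMeasurableAtFilter _ _) (continuous_extendCurve c).continuousAt

/-- A solution of an integral equation on the time interval has a derivative at interior times. -/
lemma hasDerivAt_extendCurve_of_eq [CompleteSpace V] {c d : C(TimeInterval, V)} {y : V}
    (h : ∀ t, c t = y + integralOp V d t) {t : ℝ} (ht : t ∈ Ioo (-2 : ℝ) 2) :
    HasDerivAt (extendCurve c) (extendCurve d t) t := by
  refine ((hasDerivAt_integral_extendCurve d t).const_add y).congr_of_eventuallyEq ?_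
  filter_upwards [isOpen_Ioo.mem_nhds ht] with s hs
  rw [extendCurve_of_mem c (Ioo_subset_Icc_self hs), h, integralOp_apply]

/-- The Picard operator of the autonomous equation `c' = s f(c)`, `c 0 = y`, together with its
parameters `(s, y)`. Zeros of its last component are solutions. -/
noncomputable def picardMap (f : C(V, V)) (z : (ℝ × V) × C(TimeInterval, V)) :
    (ℝ × V) × C(TimeInterval, V) :=
  (z.1, z.2 - ContinuousMap.const _ z.1.2 - z.1.1 • integralOp V (f.comp z.2))

/-- The constant curve through a point, as a bounded operator. -/
noncomputable def constCurve (V : Type*) [NormedAddCommGroup V] [NormedSpace ℝ V] :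
    V →L[ℝ] C(TimeInterval, V) := ContinuousLinearMap.const ℝ TimeInterval

lemma contDiff_picardMap {f : V → V} (hf : ContDiff ℝ ∞ f) :
    ContDiff ℝ ∞ (picardMap ⟨f, hf.continuous⟩) := by
  have h1 : ContDiff ℝ ∞ (fun z : (ℝ × V) × C(TimeInterval, V) =>
      (⟨f, hf.continuous⟩ : C(V, V)).comp z.2) := (contDiff_postcomp hf).comp contDiff_snd
  have h2 : ContDiff ℝ ∞ (fun z : (ℝ × V) × C(TimeInterval, V) =>
      z.2 - constCurve V z.1.2 - z.1.1 • integralOp V ((⟨f, hf.continuous⟩ : C(V, V)).comp z.2)) :=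
    (contDiff_snd.sub ((constCurve V).contDiff.comp (contDiff_snd.comp contDiff_fst))).sub
      ((contDiff_fst.comp contDiff_fst).smul ((integralOp V).contDiff.comp h1))
  exact contDiff_fst.prodMk h2

/-- The derivative of the Picard operator at time scale `0`, where it is invertible. -/
noncomputable def picardDeriv (k : C(TimeInterval, V)) :
    ((ℝ × V) × C(TimeInterval, V)) ≃L[ℝ] ((ℝ × V) × C(TimeInterval, V)) :=
  ContinuousLinearEquiv.equivOfInverse
    ((ContinuousLinearMap.fst ℝ _ _).prod (ContinuousLinearMap.snd ℝ _ _ -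
      (constCurve V ∘L ContinuousLinearMap.snd ℝ ℝ V ∘L ContinuousLinearMap.fst ℝ _ _) -
      ((ContinuousLinearMap.fst ℝ ℝ V ∘L ContinuousLinearMap.fst ℝ _ _).smulRight k)))
    ((ContinuousLinearMap.fst ℝ _ _).prod (ContinuousLinearMap.snd ℝ _ _ +
      (constCurve V ∘L ContinuousLinearMap.snd ℝ ℝ V ∘L ContinuousLinearMap.fst ℝ _ _) +
      ((ContinuousLinearMap.fst ℝ ℝ V ∘L ContinuousLinearMap.fst ℝ _ _).smulRight k)))
    (fun z => by ext <;> simp; abel) (fun z => by ext <;> simp; abel)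

lemma hasFDerivAt_picardMap {f : V → V} (hf : ContDiff ℝ ∞ f) (y : V) :
    HasFDerivAt (picardMap ⟨f, hf.continuous⟩)
      (picardDeriv (integralOp V ((⟨f, hf.continuous⟩ : C(V, V)).comp (constCurve V y))) :
        ((ℝ × V) × C(TimeInterval, V)) →L[ℝ] ((ℝ × V) × C(TimeInterval, V)))
      ((0, y), constCurve V y) := by
  have h1 : ContDiff ℝ ∞ (fun z : (ℝ × V) × C(TimeInterval, V) =>
      integralOp V ((⟨f, hf.continuous⟩ : C(V, V)).comp z.2)) :=
    (integralOp V).contDiff.comp ((contDiff_postcomp hf).comp contDiff_snd)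
  have h2 := (h1.differentiable (by simp) ((0, y), constCurve V y)).hasFDerivAt
  have h3 := (ContinuousLinearMap.fst ℝ ℝ V ∘L ContinuousLinearMap.fst ℝ (ℝ × V)
    C(TimeInterval, V)).hasFDerivAt (x := ((0, y), constCurve V y)) |>.smul h2
  have h4 := (ContinuousLinearMap.snd ℝ (ℝ × V) C(TimeInterval, V) -
    (constCurve V ∘L ContinuousLinearMap.snd ℝ ℝ V ∘L ContinuousLinearMap.fst ℝ _ _)).hasFDerivAt
      (x := ((0, y), constCurve V y)) |>.sub h3
  have h5 := (ContinuousLinearMap.fst ℝ (ℝ × V) C(TimeInterval, V)).hasFDerivAt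
    (x := ((0, y), constCurve V y)) |>.prodMk h4
  refine h5.congr_fderiv ?_
  ext z <;> simp [picardDeriv]

/-- **Smooth dependence on initial conditions**: a compactly supported smooth vector field has a
smooth local flow around every point. The solutions of `c' = s f(c)`, `c 0 = y` on a fixed time
interval depend smoothly on `(s, y)` by the inverse function theorem, and `c 1` is the value at
time `s` of the solution of `c' = f(c)`. -/
theorem exists_contDiffOn_flow [FiniteDimensional ℝ V] {f : V → V} (hf : ContDiff ℝ ∞ f)
    (hc : HasCompactSupport f) (y₀ : V) :
    ∃ (η : ℝ) (W : Set V) (Φ : ℝ × V → V), 0 < η ∧ IsOpen W ∧ y₀ ∈ W ∧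
      ContDiffOn ℝ ∞ Φ (Ioo (-η) η ×ˢ W) ∧ (∀ y ∈ W, Φ (0, y) = y) ∧
      ∀ y ∈ W, ∀ s ∈ Ioo (-η) η, HasDerivAt (fun s => Φ (s, y)) (f (Φ (s, y))) s := by
  have : CompleteSpace V := FiniteDimensional.complete ℝ V
  obtain ⟨K, hK⟩ := hf.lipschitzWith_of_hasCompactSupport hc (by simp)
  set Ψ := picardMap (⟨f, hf.continuous⟩ : C(V, V)) with hΨ
  have hΨs : ContDiff ℝ ∞ Ψ := contDiff_picardMap hf
  set x₀ : (ℝ × V) × C(TimeInterval, V) := ((0, y₀), constCurve V y₀) with hx₀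
  have hΨ' := hasFDerivAt_picardMap hf y₀
  set e := ContDiffAt.toOpenPartialHomeomorph Ψ hΨs.contDiffAt hΨ' (by simp) with he
  have hex : x₀ ∈ e.source := ContDiffAt.mem_toOpenPartialHomeomorph_source _ hΨ' (by simp)
  have hΨx : Ψ x₀ = ((0, y₀), 0) := by
    ext <;> simp [hΨ, picardMap, hx₀, constCurve]
  have heΨ : ∀ z, e z = Ψ z := fun z => rfl
  have hgood : ∀ᶠ q in 𝓝 (((0, y₀), 0) : (ℝ × V) × C(TimeInterval, V)),
      q ∈ e.target ∧ ContDiffAt ℝ ∞ e.symm q := by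
    have h1 : ∀ᶠ z in 𝓝 x₀, fderiv ℝ Ψ z ∈ range
        ((↑) : (((ℝ × V) × C(TimeInterval, V)) ≃L[ℝ] ((ℝ × V) × C(TimeInterval, V))) → _) := by
      refine (hΨs.continuous_fderiv (by simp)).continuousAt.eventually ?_
      rw [hΨ'.fderiv]
      exact ContinuousLinearEquiv.nhds _
    have h2 : Tendsto e.symm (𝓝 ((0, y₀), 0)) (𝓝 x₀) := by
      have := (e.continuousAt_symm (e.map_source hex)).tendsto
      rwa [e.left_inv hex, heΨ, hΨx] at this
    have h3 : e.target ∈ 𝓝 (((0, y₀), 0) : (ℝ × V) × C(TimeInterval, V)) := by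
      rw [← hΨx, ← heΨ]
      exact e.open_target.mem_nhds (e.map_source hex)
    filter_upwards [h2.eventually h1, h3] with q hq hqt
    obtain ⟨E, hE⟩ := hq
    refine ⟨hqt, e.contDiffAt_symm (f₀' := E) hqt ?_ hΨs.contDiffAt⟩
    rw [hE]
    exact (hΨs.differentiable (by simp) _).hasFDerivAt
  have hgood' : ∀ᶠ p in 𝓝 ((0, y₀) : ℝ × V), (p, (0 : C(TimeInterval, V))) ∈ e.target ∧
      ContDiffAt ℝ ∞ e.symm (p, (0 : C(TimeInterval, V))) :=
    (Continuous.prodMk_left (0 : C(TimeInterval, V))).continuousAt.eventually hgood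
  rw [nhds_prod_eq] at hgood'
  obtain ⟨P, hP, Q, hQ, hPQ⟩ := Filter.eventually_prod_iff.1 hgood'
  obtain ⟨η, hη, hηP⟩ := Metric.eventually_nhds_iff_ball.1 hP
  obtain ⟨W, hWQ, hW, hyW⟩ := mem_nhds_iff.1 hQ
  have hη' : ∀ s : ℝ, |s| < η → P s := fun s hs => hηP s (by simpa using hs)
  set c : ℝ × V → C(TimeInterval, V) := fun p => (e.symm (p, 0)).2 with hcdef
  have hsol : ∀ s y, |s| < η → y ∈ W → ∀ t, c (s, y) t =
      y + integralOp V (s • (⟨f, hf.continuous⟩ : C(V, V)).comp (c (s, y))) t := by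
    intro s y hs hy t
    have h1 := e.right_inv (hPQ (hη' s hs) (hWQ hy)).1
    rw [heΨ, hΨ, picardMap, Prod.mk.injEq] at h1
    have h2 := congrArg (fun c : C(TimeInterval, V) => c t) h1.2
    simp only [h1.1, ContinuousMap.sub_apply, ContinuousMap.const_apply, ContinuousMap.smul_apply,
      ContinuousMap.zero_apply] at h2
    rw [map_smul, ContinuousMap.smul_apply]
    rw [sub_sub, sub_eq_zero] at h2
    exact h2
  have hder : ∀ s y, |s| < η → y ∈ W → ∀ t ∈ Ioo (-2 : ℝ) 2,
      HasDerivAt (extendCurve (c (s, y))) (s • f (extendCurve (c (s, y)) t)) t := by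
    intro s y hs hy t ht
    exact hasDerivAt_extendCurve_of_eq (hsol s y hs hy) ht
  have hzero : ∀ s y, |s| < η → y ∈ W → extendCurve (c (s, y)) 0 = y := by
    intro s y hs hy
    rw [extendCurve_of_mem _ (by norm_num : (0 : ℝ) ∈ Icc (-2 : ℝ) 2), hsol s y hs hy,
      integralOp_apply]
    simp
  -- Rescaling time identifies the solutions for the parameters `s` and `σ s`.
  have hscale : ∀ s y σ, |s| < η → y ∈ W → |σ| ≤ 1 →
      extendCurve (c (σ * s, y)) 1 = extendCurve (c (s, y)) σ := by
    intro s y σ hs hy hσ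
    have hσs : |σ * s| < η := by
      rw [abs_mul]
      exact (mul_le_of_le_one_left (abs_nonneg s) hσ).trans_lt hs
    have hmem : ∀ t ∈ Ioo (-2 : ℝ) 2, t * σ ∈ Ioo (-2 : ℝ) 2 := by
      intro t ht
      rw [mem_Ioo, ← abs_lt] at ht ⊢
      rw [abs_mul]
      exact (mul_le_of_le_one_right (abs_nonneg t) hσ).trans_lt ht
    have hu := ODE_solution_unique_of_mem_Ioo (v := fun _ x => (σ * s) • f x) (s := fun _ => univ)
      (K := ‖σ * s‖₊ * K) (f := extendCurve (c (σ * s, y)))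
      (g := fun t => extendCurve (c (s, y)) (t * σ)) (a := -2) (b := 2) (t₀ := 0)
      (fun _ _ => ((lipschitzWith_smul (σ * s)).comp hK).lipschitzOnWith) (by norm_num)
      (fun t ht => ⟨hder _ y hσs hy t ht, mem_univ _⟩) (fun t ht => ⟨?_, mem_univ _⟩) ?_
    · have := hu (by norm_num : (1 : ℝ) ∈ Ioo (-2 : ℝ) 2)
      simpa using this
    · have h1 := (hder s y hs hy _ (hmem t ht)).scomp t (hasDerivAt_mul_const σ (x := t))
      rw [smul_smul] at h1
      exact h1
    · simp [hzero _ y hσs hy, hzero _ y hs hy]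
  refine ⟨η / 2, W, fun p => extendCurve (c p) 1, by positivity, hW, hyW, ?_, ?_, ?_⟩
  · rintro ⟨s, y⟩ ⟨hs, hy⟩
    have hs' : |s| < η := by
      rw [abs_lt]
      constructor <;> linarith [hs.1, hs.2]
    have h1 : ContDiffAt ℝ ∞ c (s, y) :=
      contDiffAt_snd.comp (s, y) ((hPQ (hη' s hs') (hWQ hy)).2.comp (s, y)
        (contDiffAt_id.prodMk contDiffAt_const))
    have h2 : (fun p => extendCurve (c p) 1) =
        fun p => ContinuousMap.evalCLM ℝ (⟨1, by norm_num⟩ : TimeInterval) (c p) := by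
      ext p
      exact extendCurve_of_mem _ (by norm_num : (1 : ℝ) ∈ Icc (-2 : ℝ) 2)
    rw [h2]
    exact ((ContinuousLinearMap.contDiff _).contDiffAt.comp (s, y) h1).contDiffWithinAt
  · intro y hy
    have h0 : |(η / 2)| < η := by rw [abs_of_pos (by positivity)]; linarith
    have := hscale (η / 2) y 0 h0 hy (by simp)
    rw [zero_mul] at this
    exact this.trans (hzero _ y h0 hy)
  · intro y hy s hs
    have h0 : |(η / 2)| < η := by rw [abs_of_pos (by positivity)]; linarith
    have hS : (0 : ℝ) < η / 2 := by positivity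
    have heq : ∀ s ∈ Ioo (-(η / 2)) (η / 2),
        extendCurve (c (s, y)) 1 = extendCurve (c (η / 2, y)) (s / (η / 2)) := by
      intro s hs
      have hσ : |s / (η / 2)| ≤ 1 := by
        rw [abs_div, abs_of_pos hS, div_le_one hS, abs_le]
        exact ⟨hs.1.le, hs.2.le⟩
      have := hscale (η / 2) y (s / (η / 2)) h0 hy hσ
      rwa [div_mul_cancel₀ _ hS.ne'] at this
    have hmem : s / (η / 2) ∈ Ioo (-2 : ℝ) 2 := by
      rw [mem_Ioo, lt_div_iff₀ hS, div_lt_iff₀ hS]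
      constructor <;> linarith [hs.1, hs.2]
    have h1 := (hder (η / 2) y h0 hy _ hmem).scomp s ((hasDerivAt_id s).div_const (η / 2))
    rw [smul_smul, one_div, inv_mul_cancel₀ hS.ne', one_smul] at h1
    simp only [id_eq] at h1
    change HasDerivAt (fun s => extendCurve (c (s, y)) 1) (f (extendCurve (c (s, y)) 1)) s
    rw [heq s hs]
    refine h1.congr_of_eventuallyEq ?_
    filter_upwards [isOpen_Ioo.mem_nhds hs] with r hr
    exact heq r hr

end Flow

section LinearEquation

set_option synthInstance.maxHeartbeats 200000

variable {𝔸 : Type*} [NormedRing 𝔸] [NormedAlgebra ℝ 𝔸]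

/-- The Volterra operator `Y ↦ ∫₀ q Y`, depending linearly on the coefficient `q`. -/
noncomputable def volterraOp (𝔸 : Type*) [NormedRing 𝔸] [NormedAlgebra ℝ 𝔸] :
    C(TimeInterval, 𝔸) →L[ℝ] C(TimeInterval, 𝔸) →L[ℝ] C(TimeInterval, 𝔸) :=
  (ContinuousLinearMap.compL ℝ _ _ _ (integralOp 𝔸)) ∘L (ContinuousLinearMap.mul ℝ _)

lemma volterraOp_apply (q Y : C(TimeInterval, 𝔸)) :
    volterraOp 𝔸 q Y = integralOp 𝔸 (q * Y) := rfl

lemma norm_volterraOp_pow_apply_le (q Y : C(TimeInterval, 𝔸)) (n : ℕ) (t : TimeInterval) :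
    ‖(volterraOp 𝔸 q ^ n) Y t‖ ≤ ‖q‖ ^ n * ‖Y‖ * (|(t : ℝ)| ^ n / n.factorial) := by
  induction n generalizing t with
  | zero => simpa using Y.norm_coe_le_norm t
  | succ n ih =>
    rw [pow_succ', mul_apply_eq_comp, volterraOp_apply, integralOp_apply]
    set Z := (volterraOp 𝔸 q ^ n) Y
    have hbound : ∀ s ∈ uIoc (0 : ℝ) t, ‖extendCurve (q * Z) s‖ ≤
        ‖q‖ ^ (n + 1) * ‖Y‖ / n.factorial * |s - 0| ^ n := by
      intro s hs
      have hs2 : s ∈ Icc (-2 : ℝ) 2 := by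
        have h0 : (0 : ℝ) ∈ Icc (-2 : ℝ) 2 := by norm_num
        exact (uIoc_subset_uIcc.trans (uIcc_subset_Icc h0 t.2)) hs
      rw [extendCurve_of_mem _ hs2, ContinuousMap.mul_apply, sub_zero]
      calc ‖q ⟨s, hs2⟩ * Z ⟨s, hs2⟩‖ ≤ ‖q ⟨s, hs2⟩‖ * ‖Z ⟨s, hs2⟩‖ := norm_mul_le _ _
        _ ≤ ‖q‖ * (‖q‖ ^ n * ‖Y‖ * (|s| ^ n / n.factorial)) :=
          mul_le_mul (q.norm_coe_le_norm _) (ih ⟨s, hs2⟩) (norm_nonneg _) (norm_nonneg _)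
        _ = _ := by ring
    refine (intervalIntegral.norm_integral_le_abs_of_norm_le
      (ae_restrict_of_forall_mem measurableSet_uIoc hbound)
      (Continuous.intervalIntegrable (by fun_prop) _ _)).trans ?_
    rw [intervalIntegral.integral_const_mul, abs_mul, intervalIntegral.abs_intervalIntegral_eq,
      integral_pow_abs_sub_uIoc, sub_zero, abs_of_nonneg (by positivity),
      abs_of_nonneg (by positivity), Nat.factorial_succ]
    apply le_of_eq
    push_cast
    field_simp

lemma isUnit_one_sub_of_norm_pow_lt_one {B : Type*} [NormedAddCommGroup B] [NormedSpace ℝ B]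
    [CompleteSpace B] {T : B →L[ℝ] B} {n : ℕ} (h : ‖T ^ n‖ < 1) : IsUnit (1 - T) := by
  have h1 : IsUnit (1 - T ^ n) := isUnit_one_sub_of_norm_lt_one h
  rw [← mul_neg_geom_sum] at h1
  refine ((Commute.isUnit_mul_iff ?_).1 h1).1
  exact Commute.sum_right _ _ _ fun i _ =>
    ((Commute.one_left _).sub_left (Commute.refl _)).pow_right i

/-- Inversion is smooth on invertible operators. -/
lemma contDiff_ringInverse_one_sub {B P : Type*} [NormedAddCommGroup B] [NormedSpace ℝ B]
    [CompleteSpace B] [NormedAddCommGroup P] [NormedSpace ℝ P] (T : P →L[ℝ] B →L[ℝ] B)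
    (hT : ∀ p, IsUnit (1 - T p)) (y : B) :
    ContDiff ℝ ∞ (fun p => Ring.inverse (1 - T p) y) := by
  refine contDiff_iff_contDiffAt.2 fun p => ?_
  obtain ⟨u, hu⟩ := hT p
  have h1 : ContDiffAt ℝ ∞ (fun p => Ring.inverse (1 - T p)) p := by
    refine ContDiffAt.comp p (g := Ring.inverse) ?_ (contDiff_const.sub T.contDiff).contDiffAt
    rw [← hu]
    exact contDiffAt_ringInverse ℝ u
  exact h1.clm_apply contDiffAt_const

/-- Volterra operators are quasi-nilpotent, so that `1 - T` is invertible. -/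
lemma isUnit_one_sub_volterraOp [CompleteSpace 𝔸] (q : C(TimeInterval, 𝔸)) :
    IsUnit (1 - volterraOp 𝔸 q) := by
  have hnorm : ∀ n : ℕ, ‖volterraOp 𝔸 q ^ n‖ ≤ (‖q‖ * 2) ^ n / n.factorial := by
    intro n
    refine ContinuousLinearMap.opNorm_le_bound _ (by positivity) fun Y => ?_
    refine (ContinuousMap.norm_le _ (by positivity)).2 fun t => ?_
    refine (norm_volterraOp_pow_apply_le q Y n t).trans ?_
    have ht : |(t : ℝ)| ≤ 2 := abs_le.2 t.2
    calc ‖q‖ ^ n * ‖Y‖ * (|(t : ℝ)| ^ n / n.factorial)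
        ≤ ‖q‖ ^ n * ‖Y‖ * (2 ^ n / n.factorial) := by gcongr
      _ = _ := by ring
  obtain ⟨n, hn⟩ := ((FloorSemiring.tendsto_pow_div_factorial_atTop (‖q‖ * 2)).eventually
    (gt_mem_nhds one_pos)).exists
  exact isUnit_one_sub_of_norm_pow_lt_one ((hnorm n).trans_lt hn)

/-- The fundamental solution of `Y' = q Y` with `Y 0 = 1`. -/
noncomputable def resolvent (q : C(TimeInterval, 𝔸)) : C(TimeInterval, 𝔸) :=
  Ring.inverse (1 - volterraOp 𝔸 q) 1

lemma resolvent_eq [CompleteSpace 𝔸] (q : C(TimeInterval, 𝔸)) :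
    resolvent q = 1 + integralOp 𝔸 (q * resolvent q) := by
  have h := congrArg (fun T : C(TimeInterval, 𝔸) →L[ℝ] C(TimeInterval, 𝔸) => T 1)
    (Ring.mul_inverse_cancel _ (isUnit_one_sub_volterraOp q))
  rw [← volterraOp_apply, ← sub_eq_iff_eq_add]
  exact h

lemma resolvent_zero [CompleteSpace 𝔸] (q : C(TimeInterval, 𝔸)) :
    extendCurve (resolvent q) 0 = 1 := by
  rw [extendCurve_of_mem _ (by norm_num : (0 : ℝ) ∈ Icc (-2 : ℝ) 2), resolvent_eq,
    ContinuousMap.add_apply, integralOp_apply]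
  simp

lemma hasDerivAt_resolvent [CompleteSpace 𝔸] (q : C(TimeInterval, 𝔸)) {t : ℝ}
    (ht : t ∈ Ioo (-2 : ℝ) 2) :
    HasDerivAt (extendCurve (resolvent q)) (extendCurve q t * extendCurve (resolvent q) t) t :=
  hasDerivAt_extendCurve_of_eq (c := resolvent q) (d := q * resolvent q) (y := 1) (fun t => by
    conv_lhs => rw [resolvent_eq]
    rfl) ht

lemma contDiff_resolvent [CompleteSpace 𝔸] :
    ContDiff ℝ ∞ (resolvent : C(TimeInterval, 𝔸) → C(TimeInterval, 𝔸)) :=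
  contDiff_ringInverse_one_sub (volterraOp 𝔸) isUnit_one_sub_volterraOp 1

/-- The fundamental solution of a linear differential equation whose coefficient depends smoothly
on time and on a parameter depends smoothly on the parameter. -/
lemma contDiff_resolvent_of_contDiff [CompleteSpace 𝔸] {P : Type*} [NormedAddCommGroup P]
    [NormedSpace ℝ P] {q : ℝ × P → 𝔸} (hq : ContDiff ℝ ∞ q) {t : ℝ} (ht : t ∈ Icc (-2 : ℝ) 2) :
    ContDiff ℝ ∞ (fun p : P => extendCurve (resolvent
      (⟨fun s : TimeInterval => q (s, p), hq.continuous.comp (by fun_prop)⟩ :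
        C(TimeInterval, 𝔸))) t) := by
  -- The family of curves `s ↦ (s, p)` depends affinely on `p`.
  have h1 : ContDiff ℝ ∞ (fun p : P =>
      (⟨fun s : TimeInterval => ((s : ℝ), p), by fun_prop⟩ : C(TimeInterval, ℝ × P))) := by
    have h : (fun p : P =>
        (⟨fun s : TimeInterval => ((s : ℝ), p), by fun_prop⟩ : C(TimeInterval, ℝ × P))) =
        fun p => (⟨fun s : TimeInterval => ((s : ℝ), 0), by fun_prop⟩ : C(TimeInterval, ℝ × P)) +
          constCurve (ℝ × P) (0, p) := by
      ext p s <;> simp [constCurve]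
    rw [h]
    exact contDiff_const.add ((constCurve (ℝ × P)).contDiff.comp
      (contDiff_const.prodMk contDiff_id))
  have h2 := (ContinuousMap.evalCLM ℝ (⟨t, ht⟩ : TimeInterval)).contDiff.comp
    (contDiff_resolvent.comp ((contDiff_postcomp (K := TimeInterval) hq).comp h1))
  convert! h2 using 2 with p
  exact extendCurve_of_mem _ ht

end LinearEquation

/-! ### Derivatives of curves in the fibres -/

section FiberCalculus

variable {X F : Type*} [AddCommGroup X] [Module ℝ X] [TopologicalSpace X]
  [IsTopologicalAddGroup X] [ContinuousSMul ℝ X]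
  [NormedAddCommGroup F] [NormedSpace ℝ F]

/-- The norm transported along a linear homeomorphism; its topology is the given one by
definition. -/
@[reducible] noncomputable def normedAddCommGroupOfEquiv (φ : X ≃L[ℝ] F) : NormedAddCommGroup X :=
  letI m : MetricSpace X := (MetricSpace.induced φ φ.injective inferInstance).replaceTopology
    φ.toHomeomorph.isInducing.eq_induced
  { (inferInstance : AddCommGroup X), m with
    norm := fun x => ‖φ x‖
    dist_eq := fun x y => by
      change dist (φ x) (φ y) = ‖φ (-x + y)‖
      rw [dist_eq_norm, map_add, map_neg, ← norm_neg]
      congr 1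
      abel }

@[reducible] noncomputable def normedSpaceOfEquiv (φ : X ≃L[ℝ] F) :
    letI := normedAddCommGroupOfEquiv φ
    NormedSpace ℝ X :=
  letI := normedAddCommGroupOfEquiv φ
  { (inferInstance : Module ℝ X) with
    norm_smul_le := fun r x => by
      change ‖φ (r • x)‖ ≤ ‖r‖ * ‖φ x‖
      rw [map_smul, norm_smul] }

lemma hasDerivAt_deriv_eq_of_equiv (φ : X ≃L[ℝ] F) {f : ℝ → X} {f' : X} {t : ℝ}
    (h : HasDerivAt f f' t) : deriv f t = f' := by
  let := normedAddCommGroupOfEquiv φ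
  let := normedSpaceOfEquiv φ
  exact HasDerivAt.deriv h

/-- In a finite-dimensional space, differentiability can be tested on linear functionals. -/
lemma hasDerivWithinAt_iff_forall_dual [FiniteDimensional ℝ F] (φ : X ≃L[ℝ] F) {f : ℝ → X} {f' : X}
    {s : Set ℝ} {t : ℝ} :
    HasDerivWithinAt f f' s t ↔
      ∀ l : X →ₗ[ℝ] ℝ, HasDerivWithinAt (fun r => l (f r)) (l f') s t := by
  let := normedAddCommGroupOfEquiv φ
  let := normedSpaceOfEquiv φ
  have : FiniteDimensional ℝ X := φ.symm.toLinearEquiv.finiteDimensional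
  constructor
  · intro h l
    exact (LinearMap.toContinuousLinearMap l).hasFDerivAt.comp_hasDerivWithinAt t h
  · intro h
    let b := Module.finBasis ℝ X
    have h1 : HasDerivWithinAt (fun r => ∑ i, b.coord i (f r) • b i) (∑ i, b.coord i f' • b i) s t :=
      HasDerivWithinAt.fun_sum fun i _ => (h (b.coord i)).smul_const (b i)
    simp only [Module.Basis.coord_apply, b.sum_repr] at h1
    exact h1

lemma hasDerivAt_iff_forall_dual [FiniteDimensional ℝ F] (φ : X ≃L[ℝ] F) {f : ℝ → X} {f' : X}
    {t : ℝ} :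
    HasDerivAt f f' t ↔ ∀ l : X →ₗ[ℝ] ℝ, HasDerivAt (fun r => l (f r)) (l f') t := by
  let := normedAddCommGroupOfEquiv φ
  let := normedSpaceOfEquiv φ
  have h1 : HasDerivAt f f' t ↔ HasDerivWithinAt f f' univ t := hasDerivWithinAt_univ.symm
  rw [h1, hasDerivWithinAt_iff_forall_dual φ]
  simp only [hasDerivWithinAt_univ]

end FiberCalculus

/-! ### Directional derivatives -/

section Calculus

variable {EM : Type*} [NormedAddCommGroup EM] [NormedSpace ℝ EM]
  {M : Type*} [TopologicalSpace M] [ChartedSpace EM M] [IsManifold 𝓘(ℝ, EM) ∞ M]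
  {F : Type*} [NormedAddCommGroup F] [NormedSpace ℝ F]
  {E : M → Type*} [TopologicalSpace (TotalSpace F E)]
  [∀ x, AddCommGroup (E x)] [∀ x, Module ℝ (E x)] [∀ x, TopologicalSpace (E x)]
  [∀ x, IsTopologicalAddGroup (E x)] [∀ x, ContinuousSMul ℝ (E x)]
  [FiberBundle F E] [VectorBundle ℝ F E]

/-- `γ` has velocity `v` at time `t`. -/
def HasVelocityAt (γ : ℝ → M) (t : ℝ) (v : TangentSpace 𝓘(ℝ, EM) (γ t)) : Prop :=
  HasMFDerivAt 𝓘(ℝ, ℝ) 𝓘(ℝ, EM) γ t ((1 : ℝ →L[ℝ] ℝ).smulRight v)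

lemma hasVelocityAt_mfderiv {γ : ℝ → M} {t : ℝ}
    (h : MDifferentiableAt 𝓘(ℝ, ℝ) 𝓘(ℝ, EM) γ t) :
    HasVelocityAt (EM := EM) γ t (mfderiv 𝓘(ℝ, ℝ) 𝓘(ℝ, EM) γ t (1 : ℝ)) := by
  have hA : ((1 : ℝ →L[ℝ] ℝ).smulRight (mfderiv 𝓘(ℝ, ℝ) 𝓘(ℝ, EM) γ t (1 : ℝ) : EM) : ℝ →L[ℝ] EM) =
      mfderiv 𝓘(ℝ, ℝ) 𝓘(ℝ, EM) γ t := by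
    ext
    exact one_smul ℝ _
  have h1 := h.hasMFDerivAt
  unfold HasVelocityAt
  rw [← hA] at h1
  exact h1

lemma HasVelocityAt.hasDerivAt_comp {G : Type*} [NormedAddCommGroup G] [NormedSpace ℝ G]
    {γ : ℝ → M} {t : ℝ} {v : TangentSpace 𝓘(ℝ, EM) (γ t)} (h : HasVelocityAt γ t v) {f : M → G}
    (hf : MDifferentiableAt 𝓘(ℝ, EM) 𝓘(ℝ, G) f (γ t)) :
    HasDerivAt (fun r => f (γ r)) (mvfderiv 𝓘(ℝ, EM) f (γ t) v) t := by
  have h1 := HasMFDerivAt.comp t hf.hasMFDerivAt h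
  have h2 : HasFDerivAt (fun r => f (γ r)) ((mvfderiv 𝓘(ℝ, EM) f (γ t)).comp
    ((1 : ℝ →L[ℝ] ℝ).smulRight (v : EM))) t := h1.hasFDerivAt
  convert! h2.hasDerivAt using 1
  change mvfderiv 𝓘(ℝ, EM) f (γ t) v = mvfderiv 𝓘(ℝ, EM) f (γ t) ((1 : ℝ) • v)
  rw [one_smul]

lemma HasVelocityAt.congr {γ γ' : ℝ → M} {t : ℝ} {v : EM}
    (h : HasVelocityAt (EM := EM) γ t v) (hγ : γ' =ᶠ[𝓝 t] γ) :
    HasVelocityAt (EM := EM) γ' t v := by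
  have h1 := HasMFDerivAt.congr_of_eventuallyEq h hγ
  exact h1

lemma HasVelocityAt.comp_hasDerivAt {γ : ℝ → M} {u : ℝ → ℝ} {t u' : ℝ}
    {v : TangentSpace 𝓘(ℝ, EM) (γ (u t))} (h : HasVelocityAt γ (u t) v)
    (hu : HasDerivAt u u' t) : HasVelocityAt (EM := EM) (fun r => γ (u r)) t (u' • v) := by
  have h1 := HasMFDerivAt.comp t h hu.hasFDerivAt.hasMFDerivAt
  have hA : ((1 : ℝ →L[ℝ] ℝ).smulRight (u' • v : EM) : ℝ →L[ℝ] EM) =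
      ((1 : ℝ →L[ℝ] ℝ).smulRight (v : EM)).comp ((1 : ℝ →L[ℝ] ℝ).smulRight u') := by
    ext
    change (1 : ℝ) • u' • v = ((1 : ℝ) • u') • v
    rw [smul_assoc]
  have h2 : HasMFDerivAt 𝓘(ℝ, ℝ) 𝓘(ℝ, EM) (fun r => γ (u r)) t
    (((1 : ℝ →L[ℝ] ℝ).smulRight (v : EM)).comp ((1 : ℝ →L[ℝ] ℝ).smulRight u')) := h1
  exact HasMFDerivAt.congr_mfderiv h2 hA.symm

lemma mdifferentiableAt_toFun (f : C^∞⟮𝓘(ℝ, EM), M; ℝ⟯) (x : M) :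
    MDifferentiableAt 𝓘(ℝ, EM) 𝓘(ℝ, ℝ) (fun y => f y) x :=
  (f.contMDiff x).mdifferentiableAt (by simp)

lemma HasVelocityAt.hasDerivAt_dirDeriv {γ : ℝ → M} {t : ℝ} {v : TangentSpace 𝓘(ℝ, EM) (γ t)}
    (h : HasVelocityAt γ t v) (f : C^∞⟮𝓘(ℝ, EM), M; ℝ⟯) :
    HasDerivAt (fun r => f (γ r)) (dirDeriv f v) t :=
  h.hasDerivAt_comp (mdifferentiableAt_toFun f _)

lemma dirDeriv_sub (f : C^∞⟮𝓘(ℝ, EM), M; ℝ⟯) {x : M} (v w : TangentSpace 𝓘(ℝ, EM) x) :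
    dirDeriv f (v - w) = dirDeriv f v - dirDeriv f w := map_sub _ _ _

lemma dirDeriv_smul (f : C^∞⟮𝓘(ℝ, EM), M; ℝ⟯) {x : M} (r : ℝ) (v : TangentSpace 𝓘(ℝ, EM) x) :
    dirDeriv f (r • v) = r * dirDeriv f v := map_smul (mvfderiv 𝓘(ℝ, EM) (fun y => f y) x) _ _

lemma dirDeriv_neg (f : C^∞⟮𝓘(ℝ, EM), M; ℝ⟯) {x : M} (v : TangentSpace 𝓘(ℝ, EM) x) :
    dirDeriv f (-v) = -dirDeriv f v := map_neg _ _

lemma dirDeriv_zero (f : C^∞⟮𝓘(ℝ, EM), M; ℝ⟯) {x : M} :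
    dirDeriv f (0 : TangentSpace 𝓘(ℝ, EM) x) = 0 := map_zero _

lemma dirDeriv_sum {ι : Type*} (s : Finset ι) (f : C^∞⟮𝓘(ℝ, EM), M; ℝ⟯) {x : M}
    (v : ι → TangentSpace 𝓘(ℝ, EM) x) :
    dirDeriv f (∑ i ∈ s, v i) = ∑ i ∈ s, dirDeriv f (v i) := map_sum _ _ _

lemma dirDeriv_of_eventuallyEq_const {f : C^∞⟮𝓘(ℝ, EM), M; ℝ⟯} {x : M} {r : ℝ}
    (h : ∀ᶠ y in 𝓝 x, f y = r) (v : TangentSpace 𝓘(ℝ, EM) x) : dirDeriv f v = 0 := by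
  have h1 : mfderiv 𝓘(ℝ, EM) 𝓘(ℝ, ℝ) (fun y => f y) x =
      mfderiv 𝓘(ℝ, EM) 𝓘(ℝ, ℝ) (fun _ => r) x := Filter.EventuallyEq.mfderiv_eq h
  rw [mfderiv_const] at h1
  exact congrArg (fun A : EM →L[ℝ] ℝ => A v) h1

/-- The differential of a smooth function along a smooth vector field is smooth. -/
lemma contMDiff_mvfderiv_apply {G : Type*} [NormedAddCommGroup G] [NormedSpace ℝ G] {f : M → G}
    (hf : ContMDiff 𝓘(ℝ, EM) 𝓘(ℝ, G) ∞ f) {X : (x : M) → TangentSpace 𝓘(ℝ, EM) x}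
    (hX : ContMDiff 𝓘(ℝ, EM) 𝓘(ℝ, EM).tangent ∞ (fun x => (⟨x, X x⟩ : TangentBundle 𝓘(ℝ, EM) M))) :
    ContMDiff 𝓘(ℝ, EM) 𝓘(ℝ, G) ∞ (fun x => mvfderiv 𝓘(ℝ, EM) f x (X x)) := by
  have h1 : ContMDiff 𝓘(ℝ, EM) 𝓘(ℝ, G).tangent ∞
      (fun x => tangentMap 𝓘(ℝ, EM) 𝓘(ℝ, G) f ⟨x, X x⟩) :=
    (hf.contMDiff_tangentMap (m := ∞) (by simp)).comp hX
  exact contMDiff_snd_tangentBundle_modelSpace G 𝓘(ℝ, G) |>.comp h1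

end Calculus

/-! ### Partial frames -/

section Frames

variable {EM : Type*} [NormedAddCommGroup EM] [NormedSpace ℝ EM]
  {M : Type*} [TopologicalSpace M] [ChartedSpace EM M] [IsManifold 𝓘(ℝ, EM) ∞ M]
  {F : Type*} [NormedAddCommGroup F] [NormedSpace ℝ F]
  {E : M → Type*} [TopologicalSpace (TotalSpace F E)]
  [∀ x, AddCommGroup (E x)] [∀ x, Module ℝ (E x)] [∀ x, TopologicalSpace (E x)]
  [∀ x, IsTopologicalAddGroup (E x)] [∀ x, ContinuousSMul ℝ (E x)]
  [FiberBundle F E] [VectorBundle ℝ F E]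

@[simp] lemma smulSection_apply (f : C^∞⟮𝓘(ℝ, EM), M; ℝ⟯) (β : Cₛ^∞⟮𝓘(ℝ, EM); F, E⟯) (x : M) :
    smulSection f β x = f x • β x := rfl

lemma section_sum_apply {ι : Type*} (s : Finset ι) (σ : ι → Cₛ^∞⟮𝓘(ℝ, EM); F, E⟯) (x : M) :
    (∑ i ∈ s, σ i) x = ∑ i ∈ s, σ i x := by
  have h := map_sum (ContMDiffSection.coeAddHom 𝓘(ℝ, EM) F ∞ E) σ s
  have h1 := congrFun h x
  rw [Finset.sum_apply] at h1
  exact h1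

lemma section_sum_smul_apply {ι : Type*} (s : Finset ι) (c : ι → ℝ)
    (σ : ι → Cₛ^∞⟮𝓘(ℝ, EM); F, E⟯) (x : M) :
    (∑ i ∈ s, c i • σ i) x = ∑ i ∈ s, c i • σ i x := by
  rw [section_sum_apply]
  rfl

lemma contMDiff_section_coe (σ : Cₛ^∞⟮𝓘(ℝ, EM); F, E⟯) :
    ContMDiff 𝓘(ℝ, EM) (𝓘(ℝ, EM).prod 𝓘(ℝ, F)) ∞ (fun x => (⟨x, σ x⟩ : TotalSpace F E)) :=
  σ.contMDiff

variable (EM F E) in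
/-- Finitely many global sections `sec i` together with fibrewise linear functions `coord i`, such
that `v = ∑ i, coord i v • sec i` over the region where the smooth function `weight` is one.
The sections are not required to be linearly independent. -/
structure PartialFrame (ι : Type) [Fintype ι] where
  sec : ι → Cₛ^∞⟮𝓘(ℝ, EM); F, E⟯
  coord : ι → (x : M) → E x →ₗ[ℝ] ℝ
  contMDiff_coord : ∀ i, ContMDiff (𝓘(ℝ, EM).prod 𝓘(ℝ, F)) 𝓘(ℝ, ℝ) ∞
    (fun a : TotalSpace F E => coord i a.1 a.2)
  weight : C^∞⟮𝓘(ℝ, EM), M; ℝ⟯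
  sum_coord_smul_eq : ∀ (x : M) (v : E x), ∑ i, coord i x v • sec i x = weight x • v

namespace PartialFrame

variable {ι : Type} [Fintype ι] (P : PartialFrame EM F E ι)

/-- The open set over which a partial frame spans. -/
def domain : Set M := interior {x | P.weight x = 1}

lemma isOpen_domain : IsOpen P.domain := isOpen_interior

lemma weight_eq_one {x : M} (hx : x ∈ P.domain) : P.weight x = 1 :=
  interior_subset (s := {x | P.weight x = 1}) hx

lemma eventually_weight_eq_one {x : M} (hx : x ∈ P.domain) : ∀ᶠ y in 𝓝 x, P.weight y = 1 := by
  filter_upwards [P.isOpen_domain.mem_nhds hx] with y hy using P.weight_eq_one hy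

lemma sum_coord_smul {x : M} (hx : x ∈ P.domain) (v : E x) :
    ∑ i, P.coord i x v • P.sec i x = v := by
  rw [P.sum_coord_smul_eq, P.weight_eq_one hx, one_smul]

/-- The coefficients of a section, as smooth functions. -/
noncomputable def coeff (i : ι) (σ : Cₛ^∞⟮𝓘(ℝ, EM); F, E⟯) : C^∞⟮𝓘(ℝ, EM), M; ℝ⟯ :=
  ⟨fun x => P.coord i x (σ x), (P.contMDiff_coord i).comp (contMDiff_section_coe σ)⟩

@[simp] lemma coeff_apply (i : ι) (σ : Cₛ^∞⟮𝓘(ℝ, EM); F, E⟯) (x : M) :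
    P.coeff i σ x = P.coord i x (σ x) := rfl

lemma sum_smulSection_coeff (σ : Cₛ^∞⟮𝓘(ℝ, EM); F, E⟯) :
    ∑ i, smulSection (P.coeff i σ) (P.sec i) = smulSection P.weight σ := by
  apply ContMDiffSection.ext
  intro x
  rw [section_sum_apply]
  exact P.sum_coord_smul_eq x (σ x)

/-- The sections of the frame are linearly independent over its domain, with dual basis given by
the coordinates. -/
def IsFree : Prop := ∀ x ∈ P.domain, ∀ (z : ι → ℝ) (k : ι),
  P.coord k x (∑ i, z i • P.sec i x) = z k

lemma exists_section {x : M} (hx : x ∈ P.domain) (v : E x) :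
    ∃ σ : Cₛ^∞⟮𝓘(ℝ, EM); F, E⟯, σ x = v :=
  ⟨∑ i, P.coord i x v • P.sec i, by rw [section_sum_smul_apply, P.sum_coord_smul hx]⟩

end PartialFrame

variable [FiniteDimensional ℝ EM] [FiniteDimensional ℝ F] [T2Space M] [SigmaCompactSpace M]
  [ContMDiffVectorBundle ∞ F E 𝓘(ℝ, EM)]

lemma exists_bump {x₀ : M} {U : Set M} (hU : IsOpen U) (hx : x₀ ∈ U) :
    ∃ χ : C^∞⟮𝓘(ℝ, EM), M; ℝ⟯, (∀ᶠ x in 𝓝 x₀, χ x = 1) ∧ tsupport χ ⊆ U := by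
  have := ChartedSpace.locallyCompactSpace EM M
  obtain ⟨T, hT, hTc, hTU⟩ := exists_mem_nhds_isClosed_subset (hU.mem_nhds hx)
  obtain ⟨χ, h1, h2, -⟩ := exists_contMDiffMap_one_nhds_of_subset_interior 𝓘(ℝ, EM) (n := ⊤)
    (isClosed_singleton (x := x₀)) (t := T)
    (singleton_subset_iff.2 (mem_interior_iff_mem_nhds.2 hT))
  refine ⟨χ, by simpa using h1, (closure_minimal ?_ hTc).trans hTU⟩
  intro x hx
  by_contra hxT
  exact hx (h2 x hxT)

variable (EM F E) in
/-- Near every point, a cut-off local frame of a trivialization is a free partial frame. -/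
lemma exists_partialFrame_isFree (x₀ : M) :
    ∃ P : PartialFrame EM F E (Fin (Module.finrank ℝ F)), x₀ ∈ P.domain ∧ P.IsFree := by
  set e := trivializationAt F E x₀ with he
  let b := Module.finBasis ℝ F
  obtain ⟨χ, hχ1, hχ⟩ := exists_bump (EM := EM) e.open_baseSet (FiberBundle.mem_baseSet_trivializationAt' x₀)
  have hout : ∀ x, x ∉ e.baseSet → χ x = 0 := fun x hx =>
    image_eq_zero_of_notMem_tsupport fun h => hx (hχ h)
  let crd : Fin (Module.finrank ℝ F) → (x : M) → E x →ₗ[ℝ] ℝ :=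
    fun i x => χ x • (b.coord i ∘ₗ e.linearMapAt ℝ x)
  have hs : ∀ i, ContMDiff 𝓘(ℝ, EM) (𝓘(ℝ, EM).prod 𝓘(ℝ, F)) ∞
      (fun x => (⟨x, χ x • e.localFrame b i x⟩ : TotalSpace F E)) := fun i =>
    ContMDiffOn.smul_section_of_tsupport χ.contMDiff.contMDiffOn e.open_baseSet hχ
      (e.contMDiffOn_localFrame_baseSet ∞ b i)
  have hlin : ∀ x ∈ e.baseSet, ∀ v : E x, e.linearMapAt ℝ x v = (e ⟨x, v⟩).2 := fun x hx v => by
    rw [e.coe_linearMapAt_of_mem hx]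
  have hsymm : ∀ x ∈ e.baseSet, ∀ v : E x, ∑ i, b.coord i ((e ⟨x, v⟩).2) • e.localFrame b i x = v := by
    intro x hx v
    have h1 : ∀ i, e.localFrame b i x = e.symmₗ ℝ x (b i) := fun i => by
      rw [e.localFrame_apply_of_mem_baseSet b hx]
      rw [e.symmₗ_apply hx]
      simp [Trivialization.basisAt]
    simp only [h1, ← map_smul, ← map_sum, Module.Basis.coord_apply, b.sum_repr]
    rw [← hlin x hx]
    exact e.symmₗ_linearMapAt hx v
  have hframe : ∀ x ∈ e.baseSet, ∀ i, e.linearMapAt ℝ x (e.localFrame b i x) = b i := by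
    intro x hx i
    rw [e.localFrame_apply_of_mem_baseSet b hx]
    rw [← e.linearMapAt_symmₗ (R := ℝ) hx (b i)]
    rw [e.symmₗ_apply hx]
    simp [Trivialization.basisAt]
  let P : PartialFrame EM F E (Fin (Module.finrank ℝ F)) :=
    { sec := fun i => ⟨fun x => χ x • e.localFrame b i x, hs i⟩
      coord := crd
      contMDiff_coord := by
        intro i a
        by_cases ha : a.1 ∈ e.baseSet
        · have h1 : ContMDiffAt (𝓘(ℝ, EM).prod 𝓘(ℝ, F)) 𝓘(ℝ, F) ∞
              (fun a : TotalSpace F E => (e a).2) a :=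
            ((e.contMDiffAt_iff (IB := 𝓘(ℝ, EM)) (f := fun a => a)
              (e.mem_source.2 ha)).1 contMDiffAt_id).2
          have hb : ContDiff ℝ ∞ (fun v : F => b.coord i v) :=
            (LinearMap.toContinuousLinearMap (b.coord i)).contDiff
          have h2 : ContMDiffAt (𝓘(ℝ, EM).prod 𝓘(ℝ, F)) 𝓘(ℝ, ℝ) ∞
              (fun a : TotalSpace F E => b.coord i (e a).2) a :=
            hb.contMDiff.contMDiffAt.comp a h1
          have h3 : ContMDiffAt (𝓘(ℝ, EM).prod 𝓘(ℝ, F)) 𝓘(ℝ, ℝ) ∞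
              (fun a : TotalSpace F E => χ a.1) a :=
            χ.contMDiff.contMDiffAt.comp a (contMDiff_proj E a)
          refine (h3.smul h2).congr_of_eventuallyEq ?_
          have h4 : ∀ᶠ a' : TotalSpace F E in 𝓝 a, a'.1 ∈ e.baseSet :=
            (FiberBundle.continuous_proj F E).continuousAt.preimage_mem_nhds
              (e.open_baseSet.mem_nhds ha)
          filter_upwards [h4] with a' ha'
          change χ a'.1 • b.coord i (e.linearMapAt ℝ a'.1 a'.2) = χ a'.1 • b.coord i (e a').2
          rw [hlin _ ha']
        · refine (contMDiffAt_const (c := (0 : ℝ))).congr_of_eventuallyEq ?_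
          have h4 : ∀ᶠ a' : TotalSpace F E in 𝓝 a, a'.1 ∈ (tsupport χ)ᶜ :=
            (FiberBundle.continuous_proj F E).continuousAt.preimage_mem_nhds
              ((isClosed_tsupport _).isOpen_compl.mem_nhds fun h => ha (hχ h))
          filter_upwards [h4] with a' ha'
          change χ a'.1 • b.coord i (e.linearMapAt ℝ a'.1 a'.2) = 0
          rw [image_eq_zero_of_notMem_tsupport ha', zero_smul]
      weight := χ * χ
      sum_coord_smul_eq := by
        intro x v
        change ∑ i, (χ x • b.coord i (e.linearMapAt ℝ x v)) • χ x • e.localFrame b i x =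
          (χ x * χ x) • v
        by_cases hx : x ∈ e.baseSet
        · rw [hlin x hx]
          conv_rhs => rw [← hsymm x hx v, Finset.smul_sum]
          refine Finset.sum_congr rfl fun i _ => ?_
          simp only [smul_smul, smul_eq_mul]
          congr 1
          ring
        · simp [hout x hx] }
  have hdom : ∀ x ∈ P.domain, χ x * χ x = 1 := fun x hx => P.weight_eq_one hx
  refine ⟨P, ?_, ?_⟩
  · apply mem_interior_iff_mem_nhds.2
    filter_upwards [hχ1] with x hx
    change χ x * χ x = 1
    rw [hx, one_mul]
  · intro x hx z k
    have h1 := hdom x hx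
    have hxe : x ∈ e.baseSet := by
      by_contra h
      rw [hout x h] at h1
      simp at h1
    change χ x • b.coord k (e.linearMapAt ℝ x (∑ i, z i • χ x • e.localFrame b i x)) = z k
    simp only [map_sum, map_smul, hframe x hxe, smul_eq_mul, Module.Basis.coord_apply,
      Module.Basis.repr_self, Finsupp.single_apply]
    simp only [mul_ite, mul_one, mul_zero, Finset.sum_ite_eq', Finset.mem_univ, if_true]
    rw [mul_left_comm, h1, mul_one]

lemma exists_section_apply_eq {x : M} (v : E x) : ∃ σ : Cₛ^∞⟮𝓘(ℝ, EM); F, E⟯, σ x = v := by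
  obtain ⟨P, hP, -⟩ := exists_partialFrame_isFree EM F E x
  exact P.exists_section hP v

lemma sectionThrough_apply {x : M} (v : E x) :
    (sectionThrough (EM := EM) (F := F) v) x = v := by
  unfold sectionThrough
  rw [dif_pos (exists_section_apply_eq v)]
  exact (exists_section_apply_eq (EM := EM) (F := F) v).choose_spec

/-- The function `s ↦ 1 / s` for `s ≥ 1`, cut off near zero. -/
lemma exists_contDiff_cutoff_inv : ∃ g : ℝ → ℝ, ContDiff ℝ ∞ g ∧ ∀ s, 1 ≤ s → g s * s = 1 := by
  refine ⟨fun s => Real.smoothTransition (2 * s - 1) * s⁻¹, ?_, fun s hs => ?_⟩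
  · rw [contDiff_iff_contDiffAt]
    intro s
    by_cases h : s = 0
    · refine (contDiffAt_const (c := (0 : ℝ))).congr_of_eventuallyEq ?_
      have h1 : ∀ᶠ r : ℝ in 𝓝 s, r < 1 / 2 := by
        rw [h]
        exact Iio_mem_nhds (by norm_num)
      filter_upwards [h1] with r hr
      rw [Real.smoothTransition.zero_of_nonpos (by linarith), zero_mul]
    · exact ContDiffAt.mul (Real.smoothTransition.contDiff.comp (by fun_prop)).contDiffAt
        (contDiffAt_inv ℝ h)
  · change Real.smoothTransition (2 * s - 1) * s⁻¹ * s = 1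
    rw [Real.smoothTransition.one_of_one_le (by linarith), one_mul,
      inv_mul_cancel₀ (by linarith)]

variable (EM F E) in
/-- Some partial frame spans over a neighbourhood of a given compact set. -/
lemma exists_partialFrame_of_isCompact {K : Set M} (hK : IsCompact K) :
    ∃ (N : ℕ) (P : PartialFrame EM F E (Fin N)), K ⊆ P.domain := by
  choose P hP _ using exists_partialFrame_isFree (EM := EM) (F := F) (E := E) (M := M)
  obtain ⟨t, ht⟩ := hK.elim_finite_subcover (fun x => (P x).domain)
    (fun x => (P x).isOpen_domain) (fun x _ => mem_iUnion.2 ⟨x, hP x⟩)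
  obtain ⟨g, hg, hg1⟩ := exists_contDiff_cutoff_inv
  let pt : Fin t.card → M := fun j => (t.equivFin.symm j : M)
  let h : M → ℝ := fun x => ∑ j, (P (pt j)).weight x * (P (pt j)).weight x
  have hh : ContMDiff 𝓘(ℝ, EM) 𝓘(ℝ, ℝ) ∞ h :=
    contMDiff_finsetSum fun j _ => (P (pt j)).weight.contMDiff.mul (P (pt j)).weight.contMDiff
  have hgh : ContMDiff 𝓘(ℝ, EM) 𝓘(ℝ, ℝ) ∞ (fun x => g (h x)) := hg.contMDiff.comp hh
  let n := Module.finrank ℝ F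
  let ε : Fin (t.card * n) ≃ Fin t.card × Fin n := finProdFinEquiv.symm
  let Q : PartialFrame EM F E (Fin (t.card * n)) :=
    { sec := fun i => (P (pt (ε i).1)).sec (ε i).2
      coord := fun i x => (g (h x) * (P (pt (ε i).1)).weight x) • (P (pt (ε i).1)).coord (ε i).2 x
      contMDiff_coord := fun i =>
        ContMDiff.mul (ContMDiff.mul (hgh.comp (contMDiff_proj E))
          ((P (pt (ε i).1)).weight.contMDiff.comp (contMDiff_proj E)))
          ((P (pt (ε i).1)).contMDiff_coord (ε i).2)
      weight := ⟨fun x => g (h x) * h x, hgh.mul hh⟩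
      sum_coord_smul_eq := by
        intro x v
        change _ = (g (h x) * h x) • v
        rw [← Equiv.sum_comp ε.symm, Fintype.sum_prod_type]
        simp only [Equiv.apply_symm_apply, LinearMap.smul_apply, smul_assoc, ← Finset.smul_sum,
          PartialFrame.sum_coord_smul_eq]
        simp only [mul_smul, ← Finset.smul_sum]
        simp only [← mul_smul, ← Finset.sum_smul, h] }
  refine ⟨_, Q, ht.trans ?_⟩
  refine interior_maximal (fun x hx => ?_) (isOpen_biUnion fun x _ => (P x).isOpen_domain)
  obtain ⟨y, hyt, hy⟩ := mem_iUnion₂.1 hx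
  refine hg1 _ ?_
  have h1 : (P (pt (t.equivFin ⟨y, hyt⟩))).weight x = 1 := by
    have : pt (t.equivFin ⟨y, hyt⟩) = y := by simp [pt]
    rw [this]
    exact (P y).weight_eq_one hy
  calc (1 : ℝ) = (P (pt (t.equivFin ⟨y, hyt⟩))).weight x * (P (pt (t.equivFin ⟨y, hyt⟩))).weight x := by
        rw [h1, one_mul]
    _ ≤ h x := Finset.single_le_sum (f := fun j => (P (pt j)).weight x * (P (pt j)).weight x)
        (fun j _ => mul_self_nonneg _) (Finset.mem_univ _)

end Frames

/-! ### Derivations of sections at a point -/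

section Derivations

variable {EM : Type*} [NormedAddCommGroup EM] [NormedSpace ℝ EM]
  {M : Type*} [TopologicalSpace M] [ChartedSpace EM M] [IsManifold 𝓘(ℝ, EM) ∞ M]
  {F : Type*} [NormedAddCommGroup F] [NormedSpace ℝ F]
  {E : M → Type*} [TopologicalSpace (TotalSpace F E)]
  [∀ x, AddCommGroup (E x)] [∀ x, Module ℝ (E x)] [∀ x, TopologicalSpace (E x)]
  [∀ x, IsTopologicalAddGroup (E x)] [∀ x, ContinuousSMul ℝ (E x)]
  [FiberBundle F E] [VectorBundle ℝ F E]

/-- `K` is a derivation of sections at the point `x` whose symbol is the tangent vector `w`. -/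
structure IsDerivationAt {x : M} (w : TangentSpace 𝓘(ℝ, EM) x)
    (K : Cₛ^∞⟮𝓘(ℝ, EM); F, E⟯ → E x) : Prop where
  add : ∀ σ τ, K (σ + τ) = K σ + K τ
  leibniz : ∀ (f : C^∞⟮𝓘(ℝ, EM), M; ℝ⟯) σ, K (smulSection f σ) = f x • K σ + dirDeriv f w • σ x

namespace IsDerivationAt

variable {x : M} {w : TangentSpace 𝓘(ℝ, EM) x} {K : Cₛ^∞⟮𝓘(ℝ, EM); F, E⟯ → E x}
  {ι : Type} [Fintype ι]

lemma map_zero (hK : IsDerivationAt w K) : K 0 = 0 := by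
  have h := hK.add 0 0
  rw [add_zero] at h
  exact left_eq_add.1 h

lemma map_sum (hK : IsDerivationAt w K) {κ : Type*} (s : Finset κ)
    (σ : κ → Cₛ^∞⟮𝓘(ℝ, EM); F, E⟯) : K (∑ i ∈ s, σ i) = ∑ i ∈ s, K (σ i) := by
  classical
  induction s using Finset.induction_on with
  | empty => simpa using hK.map_zero
  | insert a s ha ih => rw [Finset.sum_insert ha, Finset.sum_insert ha, hK.add, ih]

lemma map_smul (hK : IsDerivationAt w K) (r : ℝ) (σ : Cₛ^∞⟮𝓘(ℝ, EM); F, E⟯) :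
    K (r • σ) = r • K σ := by
  let f : C^∞⟮𝓘(ℝ, EM), M; ℝ⟯ := ⟨fun _ => r, contMDiff_const⟩
  have hf : dirDeriv f w = 0 :=
    dirDeriv_of_eventuallyEq_const (r := r) (Eventually.of_forall fun _ => rfl) w
  have h := hK.leibniz f σ
  rw [hf, zero_smul, add_zero] at h
  exact h

lemma map_sum_smul (hK : IsDerivationAt w K) {κ : Type*} (s : Finset κ) (c : κ → ℝ)
    (σ : κ → Cₛ^∞⟮𝓘(ℝ, EM); F, E⟯) : K (∑ i ∈ s, c i • σ i) = ∑ i ∈ s, c i • K (σ i) := by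
  rw [hK.map_sum]
  exact Finset.sum_congr rfl fun i _ => hK.map_smul _ _

/-- A derivation at `x` is determined by its values on the sections of a partial frame. -/
lemma eq_sum (hK : IsDerivationAt w K) (P : PartialFrame EM F E ι) (hx : x ∈ P.domain)
    (σ : Cₛ^∞⟮𝓘(ℝ, EM); F, E⟯) :
    K σ = ∑ k, (P.coeff k σ x • K (P.sec k) + dirDeriv (P.coeff k σ) w • P.sec k x) := by
  have h := hK.leibniz P.weight σ
  rw [dirDeriv_of_eventuallyEq_const (P.eventually_weight_eq_one hx), zero_smul, add_zero,
    P.weight_eq_one hx, one_smul, ← P.sum_smulSection_coeff, hK.map_sum] at h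
  rw [← h]
  exact Finset.sum_congr rfl fun k _ => hK.leibniz _ _

/-- A derivation with symbol zero depends only on the value of the section. -/
lemma eq_sum_of_symbol_eq_zero {K : Cₛ^∞⟮𝓘(ℝ, EM); F, E⟯ → E x}
    (hK : IsDerivationAt (0 : TangentSpace 𝓘(ℝ, EM) x) K) (P : PartialFrame EM F E ι)
    (hx : x ∈ P.domain) (σ : Cₛ^∞⟮𝓘(ℝ, EM); F, E⟯) :
    K σ = ∑ k, P.coord k x (σ x) • K (P.sec k) := by
  rw [hK.eq_sum P hx]
  simp [dirDeriv_zero]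

end IsDerivationAt

lemma PreLieAlgebroid.isDerivationAt_bracket (L : PreLieAlgebroid EM F E)
    (α : Cₛ^∞⟮𝓘(ℝ, EM); F, E⟯) (x : M) :
    IsDerivationAt (L.anchor x (α x)) (fun σ => L.bracket α σ x) :=
  ⟨fun σ τ => by rw [map_add]; rfl, fun f σ => L.leibniz α σ f x⟩

lemma PreLieAlgebroid.isDerivationAt_bracket_left (L : PreLieAlgebroid EM F E)
    (β : Cₛ^∞⟮𝓘(ℝ, EM); F, E⟯) (x : M) :
    IsDerivationAt (-L.anchor x (β x)) (fun σ => L.bracket σ β x) := by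
  refine ⟨fun σ τ => by rw [map_add]; rfl, fun f σ => ?_⟩
  rw [L.antisymm _ β, L.antisymm σ β]
  change -(L.bracket β (smulSection f σ) x) = f x • -(L.bracket β σ x) + _
  rw [L.leibniz, dirDeriv_neg, neg_add, smul_neg, neg_smul]

lemma AConnection.isDerivationAt {L : PreLieAlgebroid EM F E} (C : AConnection L)
    (α : Cₛ^∞⟮𝓘(ℝ, EM); F, E⟯) (x : M) :
    IsDerivationAt (L.anchor x (α x)) (fun σ => C.toFun α σ x) :=
  ⟨fun σ τ => by rw [map_add]; rfl, fun f σ => C.leibniz f α σ x⟩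

lemma AConnection.isDerivationAt_left {L : PreLieAlgebroid EM F E} (C : AConnection L)
    (σ : Cₛ^∞⟮𝓘(ℝ, EM); F, E⟯) (x : M) :
    IsDerivationAt (0 : TangentSpace 𝓘(ℝ, EM) x) (fun α => C.toFun α σ x) :=
  ⟨fun σ τ => by rw [map_add]; rfl, fun f α => by
    rw [dirDeriv_zero, zero_smul, add_zero]; exact C.smul_left f α σ x⟩

lemma isDerivationAt_covariantDerivative (nab : CovariantDerivative 𝓘(ℝ, EM) F E) {x : M}
    (w : TangentSpace 𝓘(ℝ, EM) x) :
    IsDerivationAt w (fun σ : Cₛ^∞⟮𝓘(ℝ, EM); F, E⟯ => nab σ x w) := by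
  have hd : ∀ σ : Cₛ^∞⟮𝓘(ℝ, EM); F, E⟯, MDifferentiableAt 𝓘(ℝ, EM) (𝓘(ℝ, EM).prod 𝓘(ℝ, F))
      (fun y => (⟨y, σ y⟩ : TotalSpace F E)) x := fun σ =>
    (contMDiff_section_coe σ x).mdifferentiableAt (by simp)
  refine ⟨fun σ τ => ?_, fun f σ => ?_⟩
  · have h := nab.isCovariantDerivativeOnUniv.add (hd σ) (hd τ)
    exact congrArg (fun A : TangentSpace 𝓘(ℝ, EM) x →L[ℝ] E x => A w) h
  · have h := nab.isCovariantDerivativeOnUniv.leibniz (hd σ) (mdifferentiableAt_toFun f x)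
    exact congrArg (fun A : TangentSpace 𝓘(ℝ, EM) x →L[ℝ] E x => A w) h

/-- The trivialization identifies the fibre at `x` with the model fibre. -/
noncomputable def fiberEquiv (F : Type*) [NormedAddCommGroup F] [NormedSpace ℝ F]
    (E : M → Type*) [TopologicalSpace (TotalSpace F E)]
    [∀ x, AddCommGroup (E x)] [∀ x, Module ℝ (E x)] [∀ x, TopologicalSpace (E x)]
    [FiberBundle F E] [VectorBundle ℝ F E] (x : M) : E x ≃L[ℝ] F :=
  (trivializationAt F E x).continuousLinearEquivAt ℝ x (FiberBundle.mem_baseSet_trivializationAt' x)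

section FiberDeriv

variable {X : Type*} [AddCommGroup X] [Module ℝ X] [TopologicalSpace X]
  [IsTopologicalAddGroup X] [ContinuousSMul ℝ X] [FiniteDimensional ℝ F]

lemma hasDerivWithinAt_sum_smul_of_equiv (φ : X ≃L[ℝ] F) {κ : Type*} {s : Finset κ}
    {c : κ → ℝ → ℝ} {c' : κ → ℝ} {S : Set ℝ} {t : ℝ}
    (hc : ∀ k ∈ s, HasDerivWithinAt (c k) (c' k) S t) (v : κ → X) :
    HasDerivWithinAt (fun r => ∑ k ∈ s, c k r • v k) (∑ k ∈ s, c' k • v k) S t := by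
  refine (hasDerivWithinAt_iff_forall_dual φ).2 fun l => ?_
  simp only [map_sum, map_smul, smul_eq_mul]
  exact HasDerivWithinAt.fun_sum fun k hk => (hc k hk).mul_const _

lemma hasDerivAt_sum_smul_of_equiv (φ : X ≃L[ℝ] F) {κ : Type*} {s : Finset κ} {c : κ → ℝ → ℝ}
    {c' : κ → ℝ} {t : ℝ} (hc : ∀ k ∈ s, HasDerivAt (c k) (c' k) t) (v : κ → X) :
    HasDerivAt (fun r => ∑ k ∈ s, c k r • v k) (∑ k ∈ s, c' k • v k) t := by
  refine (hasDerivAt_iff_forall_dual φ).2 fun l => ?_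
  simp only [map_sum, map_smul, smul_eq_mul]
  exact HasDerivAt.fun_sum fun k hk => (hc k hk).mul_const _

end FiberDeriv

end Derivations

/-! ### Covariant derivatives along curves -/

section CovDeriv

variable {EM : Type*} [NormedAddCommGroup EM] [NormedSpace ℝ EM]
  {M : Type*} [TopologicalSpace M] [ChartedSpace EM M] [IsManifold 𝓘(ℝ, EM) ∞ M]
  {F : Type*} [NormedAddCommGroup F] [NormedSpace ℝ F]
  {E : M → Type*} [TopologicalSpace (TotalSpace F E)]
  [∀ x, AddCommGroup (E x)] [∀ x, Module ℝ (E x)] [∀ x, TopologicalSpace (E x)]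
  [∀ x, IsTopologicalAddGroup (E x)] [∀ x, ContinuousSMul ℝ (E x)]
  [FiberBundle F E] [VectorBundle ℝ F E]

lemma HasVelocityAt.hasDerivAt_comp_prod {f : ℝ × M → ℝ} {γ : ℝ → M} {t : ℝ}
    {v : TangentSpace 𝓘(ℝ, EM) (γ t)} (h : HasVelocityAt γ t v)
    (hf : MDifferentiableAt (𝓘(ℝ, ℝ).prod 𝓘(ℝ, EM)) 𝓘(ℝ, ℝ) f (t, γ t)) :
    ∃ a, HasDerivAt (fun r => f (r, γ t)) a t ∧
      HasDerivAt (fun r => f (r, γ r)) (a + mvfderiv 𝓘(ℝ, EM) (fun y => f (t, y)) (γ t) v) t := by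
  obtain ⟨A, hA⟩ : ∃ A : ℝ × EM →L[ℝ] ℝ,
      HasMFDerivAt (𝓘(ℝ, ℝ).prod 𝓘(ℝ, EM)) 𝓘(ℝ, ℝ) f (t, γ t) A := ⟨_, hf.hasMFDerivAt⟩
  have key : ∀ (c : ℝ → M) (w : EM), c t = γ t → HasVelocityAt (EM := EM) c t w →
      HasDerivAt (fun r => f (r, c r)) (A (1, w)) t := by
    intro c w hc hw
    have h1 : HasMFDerivAt 𝓘(ℝ, ℝ) (𝓘(ℝ, ℝ).prod 𝓘(ℝ, EM)) (fun r : ℝ => (r, c r)) t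
        ((ContinuousLinearMap.id ℝ ℝ).prod ((1 : ℝ →L[ℝ] ℝ).smulRight w : ℝ →L[ℝ] EM)) :=
      HasMFDerivAt.prodMk (hasMFDerivAt_id t) hw
    have h0 : HasMFDerivAt (𝓘(ℝ, ℝ).prod 𝓘(ℝ, EM)) 𝓘(ℝ, ℝ) f ((fun r : ℝ => (r, c r)) t) A := by
      change HasMFDerivAt (𝓘(ℝ, ℝ).prod 𝓘(ℝ, EM)) 𝓘(ℝ, ℝ) f (t, c t) A
      rw [hc]
      exact hA
    have h2 : HasFDerivAt (fun r => f (r, c r)) (A.comp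
        ((ContinuousLinearMap.id ℝ ℝ).prod ((1 : ℝ →L[ℝ] ℝ).smulRight w : ℝ →L[ℝ] EM))) t :=
      (HasMFDerivAt.comp t h0 h1).hasFDerivAt
    convert h2.hasDerivAt using 1
    change A (1, w) = A (1, (1 : ℝ) • w)
    rw [one_smul]
  have hconst : HasVelocityAt (EM := EM) (fun _ => γ t) t (0 : EM) := by
    have h1 : HasMFDerivAt 𝓘(ℝ, ℝ) 𝓘(ℝ, EM) (fun _ : ℝ => γ t) t (0 : ℝ →L[ℝ] EM) :=
      hasMFDerivAt_const _ _
    have h2 : ((1 : ℝ →L[ℝ] ℝ).smulRight (0 : EM) : ℝ →L[ℝ] EM) = 0 := by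
      ext; exact smul_zero _
    exact HasMFDerivAt.congr_mfderiv h1 h2.symm
  refine ⟨_, key _ _ rfl hconst, ?_⟩
  have h3 : HasMFDerivAt 𝓘(ℝ, EM) (𝓘(ℝ, ℝ).prod 𝓘(ℝ, EM)) (fun y : M => (t, y)) (γ t)
      ((0 : EM →L[ℝ] ℝ).prod (ContinuousLinearMap.id ℝ EM)) :=
    HasMFDerivAt.prodMk (hasMFDerivAt_const _ _) (hasMFDerivAt_id _)
  have h4 : HasMFDerivAt 𝓘(ℝ, EM) 𝓘(ℝ, ℝ) (fun y => f (t, y)) (γ t)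
      (A.comp ((0 : EM →L[ℝ] ℝ).prod (ContinuousLinearMap.id ℝ EM))) := HasMFDerivAt.comp _ hA h3
  have h5 : mvfderiv 𝓘(ℝ, EM) (fun y => f (t, y)) (γ t) v = A (0, v) :=
    congrArg (fun B : EM →L[ℝ] ℝ => B v) h4.mfderiv
  rw [h5, ← map_add]
  have h6 := key γ v rfl h
  have h7 : ∀ v : EM, A (((1 : ℝ), (0 : EM)) + ((0 : ℝ), v)) = A (1, v) := fun v => by simp
  exact (h7 v).symm ▸ h6

variable [FiniteDimensional ℝ F] {ι : Type} [Fintype ι]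

/-- Two ways to write a curve in `E` as a combination of sections lead to the same covariant
derivative; one of them is given by a partial frame. -/
lemma IsDerivationAt.sum_deriv_coord_eq {γ : ℝ → M} {t : ℝ} {w : TangentSpace 𝓘(ℝ, EM) (γ t)}
    (hγ : HasVelocityAt γ t w) {K : Cₛ^∞⟮𝓘(ℝ, EM); F, E⟯ → E (γ t)} (hK : IsDerivationAt w K)
    (P : PartialFrame EM F E ι) (hx : γ t ∈ P.domain) {κ : Type} [Fintype κ]
    (s : κ → Cₛ^∞⟮𝓘(ℝ, EM); F, E⟯) {W : κ → ℝ → ℝ} {W' : κ → ℝ}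
    (hW : ∀ j, HasDerivAt (W j) (W' j) t) {u : (r : ℝ) → E (γ r)}
    (hu : ∀ᶠ r in 𝓝 t, u r = ∑ j, W j r • s j (γ r)) :
    ∃ z' : ι → ℝ, (∀ k, HasDerivAt (fun r => P.coord k (γ r) (u r)) (z' k) t) ∧
      ∑ k, (z' k • P.sec k (γ t) + P.coord k (γ t) (u t) • K (P.sec k)) =
        ∑ j, (W' j • s j (γ t) + W j t • K (s j)) := by
  refine ⟨fun k => ∑ j, (W' j * P.coeff k (s j) (γ t) + W j t * dirDeriv (P.coeff k (s j)) w),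
    fun k => ?_, ?_⟩
  · have h1 : HasDerivAt (fun r => ∑ j, W j r * P.coeff k (s j) (γ r))
        (∑ j, (W' j * P.coeff k (s j) (γ t) + W j t * dirDeriv (P.coeff k (s j)) w)) t :=
      HasDerivAt.fun_sum fun j _ => (hW j).mul (hγ.hasDerivAt_dirDeriv (P.coeff k (s j)))
    refine h1.congr_of_eventuallyEq ?_
    filter_upwards [hu] with r hr
    rw [hr, _root_.map_sum]
    simp
  · have h2 : ∀ j, K (s j) = _ := fun j => hK.eq_sum P hx (s j)
    have h3 : ∀ j, s j (γ t) = ∑ k, P.coeff k (s j) (γ t) • P.sec k (γ t) := fun j =>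
      (P.sum_coord_smul hx (s j (γ t))).symm
    have h4 : ∀ k, P.coord k (γ t) (u t) = ∑ j, W j t * P.coeff k (s j) (γ t) := fun k => by
      rw [hu.self_of_nhds, _root_.map_sum]
      simp
    have h5 : ∀ j, W' j • s j (γ t) + W j t • K (s j) = ∑ k, ((W' j * P.coeff k (s j) (γ t)) •
        P.sec k (γ t) + ((W j t * P.coeff k (s j) (γ t)) • K (P.sec k) +
          (W j t * dirDeriv (P.coeff k (s j)) w) • P.sec k (γ t))) := fun j => by
      rw [h2 j]
      conv_lhs => rw [h3 j]
      rw [Finset.smul_sum, Finset.smul_sum, ← Finset.sum_add_distrib]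
      simp only [smul_add, smul_smul]
    simp_rw [h5, h4]
    rw [Finset.sum_comm]
    refine Finset.sum_congr rfl fun k _ => ?_
    rw [Finset.sum_smul, Finset.sum_smul, ← Finset.sum_add_distrib]
    refine Finset.sum_congr rfl fun j _ => ?_
    rw [add_smul]
    abel

/-- The coordinates of a time dependent section along a curve determine the covariant
derivative. -/
lemma IsDerivationAt.timeDep_eq {γ : ℝ → M} {t : ℝ} {w : TangentSpace 𝓘(ℝ, EM) (γ t)}
    (hγ : HasVelocityAt γ t w) {K : Cₛ^∞⟮𝓘(ℝ, EM); F, E⟯ → E (γ t)} (hK : IsDerivationAt w K)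
    (P : PartialFrame EM F E ι) (hx : γ t ∈ P.domain) {ξ : ℝ → Cₛ^∞⟮𝓘(ℝ, EM); F, E⟯} {S : Set ℝ}
    (hS : S ∈ 𝓝 t) (hξ : IsSmoothTimeDepSection ξ S) :
    ∃ z' : ι → ℝ, (∀ k, HasDerivAt (fun r => P.coord k (γ r) (ξ r (γ r))) (z' k) t) ∧
      HasDerivAt (fun r => ξ r (γ t)) (deriv (fun r => ξ r (γ t)) t) t ∧
      K (ξ t) + deriv (fun r => ξ r (γ t)) t =
        ∑ k, (z' k • P.sec k (γ t) + P.coord k (γ t) (ξ t (γ t)) • K (P.sec k)) := by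
  have h1 : ∀ k, MDifferentiableAt (𝓘(ℝ, ℝ).prod 𝓘(ℝ, EM)) 𝓘(ℝ, ℝ)
      (fun p : ℝ × M => P.coord k p.2 (ξ p.1 p.2)) (t, γ t) := fun k =>
    (((P.contMDiff_coord k).contMDiffAt.comp (t, γ t) ((hξ (t, γ t)
      ⟨mem_of_mem_nhds hS, mem_univ _⟩).contMDiffAt (prod_mem_nhds hS univ_mem)))).mdifferentiableAt
        (by simp)
  choose a ha1 ha2 using fun k => hγ.hasDerivAt_comp_prod (h1 k)
  have hd : HasDerivAt (fun r => ξ r (γ t)) (∑ k, a k • P.sec k (γ t)) t := by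
    have h2 := hasDerivAt_sum_smul_of_equiv (fiberEquiv F E (γ t)) (s := Finset.univ)
      (fun k _ => ha1 k) (fun k => P.sec k (γ t))
    simp only [P.sum_coord_smul hx] at h2
    exact h2
  have hd' := hasDerivAt_deriv_eq_of_equiv (fiberEquiv F E (γ t)) hd
  refine ⟨_, ha2, ?_, ?_⟩
  · rw [hd']
    exact hd
  · rw [hd', hK.eq_sum P hx, ← Finset.sum_add_distrib]
    refine Finset.sum_congr rfl fun k _ => ?_
    have h3 : mvfderiv 𝓘(ℝ, EM) (fun y => P.coord k y (ξ t y)) (γ t) w =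
      dirDeriv (P.coeff k (ξ t)) w := rfl
    rw [h3, add_smul, P.coeff_apply]
    abel

lemma HasCovDerivAlong.eq_sum {γ : ℝ → M} {t : ℝ} {w : TangentSpace 𝓘(ℝ, EM) (γ t)}
    (hγ : HasVelocityAt γ t w) {K : Cₛ^∞⟮𝓘(ℝ, EM); F, E⟯ → E (γ t)} (hK : IsDerivationAt w K)
    (P : PartialFrame EM F E ι) (hx : γ t ∈ P.domain) {u : (r : ℝ) → E (γ r)} {y : E (γ t)}
    (h : HasCovDerivAlong γ u t (γ t) K y) :
    ∃ z' : ι → ℝ, (∀ k, HasDerivAt (fun r => P.coord k (γ r) (u r)) (z' k) t) ∧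
      y = ∑ k, (z' k • P.sec k (γ t) + P.coord k (γ t) (u t) • K (P.sec k)) := by
  obtain ⟨ξ, δ, hδ, hξ, hu, rfl⟩ := h
  have hS : Ioo (t - δ) (t + δ) ∈ 𝓝 t := Ioo_mem_nhds (by linarith) (by linarith)
  obtain ⟨z', hz, -, he⟩ := hK.timeDep_eq hγ P hx hS hξ
  refine ⟨z', fun k => (hz k).congr_of_eventuallyEq ?_, ?_⟩
  · filter_upwards [hS] with r hr
    rw [hu r hr]
  · rw [he, hu t (mem_of_mem_nhds hS)]

end CovDeriv

section Extension

variable {EM : Type*} [NormedAddCommGroup EM] [NormedSpace ℝ EM]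
  {M : Type*} [TopologicalSpace M] [ChartedSpace EM M] [IsManifold 𝓘(ℝ, EM) ∞ M]
  {F : Type*} [NormedAddCommGroup F] [NormedSpace ℝ F]
  {E : M → Type*} [TopologicalSpace (TotalSpace F E)]
  [∀ x, AddCommGroup (E x)] [∀ x, Module ℝ (E x)] [∀ x, TopologicalSpace (E x)]
  [∀ x, IsTopologicalAddGroup (E x)] [∀ x, ContinuousSMul ℝ (E x)]
  [FiberBundle F E] [VectorBundle ℝ F E]
  {EN : Type*} [NormedAddCommGroup EN] [NormedSpace ℝ EN] {HN : Type*} [TopologicalSpace HN]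
  {I : ModelWithCorners ℝ EN HN} {N : Type*} [TopologicalSpace N] [ChartedSpace HN N]
  {κ : Type*} [Fintype κ]

/-- Combinations of smooth sections along a smooth map, with smooth coefficients, are smooth. -/
lemma contMDiffWithinAt_sum_smul [ContMDiffVectorBundle ∞ F E 𝓘(ℝ, EM)] {f : N → M}
    {c : κ → N → ℝ} {S : Set N} {p : N} (hf : ContMDiffWithinAt I 𝓘(ℝ, EM) ∞ f S p)
    (hc : ∀ k, ContMDiffWithinAt I 𝓘(ℝ, ℝ) ∞ (c k) S p) (s : κ → Cₛ^∞⟮𝓘(ℝ, EM); F, E⟯) :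
    ContMDiffWithinAt I (𝓘(ℝ, EM).prod 𝓘(ℝ, F)) ∞
      (fun q => (⟨f q, ∑ k, c k q • s k (f q)⟩ : TotalSpace F E)) S p := by
  rw [contMDiffWithinAt_totalSpace]
  refine ⟨hf, ?_⟩
  set e := trivializationAt F E (f p)
  have h1 : ∀ k, ContMDiffWithinAt I 𝓘(ℝ, F) ∞ (fun q => (e ⟨f q, s k (f q)⟩).2) S p := fun k =>
    (contMDiffWithinAt_totalSpace.1
      ((contMDiff_section_coe (s k)).contMDiffAt.comp_contMDiffWithinAt p hf)).2
  have h2 : ContMDiffWithinAt I 𝓘(ℝ, F) ∞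
      (fun q => ∑ k, c k q • (e ⟨f q, s k (f q)⟩).2) S p :=
    contMDiffWithinAt_finsetSum fun k _ => (hc k).smul (h1 k)
  have hbase : f p ∈ e.baseSet := FiberBundle.mem_baseSet_trivializationAt' (f p)
  have h3 : ∀ q, f q ∈ e.baseSet → (e ⟨f q, ∑ k, c k q • s k (f q)⟩).2 =
      ∑ k, c k q • (e ⟨f q, s k (f q)⟩).2 := fun q hq => by
    have h4 : ∀ v : E (f q), (e ⟨f q, v⟩).2 = e.linearMapAt ℝ (f q) v := fun v => by
      rw [e.coe_linearMapAt_of_mem hq]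
    simp only [h4, map_sum, map_smul]
  refine h2.congr_of_eventuallyEq ?_ (h3 p hbase)
  filter_upwards [hf.continuousWithinAt.preimage_mem_nhdsWithin (e.open_baseSet.mem_nhds hbase)]
    with q hq using h3 q hq

lemma contMDiffOn_sum_smul [ContMDiffVectorBundle ∞ F E 𝓘(ℝ, EM)] {f : N → M}
    {c : κ → N → ℝ} {S : Set N} (hf : ContMDiffOn I 𝓘(ℝ, EM) ∞ f S)
    (hc : ∀ k, ContMDiffOn I 𝓘(ℝ, ℝ) ∞ (c k) S) (s : κ → Cₛ^∞⟮𝓘(ℝ, EM); F, E⟯) :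
    ContMDiffOn I (𝓘(ℝ, EM).prod 𝓘(ℝ, F)) ∞
      (fun q => (⟨f q, ∑ k, c k q • s k (f q)⟩ : TotalSpace F E)) S :=
  fun p hp => contMDiffWithinAt_sum_smul (hf p hp) (fun k => hc k p hp) s

lemma hasCovDerivAlong_sum_smul [FiniteDimensional ℝ F] [ContMDiffVectorBundle ∞ F E 𝓘(ℝ, EM)]
    {γ : ℝ → M} {t δ : ℝ} (hδ : 0 < δ) {w : TangentSpace 𝓘(ℝ, EM) (γ t)}
    {K : Cₛ^∞⟮𝓘(ℝ, EM); F, E⟯ → E (γ t)} (hK : IsDerivationAt w K)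
    (s : κ → Cₛ^∞⟮𝓘(ℝ, EM); F, E⟯) {c : κ → ℝ → ℝ}
    (hc : ∀ k, ContDiffOn ℝ ∞ (c k) (Ioo (t - δ) (t + δ))) {u : (r : ℝ) → E (γ r)}
    (hu : ∀ r ∈ Ioo (t - δ) (t + δ), u r = ∑ k, c k r • s k (γ r)) :
    HasCovDerivAlong γ u t (γ t) K
      (∑ k, (deriv (c k) t • s k (γ t) + c k t • K (s k))) := by
  refine ⟨fun r => ∑ k, c k r • s k, δ, hδ, ?_, fun r hr => ?_, ?_⟩
  · have h1 := contMDiffOn_sum_smul (I := 𝓘(ℝ, ℝ).prod 𝓘(ℝ, EM)) (N := ℝ × M)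
      (f := fun p : ℝ × M => p.2) (c := fun k p => c k p.1) (S := Ioo (t - δ) (t + δ) ×ˢ univ)
      contMDiff_snd.contMDiffOn (fun k => (hc k).contMDiffOn.comp contMDiff_fst.contMDiffOn
        fun p hp => hp.1) s
    refine h1.congr fun p _ => ?_
    rw [section_sum_smul_apply]
  · rw [section_sum_smul_apply, hu r hr]
  · have h2 : HasDerivAt (fun r => ∑ k, c k r • s k (γ t)) (∑ k, deriv (c k) t • s k (γ t)) t :=
      hasDerivAt_sum_smul_of_equiv (fiberEquiv F E (γ t)) (fun k _ =>
        (((hc k).contDiffAt (Ioo_mem_nhds (by linarith) (by linarith))).differentiableAt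
          (by simp)).hasDerivAt) _
    simp only [section_sum_smul_apply]
    rw [hasDerivAt_deriv_eq_of_equiv (fiberEquiv F E (γ t)) h2, hK.map_sum_smul,
      Finset.sum_add_distrib, add_comm]

end Extension

/-! ### Lie brackets of vector fields as commutators -/

section Commutator

variable {EM : Type*} [NormedAddCommGroup EM] [NormedSpace ℝ EM]
  {M : Type*} [TopologicalSpace M] [ChartedSpace EM M] [IsManifold 𝓘(ℝ, EM) ∞ M]
  {F : Type*} [NormedAddCommGroup F] [NormedSpace ℝ F]
  {E : M → Type*} [TopologicalSpace (TotalSpace F E)]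
  [∀ x, AddCommGroup (E x)] [∀ x, Module ℝ (E x)] [∀ x, TopologicalSpace (E x)]
  [∀ x, IsTopologicalAddGroup (E x)] [∀ x, ContinuousSMul ℝ (E x)]
  [FiberBundle F E] [VectorBundle ℝ F E]
  [FiniteDimensional ℝ EM] [T2Space M] [SigmaCompactSpace M]

open VectorField in
/-- The Lie bracket of smooth vector fields acts on functions as the commutator. The proof compares
the coefficients of a vector field `U` in the Jacobi identity for `V`, `W` and `f U`. -/
lemma mvfderiv_mlieBracket {V W : (x : M) → TangentSpace 𝓘(ℝ, EM) x}
    (hV : ContMDiff 𝓘(ℝ, EM) 𝓘(ℝ, EM).tangent ∞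
      (fun x => (⟨x, V x⟩ : TangentBundle 𝓘(ℝ, EM) M)))
    (hW : ContMDiff 𝓘(ℝ, EM) 𝓘(ℝ, EM).tangent ∞
      (fun x => (⟨x, W x⟩ : TangentBundle 𝓘(ℝ, EM) M)))
    {f : M → ℝ} (hf : ContMDiff 𝓘(ℝ, EM) 𝓘(ℝ, ℝ) ∞ f) (x : M) :
    mvfderiv 𝓘(ℝ, EM) f x (mlieBracket 𝓘(ℝ, EM) V W x) =
      mvfderiv 𝓘(ℝ, EM) (fun y => mvfderiv 𝓘(ℝ, EM) f y (W y)) x (V x) -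
        mvfderiv 𝓘(ℝ, EM) (fun y => mvfderiv 𝓘(ℝ, EM) f y (V y)) x (W x) := by
  have : CompleteSpace EM := FiniteDimensional.complete ℝ EM
  rcases subsingleton_or_nontrivial EM with hE | hE
  · have h0 : ∀ (g : M → ℝ) (v : TangentSpace 𝓘(ℝ, EM) x), mvfderiv 𝓘(ℝ, EM) g x v = 0 := by
      intro g v
      have : v = 0 := Subsingleton.elim (α := EM) _ _
      rw [this, map_zero]
    rw [h0, h0, h0, sub_zero]
  obtain ⟨u, hu⟩ := exists_ne (0 : EM)
  obtain ⟨σ, hσ⟩ := exists_section_apply_eq (EM := EM) (F := EM)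
    (E := (TangentSpace 𝓘(ℝ, EM) : M → Type _)) (x := x) u
  set U : (x : M) → TangentSpace 𝓘(ℝ, EM) x := fun x => σ x with hUdef
  have hU : ContMDiff 𝓘(ℝ, EM) 𝓘(ℝ, EM).tangent ∞
      (fun x => (⟨x, U x⟩ : TangentBundle 𝓘(ℝ, EM) M)) := contMDiff_section_coe σ
  have i3 : IsManifold 𝓘(ℝ, EM) (minSmoothness ℝ 3) M := by
    rw [minSmoothness_of_isRCLikeNormedField]
    exact IsManifold.of_le (n := ∞) (WithTop.coe_le_coe.2 le_top : ((3 : ℕ∞) : WithTop ℕ∞) ≤ ∞)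
  have i2 : IsManifold 𝓘(ℝ, EM) (((⊤ : ℕ∞) : WithTop ℕ∞) + 1) M := by
    have : (((⊤ : ℕ∞) : WithTop ℕ∞) + 1) = ∞ := rfl
    rw [this]
    infer_instance
  have hbr : ∀ {X Y : (x : M) → TangentSpace 𝓘(ℝ, EM) x},
      ContMDiff 𝓘(ℝ, EM) 𝓘(ℝ, EM).tangent ∞ (fun x => (⟨x, X x⟩ : TangentBundle 𝓘(ℝ, EM) M)) →
      ContMDiff 𝓘(ℝ, EM) 𝓘(ℝ, EM).tangent ∞ (fun x => (⟨x, Y x⟩ : TangentBundle 𝓘(ℝ, EM) M)) →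
      ContMDiff 𝓘(ℝ, EM) 𝓘(ℝ, EM).tangent ∞
        (fun x => (⟨x, mlieBracket 𝓘(ℝ, EM) X Y x⟩ : TangentBundle 𝓘(ℝ, EM) M)) :=
    fun hX hY => ContDiff.mlieBracket_vectorField (m := ⊤) (n := ⊤) hX hY (by
      rw [minSmoothness_of_isRCLikeNormedField]; rfl)
  have hsm : ∀ {g : M → ℝ} {X : (x : M) → TangentSpace 𝓘(ℝ, EM) x},
      ContMDiff 𝓘(ℝ, EM) 𝓘(ℝ, ℝ) ∞ g →
      ContMDiff 𝓘(ℝ, EM) 𝓘(ℝ, EM).tangent ∞ (fun x => (⟨x, X x⟩ : TangentBundle 𝓘(ℝ, EM) M)) →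
      ContMDiff 𝓘(ℝ, EM) 𝓘(ℝ, EM).tangent ∞
        (fun x => (⟨x, (g • X) x⟩ : TangentBundle 𝓘(ℝ, EM) M)) :=
    fun hg hX => ContMDiff.smul_section hg hX
  have md : ∀ {X : (x : M) → TangentSpace 𝓘(ℝ, EM) x},
      ContMDiff 𝓘(ℝ, EM) 𝓘(ℝ, EM).tangent ∞ (fun x => (⟨x, X x⟩ : TangentBundle 𝓘(ℝ, EM) M)) →
      ∀ y, MDifferentiableAt 𝓘(ℝ, EM) 𝓘(ℝ, EM).tangent
        (fun x => (⟨x, X x⟩ : TangentBundle 𝓘(ℝ, EM) M)) y := fun hX y =>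
    (hX y).mdifferentiableAt (by simp)
  have mg : ∀ {g : M → ℝ}, ContMDiff 𝓘(ℝ, EM) 𝓘(ℝ, ℝ) ∞ g → ∀ y,
      MDifferentiableAt 𝓘(ℝ, EM) 𝓘(ℝ, ℝ) g y := fun hg y => (hg y).mdifferentiableAt (by simp)
  set df : ((x : M) → TangentSpace 𝓘(ℝ, EM) x) → M → ℝ :=
    fun X y => mvfderiv 𝓘(ℝ, EM) f y (X y) with hdf
  have hdfV := contMDiff_mvfderiv_apply hf hV
  have hdfW := contMDiff_mvfderiv_apply hf hW
  have e1 : ∀ X : (x : M) → TangentSpace 𝓘(ℝ, EM) x,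
      mlieBracket 𝓘(ℝ, EM) X (f • U) = df X • U + f • mlieBracket 𝓘(ℝ, EM) X U := fun X => by
    ext1 y
    exact mlieBracket_smul_right (mg hf y) (md hU y)
  have e2 : ∀ {X Y : (x : M) → TangentSpace 𝓘(ℝ, EM) x} (hX : ContMDiff 𝓘(ℝ, EM) 𝓘(ℝ, EM).tangent ∞
        (fun x => (⟨x, X x⟩ : TangentBundle 𝓘(ℝ, EM) M)))
      (hY : ContMDiff 𝓘(ℝ, EM) 𝓘(ℝ, EM).tangent ∞
        (fun x => (⟨x, Y x⟩ : TangentBundle 𝓘(ℝ, EM) M))),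
      mlieBracket 𝓘(ℝ, EM) X (mlieBracket 𝓘(ℝ, EM) Y (f • U)) x =
        (mvfderiv 𝓘(ℝ, EM) (df Y) x (X x) • U x + df Y x • mlieBracket 𝓘(ℝ, EM) X U x) +
        (df X x • mlieBracket 𝓘(ℝ, EM) Y U x +
          f x • mlieBracket 𝓘(ℝ, EM) X (mlieBracket 𝓘(ℝ, EM) Y U) x) := by
    intro X Y hX hY
    rw [e1 Y, mlieBracket_add_right (md (hsm (contMDiff_mvfderiv_apply hf hY) hU) x)
      (md (hsm hf (hbr hY hU)) x), mlieBracket_smul_right (mg (contMDiff_mvfderiv_apply hf hY) x)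
      (md hU x), mlieBracket_smul_right (mg hf x) (md (hbr hY hU) x)]
  have s2 : ∀ {X : (x : M) → TangentSpace 𝓘(ℝ, EM) x},
      ContMDiff 𝓘(ℝ, EM) 𝓘(ℝ, EM).tangent ∞ (fun x => (⟨x, X x⟩ : TangentBundle 𝓘(ℝ, EM) M)) →
      ContMDiffAt 𝓘(ℝ, EM) 𝓘(ℝ, EM).tangent (minSmoothness ℝ 2)
        (fun x => (⟨x, X x⟩ : TangentBundle 𝓘(ℝ, EM) M)) x := fun hX => by
    rw [minSmoothness_of_isRCLikeNormedField]
    exact (hX x).of_le (WithTop.coe_le_coe.2 le_top : ((2 : ℕ∞) : WithTop ℕ∞) ≤ ∞)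
  have j1 := leibniz_identity_mlieBracket_apply (s2 hV) (s2 hW) (s2 (hsm hf hU))
  have j2 := leibniz_identity_mlieBracket_apply (s2 hV) (s2 hW) (s2 hU)
  rw [e2 hV hW, e2 hW hV, e1, j2] at j1
  have j3 : mvfderiv 𝓘(ℝ, EM) (df W) x (V x) • U x =
      df (mlieBracket 𝓘(ℝ, EM) V W) x • U x + mvfderiv 𝓘(ℝ, EM) (df V) x (W x) • U x := by
    simp only [Pi.add_apply, Pi.smul_apply', smul_add] at j1
    rw [← sub_eq_zero] at j1 ⊢
    rw [← j1]
    abel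
  have hUx : U x ≠ 0 := fun h => hu (hσ.symm.trans h)
  have j4 : (df (mlieBracket 𝓘(ℝ, EM) V W) x - (mvfderiv 𝓘(ℝ, EM) (df W) x (V x) -
      mvfderiv 𝓘(ℝ, EM) (df V) x (W x))) • U x = 0 := by
    rw [sub_smul, sub_smul, j3]
    abel
  rcases smul_eq_zero.1 j4 with h | h
  · exact sub_eq_zero.1 h
  · exact absurd h hUx

variable (L : PreLieAlgebroid EM F E)

lemma PreLieAlgebroid.contMDiff_anchor_section (α : Cₛ^∞⟮𝓘(ℝ, EM); F, E⟯) :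
    ContMDiff 𝓘(ℝ, EM) 𝓘(ℝ, EM).tangent ∞
      (fun x => (⟨x, L.anchor x (α x)⟩ : TangentBundle 𝓘(ℝ, EM) M)) :=
  L.contMDiff_anchor.comp (contMDiff_section_coe α)

/-- The derivative of a function along the vector field `ρ(α)`. -/
noncomputable def PreLieAlgebroid.anchorDeriv (α : Cₛ^∞⟮𝓘(ℝ, EM); F, E⟯)
    (f : C^∞⟮𝓘(ℝ, EM), M; ℝ⟯) : C^∞⟮𝓘(ℝ, EM), M; ℝ⟯ :=
  ⟨fun x => dirDeriv f (L.anchor x (α x)),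
    contMDiff_mvfderiv_apply f.contMDiff (L.contMDiff_anchor_section α)⟩

@[simp] lemma PreLieAlgebroid.anchorDeriv_apply (α : Cₛ^∞⟮𝓘(ℝ, EM); F, E⟯)
    (f : C^∞⟮𝓘(ℝ, EM), M; ℝ⟯) (x : M) :
    L.anchorDeriv α f x = dirDeriv f (L.anchor x (α x)) := rfl

lemma PreLieAlgebroid.dirDeriv_anchor_bracket (α β : Cₛ^∞⟮𝓘(ℝ, EM); F, E⟯)
    (f : C^∞⟮𝓘(ℝ, EM), M; ℝ⟯) (x : M) :
    dirDeriv f (L.anchor x (L.bracket α β x)) =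
      dirDeriv (L.anchorDeriv β f) (L.anchor x (α x)) -
        dirDeriv (L.anchorDeriv α f) (L.anchor x (β x)) := by
  rw [L.anchor_bracket]
  exact mvfderiv_mlieBracket (L.contMDiff_anchor_section α) (L.contMDiff_anchor_section β)
    f.contMDiff x

end Commutator

/-! ### The geodesic equation in a partial frame -/

section GeodesicEquation

variable {EM : Type*} [NormedAddCommGroup EM] [NormedSpace ℝ EM]
  {M : Type*} [TopologicalSpace M] [ChartedSpace EM M] [IsManifold 𝓘(ℝ, EM) ∞ M]
  {F : Type*} [NormedAddCommGroup F] [NormedSpace ℝ F]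
  {E : M → Type*} [TopologicalSpace (TotalSpace F E)]
  [∀ x, AddCommGroup (E x)] [∀ x, Module ℝ (E x)] [∀ x, TopologicalSpace (E x)]
  [∀ x, IsTopologicalAddGroup (E x)] [∀ x, ContinuousSMul ℝ (E x)]
  [FiberBundle F E] [VectorBundle ℝ F E]
  [FiniteDimensional ℝ EM] [T2Space M] [SigmaCompactSpace M]

variable (EM) in
/-- A chart, cut off to a smooth map on the whole manifold. -/
lemma exists_global_chart (x₀ : M) : ∃ (Y : M → EM) (Ω : Set M), ContMDiff 𝓘(ℝ, EM) 𝓘(ℝ, EM) ∞ Y ∧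
    IsOpen Ω ∧ x₀ ∈ Ω ∧ Ω ⊆ (chartAt EM x₀).source ∧
      ∀ x ∈ Ω, Y x = extChartAt 𝓘(ℝ, EM) x₀ x := by
  obtain ⟨χ, h1, h2⟩ := exists_bump (EM := EM) (chartAt EM x₀).open_source (mem_chart_source EM x₀)
  refine ⟨fun x => χ x • extChartAt 𝓘(ℝ, EM) x₀ x, interior {x | χ x = 1}, ?_, isOpen_interior,
    mem_interior_iff_mem_nhds.2 h1, fun x hx => ?_, fun x hx => ?_⟩
  · intro x
    by_cases hx : x ∈ (chartAt EM x₀).source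
    · exact (χ.contMDiff x).smul (contMDiffAt_extChartAt' hx)
    · refine (contMDiffAt_const (c := (0 : EM))).congr_of_eventuallyEq ?_
      filter_upwards [(isClosed_tsupport χ).isOpen_compl.mem_nhds fun h => hx (h2 h)] with y hy
      rw [image_eq_zero_of_notMem_tsupport hy, zero_smul]
  · refine h2 (subset_tsupport _ ?_)
    have : χ x = 1 := interior_subset (s := {x | χ x = 1}) hx
    rw [Function.mem_support, this]
    exact one_ne_zero
  · have : χ x = 1 := interior_subset (s := {x | χ x = 1}) hx
    change χ x • _ = _
    rw [this, one_smul]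

lemma injective_mvfderiv_of_eventuallyEq_chart {x₀ x : M} (hx : x ∈ (chartAt EM x₀).source)
    {Y : M → EM} (hY : ∀ᶠ y in 𝓝 x, Y y = extChartAt 𝓘(ℝ, EM) x₀ y) :
    Function.Injective (mvfderiv 𝓘(ℝ, EM) Y x) := by
  have h1 : mfderiv 𝓘(ℝ, EM) 𝓘(ℝ, EM) Y x =
      mfderiv 𝓘(ℝ, EM) 𝓘(ℝ, EM) (extChartAt 𝓘(ℝ, EM) x₀) x := Filter.EventuallyEq.mfderiv_eq hY
  have h2 := (isInvertible_mfderiv_extChartAt (I := 𝓘(ℝ, EM)) (x := x₀) (y := x)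
    (by rwa [extChartAt_source])).injective
  intro v w hvw
  apply h2
  rw [← h1]
  exact hvw

/-- Tangent vectors are determined by their action on smooth functions. -/
lemma tangent_ext {x : M} {v w : TangentSpace 𝓘(ℝ, EM) x}
    (h : ∀ f : C^∞⟮𝓘(ℝ, EM), M; ℝ⟯, dirDeriv f v = dirDeriv f w) : v = w := by
  obtain ⟨Y, Ω, hY, hΩ, hx, hs, hc⟩ := exists_global_chart EM x
  apply injective_mvfderiv_of_eventuallyEq_chart (hs hx)
    (by filter_upwards [hΩ.mem_nhds hx] with y hy using hc y hy)
  let b := Module.finBasis ℝ EM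
  refine b.ext_elem fun i => ?_
  let l : EM →L[ℝ] ℝ := LinearMap.toContinuousLinearMap (b.coord i)
  have h1 : ∀ u : TangentSpace 𝓘(ℝ, EM) x,
      mvfderiv 𝓘(ℝ, EM) (fun y => l (Y y)) x u = l (mvfderiv 𝓘(ℝ, EM) Y x u) := by
    intro u
    have h2 : HasMFDerivAt 𝓘(ℝ, EM) 𝓘(ℝ, ℝ) (fun y => l (Y y)) x
        (l.comp (mfderiv 𝓘(ℝ, EM) 𝓘(ℝ, EM) Y x : EM →L[ℝ] EM)) :=
      HasMFDerivAt.comp x l.hasFDerivAt.hasMFDerivAt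
        ((hY x).mdifferentiableAt (by simp)).hasMFDerivAt
    exact congrArg (fun A : EM →L[ℝ] ℝ => A u) h2.mfderiv
  have h3 := h ⟨fun y => l (Y y), l.contDiff.contMDiff.comp hY⟩
  exact (h1 v).symm.trans (h3.trans (h1 w))

variable [FiniteDimensional ℝ F] [ContMDiffVectorBundle ∞ F E 𝓘(ℝ, EM)] {ι : Type} [Fintype ι]

section Smoothness

variable {EN : Type*} [NormedAddCommGroup EN] [NormedSpace ℝ EN] {HN : Type*} [TopologicalSpace HN]
  {I : ModelWithCorners ℝ EN HN} {N : Type*} [TopologicalSpace N] [ChartedSpace HN N]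

/-- Smoothness of a map into the total space can be tested in a partial frame. -/
lemma PartialFrame.contMDiffWithinAt_of_coord (P : PartialFrame EM F E ι) {G : N → TotalSpace F E}
    {S : Set N} {p : N} (hp : (G p).1 ∈ P.domain)
    (hb : ContMDiffWithinAt I 𝓘(ℝ, EM) ∞ (fun q => (G q).1) S p)
    (hc : ∀ k, ContMDiffWithinAt I 𝓘(ℝ, ℝ) ∞ (fun q => P.coord k (G q).1 (G q).2) S p) :
    ContMDiffWithinAt I (𝓘(ℝ, EM).prod 𝓘(ℝ, F)) ∞ G S p := by
  have h : ∀ q, (G q).1 ∈ P.domain →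
      G q = ⟨(G q).1, ∑ k, P.coord k (G q).1 (G q).2 • P.sec k (G q).1⟩ := fun q hq => by
    rw [P.sum_coord_smul hq]
  refine (contMDiffWithinAt_sum_smul hb hc P.sec).congr_of_eventuallyEq ?_ (h p hp)
  filter_upwards [hb.continuousWithinAt.preimage_mem_nhdsWithin (P.isOpen_domain.mem_nhds hp)]
    with q hq using h q hq

lemma contMDiff_smul_add {c d : N → ℝ} {S : Set N} {f : N → M} {v w : (p : N) → E (f p)}
    (hc : ContMDiffOn I 𝓘(ℝ, ℝ) ∞ c S) (hd : ContMDiffOn I 𝓘(ℝ, ℝ) ∞ d S)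
    (hv : ContMDiffOn I (𝓘(ℝ, EM).prod 𝓘(ℝ, F)) ∞ (fun p => (⟨f p, v p⟩ : TotalSpace F E)) S)
    (hw : ContMDiffOn I (𝓘(ℝ, EM).prod 𝓘(ℝ, F)) ∞ (fun p => (⟨f p, w p⟩ : TotalSpace F E)) S) :
    ContMDiffOn I (𝓘(ℝ, EM).prod 𝓘(ℝ, F)) ∞
      (fun p => (⟨f p, c p • v p + d p • w p⟩ : TotalSpace F E)) S := by
  intro p hp
  obtain ⟨P, hP, -⟩ := exists_partialFrame_isFree EM F E (f p)
  have hf : ContMDiffWithinAt I 𝓘(ℝ, EM) ∞ f S p :=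
    (contMDiff_proj E).contMDiffAt.comp_contMDiffWithinAt p (hv p hp)
  refine P.contMDiffWithinAt_of_coord hP hf fun k => ?_
  have h1 := (P.contMDiff_coord k).contMDiffAt.comp_contMDiffWithinAt p (hv p hp)
  have h2 := (P.contMDiff_coord k).contMDiffAt.comp_contMDiffWithinAt p (hw p hp)
  refine (((hc p hp).mul h1).add ((hd p hp).mul h2)).congr (fun q _ => ?_) ?_ <;>
  · rw [map_add, map_smul, map_smul]
    rfl

end Smoothness

variable {L : PreLieAlgebroid EM F E} (C : AConnection L)

lemma AConnection.toFun_eq_sum (P : PartialFrame EM F E ι) {x : M} (hx : x ∈ P.domain)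
    (α σ : Cₛ^∞⟮𝓘(ℝ, EM); F, E⟯) :
    C.toFun α σ x = ∑ i, P.coord i x (α x) • C.toFun (P.sec i) σ x :=
  (C.isDerivationAt_left σ x).eq_sum_of_symbol_eq_zero P hx α

lemma PreLieAlgebroid.anchor_eq_sum (L : PreLieAlgebroid EM F E) (P : PartialFrame EM F E ι) {x : M}
    (hx : x ∈ P.domain) (v : E x) :
    L.anchor x v = ∑ i, P.coord i x v • L.anchor x (P.sec i x) := by
  conv_lhs => rw [← P.sum_coord_smul hx v]
  simp only [map_sum, map_smul]

/-- The quadratic term of the geodesic equation in a partial frame. -/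
noncomputable def AConnection.quadraticTerm (P : PartialFrame EM F E ι) (a : TotalSpace F E) :
    E a.1 :=
  ∑ j, P.coord j a.1 a.2 • ∑ i, P.coord i a.1 a.2 • C.toFun (P.sec i) (P.sec j) a.1

lemma IsAPathOn.hasVelocityAt {g : ℝ → TotalSpace F E} {J : Set ℝ} (hg : IsAPathOn L g J) {t : ℝ}
    (ht : t ∈ J) : HasVelocityAt (fun r => (g r).1) t (L.anchor (g t).1 (g t).2) := hg.2 t ht

lemma IsAPathOn.contDiffOn_coord {g : ℝ → TotalSpace F E} {J : Set ℝ} (hg : IsAPathOn L g J)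
    (P : PartialFrame EM F E ι) (k : ι) :
    ContDiffOn ℝ ∞ (fun r => P.coord k (g r).1 (g r).2) J :=
  ((P.contMDiff_coord k).comp_contMDiffOn hg.1).contDiffOn

/-- The geodesic equation in a partial frame. -/
lemma AConnection.hasCovDerivAt_zero_iff {g : ℝ → TotalSpace F E} {J : Set ℝ} (hJ : IsOpen J)
    (hg : IsAPathOn L g J) {t : ℝ} (ht : t ∈ J) (P : PartialFrame EM F E ι)
    (hP : (g t).1 ∈ P.domain) :
    C.HasCovDerivAt g (fun r => (g r).2) t 0 ↔
      ∑ k, deriv (fun r => P.coord k (g r).1 (g r).2) t • P.sec k (g t).1 +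
        C.quadraticTerm P (g t) = 0 := by
  have key : ∀ α : Cₛ^∞⟮𝓘(ℝ, EM); F, E⟯, α (g t).1 = (g t).2 →
      ∑ k, (deriv (fun r => P.coord k (g r).1 (g r).2) t • P.sec k (g t).1 +
        P.coord k (g t).1 (g t).2 • C.toFun α (P.sec k) (g t).1) =
      ∑ k, deriv (fun r => P.coord k (g r).1 (g r).2) t • P.sec k (g t).1 +
        C.quadraticTerm P (g t) := fun α hα => by
    rw [Finset.sum_add_distrib, AConnection.quadraticTerm]
    simp only [C.toFun_eq_sum P hP α, hα]
  have hK : ∀ α : Cₛ^∞⟮𝓘(ℝ, EM); F, E⟯, α (g t).1 = (g t).2 →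
      IsDerivationAt (L.anchor (g t).1 (g t).2) (fun σ => C.toFun α σ (g t).1) := fun α hα => by
    rw [← hα]
    exact C.isDerivationAt α (g t).1
  constructor
  · rintro ⟨α, hα, h⟩
    obtain ⟨z', hz, he⟩ := h.eq_sum (hg.hasVelocityAt ht) (hK α hα) P hP
    rw [← key α hα, he]
    exact Finset.sum_congr rfl fun k _ => by rw [(hz k).deriv]
  · intro h
    obtain ⟨α, hα⟩ := P.exists_section hP (g t).2
    refine ⟨α, hα, ?_⟩
    have hU : {r | r ∈ J ∧ (g r).1 ∈ P.domain} ∈ 𝓝 t := by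
      have h1 := (hg.hasVelocityAt ht).continuousAt.preimage_mem_nhds (P.isOpen_domain.mem_nhds hP)
      exact inter_mem (hJ.mem_nhds ht) h1
    obtain ⟨δ, hδ, hsub⟩ := Metric.mem_nhds_iff.1 hU
    rw [Real.ball_eq_Ioo] at hsub
    have h2 := hasCovDerivAlong_sum_smul (γ := fun r => (g r).1) (t := t) hδ (hK α hα) P.sec
      (c := fun k r => P.coord k (g r).1 (g r).2) (u := fun r => (g r).2)
      (fun k => (hg.contDiffOn_coord P k).mono fun r hr => (hsub hr).1)
      (fun r hr => (P.sum_coord_smul (hsub hr).2 _).symm)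
    rw [key α hα, h] at h2
    exact h2

end GeodesicEquation

/-! ### The geodesic spray in local coordinates -/

section Spray

variable {EM : Type*} [NormedAddCommGroup EM] [NormedSpace ℝ EM]
  {M : Type*} [TopologicalSpace M] [ChartedSpace EM M] [IsManifold 𝓘(ℝ, EM) ∞ M]
  {F : Type*} [NormedAddCommGroup F] [NormedSpace ℝ F]
  {E : M → Type*} [TopologicalSpace (TotalSpace F E)]
  [∀ x, AddCommGroup (E x)] [∀ x, Module ℝ (E x)] [∀ x, TopologicalSpace (E x)]
  [∀ x, IsTopologicalAddGroup (E x)] [∀ x, ContinuousSMul ℝ (E x)]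
  [FiberBundle F E] [VectorBundle ℝ F E]

variable (EM F E) in
/-- Coordinates on `E` made of a chart of the base and a free partial frame. Both are cut off, so
that the coordinate functions are smooth everywhere; they are coordinates over `source`. -/
structure BundleChart (ι : Type) [Fintype ι] where
  frame : PartialFrame EM F E ι
  isFree : frame.IsFree
  base : M → EM
  contMDiff_base : ContMDiff 𝓘(ℝ, EM) 𝓘(ℝ, EM) ∞ base
  center : M
  source : Set M
  isOpen_source : IsOpen source
  source_subset_domain : source ⊆ frame.domain
  source_subset_chart : source ⊆ (chartAt EM center).source
  base_eq : ∀ x ∈ source, base x = extChartAt 𝓘(ℝ, EM) center x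

namespace BundleChart

variable {ι : Type} [Fintype ι] (B : BundleChart EM F E ι)

/-- The coordinates of a vector. -/
def toCoord (a : TotalSpace F E) : EM × (ι → ℝ) :=
  (B.base a.1, fun k => B.frame.coord k a.1 a.2)

/-- The base point with given coordinates. -/
noncomputable def basePoint (p : EM) : M := (extChartAt 𝓘(ℝ, EM) B.center).symm p

/-- The vector with given coordinates. -/
noncomputable def ofCoord (c : EM × (ι → ℝ)) : TotalSpace F E :=
  ⟨B.basePoint c.1, ∑ k, c.2 k • B.frame.sec k (B.basePoint c.1)⟩

/-- The coordinates of the points of `source`. -/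
def baseTarget : Set EM :=
  (chartAt EM B.center).target ∩ (chartAt EM B.center).symm ⁻¹' B.source

lemma isOpen_baseTarget : IsOpen B.baseTarget :=
  (chartAt EM B.center).isOpen_inter_preimage_symm B.isOpen_source

lemma basePoint_mem {p : EM} (hp : p ∈ B.baseTarget) : B.basePoint p ∈ B.source := hp.2

lemma base_basePoint {p : EM} (hp : p ∈ B.baseTarget) : B.base (B.basePoint p) = p := by
  rw [B.base_eq _ (B.basePoint_mem hp)]
  exact (chartAt EM B.center).right_inv hp.1

lemma basePoint_base {x : M} (hx : x ∈ B.source) : B.basePoint (B.base x) = x := by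
  rw [B.base_eq _ hx]
  exact (chartAt EM B.center).left_inv (B.source_subset_chart hx)

lemma base_mem {x : M} (hx : x ∈ B.source) : B.base x ∈ B.baseTarget := by
  refine ⟨?_, ?_⟩
  · rw [B.base_eq _ hx]
    exact (chartAt EM B.center).map_source (B.source_subset_chart hx)
  · change B.basePoint (B.base x) ∈ B.source
    rwa [B.basePoint_base hx]

lemma ofCoord_toCoord {a : TotalSpace F E} (ha : a.1 ∈ B.source) : B.ofCoord (B.toCoord a) = a := by
  obtain ⟨x, v⟩ := a
  have h1 : B.basePoint (B.base x) = x := B.basePoint_base ha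
  unfold ofCoord toCoord
  rw [h1]
  congr 1
  exact B.frame.sum_coord_smul (B.source_subset_domain ha) v

lemma toCoord_ofCoord {c : EM × (ι → ℝ)} (hc : c.1 ∈ B.baseTarget) :
    B.toCoord (B.ofCoord c) = c := by
  refine Prod.ext (B.base_basePoint hc) ?_
  funext k
  exact B.isFree _ (B.source_subset_domain (B.basePoint_mem hc)) c.2 k

lemma contMDiffOn_basePoint : ContMDiffOn 𝓘(ℝ, EM) 𝓘(ℝ, EM) ∞ B.basePoint B.baseTarget :=
  (contMDiffOn_extChartAt_symm B.center).mono fun p hp => by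
    rw [extChartAt_target]
    exact ⟨hp.1, mem_range_self _⟩

lemma contMDiff_toCoord :
    ContMDiff (𝓘(ℝ, EM).prod 𝓘(ℝ, F)) 𝓘(ℝ, EM × (ι → ℝ)) ∞ B.toCoord :=
  (B.contMDiff_base.comp (contMDiff_proj E)).prodMk_space
    (contMDiff_pi_space.2 fun k => B.frame.contMDiff_coord k)

variable [FiniteDimensional ℝ EM] [FiniteDimensional ℝ F] [T2Space M] [SigmaCompactSpace M]
  [ContMDiffVectorBundle ∞ F E 𝓘(ℝ, EM)]

lemma contMDiffOn_ofCoord :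
    ContMDiffOn 𝓘(ℝ, EM × (ι → ℝ)) (𝓘(ℝ, EM).prod 𝓘(ℝ, F)) ∞ B.ofCoord
      (B.baseTarget ×ˢ univ) := by
  refine contMDiffOn_sum_smul (B.contMDiffOn_basePoint.comp contDiff_fst.contMDiff.contMDiffOn
    fun p hp => hp.1) (fun k => ContMDiff.contMDiffOn (ContDiff.contMDiff ?_)) B.frame.sec
  fun_prop

variable {L : PreLieAlgebroid EM F E} (C : AConnection L)

/-- The geodesic spray in coordinates. -/
noncomputable def spray (c : EM × (ι → ℝ)) : EM × (ι → ℝ) :=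
  (∑ i, c.2 i • mvfderiv 𝓘(ℝ, EM) B.base (B.basePoint c.1)
      (L.anchor (B.basePoint c.1) (B.frame.sec i (B.basePoint c.1))),
    fun k => -∑ j, c.2 j * ∑ i, c.2 i *
      B.frame.coeff k (C.toFun (B.frame.sec i) (B.frame.sec j)) (B.basePoint c.1))

lemma contDiffOn_spray : ContDiffOn ℝ ∞ (B.spray C) (B.baseTarget ×ˢ univ) := by
  have hb : ContMDiffOn 𝓘(ℝ, EM × (ι → ℝ)) 𝓘(ℝ, EM) ∞
      (fun c : EM × (ι → ℝ) => B.basePoint c.1) (B.baseTarget ×ˢ univ) :=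
    B.contMDiffOn_basePoint.comp contDiff_fst.contMDiff.contMDiffOn fun p hp => hp.1
  have hz : ∀ i : ι, ContDiffOn ℝ ∞ (fun c : EM × (ι → ℝ) => c.2 i) (B.baseTarget ×ˢ univ) :=
    fun i => ContDiff.contDiffOn (by fun_prop)
  refine ContDiffOn.prodMk ?_ (contDiffOn_pi.2 fun k => ?_)
  · refine ContDiffOn.sum fun i _ => (hz i).smul ?_
    exact ((contMDiff_mvfderiv_apply B.contMDiff_base
      (L.contMDiff_anchor_section (B.frame.sec i))).comp_contMDiffOn hb).contDiffOn
  · refine (ContDiffOn.sum fun j _ => (hz j).mul (ContDiffOn.sum fun i _ => (hz i).mul ?_)).neg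
    exact ((B.frame.coeff k
      (C.toFun (B.frame.sec i) (B.frame.sec j))).contMDiff.comp_contMDiffOn hb).contDiffOn

lemma spray_toCoord_fst {a : TotalSpace F E} (ha : a.1 ∈ B.source) :
    (B.spray C (B.toCoord a)).1 = mvfderiv 𝓘(ℝ, EM) B.base a.1 (L.anchor a.1 a.2) := by
  rw [L.anchor_eq_sum B.frame (B.source_subset_domain ha)]
  change ∑ i, B.frame.coord i a.1 a.2 • mvfderiv 𝓘(ℝ, EM) B.base (B.basePoint (B.base a.1))
      (L.anchor _ (B.frame.sec i (B.basePoint (B.base a.1)))) = _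
  rw [B.basePoint_base ha, map_sum]
  exact Finset.sum_congr rfl fun i _ => (map_smul _ _ _).symm

lemma spray_toCoord_snd {a : TotalSpace F E} (ha : a.1 ∈ B.source) (k : ι) :
    (B.spray C (B.toCoord a)).2 k = -B.frame.coord k a.1 (C.quadraticTerm B.frame a) := by
  change -∑ j, B.frame.coord j a.1 a.2 * ∑ i, B.frame.coord i a.1 a.2 *
    B.frame.coeff k (C.toFun (B.frame.sec i) (B.frame.sec j)) (B.basePoint (B.base a.1)) = _
  rw [B.basePoint_base ha]
  simp [AConnection.quadraticTerm, map_sum, map_smul]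

/-- Geodesics are integral curves of the spray in coordinates. -/
lemma hasDerivAt_toCoord {g : ℝ → TotalSpace F E} {J : Set ℝ} (hJ : IsOpen J)
    (hg : C.IsGeodesicOn g J) {t : ℝ} (ht : t ∈ J) (hs : (g t).1 ∈ B.source) :
    HasDerivAt (fun r => B.toCoord (g r)) (B.spray C (B.toCoord (g t))) t := by
  have hP := B.source_subset_domain hs
  have hfst : HasDerivAt (fun r => B.base (g r).1) (B.spray C (B.toCoord (g t))).1 t := by
    rw [B.spray_toCoord_fst C hs]
    exact (hg.1.hasVelocityAt ht).hasDerivAt_comp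
      ((B.contMDiff_base _).mdifferentiableAt (by simp))
  have hsnd : ∀ k, HasDerivAt (fun r => B.frame.coord k (g r).1 (g r).2)
      ((B.spray C (B.toCoord (g t))).2 k) t := fun k => by
    have h1 := (C.hasCovDerivAt_zero_iff hJ hg.1 ht B.frame hP).1 (hg.2 t ht)
    have h2 := congrArg (B.frame.coord k (g t).1) h1
    rw [map_add, B.isFree _ hP, map_zero] at h2
    rw [B.spray_toCoord_snd C hs, ← eq_neg_of_add_eq_zero_left h2]
    exact (((hg.1.contDiffOn_coord B.frame k).contDiffAt (hJ.mem_nhds ht)).differentiableAt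
      (by simp)).hasDerivAt
  exact hfst.prodMk (hasDerivAt_pi.2 hsnd)

/-- Integral curves of the spray give geodesics. -/
lemma isGeodesicOn_ofCoord {c : ℝ → EM × (ι → ℝ)} {J : Set ℝ} (hJ : IsOpen J)
    (hc : ContDiffOn ℝ ∞ c J) (hm : ∀ t ∈ J, (c t).1 ∈ B.baseTarget)
    (hd : ∀ t ∈ J, HasDerivAt c (B.spray C (c t)) t) :
    C.IsGeodesicOn (fun r => B.ofCoord (c r)) J := by
  have hsm : ContMDiffOn 𝓘(ℝ, ℝ) (𝓘(ℝ, EM).prod 𝓘(ℝ, F)) ∞ (fun r => B.ofCoord (c r)) J :=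
    B.contMDiffOn_ofCoord.comp hc.contMDiffOn fun t ht => ⟨hm t ht, mem_univ _⟩
  have hs : ∀ t ∈ J, (B.ofCoord (c t)).1 ∈ B.source := fun t ht => B.basePoint_mem (hm t ht)
  have hto : ∀ t ∈ J, B.toCoord (B.ofCoord (c t)) = c t := fun t ht => B.toCoord_ofCoord (hm t ht)
  have hev : ∀ t ∈ J, ∀ᶠ r in 𝓝 t, B.toCoord (B.ofCoord (c r)) = c r := fun t ht => by
    filter_upwards [hJ.mem_nhds ht] with r hr using hto r hr
  have hpath : IsAPathOn L (fun r => B.ofCoord (c r)) J := by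
    refine ⟨hsm, fun t ht => ?_⟩
    have h1 : MDifferentiableAt 𝓘(ℝ, ℝ) 𝓘(ℝ, EM) (fun r => (B.ofCoord (c r)).1) t :=
      ((contMDiff_proj E).comp_contMDiffOn hsm |>.contMDiffAt (hJ.mem_nhds ht)).mdifferentiableAt
        (by simp)
    have h2 := hasVelocityAt_mfderiv h1
    have h3 := h2.hasDerivAt_comp ((B.contMDiff_base _).mdifferentiableAt (by simp))
    have h4 : HasDerivAt (fun r => B.base (B.ofCoord (c r)).1) (B.spray C (c t)).1 t :=
      HasDerivAt.congr_of_eventuallyEq (f := fun r => (c r).1)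
        ((ContinuousLinearMap.fst ℝ EM (ι → ℝ)).hasFDerivAt.comp_hasDerivAt t (hd t ht))
        (by filter_upwards [hev t ht] with r hr using congrArg Prod.fst hr)
    have h5 := B.spray_toCoord_fst C (hs t ht)
    rw [hto t ht] at h5
    have h6 := injective_mvfderiv_of_eventuallyEq_chart (B.source_subset_chart (hs t ht))
      (by filter_upwards [B.isOpen_source.mem_nhds (hs t ht)] with y hy using B.base_eq y hy)
      (h3.unique (h4.congr_deriv h5))
    rw [h6] at h2
    exact h2
  refine ⟨hpath, fun t ht => ?_⟩
  have hP := B.source_subset_domain (hs t ht)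
  rw [C.hasCovDerivAt_zero_iff hJ hpath ht B.frame hP]
  have h1 : ∀ k, deriv (fun r => B.frame.coord k (B.ofCoord (c r)).1 (B.ofCoord (c r)).2) t =
      -B.frame.coord k _ (C.quadraticTerm B.frame (B.ofCoord (c t))) := fun k => by
    rw [← B.spray_toCoord_snd C (hs t ht), hto t ht]
    have h2 : HasDerivAt (fun r => (c r).2) (B.spray C (c t)).2 t :=
      (ContinuousLinearMap.snd ℝ EM (ι → ℝ)).hasFDerivAt.comp_hasDerivAt t (hd t ht)
    refine HasDerivAt.deriv ((hasDerivAt_pi.1 h2 k).congr_of_eventuallyEq ?_)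
    filter_upwards [hev t ht] with r hr using congrFun (congrArg Prod.snd hr) k
  simp only [h1, neg_smul, Finset.sum_neg_distrib]
  rw [B.frame.sum_coord_smul hP, neg_add_cancel]

variable (EM F E) in
lemma exists_mem_source (x₀ : M) :
    ∃ B : BundleChart EM F E (Fin (Module.finrank ℝ F)), x₀ ∈ B.source := by
  obtain ⟨P, hP, hfree⟩ := exists_partialFrame_isFree EM F E x₀
  obtain ⟨Y, Ω, hY, hΩ, hx, hs, hc⟩ := exists_global_chart EM x₀
  exact ⟨⟨P, hfree, Y, hY, x₀, Ω ∩ P.domain, hΩ.inter P.isOpen_domain, inter_subset_right,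
    inter_subset_left.trans hs, fun x hx => hc x hx.1⟩, hx, hP⟩

end BundleChart

end Spray

/-! ### Existence and uniqueness of geodesics -/

section Geodesics

variable {EM : Type*} [NormedAddCommGroup EM] [NormedSpace ℝ EM]
  {M : Type*} [TopologicalSpace M] [ChartedSpace EM M] [IsManifold 𝓘(ℝ, EM) ∞ M]
  {F : Type*} [NormedAddCommGroup F] [NormedSpace ℝ F]
  {E : M → Type*} [TopologicalSpace (TotalSpace F E)]
  [∀ x, AddCommGroup (E x)] [∀ x, Module ℝ (E x)] [∀ x, TopologicalSpace (E x)]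
  [∀ x, IsTopologicalAddGroup (E x)] [∀ x, ContinuousSMul ℝ (E x)]
  [FiberBundle F E] [VectorBundle ℝ F E]
  [FiniteDimensional ℝ EM] [FiniteDimensional ℝ F] [T2Space M] [SigmaCompactSpace M]
  [ContMDiffVectorBundle ∞ F E 𝓘(ℝ, EM)]
  {L : PreLieAlgebroid EM F E} {C : AConnection L}

/-- Being a geodesic is a local property. -/
lemma AConnection.isGeodesicOn_of_forall_exists {g : ℝ → TotalSpace F E} {J : Set ℝ}
    (h : ∀ t ∈ J, ∃ (k : ℝ → TotalSpace F E) (J' : Set ℝ), IsOpen J' ∧ t ∈ J' ∧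
      C.IsGeodesicOn k J' ∧ ∀ r ∈ J', g r = k r) : C.IsGeodesicOn g J := by
  refine ⟨⟨fun t ht => ?_, fun t ht => ?_⟩, fun t ht => ?_⟩
  · obtain ⟨k, J', hJ', htJ, hk, he⟩ := h t ht
    refine ContMDiffAt.contMDiffWithinAt ((hk.1.1.contMDiffAt (hJ'.mem_nhds htJ)).congr_of_eventuallyEq ?_)
    filter_upwards [hJ'.mem_nhds htJ] with r hr using he r hr
  · obtain ⟨k, J', hJ', htJ, hk, he⟩ := h t ht
    have h1 := (hk.1.hasVelocityAt htJ).congr (γ' := fun r => (g r).1)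
      (by filter_upwards [hJ'.mem_nhds htJ] with r hr using congrArg TotalSpace.proj (he r hr))
    have h2 : ∀ b : TotalSpace F E, b = k t →
        HasVelocityAt (EM := EM) (fun r => (g r).1) t (L.anchor b.1 b.2 : EM) := by
      rintro b rfl
      exact h1
    exact h2 _ (he t htJ)
  · obtain ⟨k, J', hJ', htJ, hk, he⟩ := h t ht
    have h2 : ∀ b : TotalSpace F E, b = k t → ∃ α : Cₛ^∞⟮𝓘(ℝ, EM); F, E⟯, α b.1 = b.2 ∧
        ∃ (ξ : ℝ → Cₛ^∞⟮𝓘(ℝ, EM); F, E⟯) (δ : ℝ), 0 < δ ∧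
          IsSmoothTimeDepSection ξ (Ioo (t - δ) (t + δ)) ∧
          (∀ r ∈ Ioo (t - δ) (t + δ), ξ r (g r).1 = (g r).2) ∧
          (0 : E b.1) = C.toFun α (ξ t) b.1 + deriv (fun r => ξ r b.1) t := by
      rintro b rfl
      obtain ⟨α, hα, ξ, δ, hδ, hξ, hu, h0⟩ := hk.2 t htJ
      obtain ⟨δ', hδ', hsub⟩ := Metric.mem_nhds_iff.1 (hJ'.mem_nhds htJ)
      rw [Real.ball_eq_Ioo] at hsub
      have hmono : Ioo (t - min δ δ') (t + min δ δ') ⊆ Ioo (t - δ) (t + δ) :=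
        Ioo_subset_Ioo (by linarith [min_le_left δ δ']) (by linarith [min_le_left δ δ'])
      have hmono' : Ioo (t - min δ δ') (t + min δ δ') ⊆ J' :=
        (Ioo_subset_Ioo (by linarith [min_le_right δ δ']) (by linarith [min_le_right δ δ'])).trans
          hsub
      refine ⟨α, hα, ξ, min δ δ', lt_min hδ hδ', ContMDiffOn.mono hξ (prod_mono hmono subset_rfl),
        fun r hr => ?_, h0⟩
      have h3 : ∀ b : TotalSpace F E, b = k r → ξ r b.1 = b.2 := by
        rintro b rfl
        exact hu r (hmono hr)
      exact h3 _ (he r (hmono' hr))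
    exact h2 _ (he t htJ)

lemma AConnection.IsGeodesicOn.congr {g g' : ℝ → TotalSpace F E} {J J' : Set ℝ} (hJ : IsOpen J')
    (h : C.IsGeodesicOn g J) (hsub : J' ⊆ J) (he : ∀ t ∈ J', g' t = g t) : C.IsGeodesicOn g' J' :=
  AConnection.isGeodesicOn_of_forall_exists fun _ ht => ⟨g, J', hJ, ht,
    ⟨⟨h.1.1.mono hsub, fun r hr => h.1.2 r (hsub hr)⟩, fun r hr => h.2 r (hsub hr)⟩, he⟩

/-- Affine reparametrizations of geodesics are geodesics after rescaling. -/
lemma AConnection.IsGeodesicOn.comp_affine {g : ℝ → TotalSpace F E} {J : Set ℝ} (hJ : IsOpen J)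
    (h : C.IsGeodesicOn g J) (c u : ℝ) :
    C.IsGeodesicOn (fun r => (⟨(g (c * r + u)).1, c • (g (c * r + u)).2⟩ : TotalSpace F E))
      {r | c * r + u ∈ J} := by
  have hJ' : IsOpen {r | c * r + u ∈ J} := hJ.preimage (by fun_prop)
  have haff : ∀ t, HasDerivAt (fun r => c * r + u) c t := fun t => by
    simpa using ((hasDerivAt_id t).const_mul c).add_const u
  have haffs : ContMDiff 𝓘(ℝ, ℝ) 𝓘(ℝ, ℝ) ∞ (fun r : ℝ => c * r + u) :=
    ContDiff.contMDiff (by fun_prop)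
  have hcomp : ContMDiffOn 𝓘(ℝ, ℝ) (𝓘(ℝ, EM).prod 𝓘(ℝ, F)) ∞ (fun r => g (c * r + u))
      {r | c * r + u ∈ J} := h.1.1.comp haffs.contMDiffOn fun r hr => hr
  have hpath : IsAPathOn L
      (fun r => (⟨(g (c * r + u)).1, c • (g (c * r + u)).2⟩ : TotalSpace F E))
      {r | c * r + u ∈ J} := by
    refine ⟨?_, fun t ht => ?_⟩
    · have h1 := contMDiff_smul_add (f := fun r => (g (c * r + u)).1) (c := fun _ => c)
        (d := fun _ => 0) contMDiffOn_const contMDiffOn_const hcomp hcomp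
      simpa only [zero_smul, add_zero] using h1
    · have h1 := (h.1.hasVelocityAt ht).comp_hasDerivAt (u := fun r => c * r + u) (haff t)
      rw [← map_smul] at h1
      exact h1
  refine ⟨hpath, fun t ht => ?_⟩
  obtain ⟨P, hP, -⟩ := exists_partialFrame_isFree EM F E (g (c * t + u)).1
  rw [C.hasCovDerivAt_zero_iff hJ' hpath ht P hP]
  have h0 := (C.hasCovDerivAt_zero_iff hJ h.1 ht P hP).1 (h.2 _ ht)
  have h1 : ∀ k, deriv (fun r => P.coord k (g (c * r + u)).1 (c • (g (c * r + u)).2)) t =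
      c * c * deriv (fun r => P.coord k (g r).1 (g r).2) (c * t + u) := fun k => by
    have h2 : HasDerivAt (fun r => P.coord k (g r).1 (g r).2)
        (deriv (fun r => P.coord k (g r).1 (g r).2) (c * t + u)) (c * t + u) :=
      (((h.1.contDiffOn_coord P k).contDiffAt (hJ.mem_nhds ht)).differentiableAt
        (by simp)).hasDerivAt
    have h3 := (h2.comp t (haff t)).const_mul c
    simp only [map_smul, smul_eq_mul]
    rw [show c * c * deriv (fun r => P.coord k (g r).1 (g r).2) (c * t + u) =
      c * (deriv (fun r => P.coord k (g r).1 (g r).2) (c * t + u) * c) by ring]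
    exact h3.deriv
  have h2 : C.quadraticTerm P ⟨(g (c * t + u)).1, c • (g (c * t + u)).2⟩ =
      (c * c) • C.quadraticTerm P (g (c * t + u)) := by
    simp only [AConnection.quadraticTerm, map_smul, smul_eq_mul, Finset.smul_sum, smul_smul]
    refine Finset.sum_congr rfl fun i _ => Finset.sum_congr rfl fun j _ => ?_
    congr 1
    ring
  simp only [h1, mul_smul _ (deriv _ _), ← Finset.smul_sum]
  rw [h2, ← smul_add, h0, smul_zero]

lemma AConnection.IsGeodesicOn.comp_sub {g : ℝ → TotalSpace F E} {J : Set ℝ} (hJ : IsOpen J)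
    (h : C.IsGeodesicOn g J) (u : ℝ) :
    C.IsGeodesicOn (fun r => g (r - u)) {r | r - u ∈ J} := by
  have h1 := h.comp_affine hJ 1 (-u)
  have h2 : ∀ r, r - u = 1 * r + -u := fun r => by ring
  refine h1.congr (hJ.preimage (by fun_prop)) (fun r hr => ?_) fun r _ => ?_
  · rw [mem_ofPred_eq, ← h2]
    exact hr
  · rw [h2 r, one_smul]

/-- Local uniqueness of geodesics, from uniqueness of integral curves of the spray. -/
lemma AConnection.IsGeodesicOn.eventuallyEq {g₁ g₂ : ℝ → TotalSpace F E} {J : Set ℝ}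
    (hJ : IsOpen J) (h₁ : C.IsGeodesicOn g₁ J) (h₂ : C.IsGeodesicOn g₂ J) {t : ℝ} (ht : t ∈ J)
    (he : g₁ t = g₂ t) : g₁ =ᶠ[𝓝 t] g₂ := by
  obtain ⟨B, hB⟩ := BundleChart.exists_mem_source EM F E (g₁ t).1
  have hB₂ : (g₂ t).1 ∈ B.source := he ▸ hB
  have hsp : ContDiffAt ℝ 1 (B.spray C) (B.toCoord (g₁ t)) :=
    ((B.contDiffOn_spray C).contDiffAt ((B.isOpen_baseTarget.prod isOpen_univ).mem_nhds
      ⟨B.base_mem hB, mem_univ _⟩)).of_le (by simp)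
  obtain ⟨K, s, hs, hlip⟩ := hsp.exists_lipschitzOnWith
  have key : ∀ {g : ℝ → TotalSpace F E}, C.IsGeodesicOn g J → g t = g₁ t →
      ∀ᶠ r in 𝓝 t, (g r).1 ∈ B.source ∧ HasDerivAt (fun r => B.toCoord (g r))
        (B.spray C (B.toCoord (g r))) r ∧ B.toCoord (g r) ∈ s := by
    intro g hg hgt
    have hc : ContinuousAt g t := (hg.1.1.contMDiffAt (hJ.mem_nhds ht)).continuousAt
    have h1 : ∀ᶠ r in 𝓝 t, (g r).1 ∈ B.source :=
      ((FiberBundle.continuous_proj F E).continuousAt.comp hc).preimage_mem_nhds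
        (B.isOpen_source.mem_nhds (by rw [Function.comp_apply, hgt]; exact hB))
    have h2 : ∀ᶠ r in 𝓝 t, B.toCoord (g r) ∈ s :=
      (B.contMDiff_toCoord.continuous.continuousAt.comp hc).preimage_mem_nhds
        (by rw [Function.comp_apply, hgt]; exact hs)
    filter_upwards [h1, h2, hJ.mem_nhds ht] with r hr1 hr2 hr3
    exact ⟨hr1, B.hasDerivAt_toCoord C hJ hg hr3 hr1, hr2⟩
  have k1 := key h₁ rfl
  have k2 := key h₂ he.symm
  have h3 := ODE_solution_unique_of_eventually (v := fun _ => B.spray C) (s := fun _ => s)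
    (Eventually.of_forall fun _ => hlip) (k1.mono fun r hr => hr.2) (k2.mono fun r hr => hr.2)
    (congrArg B.toCoord he)
  filter_upwards [h3, k1, k2] with r hr hr1 hr2
  rw [← B.ofCoord_toCoord hr1.1, hr, B.ofCoord_toCoord hr2.1]

lemma t2Space_totalSpace : T2Space (TotalSpace F E) := by
  refine ⟨fun a b hab => ?_⟩
  by_cases h : a.1 = b.1
  · set e := trivializationAt F E a.1
    have ha : a ∈ e.source := FiberBundle.mem_trivializationAt_proj_source
    have hb : b ∈ e.source := e.mem_source.2 (h ▸ FiberBundle.mem_baseSet_trivializationAt' a.1)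
    have hne : e a ≠ e b := fun he => hab (e.injOn ha hb he)
    obtain ⟨u, v, hu, hv, hau, hbv, hd⟩ := t2_separation hne
    refine ⟨e.source ∩ e ⁻¹' u, e.source ∩ e ⁻¹' v,
      e.continuousOn.isOpen_inter_preimage e.open_source hu,
      e.continuousOn.isOpen_inter_preimage e.open_source hv, ⟨ha, hau⟩, ⟨hb, hbv⟩, ?_⟩
    exact (hd.preimage e).mono inter_subset_right inter_subset_right
  · obtain ⟨u, v, hu, hv, hau, hbv, hd⟩ := t2_separation h
    exact ⟨_, _, hu.preimage (FiberBundle.continuous_proj F E),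
      hv.preimage (FiberBundle.continuous_proj F E), hau, hbv, hd.preimage _⟩

/-- Geodesics on an interval that agree at one time agree: the set of times near which they agree is
open and, the total space being Hausdorff, closed. -/
lemma AConnection.IsGeodesicOn.eqOn {g₁ g₂ : ℝ → TotalSpace F E} {J : Set ℝ} (hJ : IsOpen J)
    (hJc : J.OrdConnected) (h₁ : C.IsGeodesicOn g₁ J) (h₂ : C.IsGeodesicOn g₂ J) {t : ℝ}
    (ht : t ∈ J) (he : g₁ t = g₂ t) : EqOn g₁ g₂ J := by
  have := t2Space_totalSpace (M := M) (F := F) (E := E)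
  have hsub : J ⊆ {r | g₁ =ᶠ[𝓝 r] g₂} := by
    refine hJc.isPreconnected.subset_of_closure_inter_subset (isOpen_setOfPred_eventually_nhds)
      ⟨t, ht, h₁.eventuallyEq hJ h₂ ht he⟩ fun r hr => ?_
    refine h₁.eventuallyEq hJ h₂ hr.2 ?_
    have c₁ : ContinuousAt g₁ r := (h₁.1.1.contMDiffAt (hJ.mem_nhds hr.2)).continuousAt
    have c₂ : ContinuousAt g₂ r := (h₂.1.1.contMDiffAt (hJ.mem_nhds hr.2)).continuousAt
    have hf : ∃ᶠ s in 𝓝 r, g₁ s = g₂ s :=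
      (mem_closure_iff_frequently.1 hr.1).mono fun s (hs : g₁ =ᶠ[𝓝 s] g₂) =>
        hs.self_of_nhds
    exact tendsto_nhds_unique_of_frequently_eq c₁ c₂ hf
  exact fun r hr => (hsub hr).self_of_nhds

/-- The local flow of the geodesic spray. -/
lemma AConnection.exists_local_flow (C : AConnection L) (a₀ : TotalSpace F E) :
    ∃ (η : ℝ) (W : Set (TotalSpace F E)) (Ψ : ℝ × TotalSpace F E → TotalSpace F E),
      0 < η ∧ IsOpen W ∧ a₀ ∈ W ∧
      ContMDiffOn (𝓘(ℝ, ℝ).prod (𝓘(ℝ, EM).prod 𝓘(ℝ, F))) (𝓘(ℝ, EM).prod 𝓘(ℝ, F)) ∞ Ψ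
        (Ioo (-η) η ×ˢ W) ∧
      ∀ a ∈ W, Ψ (0, a) = a ∧ C.IsGeodesicOn (fun s => Ψ (s, a)) (Ioo (-η) η) := by
  obtain ⟨B, hB⟩ := BundleChart.exists_mem_source EM F E a₀.1
  set c₀ := B.toCoord a₀ with hc₀
  have hO : IsOpen (B.baseTarget ×ˢ (univ : Set (Fin (Module.finrank ℝ F) → ℝ))) :=
    B.isOpen_baseTarget.prod isOpen_univ
  have hc₀O : c₀ ∈ B.baseTarget ×ˢ univ := ⟨B.base_mem hB, mem_univ _⟩
  obtain ⟨f, hf, hfc, hfe⟩ := exists_contDiff_eventuallyEq_nhdsSet (isCompact_singleton (x := c₀))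
    hO (singleton_subset_iff.2 hc₀O) (B.contDiffOn_spray C)
  rw [nhdsSet_singleton] at hfe
  obtain ⟨η, W₀, Φ, hη, hW₀, hcW, hΦ, hΦ0, hΦd⟩ := exists_contDiffOn_flow hf hfc c₀
  obtain ⟨D, hDsub, hD, hcD⟩ := mem_nhds_iff.1 (inter_mem (hO.mem_nhds hc₀O) hfe)
  have hopen : IsOpen ((Ioo (-η) η ×ˢ W₀) ∩ Φ ⁻¹' D) :=
    hΦ.continuousOn.isOpen_inter_preimage (isOpen_Ioo.prod hW₀) hD
  have hmem : ((0 : ℝ), c₀) ∈ (Ioo (-η) η ×ˢ W₀) ∩ Φ ⁻¹' D :=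
    ⟨⟨⟨by linarith, hη⟩, hcW⟩, by rw [mem_preimage, hΦ0 _ hcW]; exact hcD⟩
  obtain ⟨u, v, hu, h0u, hv, hcv, huv⟩ := mem_nhds_prod_iff'.1 (hopen.mem_nhds hmem)
  obtain ⟨η', hη', hball⟩ := Metric.mem_nhds_iff.1 (hu.mem_nhds h0u)
  rw [Real.ball_eq_Ioo, zero_sub, zero_add] at hball
  have hsub : Ioo (-η') η' ×ˢ v ⊆ (Ioo (-η) η ×ˢ W₀) ∩ Φ ⁻¹' D :=
    (prod_mono hball subset_rfl).trans huv
  refine ⟨η', {a | a.1 ∈ B.source ∧ B.toCoord a ∈ v}, fun p => B.ofCoord (Φ (p.1, B.toCoord p.2)),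
    hη', ?_, ⟨hB, hcv⟩, ?_, fun a ha => ⟨?_, ?_⟩⟩
  · exact (B.isOpen_source.preimage (FiberBundle.continuous_proj F E)).inter
      (hv.preimage B.contMDiff_toCoord.continuous)
  · have h1 : ContMDiffOn (𝓘(ℝ, ℝ).prod (𝓘(ℝ, EM).prod 𝓘(ℝ, F)))
        𝓘(ℝ, ℝ × (EM × (Fin (Module.finrank ℝ F) → ℝ))) ∞
        (fun p : ℝ × TotalSpace F E => (p.1, B.toCoord p.2))
        (Ioo (-η') η' ×ˢ {a | a.1 ∈ B.source ∧ B.toCoord a ∈ v}) :=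
      (contMDiff_fst.prodMk_space (B.contMDiff_toCoord.comp contMDiff_snd)).contMDiffOn
    have h2 := hΦ.contMDiffOn.comp h1 fun p hp => (hsub ⟨hp.1, hp.2.2⟩).1
    exact B.contMDiffOn_ofCoord.comp h2 fun p hp => (hDsub (hsub ⟨hp.1, hp.2.2⟩).2).1
  · change B.ofCoord (Φ (0, B.toCoord a)) = a
    rw [hΦ0 _ (hsub (a := (0, B.toCoord a)) ⟨⟨by linarith, hη'⟩, ha.2⟩).1.2, B.ofCoord_toCoord ha.1]
  · refine B.isGeodesicOn_ofCoord C isOpen_Ioo ?_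
      (fun s hs => (hDsub (hsub (a := (s, B.toCoord a)) ⟨hs, ha.2⟩).2).1.1) fun s hs => ?_
    · have h2 : ContDiff ℝ ∞ (fun s : ℝ => (s, B.toCoord a)) := contDiff_id.prodMk contDiff_const
      exact hΦ.comp h2.contDiffOn fun s hs =>
        (hsub (a := (s, B.toCoord a)) ⟨hs, ha.2⟩).1
    · have h3 := hsub (a := (s, B.toCoord a)) ⟨hs, ha.2⟩
      rw [← (hDsub h3.2).2]
      exact hΦd _ h3.1.2 s h3.1.1

end Geodesics

/-! ### The geodesic flow -/

section Flow

variable {EM : Type*} [NormedAddCommGroup EM] [NormedSpace ℝ EM]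
  {M : Type*} [TopologicalSpace M] [ChartedSpace EM M] [IsManifold 𝓘(ℝ, EM) ∞ M]
  {F : Type*} [NormedAddCommGroup F] [NormedSpace ℝ F]
  {E : M → Type*} [TopologicalSpace (TotalSpace F E)]
  [∀ x, AddCommGroup (E x)] [∀ x, Module ℝ (E x)] [∀ x, TopologicalSpace (E x)]
  [∀ x, IsTopologicalAddGroup (E x)] [∀ x, ContinuousSMul ℝ (E x)]
  [FiberBundle F E] [VectorBundle ℝ F E]
  [FiniteDimensional ℝ EM] [FiniteDimensional ℝ F] [T2Space M] [SigmaCompactSpace M]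
  [ContMDiffVectorBundle ∞ F E 𝓘(ℝ, EM)]
  {L : PreLieAlgebroid EM F E} (C : AConnection L)

namespace AConnection

lemma geodesic_eq {a : TotalSpace F E} {g : ℝ → TotalSpace F E} {J : Set ℝ} (hJ : IsOpen J)
    (hJc : J.OrdConnected) (h0 : (0 : ℝ) ∈ J) (hg : C.IsGeodesicOn g J) (hg0 : g 0 = a) {t : ℝ}
    (ht : t ∈ J) : t ∈ C.geodesicDomain a ∧ C.geodesic a t = g t := by
  have hex : ∃ g, C.IsGeodesicFromTo a t g := ⟨g, hg0, J, hJ, hJc, h0, ht, hg⟩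
  refine ⟨hex, ?_⟩
  unfold geodesic
  rw [dif_pos hex]
  obtain ⟨hk0, J', hJ', hJc', h0', ht', hk⟩ := hex.choose_spec
  refine IsGeodesicOn.eqOn (hJ'.inter hJ) (hJc'.inter hJc)
    (hk.congr (hJ'.inter hJ) inter_subset_left fun _ _ => rfl)
    (hg.congr (hJ'.inter hJ) inter_subset_right fun _ _ => rfl) ⟨h0', h0⟩ ?_ ⟨ht', ht⟩
  rw [hk0, hg0]

lemma exists_isGeodesicOn_geodesic {a : TotalSpace F E} {t : ℝ} (ht : t ∈ C.geodesicDomain a) :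
    ∃ J : Set ℝ, IsOpen J ∧ J.OrdConnected ∧ 0 ∈ J ∧ t ∈ J ∧ J ⊆ C.geodesicDomain a ∧
      C.IsGeodesicOn (C.geodesic a) J := by
  obtain ⟨g, hg0, J, hJ, hJc, h0, htJ, hg⟩ := ht
  have h1 := fun r (hr : r ∈ J) => C.geodesic_eq hJ hJc h0 hg hg0 hr
  exact ⟨J, hJ, hJc, h0, htJ, fun r hr => (h1 r hr).1,
    hg.congr hJ subset_rfl fun r hr => (h1 r hr).2⟩

lemma zero_mem_geodesicDomain (a : TotalSpace F E) : (0 : ℝ) ∈ C.geodesicDomain a := by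
  obtain ⟨η, W, Ψ, hη, -, haW, -, hΨ⟩ := C.exists_local_flow a
  have h0 : (0 : ℝ) ∈ Ioo (-η) η := ⟨by linarith, hη⟩
  exact (C.geodesic_eq isOpen_Ioo ordConnected_Ioo h0 (hΨ a haW).2 (hΨ a haW).1 h0).1

@[simp] lemma geodesic_zero (a : TotalSpace F E) : C.geodesic a 0 = a := by
  obtain ⟨g, hg0, J, hJ, hJc, h0, htJ, hg⟩ := C.zero_mem_geodesicDomain a
  exact (C.geodesic_eq hJ hJc h0 hg hg0 h0).2.trans hg0

lemma isOpen_geodesicDomain (a : TotalSpace F E) : IsOpen (C.geodesicDomain a) := by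
  refine isOpen_iff_forall_mem_open.2 fun t ht => ?_
  obtain ⟨J, hJ, -, -, htJ, hsub, -⟩ := C.exists_isGeodesicOn_geodesic ht
  exact ⟨J, hsub, hJ, htJ⟩

lemma ordConnected_geodesicDomain (a : TotalSpace F E) : (C.geodesicDomain a).OrdConnected := by
  refine ordConnected_of_uIcc_subset_left (x := 0) fun t ht => ?_
  obtain ⟨J, -, hJc, h0, htJ, hsub, -⟩ := C.exists_isGeodesicOn_geodesic ht
  exact (hJc.uIcc_subset h0 htJ).trans hsub

lemma isGeodesicOn_geodesic (a : TotalSpace F E) :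
    C.IsGeodesicOn (C.geodesic a) (C.geodesicDomain a) := by
  refine isGeodesicOn_of_forall_exists fun t ht => ?_
  obtain ⟨J, hJ, -, -, htJ, -, hg⟩ := C.exists_isGeodesicOn_geodesic ht
  exact ⟨_, J, hJ, htJ, hg, fun _ _ => rfl⟩

/-- The maximal geodesic `g_a` can be prolonged by a geodesic that starts at `g_a u`. -/
lemma geodesic_concat {a : TotalSpace F E} {u η : ℝ} (hu : u ∈ C.geodesicDomain a)
    {h : ℝ → TotalSpace F E} (hh : C.IsGeodesicOn h (Ioo (-η) η)) (h0 : h 0 = C.geodesic a u)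
    {t : ℝ} (ht : t ∈ Ioo (u - η) (u + η)) :
    t ∈ C.geodesicDomain a ∧ C.geodesic a t = h (t - u) := by
  classical
  have hη : 0 < η := by linarith [ht.1, ht.2]
  set J := C.geodesicDomain a with hJdef
  have hJ : IsOpen J := C.isOpen_geodesicDomain a
  have hJc : J.OrdConnected := C.ordConnected_geodesicDomain a
  set I := Ioo (u - η) (u + η) with hI
  have huI : u ∈ I := ⟨by linarith, by linarith⟩
  have hh' : C.IsGeodesicOn (fun r => h (r - u)) I :=
    (hh.comp_sub isOpen_Ioo u).congr isOpen_Ioo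
      (fun r hr => ⟨by linarith [hr.1], by linarith [hr.2]⟩) fun _ _ => rfl
  have hov : EqOn (C.geodesic a) (fun r => h (r - u)) (J ∩ I) := by
    refine IsGeodesicOn.eqOn (hJ.inter isOpen_Ioo) (hJc.inter ordConnected_Ioo)
      ((C.isGeodesicOn_geodesic a).congr (hJ.inter isOpen_Ioo) inter_subset_left fun _ _ => rfl)
      (hh'.congr (hJ.inter isOpen_Ioo) inter_subset_right fun _ _ => rfl) ⟨hu, huI⟩ ?_
    rw [sub_self, h0]
  set k : ℝ → TotalSpace F E := fun r => if r ∈ J then C.geodesic a r else h (r - u) with hk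
  have hkI : ∀ r ∈ I, k r = h (r - u) := fun r hr => by
    by_cases hrJ : r ∈ J
    · rw [hk]
      change (if r ∈ J then _ else _) = _
      rw [if_pos hrJ]
      exact hov ⟨hrJ, hr⟩
    · exact if_neg hrJ
  have hkg : C.IsGeodesicOn k (J ∪ I) := by
    refine isGeodesicOn_of_forall_exists fun r hr => ?_
    rcases hr with hr | hr
    · exact ⟨_, J, hJ, hr, C.isGeodesicOn_geodesic a, fun s hs => if_pos hs⟩
    · exact ⟨_, I, isOpen_Ioo, hr, hh', hkI⟩
  have hconn : (J ∪ I).OrdConnected :=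
    (hJc.isPreconnected.union u hu huI isPreconnected_Ioo).ordConnected
  have h0J : (0 : ℝ) ∈ J := C.zero_mem_geodesicDomain a
  have h1 := C.geodesic_eq (hJ.union isOpen_Ioo) hconn (Or.inl h0J) hkg
    ((if_pos h0J).trans (C.geodesic_zero a)) (Or.inr ht)
  exact ⟨h1.1, h1.2.trans (hkI t ht)⟩

/-- The geodesic flow is smooth on an open domain: near every point of its domain it is obtained by
composing local flows along a geodesic. -/
lemma eventually_contMDiffAt_geodesic {a₀ : TotalSpace F E} {t₀ : ℝ}
    (ht₀ : t₀ ∈ C.geodesicDomain a₀) :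
    ∀ᶠ p : ℝ × TotalSpace F E in 𝓝 (t₀, a₀), p.1 ∈ C.geodesicDomain p.2 ∧
      ContMDiffAt (𝓘(ℝ, ℝ).prod (𝓘(ℝ, EM).prod 𝓘(ℝ, F))) (𝓘(ℝ, EM).prod 𝓘(ℝ, F)) ∞
        (fun p : ℝ × TotalSpace F E => C.geodesic p.2 p.1) p := by
  set Good : ℝ → Prop := fun T => ∀ᶠ p : ℝ × TotalSpace F E in 𝓝 (T, a₀),
    p.1 ∈ C.geodesicDomain p.2 ∧
      ContMDiffAt (𝓘(ℝ, ℝ).prod (𝓘(ℝ, EM).prod 𝓘(ℝ, F))) (𝓘(ℝ, EM).prod 𝓘(ℝ, F)) ∞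
        (fun p : ℝ × TotalSpace F E => C.geodesic p.2 p.1) p with hGood
  have step : ∀ {η : ℝ} {W : Set (TotalSpace F E)} {Ψ : ℝ × TotalSpace F E → TotalSpace F E},
      IsOpen W → ContMDiffOn (𝓘(ℝ, ℝ).prod (𝓘(ℝ, EM).prod 𝓘(ℝ, F))) (𝓘(ℝ, EM).prod 𝓘(ℝ, F)) ∞ Ψ
        (Ioo (-η) η ×ˢ W) →
      (∀ a ∈ W, Ψ (0, a) = a ∧ C.IsGeodesicOn (fun s => Ψ (s, a)) (Ioo (-η) η)) →
      ∀ {u y : ℝ}, y - u ∈ Ioo (-η) η → C.geodesic a₀ u ∈ W → Good u → Good y := by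
    intro η W Ψ hW hΨ hΨg u y hy huW hu
    have hu1 : ∀ᶠ a in 𝓝 a₀, u ∈ C.geodesicDomain a ∧
        ContMDiffAt (𝓘(ℝ, EM).prod 𝓘(ℝ, F)) (𝓘(ℝ, EM).prod 𝓘(ℝ, F)) ∞
          (fun a => C.geodesic a u) a := by
      have hc : Tendsto (fun a : TotalSpace F E => (u, a)) (𝓝 a₀) (𝓝 (u, a₀)) :=
        (Continuous.prodMk_right u).tendsto a₀
      filter_upwards [hc.eventually hu] with a ha
      refine ⟨ha.1, ?_⟩
      exact ContMDiffAt.comp a (f := fun a : TotalSpace F E => (u, a)) ha.2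
        (contMDiffAt_const.prodMk contMDiffAt_id)
    have hu2 : ∀ᶠ a in 𝓝 a₀, C.geodesic a u ∈ W :=
      hu1.self_of_nhds.2.continuousAt.preimage_mem_nhds (hW.mem_nhds huW)
    have hloc : ∀ᶠ p : ℝ × TotalSpace F E in 𝓝 (y, a₀), p.1 - u ∈ Ioo (-η) η ∧
        C.geodesic p.2 u ∈ W ∧ u ∈ C.geodesicDomain p.2 ∧
        ContMDiffAt (𝓘(ℝ, EM).prod 𝓘(ℝ, F)) (𝓘(ℝ, EM).prod 𝓘(ℝ, F)) ∞
          (fun a => C.geodesic a u) p.2 := by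
      have h1 : ∀ᶠ r in 𝓝 y, r - u ∈ Ioo (-η) η :=
        (continuousAt_id.sub continuousAt_const).preimage_mem_nhds (isOpen_Ioo.mem_nhds hy)
      rw [nhds_prod_eq]
      filter_upwards [h1.prod_mk (hu1.and hu2)] with p hp
      exact ⟨hp.1, hp.2.2, hp.2.1.1, hp.2.1.2⟩
    have hval : ∀ p : ℝ × TotalSpace F E, p.1 - u ∈ Ioo (-η) η → C.geodesic p.2 u ∈ W →
        u ∈ C.geodesicDomain p.2 →
        p.1 ∈ C.geodesicDomain p.2 ∧ C.geodesic p.2 p.1 = Ψ (p.1 - u, C.geodesic p.2 u) :=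
      fun p h1 h2 h3 => C.geodesic_concat h3 (hΨg _ h2).2 (hΨg _ h2).1
        ⟨by linarith [h1.1], by linarith [h1.2]⟩
    filter_upwards [eventually_eventually_nhds.2 hloc] with p hp
    have hp0 := hp.self_of_nhds
    refine ⟨(hval p hp0.1 hp0.2.1 hp0.2.2.1).1, ?_⟩
    have h2 : ContMDiffAt (𝓘(ℝ, ℝ).prod (𝓘(ℝ, EM).prod 𝓘(ℝ, F))) (𝓘(ℝ, EM).prod 𝓘(ℝ, F)) ∞
        (fun p : ℝ × TotalSpace F E => Ψ (p.1 - u, C.geodesic p.2 u)) p := by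
      have h3 : ContMDiffAt (𝓘(ℝ, ℝ).prod (𝓘(ℝ, EM).prod 𝓘(ℝ, F))) 𝓘(ℝ, ℝ) ∞
          (fun p : ℝ × TotalSpace F E => p.1 - u) p := contMDiffAt_fst.sub contMDiffAt_const
      have h4 : ContMDiffAt (𝓘(ℝ, ℝ).prod (𝓘(ℝ, EM).prod 𝓘(ℝ, F))) (𝓘(ℝ, EM).prod 𝓘(ℝ, F)) ∞
          (fun p : ℝ × TotalSpace F E => C.geodesic p.2 u) p :=
        ContMDiffAt.comp p (f := fun p : ℝ × TotalSpace F E => p.2) hp0.2.2.2 contMDiffAt_snd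
      exact ContMDiffAt.comp p (f := fun p : ℝ × TotalSpace F E => (p.1 - u, C.geodesic p.2 u))
        (hΨ.contMDiffAt ((isOpen_Ioo.prod hW).mem_nhds ⟨hp0.1, hp0.2.1⟩)) (h3.prodMk h4)
    refine h2.congr_of_eventuallyEq ?_
    filter_upwards [hp] with q hq using (hval q hq.1 hq.2.1 hq.2.2.1).2
  have hbase : Good 0 := by
    obtain ⟨η, W, Ψ, hη, hW, haW, hΨ, hΨg⟩ := C.exists_local_flow a₀
    have hmem : Ioo (-η) η ×ˢ W ∈ 𝓝 ((0 : ℝ), a₀) :=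
      (isOpen_Ioo.prod hW).mem_nhds ⟨⟨by linarith, hη⟩, haW⟩
    have hval : ∀ p ∈ Ioo (-η) η ×ˢ W, p.1 ∈ C.geodesicDomain p.2 ∧ C.geodesic p.2 p.1 = Ψ p := by
      intro p hp
      exact C.geodesic_eq isOpen_Ioo ordConnected_Ioo ⟨by linarith, hη⟩ (hΨg _ hp.2).2
        (hΨg _ hp.2).1 hp.1
    filter_upwards [eventually_eventually_nhds.2 hmem] with p hp
    refine ⟨(hval p hp.self_of_nhds).1, (hΨ.contMDiffAt hp).congr_of_eventuallyEq ?_⟩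
    filter_upwards [hp] with q hq using (hval q hq).2
  refine (C.ordConnected_geodesicDomain a₀).isPreconnected.induction₂'
    (fun s t => Good s → Good t) (fun s hs => ?_) (fun _ _ _ _ _ _ h1 h2 h => h2 (h1 h))
    (C.zero_mem_geodesicDomain a₀) ht₀ hbase
  obtain ⟨η, W, Ψ, hη, hW, haW, hΨ, hΨg⟩ := C.exists_local_flow (C.geodesic a₀ s)
  have hc : ContinuousAt (C.geodesic a₀) s := ((C.isGeodesicOn_geodesic a₀).1.1.contMDiffAt
    ((C.isOpen_geodesicDomain a₀).mem_nhds hs)).continuousAt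
  refine nhdsWithin_le_nhds ?_
  filter_upwards [hc.preimage_mem_nhds (hW.mem_nhds haW),
    Ioo_mem_nhds (show s - η < s by linarith) (show s < s + η by linarith)] with y hyW hy
  exact ⟨step hW hΨ hΨg ⟨by linarith [hy.1], by linarith [hy.2]⟩ haW,
    step hW hΨ hΨg ⟨by linarith [hy.2], by linarith [hy.1]⟩ hyW⟩

/-- The domain of the geodesic flow. -/
def flowDomain : Set (ℝ × TotalSpace F E) := {p | p.1 ∈ C.geodesicDomain p.2}

lemma isOpen_flowDomain : IsOpen C.flowDomain :=
  isOpen_iff_mem_nhds.2 fun p hp =>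
    (C.eventually_contMDiffAt_geodesic (t₀ := p.1) (a₀ := p.2) hp).mono fun _ h => h.1

lemma contMDiffAt_geodesic {p : ℝ × TotalSpace F E} (hp : p ∈ C.flowDomain) :
    ContMDiffAt (𝓘(ℝ, ℝ).prod (𝓘(ℝ, EM).prod 𝓘(ℝ, F))) (𝓘(ℝ, EM).prod 𝓘(ℝ, F)) ∞
      (fun p : ℝ × TotalSpace F E => C.geodesic p.2 p.1) p :=
  (C.eventually_contMDiffAt_geodesic (t₀ := p.1) (a₀ := p.2) hp).self_of_nhds.2

/-- The scaling property of geodesics. -/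
lemma geodesic_smul {a : TotalSpace F E} {c r : ℝ} (h : c * r ∈ C.geodesicDomain a) :
    r ∈ C.geodesicDomain ⟨a.1, c • a.2⟩ ∧ C.geodesic ⟨a.1, c • a.2⟩ r =
      ⟨(C.geodesic a (c * r)).1, c • (C.geodesic a (c * r)).2⟩ := by
  have hJ := C.isOpen_geodesicDomain a
  have hg := (C.isGeodesicOn_geodesic a).comp_affine hJ c 0
  have hset : {r | c * r + 0 ∈ C.geodesicDomain a} = (fun r => c * r) ⁻¹' C.geodesicDomain a := by
    ext r
    simp
  have hconv : Convex ℝ {r | c * r + 0 ∈ C.geodesicDomain a} := by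
    rw [hset]
    exact (C.ordConnected_geodesicDomain a).convex.is_linear_preimage (𝕜 := ℝ)
      (f := fun r : ℝ => c * r) ⟨fun x y => mul_add c x y, fun x y => by
        simp only [smul_eq_mul]; ring⟩
  have h0 : (0 : ℝ) ∈ {r | c * r + 0 ∈ C.geodesicDomain a} := by
    simpa using C.zero_mem_geodesicDomain a
  have hr : r ∈ {r | c * r + 0 ∈ C.geodesicDomain a} := by simpa using h
  have hs : ∀ b b' : TotalSpace F E, b = b' →
      (⟨b.1, c • b.2⟩ : TotalSpace F E) = ⟨b'.1, c • b'.2⟩ := by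
    rintro _ _ rfl
    rfl
  have h2 := C.geodesic_eq (a := ⟨a.1, c • a.2⟩) (hJ.preimage (by fun_prop)) hconv.ordConnected h0
    hg (hs _ _ (by simp)) hr
  exact ⟨h2.1, h2.2.trans (hs _ _ (by rw [add_zero]))⟩

end AConnection

end Flow

/-! ### Families of `A`-paths -/

section PartialDerivatives

variable {G : Type*} [NormedAddCommGroup G] [NormedSpace ℝ G]

/-- The partial derivative with respect to the first variable. -/
noncomputable def partialFst (h : ℝ × ℝ → G) (p : ℝ × ℝ) : G := fderiv ℝ h p (1, 0)

/-- The partial derivative with respect to the second variable. -/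
noncomputable def partialSnd (h : ℝ × ℝ → G) (p : ℝ × ℝ) : G := fderiv ℝ h p (0, 1)

variable {h : ℝ × ℝ → G} {O : Set (ℝ × ℝ)}

lemma contDiffOn_partialSnd (hO : IsOpen O) (hh : ContDiffOn ℝ ∞ h O) :
    ContDiffOn ℝ ∞ (partialSnd h) O :=
  (hh.fderiv_of_isOpen hO (m := ∞) (by simp)).clm_apply contDiffOn_const

lemma hasFDerivAt_of_contDiffOn (hO : IsOpen O) (hh : ContDiffOn ℝ ∞ h O) {p : ℝ × ℝ}
    (hp : p ∈ O) : HasFDerivAt h (fderiv ℝ h p) p :=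
  ((hh.contDiffAt (hO.mem_nhds hp)).differentiableAt (by simp)).hasFDerivAt

lemma hasDerivAt_partialFst (hO : IsOpen O) (hh : ContDiffOn ℝ ∞ h O) {t ε : ℝ}
    (hp : (t, ε) ∈ O) : HasDerivAt (fun r => h (r, ε)) (partialFst h (t, ε)) t :=
  HasFDerivAt.comp_hasDerivAt t (hasFDerivAt_of_contDiffOn hO hh hp)
    ((hasDerivAt_id t).prodMk (hasDerivAt_const t ε))

lemma hasDerivAt_partialSnd (hO : IsOpen O) (hh : ContDiffOn ℝ ∞ h O) {t ε : ℝ}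
    (hp : (t, ε) ∈ O) : HasDerivAt (fun r => h (t, r)) (partialSnd h (t, ε)) ε :=
  HasFDerivAt.comp_hasDerivAt ε (hasFDerivAt_of_contDiffOn hO hh hp)
    ((hasDerivAt_const ε t).prodMk (hasDerivAt_id ε))

/-- Symmetry of second derivatives. -/
lemma partialFst_partialSnd (hO : IsOpen O) (hh : ContDiffOn ℝ ∞ h O) {p : ℝ × ℝ} (hp : p ∈ O) :
    partialFst (partialSnd h) p = partialSnd (partialFst h) p := by
  have h1 : ContDiffAt ℝ ∞ h p := hh.contDiffAt (hO.mem_nhds hp)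
  have h2 : IsSymmSndFDerivAt ℝ h p := h1.isSymmSndFDerivAt (by
    rw [minSmoothness_of_isRCLikeNormedField]
    exact (WithTop.coe_le_coe.2 le_top : ((2 : ℕ∞) : WithTop ℕ∞) ≤ ∞))
  have h3 : DifferentiableAt ℝ (fderiv ℝ h) p :=
    (h1.fderiv_right (m := ∞) (by simp)).differentiableAt (by simp)
  have h4 : ∀ v w : ℝ × ℝ, fderiv ℝ (fun q => fderiv ℝ h q v) p w = fderiv ℝ (fderiv ℝ h) p w v := by
    intro v w
    have h5 := h3.hasFDerivAt.clm_apply (hasFDerivAt_const v p)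
    rw [h5.fderiv]
    simp
  change fderiv ℝ (fun q => fderiv ℝ h q (0, 1)) p (1, 0) =
    fderiv ℝ (fun q => fderiv ℝ h q (1, 0)) p (0, 1)
  rw [h4, h4]
  exact h2 _ _

end PartialDerivatives

section Family

variable {EM : Type*} [NormedAddCommGroup EM] [NormedSpace ℝ EM]
  {M : Type*} [TopologicalSpace M] [ChartedSpace EM M] [IsManifold 𝓘(ℝ, EM) ∞ M]
  {F : Type*} [NormedAddCommGroup F] [NormedSpace ℝ F]
  {E : M → Type*} [TopologicalSpace (TotalSpace F E)]
  [∀ x, AddCommGroup (E x)] [∀ x, Module ℝ (E x)] [∀ x, TopologicalSpace (E x)]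
  [∀ x, IsTopologicalAddGroup (E x)] [∀ x, ContinuousSMul ℝ (E x)]
  [FiberBundle F E] [VectorBundle ℝ F E]
  [FiniteDimensional ℝ EM] [FiniteDimensional ℝ F] [T2Space M] [SigmaCompactSpace M]
  [ContMDiffVectorBundle ∞ F E 𝓘(ℝ, EM)]
  {L : PreLieAlgebroid EM F E}

variable (L) in
/-- A smooth family of `A`-paths `t ↦ G (t, ε)` with a fixed initial point in `M`, such that
`G (·, 0)` is defined on `[0, 1]`. -/
structure IsAPathFamily (G : ℝ × ℝ → TotalSpace F E) (O : Set (ℝ × ℝ)) : Prop where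
  isOpen : IsOpen O
  smooth : ContMDiffOn 𝓘(ℝ, ℝ × ℝ) (𝓘(ℝ, EM).prod 𝓘(ℝ, F)) ∞ G O
  velocity : ∀ t ε, (t, ε) ∈ O →
    HasVelocityAt (fun r => (G (r, ε)).1) t (L.anchor (G (t, ε)).1 (G (t, ε)).2)
  mem : ∀ t ∈ Icc (0 : ℝ) 1, (t, (0 : ℝ)) ∈ O
  base_zero : ∀ ε, (0, ε) ∈ O → (G (0, ε)).1 = (G (0, 0)).1

namespace IsAPathFamily

variable {G : ℝ × ℝ → TotalSpace F E} {O : Set (ℝ × ℝ)} (hG : IsAPathFamily L G O)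
  {ι : Type} [Fintype ι] (P : PartialFrame EM F E ι)

lemma contMDiffOn_base (hG : IsAPathFamily L G O) :
    ContMDiffOn 𝓘(ℝ, ℝ × ℝ) 𝓘(ℝ, EM) ∞ (fun p => (G p).1) O :=
  (contMDiff_proj E).comp_contMDiffOn hG.smooth

lemma contDiffOn_coord (hG : IsAPathFamily L G O) (k : ι) :
    ContDiffOn ℝ ∞ (fun p => P.coord k (G p).1 (G p).2) O :=
  ((P.contMDiff_coord k).comp_contMDiffOn hG.smooth).contDiffOn

lemma contDiffOn_comp (hG : IsAPathFamily L G O) (f : C^∞⟮𝓘(ℝ, EM), M; ℝ⟯) :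
    ContDiffOn ℝ ∞ (fun p => f (G p).1) O :=
  (f.contMDiff.comp_contMDiffOn hG.contMDiffOn_base).contDiffOn

/-- The derivative of the family of base curves with respect to the parameter. -/
noncomputable def _root_.PreLie.variationField (EM : Type*) [NormedAddCommGroup EM]
    [NormedSpace ℝ EM] {M : Type*} [TopologicalSpace M] [ChartedSpace EM M] {F : Type*}
    {E : M → Type*} (G : ℝ × ℝ → TotalSpace F E) (t ε : ℝ) :
    TangentSpace 𝓘(ℝ, EM) (G (t, ε)).1 :=
  (mfderiv 𝓘(ℝ, ℝ) 𝓘(ℝ, EM) (fun ε => (G (t, ε)).1) ε (1 : ℝ) : EM)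

lemma hasVelocityAt_variationField (hG : IsAPathFamily L G O) {t ε : ℝ} (hp : (t, ε) ∈ O) :
    HasVelocityAt (fun ε => (G (t, ε)).1) ε (variationField EM G t ε) := by
  refine hasVelocityAt_mfderiv ?_
  have h1 : ContMDiffAt 𝓘(ℝ, ℝ × ℝ) 𝓘(ℝ, EM) ∞ (fun p => (G p).1) (t, ε) :=
    hG.contMDiffOn_base.contMDiffAt (hG.isOpen.mem_nhds hp)
  have h2 : ContMDiffAt 𝓘(ℝ, ℝ) 𝓘(ℝ, ℝ × ℝ) ∞ (fun r : ℝ => (t, r)) ε :=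
    (contDiff_const.prodMk contDiff_id).contMDiff.contMDiffAt
  exact (ContMDiffAt.comp ε h1 h2).mdifferentiableAt (by simp)

lemma dirDeriv_variationField (hG : IsAPathFamily L G O) {t ε : ℝ} (hp : (t, ε) ∈ O)
    (f : C^∞⟮𝓘(ℝ, EM), M; ℝ⟯) :
    dirDeriv f (variationField EM G t ε) = partialSnd (fun p => f (G p).1) (t, ε) :=
  ((hG.hasVelocityAt_variationField hp).hasDerivAt_dirDeriv f).unique
    (hasDerivAt_partialSnd hG.isOpen (hG.contDiffOn_comp f) hp)

lemma partialFst_comp (hG : IsAPathFamily L G O) {t ε : ℝ} (hp : (t, ε) ∈ O)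
    (hP : (G (t, ε)).1 ∈ P.domain) (f : C^∞⟮𝓘(ℝ, EM), M; ℝ⟯) :
    partialFst (fun p => f (G p).1) (t, ε) =
      ∑ i, P.coord i (G (t, ε)).1 (G (t, ε)).2 * L.anchorDeriv (P.sec i) f (G (t, ε)).1 := by
  have h1 := (hasDerivAt_partialFst hG.isOpen (hG.contDiffOn_comp f) hp).unique
    ((hG.velocity t ε hp).hasDerivAt_dirDeriv f)
  rw [h1, L.anchor_eq_sum P hP, dirDeriv_sum]
  simp only [dirDeriv_smul, PreLieAlgebroid.anchorDeriv_apply]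

/-- The linear differential equation that describes the variation of a family of `A`-paths:
the coordinates of a section along the central curve, with initial value zero, that differ from
the parameter derivative of the coordinates of the family by the bracket term. -/
structure _root_.PreLie.IsVariationSolution (L : PreLieAlgebroid EM F E)
    (P : PartialFrame EM F E ι) (G : ℝ × ℝ → TotalSpace F E) (V : ι → ℝ → ℝ) : Prop where
  zero : ∀ k, V k 0 = 0
  hasDerivAt : ∀ t ∈ Icc (0 : ℝ) 1, ∀ k, HasDerivAt (V k)
    (partialSnd (fun p => P.coord k (G p).1 (G p).2) (t, 0) -
      ∑ i, ∑ j, P.coord i (G (t, 0)).1 (G (t, 0)).2 * V j t *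
        P.coeff k (L.bracket (P.sec i) (P.sec j)) (G (t, 0)).1) t

variable {V : ι → ℝ → ℝ}

/-- The difference between the anchor of a variation solution and the variation field, applied to
a function. -/
noncomputable def _root_.PreLie.anchorDefect (L : PreLieAlgebroid EM F E)
    (P : PartialFrame EM F E ι) (G : ℝ × ℝ → TotalSpace F E) (V : ι → ℝ → ℝ)
    (f : C^∞⟮𝓘(ℝ, EM), M; ℝ⟯) (t : ℝ) : ℝ :=
  ∑ k, V k t * L.anchorDeriv (P.sec k) f (G (t, 0)).1 - partialSnd (fun p => f (G p).1) (t, 0)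

lemma anchorDefect_eq (hG : IsAPathFamily L G O) {t : ℝ} (ht : (t, 0) ∈ O)
    (f : C^∞⟮𝓘(ℝ, EM), M; ℝ⟯) :
    anchorDefect L P G V f t = dirDeriv f (L.anchor (G (t, 0)).1
      (∑ k, V k t • P.sec k (G (t, 0)).1) - variationField EM G t 0) := by
  rw [dirDeriv_sub, hG.dirDeriv_variationField ht, map_sum, dirDeriv_sum]
  simp only [map_smul, dirDeriv_smul]
  rfl

/-- The key computation behind anchoring: the defect satisfies a homogeneous linear differential
equation along the anchor, because the anchor turns brackets into commutators. -/
lemma hasDerivAt_anchorDefect (hG : IsAPathFamily L G O) (hV : IsVariationSolution L P G V) {t : ℝ}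
    (ht : t ∈ Icc (0 : ℝ) 1) (hP : (G (t, 0)).1 ∈ P.domain) (f : C^∞⟮𝓘(ℝ, EM), M; ℝ⟯) :
    HasDerivAt (anchorDefect L P G V f)
      (∑ i, P.coord i (G (t, 0)).1 (G (t, 0)).2 *
        anchorDefect L P G V (L.anchorDeriv (P.sec i) f) t) t := by
  have hO := hG.mem t ht
  set x := (G (t, 0)).1 with hx
  set u : ι → ℝ := fun i => P.coord i (G (t, 0)).1 (G (t, 0)).2 with hu
  set U : ι → ℝ × ℝ → ℝ := fun i p => P.coord i (G p).1 (G p).2 with hU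
  have hA : ∀ k, HasDerivAt (fun r => L.anchorDeriv (P.sec k) f (G (r, 0)).1)
      (∑ i, u i * L.anchorDeriv (P.sec i) (L.anchorDeriv (P.sec k) f) x) t := fun k => by
    have h1 := hasDerivAt_partialFst hG.isOpen (hG.contDiffOn_comp (L.anchorDeriv (P.sec k) f)) hO
    rw [hG.partialFst_comp P hO hP] at h1
    exact h1
  have hev : (fun p => partialFst (fun p => f (G p).1) p) =ᶠ[𝓝 (t, 0)]
      fun p => ∑ i, U i p * L.anchorDeriv (P.sec i) f (G p).1 := by
    have h1 := (hG.contMDiffOn_base.contMDiffAt (hG.isOpen.mem_nhds hO)).continuousAt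
    filter_upwards [hG.isOpen.mem_nhds hO,
      h1.preimage_mem_nhds (P.isOpen_domain.mem_nhds hP)] with p hp hp'
    exact hG.partialFst_comp P hp hp' f
  have hB : HasDerivAt (fun r => partialSnd (fun p => f (G p).1) (r, 0))
      (∑ i, (partialSnd (U i) (t, 0) * L.anchorDeriv (P.sec i) f x +
        u i * partialSnd (fun p => L.anchorDeriv (P.sec i) f (G p).1) (t, 0))) t := by
    have h1 := hasDerivAt_partialFst hG.isOpen
      (contDiffOn_partialSnd hG.isOpen (hG.contDiffOn_comp f)) hO
    rw [partialFst_partialSnd hG.isOpen (hG.contDiffOn_comp f) hO] at h1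
    have h2 : partialSnd (partialFst fun p => f (G p).1) (t, 0) =
        ∑ i, (partialSnd (U i) (t, 0) * L.anchorDeriv (P.sec i) f x +
          u i * partialSnd (fun p => L.anchorDeriv (P.sec i) f (G p).1) (t, 0)) := by
      have h3 : partialSnd (partialFst fun p => f (G p).1) (t, 0) =
          partialSnd (fun p => ∑ i, U i p * L.anchorDeriv (P.sec i) f (G p).1) (t, 0) := by
        unfold partialSnd
        rw [hev.fderiv_eq]
      rw [h3]
      have h4 : ContDiffOn ℝ ∞ (fun p => ∑ i, U i p * L.anchorDeriv (P.sec i) f (G p).1) O :=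
        ContDiffOn.sum fun i _ => (hG.contDiffOn_coord P i).mul (hG.contDiffOn_comp _)
      refine (hasDerivAt_partialSnd hG.isOpen h4 hO).unique ?_
      exact HasDerivAt.fun_sum fun i _ =>
        (hasDerivAt_partialSnd hG.isOpen (hG.contDiffOn_coord P i) hO).mul
          (hasDerivAt_partialSnd hG.isOpen (hG.contDiffOn_comp _) hO)
    rw [h2] at h1
    exact h1
  have hC := (HasDerivAt.fun_sum (u := Finset.univ) fun k _ =>
    (hV.hasDerivAt t ht k).mul (hA k)).sub hB
  refine hC.congr_deriv ?_
  -- the anchor of the bracket term is a commutator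
  have hbr : ∀ i j, ∑ k, P.coeff k (L.bracket (P.sec i) (P.sec j)) x *
      L.anchorDeriv (P.sec k) f x = L.anchorDeriv (P.sec i) (L.anchorDeriv (P.sec j) f) x -
        L.anchorDeriv (P.sec j) (L.anchorDeriv (P.sec i) f) x := fun i j => by
    have h1 := L.dirDeriv_anchor_bracket (P.sec i) (P.sec j) f x
    rw [L.anchor_eq_sum P hP, dirDeriv_sum] at h1
    simp only [dirDeriv_smul] at h1
    exact h1
  have e1 : ∑ k, ∑ i, ∑ j, u i * V j t * P.coeff k (L.bracket (P.sec i) (P.sec j)) x *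
      L.anchorDeriv (P.sec k) f x = ∑ i, ∑ j, u i * V j t *
        (L.anchorDeriv (P.sec i) (L.anchorDeriv (P.sec j) f) x -
          L.anchorDeriv (P.sec j) (L.anchorDeriv (P.sec i) f) x) := by
    rw [Finset.sum_comm]
    refine Finset.sum_congr rfl fun i _ => ?_
    rw [Finset.sum_comm]
    refine Finset.sum_congr rfl fun j _ => ?_
    rw [← hbr, Finset.mul_sum]
    exact Finset.sum_congr rfl fun k _ => by ring
  have e2 : ∑ k, V k t * ∑ i, u i * L.anchorDeriv (P.sec i) (L.anchorDeriv (P.sec k) f) x =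
      ∑ i, ∑ j, u i * V j t * L.anchorDeriv (P.sec i) (L.anchorDeriv (P.sec j) f) x := by
    simp only [Finset.mul_sum]
    rw [Finset.sum_comm]
    exact Finset.sum_congr rfl fun i _ => Finset.sum_congr rfl fun j _ => by ring
  have e3 : ∑ i, u i * anchorDefect L P G V (L.anchorDeriv (P.sec i) f) t =
      ∑ i, ∑ j, u i * V j t * L.anchorDeriv (P.sec j) (L.anchorDeriv (P.sec i) f) x -
        ∑ i, u i * partialSnd (fun p => L.anchorDeriv (P.sec i) f (G p).1) (t, 0) := by
    simp only [anchorDefect, mul_sub, Finset.sum_sub_distrib, Finset.mul_sum, mul_assoc]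
    rfl
  rw [e3]
  simp only [sub_mul, Finset.sum_sub_distrib, Finset.sum_add_distrib, Finset.sum_mul]
  change _ - ∑ k, ∑ i, ∑ j, u i * V j t * P.coeff k (L.bracket (P.sec i) (P.sec j)) x *
      L.anchorDeriv (P.sec k) f x + ∑ k, V k t * ∑ i, u i *
        L.anchorDeriv (P.sec i) (L.anchorDeriv (P.sec k) f) x - _ = _
  rw [e1, e2]
  simp only [mul_sub, Finset.sum_sub_distrib]
  ring

end IsAPathFamily

end Family

/-! ### The anchor of the solution of the variation equation -/

section Anchoring

variable {EM : Type*} [NormedAddCommGroup EM] [NormedSpace ℝ EM]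
  {M : Type*} [TopologicalSpace M] [ChartedSpace EM M] [IsManifold 𝓘(ℝ, EM) ∞ M]
  {F : Type*} [NormedAddCommGroup F] [NormedSpace ℝ F]
  {E : M → Type*} [TopologicalSpace (TotalSpace F E)]
  [∀ x, AddCommGroup (E x)] [∀ x, Module ℝ (E x)] [∀ x, TopologicalSpace (E x)]
  [∀ x, IsTopologicalAddGroup (E x)] [∀ x, ContinuousSMul ℝ (E x)]
  [FiberBundle F E] [VectorBundle ℝ F E]
  [FiniteDimensional ℝ EM] [FiniteDimensional ℝ F] [T2Space M] [SigmaCompactSpace M]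
  [ContMDiffVectorBundle ∞ F E 𝓘(ℝ, EM)]
  {L : PreLieAlgebroid EM F E}

lemma mvfderiv_clm_comp {G G' : Type*} [NormedAddCommGroup G] [NormedSpace ℝ G]
    [NormedAddCommGroup G'] [NormedSpace ℝ G'] (l : G →L[ℝ] G') {f : M → G} {x : M}
    (hf : MDifferentiableAt 𝓘(ℝ, EM) 𝓘(ℝ, G) f x) (v : TangentSpace 𝓘(ℝ, EM) x) :
    mvfderiv 𝓘(ℝ, EM) (fun y => l (f y)) x v = l (mvfderiv 𝓘(ℝ, EM) f x v) := by
  have h2 : HasMFDerivAt 𝓘(ℝ, EM) 𝓘(ℝ, G') (fun y => l (f y)) x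
      (l.comp (mfderiv 𝓘(ℝ, EM) 𝓘(ℝ, G) f x : EM →L[ℝ] G)) :=
    HasMFDerivAt.comp x l.hasFDerivAt.hasMFDerivAt hf.hasMFDerivAt
  exact congrArg (fun A : EM →L[ℝ] G' => A v) h2.mfderiv

namespace BundleChart

variable {ι : Type} [Fintype ι] (B : BundleChart EM F E ι) {G : Type*} [NormedAddCommGroup G]
  [NormedSpace ℝ G]

/-- A function of time and a point of the base, in coordinates. -/
noncomputable def localRep (h : ℝ × M → G) (q : ℝ × EM) : G := h (q.1, B.basePoint q.2)

variable {h : ℝ × M → G} {T : Set ℝ}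

lemma contDiffOn_localRep
    (hh : ContMDiffOn (𝓘(ℝ, ℝ).prod 𝓘(ℝ, EM)) 𝓘(ℝ, G) ∞ h (T ×ˢ univ)) :
    ContDiffOn ℝ ∞ (B.localRep h) (T ×ˢ B.baseTarget) := by
  have h1 : ContMDiffOn 𝓘(ℝ, ℝ × EM) (𝓘(ℝ, ℝ).prod 𝓘(ℝ, EM)) ∞
      (fun q : ℝ × EM => (q.1, B.basePoint q.2)) (T ×ˢ B.baseTarget) :=
    contDiff_fst.contMDiff.contMDiffOn.prodMk
      (B.contMDiffOn_basePoint.comp contDiff_snd.contMDiff.contMDiffOn fun q hq => hq.2)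
  exact (hh.comp h1 fun q hq => ⟨hq.1, mem_univ _⟩).contDiffOn

/-- The differential in the direction of the manifold, computed in coordinates. -/
lemma mvfderiv_eq_fderivWithin
    (hh : ContMDiffOn (𝓘(ℝ, ℝ).prod 𝓘(ℝ, EM)) 𝓘(ℝ, G) ∞ h (T ×ˢ univ)) {t : ℝ}
    (ht : t ∈ T) {x : M} (hx : x ∈ B.source) (w : TangentSpace 𝓘(ℝ, EM) x) :
    mvfderiv 𝓘(ℝ, EM) (fun y => h (t, y)) x w =
      fderivWithin ℝ (B.localRep h) (T ×ˢ B.baseTarget) (t, B.base x)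
        (0, mvfderiv 𝓘(ℝ, EM) B.base x w) := by
  have hm : (t, B.base x) ∈ T ×ˢ B.baseTarget := ⟨ht, B.base_mem hx⟩
  have h1 : HasFDerivWithinAt (B.localRep h)
      (fderivWithin ℝ (B.localRep h) (T ×ˢ B.baseTarget) (t, B.base x)) (T ×ˢ B.baseTarget)
      (t, B.base x) :=
    ((B.contDiffOn_localRep hh).differentiableOn (by simp) _ hm).hasFDerivWithinAt
  have h2 : HasFDerivWithinAt (fun p : EM => (t, p))
      ((0 : EM →L[ℝ] ℝ).prod (ContinuousLinearMap.id ℝ EM)) B.baseTarget (B.base x) :=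
    (hasFDerivAt_const t _).prodMk (hasFDerivAt_id _) |>.hasFDerivWithinAt
  have h3 : HasFDerivAt (fun p => B.localRep h (t, p)) _ (B.base x) :=
    (h1.comp (B.base x) h2 fun p hp => ⟨ht, hp⟩).hasFDerivAt (B.isOpen_baseTarget.mem_nhds hm.2)
  have h4 : HasMFDerivAt 𝓘(ℝ, EM) 𝓘(ℝ, G) (fun y => B.localRep h (t, B.base y)) x _ :=
    HasMFDerivAt.comp (g := fun p => B.localRep h (t, p)) (f := B.base) x h3.hasMFDerivAt
      (((B.contMDiff_base x).mdifferentiableAt (by simp)).hasMFDerivAt)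
  have h5 : (fun y => h (t, y)) =ᶠ[𝓝 x] fun y => B.localRep h (t, B.base y) := by
    filter_upwards [B.isOpen_source.mem_nhds hx] with y hy
    unfold localRep
    rw [B.basePoint_base hy]
  have h6 := (h4.congr_of_eventuallyEq h5).mfderiv
  exact congrArg (fun A : EM →L[ℝ] G => A w) h6

end BundleChart

namespace IsAPathFamily

variable {G : ℝ × ℝ → TotalSpace F E} {O : Set (ℝ × ℝ)} {ι : Type} [Fintype ι]
  {P : PartialFrame EM F E ι} {V : ι → ℝ → ℝ}

lemma continuousAt_base (hG : IsAPathFamily L G O) {p : ℝ × ℝ} (hp : p ∈ O) :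
    ContinuousAt (fun p => (G p).1) p :=
  (hG.contMDiffOn_base.contMDiffAt (hG.isOpen.mem_nhds hp)).continuousAt

lemma continuousAt_centralBase (hG : IsAPathFamily L G O) {t : ℝ} (ht : (t, 0) ∈ O) :
    ContinuousAt (fun r => (G (r, 0)).1) t :=
  ContinuousAt.comp (f := fun r : ℝ => (r, (0 : ℝ))) (x := t) (hG.continuousAt_base ht)
    (Continuous.prodMk_left (0 : ℝ)).continuousAt

lemma variationField_zero (hG : IsAPathFamily L G O) : variationField EM G 0 0 = 0 := by
  have h0 : ((0 : ℝ), (0 : ℝ)) ∈ O := hG.mem 0 ⟨le_rfl, zero_le_one⟩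
  have h1 : (fun ε => (G (0, ε)).1) =ᶠ[𝓝 0] fun _ => (G (0, 0)).1 := by
    filter_upwards [(Continuous.prodMk_right (0 : ℝ)).continuousAt.preimage_mem_nhds
      (hG.isOpen.mem_nhds h0)] with ε hε using hG.base_zero ε hε
  have h2 : HasMFDerivAt 𝓘(ℝ, ℝ) 𝓘(ℝ, EM) (fun ε => (G (0, ε)).1) (0 : ℝ) (0 : ℝ →L[ℝ] EM) :=
    (hasMFDerivAt_const (G (0, 0)).1 (0 : ℝ)).congr_of_eventuallyEq h1
  exact congrArg (fun A : ℝ →L[ℝ] EM => A 1) h2.mfderiv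

/-- The defect vanishes initially and solves a homogeneous linear differential equation. As it lives in
varying tangent spaces, the equation is used in one chart at a time: the set of times at which the
defect vanishes is closed, and each of its points has a neighbourhood to the right inside it. -/
lemma anchorDefect_eq_zero (hG : IsAPathFamily L G O) (hV : IsVariationSolution L P G V)
    (hP : ∀ t ∈ Icc (0 : ℝ) 1, (G (t, 0)).1 ∈ P.domain) {t : ℝ} (ht : t ∈ Icc (0 : ℝ) 1)
    (f : C^∞⟮𝓘(ℝ, EM), M; ℝ⟯) : anchorDefect L P G V f t = 0 := by
  set S : Set ℝ := {t | ∀ f : C^∞⟮𝓘(ℝ, EM), M; ℝ⟯, anchorDefect L P G V f t = 0} with hS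
  suffices h : Icc 0 1 ⊆ S from h ht f
  have hcont : ∀ f : C^∞⟮𝓘(ℝ, EM), M; ℝ⟯, ContinuousOn (anchorDefect L P G V f) (Icc 0 1) :=
    fun f t ht => (hG.hasDerivAt_anchorDefect P hV ht (hP t ht) f).continuousAt.continuousWithinAt
  refine IsClosed.Icc_subset_of_forall_mem_nhdsWithin ?_ ?_ ?_
  · have h1 : S ∩ Icc 0 1 = ⋂ f : C^∞⟮𝓘(ℝ, EM), M; ℝ⟯,
        Icc 0 1 ∩ anchorDefect L P G V f ⁻¹' {0} := by
      ext t
      simp only [mem_inter_iff, mem_iInter, mem_preimage, mem_singleton_iff]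
      exact ⟨fun h f => ⟨h.2, h.1 f⟩, fun h => ⟨fun f => (h f).2, (h 0).1⟩⟩
    rw [h1]
    exact isClosed_iInter fun f => (hcont f).preimage_isClosed_of_isClosed isClosed_Icc
      isClosed_singleton
  · intro f
    rw [hG.anchorDefect_eq P (hG.mem 0 ⟨le_rfl, zero_le_one⟩), hG.variationField_zero]
    simp [hV.zero, dirDeriv_zero]
  · rintro t₀ ⟨ht₀S, ht₀⟩
    have ht₀' : t₀ ∈ Icc (0 : ℝ) 1 := Ico_subset_Icc_self ht₀
    obtain ⟨B, hB⟩ := BundleChart.exists_mem_source EM F E (G (t₀, 0)).1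
    obtain ⟨η, hη, hball⟩ := Metric.mem_nhds_iff.1
      ((hG.continuousAt_centralBase (hG.mem t₀ ht₀')).preimage_mem_nhds
        (B.isOpen_source.mem_nhds hB))
    rw [Real.ball_eq_Ioo] at hball
    set s := min (t₀ + η / 2) 1 with hs
    have hts : t₀ < s := lt_min (by linarith) ht₀.2
    have hs1 : s ≤ 1 := min_le_right _ _
    have hI : Icc t₀ s ⊆ Icc (0 : ℝ) 1 := Icc_subset_Icc ht₀.1 hs1
    have hsrc : ∀ r ∈ Icc t₀ s, (G (r, 0)).1 ∈ B.source := fun r hr =>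
      hball ⟨by linarith [hr.1], by linarith [hr.2, min_le_left (t₀ + η / 2) 1]⟩
    -- the defect, as a tangent vector, and its coordinates
    set z : (r : ℝ) → TangentSpace 𝓘(ℝ, EM) (G (r, 0)).1 := fun r =>
      L.anchor (G (r, 0)).1 (∑ k, V k r • P.sec k (G (r, 0)).1) - variationField EM G r 0 with hz
    have hdef : ∀ (f : C^∞⟮𝓘(ℝ, EM), M; ℝ⟯), ∀ r ∈ Icc t₀ s,
        anchorDefect L P G V f r = dirDeriv f (z r) := fun f r hr =>
      hG.anchorDefect_eq P (hG.mem r (hI hr)) f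
    set y : ℝ → EM := fun r => mvfderiv 𝓘(ℝ, EM) B.base (G (r, 0)).1 (z r) with hy
    set Q : ι → ℝ × M → EM := fun i q =>
      mvfderiv 𝓘(ℝ, EM) B.base q.2 (L.anchor q.2 (P.sec i q.2)) with hQ
    have hQs : ∀ i, ContMDiff 𝓘(ℝ, EM) 𝓘(ℝ, EM) ∞ (fun x => Q i (0, x)) := fun i =>
      contMDiff_mvfderiv_apply B.contMDiff_base (L.contMDiff_anchor_section (P.sec i))
    have hQs' : ∀ i, ContMDiffOn (𝓘(ℝ, ℝ).prod 𝓘(ℝ, EM)) 𝓘(ℝ, EM) ∞ (Q i) (univ ×ˢ univ) :=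
      fun i => ((hQs i).comp contMDiff_snd).contMDiffOn
    have hbd : ∀ x : M, MDifferentiableAt 𝓘(ℝ, EM) 𝓘(ℝ, EM) B.base x := fun x =>
      (B.contMDiff_base x).mdifferentiableAt (by simp)
    set D : ι → ℝ → EM →L[ℝ] EM := fun i r =>
      (fderivWithin ℝ (B.localRep (Q i)) (univ ×ˢ B.baseTarget) (0, B.base (G (r, 0)).1)).comp
        ((0 : EM →L[ℝ] ℝ).prod (ContinuousLinearMap.id ℝ EM)) with hD
    set A : ℝ → EM →L[ℝ] EM := fun r =>
      ∑ i, P.coord i (G (r, 0)).1 (G (r, 0)).2 • D i r with hA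
    have hbase : ContinuousOn (fun r => (G (r, 0)).1) (Icc t₀ s) := fun r hr =>
      (hG.continuousAt_centralBase (hG.mem r (hI hr))).continuousWithinAt
    have hAc : ContinuousOn A (Icc t₀ s) := by
      refine continuousOn_finsetSum _ fun i _ => ContinuousOn.fun_smul
        (f := fun r => P.coord i (G (r, 0)).1 (G (r, 0)).2) (g := fun r => D i r) ?_ ?_
      · exact (hG.contDiffOn_coord P i).continuousOn.comp
          (Continuous.prodMk_left (0 : ℝ)).continuousOn fun r hr => hG.mem r (hI hr)
      · refine ContinuousOn.clm_comp ?_ continuousOn_const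
        refine ((B.contDiffOn_localRep (hQs' i)).continuousOn_fderivWithin
          (isOpen_univ.prod B.isOpen_baseTarget).uniqueDiffOn (by simp)).comp
          (continuousOn_const.prodMk (B.contMDiff_base.continuous.comp_continuousOn hbase)) ?_
        exact fun r hr => ⟨mem_univ _, B.base_mem (hsrc r hr)⟩
    have hyd : ∀ r ∈ Icc t₀ s, HasDerivAt y (A r (y r)) r := by
      intro r hr
      refine (hasDerivAt_iff_forall_dual (ContinuousLinearEquiv.refl ℝ EM)).2 fun l => ?_
      set l' : EM →L[ℝ] ℝ := LinearMap.toContinuousLinearMap l with hl'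
      set f : C^∞⟮𝓘(ℝ, EM), M; ℝ⟯ :=
        ⟨fun x => l' (B.base x), l'.contDiff.contMDiff.comp B.contMDiff_base⟩ with hf
      have hfv : ∀ (x : M) (v : TangentSpace 𝓘(ℝ, EM) x),
          dirDeriv f v = l (mvfderiv 𝓘(ℝ, EM) B.base x v) := fun x v =>
        mvfderiv_clm_comp l' (hbd x) v
      have h1 : (fun r => l (y r)) =ᶠ[𝓝 r] anchorDefect L P G V f := by
        filter_upwards [(Continuous.prodMk_left (0 : ℝ)).continuousAt.preimage_mem_nhds
          (hG.isOpen.mem_nhds (hG.mem r (hI hr)))] with r' hr'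
        rw [hG.anchorDefect_eq P hr' f, hfv]
      refine ((hG.hasDerivAt_anchorDefect P hV (hI hr) (hP r (hI hr)) f).congr_of_eventuallyEq
        h1).congr_deriv ?_
      simp only [hA, _root_.sum_apply, map_sum, _root_.smul_apply,
        map_smul, smul_eq_mul]
      refine Finset.sum_congr rfl fun i _ => ?_
      rw [hdef _ r hr]
      congr 1
      have h2 : ∀ x : M, L.anchorDeriv (P.sec i) f x = l' (Q i (0, x)) := fun x => by
        rw [PreLieAlgebroid.anchorDeriv_apply, hfv]
        rfl
      have h3 : dirDeriv (L.anchorDeriv (P.sec i) f) (z r) =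
          l' (mvfderiv 𝓘(ℝ, EM) (fun x => Q i (0, x)) (G (r, 0)).1 (z r)) := by
        rw [← mvfderiv_clm_comp l' ((hQs i _).mdifferentiableAt (by simp))]
        unfold dirDeriv
        congr 1
        congr 1
        exact funext h2
      rw [h3, B.mvfderiv_eq_fderivWithin (hQs' i) (mem_univ _) (hsrc r hr)]
      rfl
    obtain ⟨K, hK⟩ := isCompact_Icc.exists_bound_of_continuousOn hAc
    have hy0 : y t₀ = 0 := by
      have h1 : z t₀ = 0 := tangent_ext fun f => by
        rw [← hdef f t₀ (left_mem_Icc.2 hts.le), ht₀S f, dirDeriv_zero]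
      simp only [hy, h1, map_zero]
    have hyz : ∀ r ∈ Icc t₀ s, y r = 0 :=
      eq_zero_of_abs_deriv_le_mul_abs_self_of_eq_zero_right
        (fun r hr => (hyd r hr).continuousAt.continuousWithinAt)
        (fun r hr => (hyd r (Ico_subset_Icc_self hr)).hasDerivWithinAt) hy0
        (K := K) fun r hr => (ContinuousLinearMap.le_opNorm _ _).trans
          (mul_le_mul_of_nonneg_right (hK r (Ico_subset_Icc_self hr)) (norm_nonneg _))
    refine mem_of_superset (Icc_mem_nhdsGT hts) fun r hr f => ?_
    have h1 : z r = 0 :=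
      injective_mvfderiv_of_eventuallyEq_chart (B.source_subset_chart (hsrc r hr))
        (by filter_upwards [B.isOpen_source.mem_nhds (hsrc r hr)] with y hy using B.base_eq y hy)
        ((hyz r hr).trans (map_zero _).symm)
    rw [hdef f r hr, h1, dirDeriv_zero]

end IsAPathFamily

end Anchoring

/-! ### Solutions of the variation equation -/

/-- Inhomogeneous linear differential equations whose coefficients are smooth near
`[0, 1] × {p₀}` have solutions on `[0, 1]` with initial value `0` that depend smoothly on the
parameter. -/
lemma exists_linear_solution {X Y : Type*} [NormedAddCommGroup X] [NormedSpace ℝ X]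
    [FiniteDimensional ℝ X] [NormedAddCommGroup Y] [NormedSpace ℝ Y] [CompleteSpace Y]
    {Ω : Set (ℝ × X)}
    (hΩ : IsOpen Ω) {p₀ : X} (hp₀ : ∀ t ∈ Icc (0 : ℝ) 1, (t, p₀) ∈ Ω) {A : ℝ × X → Y →L[ℝ] Y}
    {B : ℝ × X → Y} (hA : ContDiffOn ℝ ∞ A Ω) (hB : ContDiffOn ℝ ∞ B Ω) :
    ∃ (N : Set X) (z : ℝ × X → Y), IsOpen N ∧ p₀ ∈ N ∧
      (∀ t ∈ Icc (0 : ℝ) 1, ContDiff ℝ ∞ (fun p => z (t, p))) ∧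
      ∀ p ∈ N, z (0, p) = 0 ∧ ∀ t ∈ Icc (0 : ℝ) 1, (t, p) ∈ Ω ∧
        HasDerivAt (fun r => z (r, p)) (A (t, p) (z (t, p)) + B (t, p)) t := by
  -- the augmented homogeneous equation for `(z, 1)`
  let i : Y →L[ℝ] Y × ℝ := ContinuousLinearMap.inl ℝ Y ℝ
  let f : Y × ℝ →L[ℝ] Y := ContinuousLinearMap.fst ℝ Y ℝ
  let s : Y × ℝ →L[ℝ] ℝ := ContinuousLinearMap.snd ℝ Y ℝ
  set q : ℝ × X → (Y × ℝ) →L[ℝ] (Y × ℝ) := fun p =>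
    i.comp ((A p).comp f + s.smulRight (B p)) with hq
  have hqs : ContDiffOn ℝ ∞ q Ω := contDiffOn_const.clm_comp
    ((hA.clm_comp contDiffOn_const).add (contDiffOn_const.smulRight hB))
  have hcpt : IsCompact (Icc (0 : ℝ) 1 ×ˢ {p₀}) := isCompact_Icc.prod isCompact_singleton
  have hsub : Icc (0 : ℝ) 1 ×ˢ {p₀} ⊆ Ω := by
    rintro ⟨t, p⟩ ⟨ht, hp⟩
    obtain rfl : p = p₀ := hp
    exact hp₀ t ht
  obtain ⟨g, hg, -, hgq⟩ := exists_contDiff_eventuallyEq_nhdsSet hcpt hΩ hsub hqs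
  have h1 := hgq.and (hΩ.mem_nhdsSet.2 hsub)
  rw [isCompact_Icc.nhdsSet_prod_eq isCompact_singleton, nhdsSet_singleton] at h1
  obtain ⟨pa, hpa, pb, hpb, hab⟩ := eventually_prod_iff.1 h1
  obtain ⟨N, hN, hNo, hpN⟩ := mem_nhds_iff.1 hpb
  let R : X → C(TimeInterval, (Y × ℝ) →L[ℝ] (Y × ℝ)) := fun p =>
    ⟨fun s : TimeInterval => g (s, p), hg.continuous.comp (by fun_prop)⟩
  let w : ℝ × X → Y × ℝ := fun p => extendCurve (resolvent (R p.2)) p.1 (0, 1)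
  have hw0 : ∀ p, w (0, p) = (0, 1) := fun p => by simp [w, resolvent_zero]
  have hwd : ∀ p, ∀ t ∈ Icc (0 : ℝ) 1, HasDerivAt (fun r => w (r, p)) (g (t, p) (w (t, p))) t := by
    intro p t ht
    have h2 := hasDerivAt_resolvent (R p) (t := t) ⟨by linarith [ht.1], by linarith [ht.2]⟩
    have h3 : extendCurve (R p) t = g (t, p) :=
      extendCurve_of_mem _ ⟨by linarith [ht.1], by linarith [ht.2]⟩
    rw [h3] at h2
    exact h2.clm_apply (hasDerivAt_const t ((0, 1) : Y × ℝ)) |>.congr_deriv (by simp [w])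
  have hgN : ∀ p ∈ N, ∀ t ∈ Icc (0 : ℝ) 1, g (t, p) = q (t, p) ∧ (t, p) ∈ Ω := fun p hp t ht =>
    hab (subset_of_mem_nhdsSet hpa ht) (hN hp)
  have hw1 : ∀ p ∈ N, ∀ t ∈ Icc (0 : ℝ) 1, (w (t, p)).2 = 1 := by
    intro p hp t ht
    have h2 : ∀ r ∈ Icc (0 : ℝ) 1, HasDerivAt (fun r => (w (r, p)).2) 0 r := fun r hr => by
      refine HasFDerivAt.comp_hasDerivAt r (s.hasFDerivAt (x := w (r, p))) (hwd p r hr)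
        |>.congr_deriv ?_
      rw [(hgN p hp r hr).1]
      simp [hq, s, i]
    have h3 := constant_of_has_deriv_right_zero
      (fun r hr => (h2 r hr).continuousAt.continuousWithinAt)
      (fun r hr => (h2 r (Ico_subset_Icc_self hr)).hasDerivWithinAt) t ht
    rw [h3, hw0]
  refine ⟨N, fun p => (w p).1, hNo, hpN, fun t ht => ?_, fun p hp => ⟨?_, fun t ht =>
    ⟨(hgN p hp t ht).2, ?_⟩⟩⟩
  · have h2 := contDiff_resolvent_of_contDiff hg (t := t) ⟨by linarith [ht.1], by linarith [ht.2]⟩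
    exact contDiff_fst.comp (h2.clm_apply contDiff_const)
  · simp [hw0]
  · refine HasFDerivAt.comp_hasDerivAt t (f.hasFDerivAt (x := w (t, p))) (hwd p t ht)
        |>.congr_deriv ?_
    rw [(hgN p hp t ht).1]
    simp [hq, f, i, s, hw1 p hp t ht]

section Variation

variable {EM : Type*} [NormedAddCommGroup EM] [NormedSpace ℝ EM]
  {M : Type*} [TopologicalSpace M] [ChartedSpace EM M] [IsManifold 𝓘(ℝ, EM) ∞ M]
  {F : Type*} [NormedAddCommGroup F] [NormedSpace ℝ F]
  {E : M → Type*} [TopologicalSpace (TotalSpace F E)]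
  [∀ x, AddCommGroup (E x)] [∀ x, Module ℝ (E x)] [∀ x, TopologicalSpace (E x)]
  [∀ x, IsTopologicalAddGroup (E x)] [∀ x, ContinuousSMul ℝ (E x)]
  [FiberBundle F E] [VectorBundle ℝ F E]
  [FiniteDimensional ℝ EM] [FiniteDimensional ℝ F] [T2Space M] [SigmaCompactSpace M]
  [ContMDiffVectorBundle ∞ F E 𝓘(ℝ, EM)]
  {L : PreLieAlgebroid EM F E} (C : AConnection L)

namespace AConnection

/-- The geodesics that start on the line `a + ε b` in a fibre. -/
noncomputable def geodesicFamily (a : TotalSpace F E) (b : E a.1) (p : ℝ × ℝ) : TotalSpace F E :=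
  C.geodesic ⟨a.1, a.2 + p.2 • b⟩ p.1

/-- The domain of `geodesicFamily`. -/
def familyDomain (a : TotalSpace F E) (b : E a.1) : Set (ℝ × ℝ) :=
  {p | p.1 ∈ C.geodesicDomain ⟨a.1, a.2 + p.2 • b⟩}

lemma contMDiff_line (a : TotalSpace F E) (b : E a.1) :
    ContMDiff 𝓘(ℝ, ℝ) (𝓘(ℝ, EM).prod 𝓘(ℝ, F)) ∞
      (fun ε : ℝ => (⟨a.1, a.2 + ε • b⟩ : TotalSpace F E)) := by
  have hc : ∀ v : E a.1, ContMDiffOn 𝓘(ℝ, ℝ) (𝓘(ℝ, EM).prod 𝓘(ℝ, F)) ∞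
      (fun _ : ℝ => (⟨a.1, v⟩ : TotalSpace F E)) univ := fun v => contMDiffOn_const
  have h := contMDiff_smul_add (I := 𝓘(ℝ, ℝ)) (N := ℝ) (c := fun _ => 1) (d := fun ε => ε)
    (S := univ) (f := fun _ => a.1) (v := fun _ => a.2) (w := fun _ => b) contMDiffOn_const
    contMDiffOn_id (hc _) (hc _)
  exact contMDiffOn_univ.1 (by simpa using h)

lemma isAPathFamily_geodesicFamily {a : TotalSpace F E} (ha : 1 ∈ C.geodesicDomain a) (b : E a.1) :
    IsAPathFamily L (C.geodesicFamily a b) (C.familyDomain a b) := by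
  have hl : ContMDiff 𝓘(ℝ, ℝ × ℝ) (𝓘(ℝ, ℝ).prod (𝓘(ℝ, EM).prod 𝓘(ℝ, F))) ∞
      (fun p : ℝ × ℝ => (p.1, (⟨a.1, a.2 + p.2 • b⟩ : TotalSpace F E))) :=
    contDiff_fst.contMDiff.prodMk ((contMDiff_line a b).comp contDiff_snd.contMDiff)
  refine ⟨C.isOpen_flowDomain.preimage hl.continuous, fun p hp => ?_, fun t ε hp => ?_,
    fun t ht => ?_, fun ε _ => ?_⟩
  · exact (ContMDiffAt.comp p (C.contMDiffAt_geodesic hp) (hl p)).contMDiffWithinAt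
  · exact (C.isGeodesicOn_geodesic ⟨a.1, a.2 + ε • b⟩).1.hasVelocityAt hp
  · have h1 : (⟨a.1, a.2 + (0 : ℝ) • b⟩ : TotalSpace F E) = a := by simp
    change t ∈ C.geodesicDomain _
    simp only [h1]
    exact (C.ordConnected_geodesicDomain a).out (C.zero_mem_geodesicDomain a) ha ht
  · simp [geodesicFamily]

lemma geodesicFamily_zero (a : TotalSpace F E) (b : E a.1) (t : ℝ) :
    C.geodesicFamily a b (t, 0) = C.geodesic a t := by
  simp [geodesicFamily]

/-- Near every `a₀` whose geodesic is defined up to time `1`, solutions of the variation equation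
exist, and their values at time `1` depend smoothly on `a`. -/
lemma exists_variationSolution {a₀ : TotalSpace F E} (ha₀ : 1 ∈ C.geodesicDomain a₀) {ι : Type}
    [Fintype ι] (P : PartialFrame EM F E ι)
    (hP : ∀ t ∈ Icc (0 : ℝ) 1, (C.geodesic a₀ t).1 ∈ P.domain) (β : Cₛ^∞⟮𝓘(ℝ, EM); F, E⟯) :
    ∃ (W : Set (TotalSpace F E)) (V : ι → ℝ → TotalSpace F E → ℝ), IsOpen W ∧ a₀ ∈ W ∧
      (∀ k, ContMDiffOn (𝓘(ℝ, EM).prod 𝓘(ℝ, F)) 𝓘(ℝ, ℝ) ∞ (V k 1) W) ∧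
      ∀ a ∈ W, (∀ t ∈ Icc (0 : ℝ) 1, t ∈ C.geodesicDomain a ∧ (C.geodesic a t).1 ∈ P.domain) ∧
        IsVariationSolution L P (C.geodesicFamily a (β a.1)) (fun k t => V k t a) := by
  obtain ⟨B, hB⟩ := BundleChart.exists_mem_source EM F E a₀.1
  set X := EM × (Fin (Module.finrank ℝ F) → ℝ) with hX
  -- the family of lines in coordinates
  set ℓ : X × ℝ → TotalSpace F E := fun c =>
    ⟨(B.ofCoord c.1).1, (B.ofCoord c.1).2 + c.2 • β (B.ofCoord c.1).1⟩ with hℓ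
  set S : Set (ℝ × X × ℝ) := {c | c.2.1.1 ∈ B.baseTarget} with hS
  have hSo : IsOpen S := B.isOpen_baseTarget.preimage
    (continuous_fst.comp (continuous_fst.comp continuous_snd))
  have hℓs : ContMDiffOn 𝓘(ℝ, ℝ × X × ℝ) (𝓘(ℝ, EM).prod 𝓘(ℝ, F)) ∞
      (fun c : ℝ × X × ℝ => ℓ c.2) S := by
    have h1 : ContMDiffOn 𝓘(ℝ, ℝ × X × ℝ) (𝓘(ℝ, EM).prod 𝓘(ℝ, F)) ∞
        (fun c : ℝ × X × ℝ => B.ofCoord c.2.1) S :=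
      B.contMDiffOn_ofCoord.comp (contDiff_fst.comp contDiff_snd).contMDiff.contMDiffOn
        fun c hc => ⟨hc, mem_univ _⟩
    have h2 := contMDiff_smul_add (I := 𝓘(ℝ, ℝ × X × ℝ)) (N := ℝ × X × ℝ) (c := fun _ => 1)
      (d := fun c => c.2.2) (S := S) (f := fun c : ℝ × X × ℝ => (B.ofCoord c.2.1).1)
      (v := fun c => (B.ofCoord c.2.1).2) (w := fun c => β (B.ofCoord c.2.1).1) contMDiffOn_const
      (contDiff_snd.comp contDiff_snd).contMDiff.contMDiffOn h1
      ((contMDiff_section_coe β).comp_contMDiffOn ((contMDiff_proj E).comp_contMDiffOn h1))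
    simpa only [one_smul] using h2
  have hpair : ContMDiffOn 𝓘(ℝ, ℝ × X × ℝ) (𝓘(ℝ, ℝ).prod (𝓘(ℝ, EM).prod 𝓘(ℝ, F))) ∞
      (fun c : ℝ × X × ℝ => (c.1, ℓ c.2)) S := contDiff_fst.contMDiff.contMDiffOn.prodMk hℓs
  set Ω₁ : Set (ℝ × X × ℝ) := S ∩ (fun c : ℝ × X × ℝ => (c.1, ℓ c.2)) ⁻¹' C.flowDomain with hΩ₁
  have hΩ₁o : IsOpen Ω₁ := hpair.continuousOn.isOpen_inter_preimage hSo C.isOpen_flowDomain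
  set Γ : ℝ × X × ℝ → TotalSpace F E := fun c => C.geodesic (ℓ c.2) c.1 with hΓ
  have hΓs : ContMDiffOn 𝓘(ℝ, ℝ × X × ℝ) (𝓘(ℝ, EM).prod 𝓘(ℝ, F)) ∞ Γ Ω₁ := fun c hc =>
    (ContMDiffAt.comp c (C.contMDiffAt_geodesic hc.2)
      (hpair.contMDiffAt (hSo.mem_nhds hc.1))).contMDiffWithinAt
  have hΓb : ContMDiffOn 𝓘(ℝ, ℝ × X × ℝ) 𝓘(ℝ, EM) ∞ (fun c => (Γ c).1) Ω₁ :=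
    (contMDiff_proj E).comp_contMDiffOn hΓs
  set Ω₂ : Set (ℝ × X × ℝ) := Ω₁ ∩ (fun c => (Γ c).1) ⁻¹' P.domain with hΩ₂
  have hΩ₂o : IsOpen Ω₂ := hΓb.continuousOn.isOpen_inter_preimage hΩ₁o P.isOpen_domain
  set j : ℝ × X → ℝ × X × ℝ := fun c => (c.1, c.2, 0) with hj
  have hjs : ContDiff ℝ ∞ j := contDiff_fst.prodMk (contDiff_snd.prodMk contDiff_const)
  set H : ι → ℝ × X × ℝ → ℝ := fun k c => P.coord k (Γ c).1 (Γ c).2 with hH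
  have hHs : ∀ k, ContDiffOn ℝ ∞ (H k) Ω₁ := fun k =>
    ((P.contMDiff_coord k).comp_contMDiffOn hΓs).contDiffOn
  set A : ℝ × X → (ι → ℝ) →L[ℝ] (ι → ℝ) := fun c => LinearMap.toContinuousLinearMap
    { toFun := fun v k => -∑ i, ∑ m, H i (j c) * v m *
        P.coeff k (L.bracket (P.sec i) (P.sec m)) (Γ (j c)).1
      map_add' := fun v w => by
        funext k
        simp only [Pi.add_apply, mul_add, add_mul, Finset.sum_add_distrib, neg_add]
      map_smul' := fun r v => by
        funext k
        simp only [Pi.smul_apply, smul_eq_mul, RingHom.id_apply, mul_neg, Finset.mul_sum]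
        refine congrArg _ (Finset.sum_congr rfl fun i _ => Finset.sum_congr rfl fun m _ => ?_)
        ring } with hA
  have hmaps : MapsTo j (j ⁻¹' Ω₂) Ω₁ := fun c hc => hc.1
  have hHj : ∀ k, ContDiffOn ℝ ∞ (fun c => H k (j c)) (j ⁻¹' Ω₂) := fun k =>
    (hHs k).comp hjs.contDiffOn hmaps
  have hAs : ContDiffOn ℝ ∞ A (j ⁻¹' Ω₂) := by
    refine contDiffOn_clm_apply.2 fun v => contDiffOn_pi.2 fun k => ?_
    refine (ContDiffOn.sum fun i _ => ContDiffOn.sum fun m _ =>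
      ((hHj i).mul contDiffOn_const).mul ?_).neg
    exact (((P.coeff k _).contMDiff.comp_contMDiffOn hΓb).contDiffOn).comp hjs.contDiffOn hmaps
  set Bv : ℝ × X → ι → ℝ := fun c k => fderiv ℝ (H k) (j c) (0, 0, 1) with hBv
  have hBs : ContDiffOn ℝ ∞ Bv (j ⁻¹' Ω₂) := contDiffOn_pi.2 fun k =>
    ((((hHs k).fderiv_of_isOpen hΩ₁o (m := ∞) (by simp)).comp hjs.contDiffOn hmaps).clm_apply
      contDiffOn_const)
  have hℓ0 : ∀ a : TotalSpace F E, a.1 ∈ B.source → ∀ ε,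
      ℓ (B.toCoord a, ε) = ⟨a.1, a.2 + ε • β a.1⟩ := fun a ha ε => by
    have h1 : ∀ a' a : TotalSpace F E, a' = a →
        (⟨a'.1, a'.2 + ε • β a'.1⟩ : TotalSpace F E) = ⟨a.1, a.2 + ε • β a.1⟩ := by
      rintro _ _ rfl
      rfl
    exact h1 _ _ (B.ofCoord_toCoord ha)
  have hΓ0 : ∀ a : TotalSpace F E, a.1 ∈ B.source → ∀ t ε,
      Γ (t, B.toCoord a, ε) = C.geodesicFamily a (β a.1) (t, ε) := fun a ha t ε => by
    simp only [hΓ, hℓ0 a ha]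
    rfl
  have hline0 : ∀ a : TotalSpace F E, (⟨a.1, a.2 + (0 : ℝ) • β a.1⟩ : TotalSpace F E) = a :=
    fun a => by simp
  have hΓ00 : ∀ a : TotalSpace F E, a.1 ∈ B.source → ∀ t,
      Γ (j (t, B.toCoord a)) = C.geodesic a t := fun a ha t => by
    rw [hj, hΓ0 a ha, C.geodesicFamily_zero]
  have hmem : ∀ t ∈ Icc (0 : ℝ) 1, (t, B.toCoord a₀) ∈ j ⁻¹' Ω₂ := by
    intro t ht
    refine ⟨⟨B.base_mem hB, ?_⟩, ?_⟩
    · change t ∈ C.geodesicDomain (ℓ (B.toCoord a₀, 0))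
      rw [hℓ0 a₀ hB, hline0]
      exact (C.ordConnected_geodesicDomain a₀).out (C.zero_mem_geodesicDomain a₀) ha₀ ht
    · change (Γ (j (t, B.toCoord a₀))).1 ∈ P.domain
      rw [hΓ00 a₀ hB]
      exact hP t ht
  obtain ⟨N, z, hN, hpN, hz, hsol⟩ := exists_linear_solution (hΩ₂o.preimage hjs.continuous) hmem
    hAs hBs
  refine ⟨{a | a.1 ∈ B.source} ∩ B.toCoord ⁻¹' N, fun k t a => z (t, B.toCoord a) k,
    (B.isOpen_source.preimage (contMDiff_proj E (n := ∞) (IB := 𝓘(ℝ, EM))).continuous).inter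
      (hN.preimage B.contMDiff_toCoord.continuous), ⟨hB, hpN⟩, fun k => ?_, ?_⟩
  · exact (((contDiff_pi.1 (hz 1 ⟨zero_le_one, le_rfl⟩) k).contMDiff).comp
      B.contMDiff_toCoord).contMDiffOn
  · rintro a ⟨haB, haN⟩
    obtain ⟨hz0, hzd⟩ := hsol _ haN
    refine ⟨fun t ht => ?_, fun k => congrFun hz0 k, fun t ht k => ?_⟩
    · have h1 := (hzd t ht).1
      have h2 : t ∈ C.geodesicDomain (ℓ (B.toCoord a, 0)) := h1.1.2
      have h3 : (Γ (j (t, B.toCoord a))).1 ∈ P.domain := h1.2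
      rw [hℓ0 a haB, hline0] at h2
      rw [hΓ00 a haB] at h3
      exact ⟨h2, h3⟩
    · have h1 := hasDerivAt_pi.1 (hzd t ht).2 k
      refine h1.congr_deriv ?_
      have h2 : Γ (j (t, B.toCoord a)) = C.geodesicFamily a (β a.1) (t, 0) := hΓ0 a haB t 0
      have h3 : Bv (t, B.toCoord a) k = partialSnd (fun p =>
          P.coord k (C.geodesicFamily a (β a.1) p).1 (C.geodesicFamily a (β a.1) p).2) (t, 0) := by
        have h4 : (fun p : ℝ × ℝ => P.coord k (C.geodesicFamily a (β a.1) p).1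
            (C.geodesicFamily a (β a.1) p).2) = fun p => H k (p.1, B.toCoord a, p.2) := by
          funext p
          exact congrArg (fun y : TotalSpace F E => P.coord k y.1 y.2) (hΓ0 a haB p.1 p.2).symm
        have h5 : HasFDerivAt (fun p : ℝ × ℝ => (p.1, B.toCoord a, p.2))
            ((ContinuousLinearMap.fst ℝ ℝ ℝ).prod
              ((0 : ℝ × ℝ →L[ℝ] X).prod (ContinuousLinearMap.snd ℝ ℝ ℝ))) (t, 0) :=
          hasFDerivAt_fst.prodMk ((hasFDerivAt_const _ _).prodMk hasFDerivAt_snd)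
        have h6 : HasFDerivAt (H k) (fderiv ℝ (H k) (j (t, B.toCoord a))) (t, B.toCoord a, 0) :=
          (((hHs k).contDiffAt (hΩ₁o.mem_nhds (hzd t ht).1.1)).differentiableAt
            (by simp)).hasFDerivAt
        have h7 : HasFDerivAt (fun p : ℝ × ℝ => H k (p.1, B.toCoord a, p.2)) _ (t, 0) :=
          HasFDerivAt.comp (g := H k) (f := fun p : ℝ × ℝ => (p.1, B.toCoord a, p.2))
            (t, (0 : ℝ)) h6 h5
        rw [h4]
        unfold partialSnd
        rw [h7.fderiv]
        simp [hBv]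
      rw [Pi.add_apply, h3, add_comm, sub_eq_add_neg]
      exact congrArg (fun y : TotalSpace F E => partialSnd (fun p =>
        P.coord k (C.geodesicFamily a (β a.1) p).1 (C.geodesicFamily a (β a.1) p).2) (t, 0) +
          -∑ i, ∑ m, P.coord i y.1 y.2 * z (t, B.toCoord a) m *
            P.coeff k (L.bracket (P.sec i) (P.sec m)) y.1) h2

end AConnection

end Variation

/-! ### The integral formula for solutions of the variation equation -/

section Formula

variable {EM : Type*} [NormedAddCommGroup EM] [NormedSpace ℝ EM]
  {M : Type*} [TopologicalSpace M] [ChartedSpace EM M] [IsManifold 𝓘(ℝ, EM) ∞ M]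
  {F : Type*} [NormedAddCommGroup F] [NormedSpace ℝ F]
  {E : M → Type*} [TopologicalSpace (TotalSpace F E)]
  [∀ x, AddCommGroup (E x)] [∀ x, Module ℝ (E x)] [∀ x, TopologicalSpace (E x)]
  [∀ x, IsTopologicalAddGroup (E x)] [∀ x, ContinuousSMul ℝ (E x)]
  [FiberBundle F E] [VectorBundle ℝ F E]
  [FiniteDimensional ℝ EM] [FiniteDimensional ℝ F] [T2Space M] [SigmaCompactSpace M]
  [ContMDiffVectorBundle ∞ F E 𝓘(ℝ, EM)]
  {L : PreLieAlgebroid EM F E} {C : AConnection L} {ι : Type} [Fintype ι]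

/-- The flow property of an infinitesimal flow in its last argument, after composition with
`ψ u s`. -/
lemma IsInfinitesimalFlow.hasDerivWithinAt_dual {ξ : ℝ → Cₛ^∞⟮𝓘(ℝ, EM); F, E⟯} {J : Set ℝ}
    {c : ℝ → M} {ψ : (t s : ℝ) → E (c s) →ₗ[ℝ] E (c t)} (hψ : IsInfinitesimalFlow L ξ J c ψ)
    {u s : ℝ} (hu : u ∈ J) (hs : s ∈ J) (α : Cₛ^∞⟮𝓘(ℝ, EM); F, E⟯) (l : E (c u) →ₗ[ℝ] ℝ) :
    HasDerivWithinAt (fun t => l (ψ u t (α (c t)))) (l (ψ u s (L.bracket (ξ s) α (c s)))) J s := by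
  refine ((hasDerivWithinAt_iff_forall_dual (fiberEquiv F E (c s))).1 (hψ.deriv s hs α)
    (l ∘ₗ ψ u s)).congr_of_mem (fun t ht => ?_) hs
  rw [← hψ.comp t ht s hs u hu]
  rfl

namespace AConnection

variable (C) in
/-- The derivative with respect to the parameter of a coordinate of the family of geodesics. -/
noncomputable def paramDeriv (P : PartialFrame EM F E ι) (a : TotalSpace F E) (b : E a.1) (k : ι)
    (t : ℝ) : ℝ :=
  partialSnd (fun p => P.coord k (C.geodesicFamily a b p).1 (C.geodesicFamily a b p).2) (t, 0)

variable (C) in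
/-- The coordinates `z` of a curve of vectors over the base curve of `g_a` satisfy the transport
equation `ż + [g_a, z] = ∂_b g` on `(0, 1)`, with initial value `0`, and are mapped by the anchor to
the variation of the base curve in the direction `b`. -/
structure IsTransport (P : PartialFrame EM F E ι) (a : TotalSpace F E) (b : E a.1)
    (z : ι → ℝ → ℝ) : Prop where
  continuousOn : ∀ k, ContinuousOn (z k) (Icc 0 1)
  zero : ∀ k, z k 0 = 0
  equation : ∀ t ∈ Ioo (0 : ℝ) 1, ∃ z' : ι → ℝ, (∀ k, HasDerivAt (z k) (z' k) t) ∧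
    ∑ k, z' k • P.sec k (C.baseCurve a t) +
      ∑ i, ∑ j, (P.coord i (C.baseCurve a t) (C.geodesic a t).2 * z j t) •
        L.bracket (P.sec i) (P.sec j) (C.baseCurve a t) =
      ∑ k, C.paramDeriv P a b k t • P.sec k (C.baseCurve a t)
  anchor : ∀ t ∈ Ioo (0 : ℝ) 1, ∀ f : C^∞⟮𝓘(ℝ, EM), M; ℝ⟯,
    ∑ k, z k t * L.anchorDeriv (P.sec k) f (C.baseCurve a t) =
      partialSnd (fun p => f (C.geodesicFamily a b p).1) (t, 0)

namespace IsGeodesicExtension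

variable {A₀ : Set (TotalSpace F E)} {a : TotalSpace F E} {b : E a.1} {δ : ℝ}
  {ξ : ℝ → ℝ → Cₛ^∞⟮𝓘(ℝ, EM); F, E⟯}

/-- The derivatives of the coefficients of the sections `ξ^t_ε` along the central base curve. -/
noncomputable def _root_.PreLie.extensionDeriv (P : PartialFrame EM F E ι) (γ : ℝ → M)
    (ξ : ℝ → ℝ → Cₛ^∞⟮𝓘(ℝ, EM); F, E⟯) (i : ι) (t : ℝ) : ℝ :=
  deriv (fun ε => P.coord i (γ t) (ξ t ε (γ t))) 0

lemma zero_mem (hξ : C.IsGeodesicExtension A₀ a b δ ξ) : (0 : ℝ) ∈ Ioo (-δ) δ :=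
  ⟨by linarith [hξ.pos], hξ.pos⟩

lemma contMDiffOn_coord (hξ : C.IsGeodesicExtension A₀ a b δ ξ) (P : PartialFrame EM F E ι)
    {t : ℝ} (ht : t ∈ Icc (0 : ℝ) 1) (i : ι) :
    ContMDiffOn (𝓘(ℝ, ℝ).prod 𝓘(ℝ, EM)) 𝓘(ℝ, ℝ) ∞
      (fun p : ℝ × M => P.coord i p.2 (ξ t p.1 p.2)) (Ioo (-δ) δ ×ˢ univ) := by
  have h1 : ContMDiff (𝓘(ℝ, ℝ).prod 𝓘(ℝ, EM)) (𝓘(ℝ, ℝ).prod (𝓘(ℝ, ℝ).prod 𝓘(ℝ, EM))) ∞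
      (fun p : ℝ × M => (t, p.1, p.2)) :=
    contMDiff_const.prodMk (contMDiff_fst.prodMk contMDiff_snd)
  exact (P.contMDiff_coord i).comp_contMDiffOn
    (hξ.contMDiffOn.comp h1.contMDiffOn fun p hp => ⟨ht, hp.1, mem_univ _⟩)

lemma mdifferentiableAt_coord (hξ : C.IsGeodesicExtension A₀ a b δ ξ) (P : PartialFrame EM F E ι)
    {t : ℝ} (ht : t ∈ Icc (0 : ℝ) 1) (i : ι) (x : M) :
    MDifferentiableAt (𝓘(ℝ, ℝ).prod 𝓘(ℝ, EM)) 𝓘(ℝ, ℝ)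
      (fun p : ℝ × M => P.coord i p.2 (ξ t p.1 p.2)) (0, x) :=
  ((hξ.contMDiffOn_coord P ht i).contMDiffAt
    ((isOpen_Ioo.prod isOpen_univ).mem_nhds ⟨hξ.zero_mem, mem_univ _⟩)).mdifferentiableAt (by simp)

/-- The chain rule for `ξ^t_ε(γ_{a+εb}(t)) = g_{a+εb}(t)`. -/
lemma paramDeriv_eq (hξ : C.IsGeodesicExtension A₀ a b δ ξ) (ha : 1 ∈ C.geodesicDomain a)
    (P : PartialFrame EM F E ι) {t : ℝ} (ht : t ∈ Icc (0 : ℝ) 1) (i : ι) :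
    HasDerivAt (fun ε => P.coord i (C.baseCurve a t) (ξ t ε (C.baseCurve a t)))
      (extensionDeriv P (C.baseCurve a) ξ i t) 0 ∧
    C.paramDeriv P a b i t = extensionDeriv P (C.baseCurve a) ξ i t +
      partialSnd (fun p => P.coeff i (ξ t 0) (C.geodesicFamily a b p).1) (t, 0) := by
  have hG := C.isAPathFamily_geodesicFamily ha b
  have hO := hG.mem t ht
  obtain ⟨c, hc1, hc2⟩ := (hG.hasVelocityAt_variationField hO).hasDerivAt_comp_prod
    (hξ.mdifferentiableAt_coord P ht i _)
  have h0 : (C.geodesicFamily a b (t, 0)).1 = C.baseCurve a t :=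
    congrArg TotalSpace.proj (C.geodesicFamily_zero a b t)
  have hc1' : HasDerivAt (fun ε => P.coord i (C.baseCurve a t) (ξ t ε (C.baseCurve a t))) c 0 := by
    rw [← h0]
    exact hc1
  have hc : extensionDeriv P (C.baseCurve a) ξ i t = c := hc1'.deriv
  rw [hc]
  refine ⟨hc1', ?_⟩
  have h2 : (fun ε => P.coord i (C.geodesicFamily a b (t, ε)).1 (C.geodesicFamily a b (t, ε)).2)
      =ᶠ[𝓝 0] fun ε => P.coord i (C.geodesicFamily a b (t, ε)).1
        (ξ t ε (C.geodesicFamily a b (t, ε)).1) := by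
    filter_upwards [isOpen_Ioo.mem_nhds hξ.zero_mem] with ε hε
    exact congrArg (P.coord i _) (hξ.extends_geodesic t ht ε hε).symm
  refine (hasDerivAt_partialSnd hG.isOpen (hG.contDiffOn_coord P i) hO).unique
    ((hc2.congr_of_eventuallyEq h2).congr_deriv ?_)
  rw [← hG.dirDeriv_variationField hO]
  rfl

lemma deriv_section (hξ : C.IsGeodesicExtension A₀ a b δ ξ) (ha : 1 ∈ C.geodesicDomain a)
    (P : PartialFrame EM F E ι) {t : ℝ} (ht : t ∈ Icc (0 : ℝ) 1)
    (hP : C.baseCurve a t ∈ P.domain) :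
    deriv (fun ε => ξ t ε (C.baseCurve a t)) 0 =
      ∑ i, extensionDeriv P (C.baseCurve a) ξ i t • P.sec i (C.baseCurve a t) := by
  have h1 : (fun ε => ξ t ε (C.baseCurve a t)) = fun ε =>
      ∑ i, P.coord i (C.baseCurve a t) (ξ t ε (C.baseCurve a t)) • P.sec i (C.baseCurve a t) :=
    funext fun ε => (P.sum_coord_smul hP _).symm
  rw [h1]
  exact hasDerivAt_deriv_eq_of_equiv (fiberEquiv F E _)
    (hasDerivAt_sum_smul_of_equiv (fiberEquiv F E _) (s := Finset.univ)
      (fun i _ => (hξ.paramDeriv_eq ha P ht i).1) fun i => P.sec i (C.baseCurve a t))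

lemma contMDiffOn_baseCurve (ha : 1 ∈ C.geodesicDomain a) :
    ContMDiffOn 𝓘(ℝ, ℝ) 𝓘(ℝ, EM) ∞ (C.baseCurve a) (Icc 0 1) :=
  ((contMDiff_proj E).comp_contMDiffOn (C.isGeodesicOn_geodesic a).1.1).mono
    ((C.ordConnected_geodesicDomain a).out (C.zero_mem_geodesicDomain a) ha)

lemma continuousOn_extensionDeriv (hξ : C.IsGeodesicExtension A₀ a b δ ξ)
    (ha : 1 ∈ C.geodesicDomain a) (P : PartialFrame EM F E ι) (i : ι) :
    ContinuousOn (extensionDeriv P (C.baseCurve a) ξ i) (Icc 0 1) := by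
  set T : Set (ℝ × ℝ) := Icc 0 1 ×ˢ Ioo (-δ) δ with hT
  have h1 : ContMDiffOn 𝓘(ℝ, ℝ × ℝ) (𝓘(ℝ, ℝ).prod (𝓘(ℝ, ℝ).prod 𝓘(ℝ, EM))) ∞
      (fun p : ℝ × ℝ => (p.1, p.2, C.baseCurve a p.1)) T :=
    contDiff_fst.contMDiff.contMDiffOn.prodMk (contDiff_snd.contMDiff.contMDiffOn.prodMk
      ((contMDiffOn_baseCurve ha).comp contDiff_fst.contMDiff.contMDiffOn fun p hp => hp.1))
  set h : ℝ × ℝ → ℝ := fun p => P.coord i (C.baseCurve a p.1) (ξ p.1 p.2 (C.baseCurve a p.1))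
  have h2 : ContDiffOn ℝ ∞ h T := ((P.contMDiff_coord i).comp_contMDiffOn
    (hξ.contMDiffOn.comp h1 fun p hp => ⟨hp.1, hp.2, mem_univ _⟩)).contDiffOn
  have hu : UniqueDiffOn ℝ T := (uniqueDiffOn_Icc zero_lt_one).prod isOpen_Ioo.uniqueDiffOn
  have h3 : ContinuousOn (fun t : ℝ => fderivWithin ℝ h T (t, 0) (0, 1)) (Icc 0 1) :=
    ((h2.continuousOn_fderivWithin hu (by simp)).comp
      (Continuous.prodMk_left (0 : ℝ)).continuousOn fun t ht => ⟨ht, hξ.zero_mem⟩).clm_apply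
      continuousOn_const
  refine h3.congr fun t ht => ?_
  have h4 : HasDerivWithinAt (fun ε => h (t, ε)) (fderivWithin ℝ h T (t, 0) (0, 1)) (Ioo (-δ) δ)
      0 :=
    HasFDerivWithinAt.comp_hasDerivWithinAt (f := fun ε : ℝ => (t, ε)) (t := T) (0 : ℝ)
      ((h2.differentiableOn (by simp)) (t, 0) ⟨ht, hξ.zero_mem⟩).hasFDerivWithinAt
      ((hasDerivWithinAt_const _ _ t).prodMk (hasDerivWithinAt_id _ _)) fun ε hε => ⟨ht, hε⟩
  exact (h4.hasDerivAt (isOpen_Ioo.mem_nhds hξ.zero_mem)).deriv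

/-- Along the central curve, the transport equation is `ż + [ξ₀, z] = ∂_ε ξ_ε`. -/
lemma sum_bracket_eq (hξ : C.IsGeodesicExtension A₀ a b δ ξ) (ha : 1 ∈ C.geodesicDomain a)
    (P : PartialFrame EM F E ι) {t : ℝ} (ht : t ∈ Icc (0 : ℝ) 1)
    (hP : C.baseCurve a t ∈ P.domain) {z z' : ι → ℝ}
    (hz : ∑ k, z' k • P.sec k (C.baseCurve a t) +
      ∑ i, ∑ j, (P.coord i (C.baseCurve a t) (C.geodesic a t).2 * z j) •
        L.bracket (P.sec i) (P.sec j) (C.baseCurve a t) =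
      ∑ k, C.paramDeriv P a b k t • P.sec k (C.baseCurve a t))
    (hanc : ∀ f : C^∞⟮𝓘(ℝ, EM), M; ℝ⟯,
      ∑ k, z k * L.anchorDeriv (P.sec k) f (C.baseCurve a t) =
        partialSnd (fun p => f (C.geodesicFamily a b p).1) (t, 0)) :
    ∑ k, z' k • P.sec k (C.baseCurve a t) +
      ∑ k, z k • L.bracket (ξ t 0) (P.sec k) (C.baseCurve a t) =
        ∑ i, extensionDeriv P (C.baseCurve a) ξ i t • P.sec i (C.baseCurve a t) := by
  have hval : ξ t 0 (C.baseCurve a t) = (C.geodesic a t).2 := by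
    have h1 := hξ.extends_geodesic t ht 0 hξ.zero_mem
    have h2 : (⟨a.1, a.2 + (0 : ℝ) • b⟩ : TotalSpace F E) = a := by simp
    rwa [h2] at h1
  have hbr : ∀ k, L.bracket (ξ t 0) (P.sec k) (C.baseCurve a t) =
      ∑ i, (P.coord i (C.baseCurve a t) (C.geodesic a t).2 •
        L.bracket (P.sec i) (P.sec k) (C.baseCurve a t) -
        L.anchorDeriv (P.sec k) (P.coeff i (ξ t 0)) (C.baseCurve a t) •
          P.sec i (C.baseCurve a t)) := fun k => by
    refine ((L.isDerivationAt_bracket_left (P.sec k) _).eq_sum P hP (ξ t 0)).trans ?_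
    refine Finset.sum_congr rfl fun i _ => ?_
    rw [P.coeff_apply, hval, dirDeriv_neg, neg_smul, ← sub_eq_add_neg]
    rfl
  have h1 : ∑ k, z k • L.bracket (ξ t 0) (P.sec k) (C.baseCurve a t) =
      ∑ i, ∑ j, (P.coord i (C.baseCurve a t) (C.geodesic a t).2 * z j) •
        L.bracket (P.sec i) (P.sec j) (C.baseCurve a t) -
      ∑ i, partialSnd (fun p => P.coeff i (ξ t 0) (C.geodesicFamily a b p).1) (t, 0) •
        P.sec i (C.baseCurve a t) := by
    simp only [← hanc, hbr, Finset.smul_sum, smul_sub, smul_smul, Finset.sum_smul,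
      Finset.sum_sub_distrib]
    congr 1
    · rw [Finset.sum_comm]
      exact Finset.sum_congr rfl fun i _ => Finset.sum_congr rfl fun j _ => by rw [mul_comm]
    · rw [Finset.sum_comm]
  have h2 : ∀ i, C.paramDeriv P a b i t • P.sec i (C.baseCurve a t) =
      extensionDeriv P (C.baseCurve a) ξ i t • P.sec i (C.baseCurve a t) +
      partialSnd (fun p => P.coeff i (ξ t 0) (C.geodesicFamily a b p).1) (t, 0) •
        P.sec i (C.baseCurve a t) := fun i => by
    rw [(hξ.paramDeriv_eq ha P ht i).2, add_smul]
  rw [h1, ← add_sub_assoc, hz, Finset.sum_congr rfl fun i _ => h2 i, Finset.sum_add_distrib,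
    add_sub_cancel_right]

/-- The integral formula: variation of constants for the transport equation, with the
infinitesimal flow as fundamental solution. -/
theorem hasIntegral (hξ : C.IsGeodesicExtension A₀ a b δ ξ) (ha : 1 ∈ C.geodesicDomain a)
    (P : PartialFrame EM F E ι) (hP : ∀ t ∈ Icc (0 : ℝ) 1, C.baseCurve a t ∈ P.domain)
    {z : ι → ℝ → ℝ} (hz : C.IsTransport P a b z)
    {ψ : (t s : ℝ) → E (C.baseCurve a s) →ₗ[ℝ] E (C.baseCurve a t)}
    (hψ : IsInfinitesimalFlow L (fun t => ξ t 0) (Icc 0 1) (C.baseCurve a) ψ) :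
    HasIntegral (fun t => ψ 1 t (deriv (fun ε => ξ t ε (C.baseCurve a t)) 0))
      (∑ k, z k 1 • P.sec k (C.baseCurve a 1)) := by
  intro l
  have h1I : (1 : ℝ) ∈ Icc (0 : ℝ) 1 := ⟨zero_le_one, le_rfl⟩
  set m : ι → ℝ → ℝ := fun k t => l (ψ 1 t (P.sec k (C.baseCurve a t))) with hm
  have hmd : ∀ k, ∀ s ∈ Icc (0 : ℝ) 1, HasDerivWithinAt (m k)
      (l (ψ 1 s (L.bracket (ξ s 0) (P.sec k) (C.baseCurve a s)))) (Icc 0 1) s := fun k s hs =>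
    hψ.hasDerivWithinAt_dual h1I hs (P.sec k) l
  have hmc : ∀ k, ContinuousOn (m k) (Icc 0 1) := fun k s hs => (hmd k s hs).continuousWithinAt
  set D : ℝ → ℝ := fun t => ∑ i, extensionDeriv P (C.baseCurve a) ξ i t * m i t with hD
  have hDc : ContinuousOn D (Icc 0 1) := continuousOn_finsetSum _ fun i _ =>
    (hξ.continuousOn_extensionDeriv ha P i).mul (hmc i)
  have heq : ∀ t ∈ Icc (0 : ℝ) 1,
      l (ψ 1 t (deriv (fun ε => ξ t ε (C.baseCurve a t)) 0)) = D t := fun t ht => by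
    rw [hξ.deriv_section ha P ht (hP t ht)]
    simp only [map_sum, map_smul, smul_eq_mul, hD, hm]
  have hint : IntervalIntegrable D volume 0 1 :=
    ContinuousOn.intervalIntegrable (by rwa [uIcc_of_le zero_le_one])
  have heq' : EqOn (fun t => l (ψ 1 t (deriv (fun ε => ξ t ε (C.baseCurve a t)) 0))) D
      (uIcc 0 1) := by
    rw [uIcc_of_le zero_le_one]
    exact heq
  refine ⟨hint.congr fun t ht => (heq' (uIoc_subset_uIcc ht)).symm, ?_⟩
  rw [intervalIntegral.integral_congr heq']
  have hFTC := intervalIntegral.integral_eq_sub_of_hasDerivAt_of_le zero_le_one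
    (f := fun t => ∑ k, z k t * m k t) (f' := D)
    (continuousOn_finsetSum _ fun k _ => (hz.continuousOn k).mul (hmc k)) (fun t ht => ?_) hint
  · rw [hFTC]
    have h2 : ψ 1 1 = LinearMap.id := hψ.refl 1 h1I
    simp [hz.zero, hm, h2]
  · obtain ⟨z', hz', he⟩ := hz.equation t ht
    have htI := Ioo_subset_Icc_self ht
    have h3 := hξ.sum_bracket_eq ha P htI (hP t htI) he (hz.anchor t ht)
    refine (HasDerivAt.fun_sum fun k _ => (hz' k).mul
      ((hmd k t htI).hasDerivAt (Icc_mem_nhds ht.1 ht.2))).congr_deriv ?_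
    have h4 := congrArg (fun v => l (ψ 1 t v)) h3
    simp only [map_add, map_sum, map_smul, smul_eq_mul] at h4
    rw [Finset.sum_add_distrib]
    exact h4

end IsGeodesicExtension

end AConnection

end Formula

/-! ### Existence of geodesic extensions and of their infinitesimal flow -/

section LinearODE

variable {Y : Type*} [NormedAddCommGroup Y] [NormedSpace ℝ Y] [FiniteDimensional ℝ Y]

/-- The fundamental solution of a linear differential equation on `[0, 1]`, and its inverse. -/
lemma exists_fundamental_solution {Q : ℝ → Y →L[ℝ] Y} (hQ : ContinuousOn Q (Icc 0 1)) :
    ∃ Φ Ψ : ℝ → Y →L[ℝ] Y, ∀ t ∈ Icc (0 : ℝ) 1, HasDerivAt Φ (-(Q t * Φ t)) t ∧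
      HasDerivAt Ψ (Ψ t * Q t) t ∧ Φ t * Ψ t = 1 ∧ Ψ t * Φ t = 1 := by
  have := FiniteDimensional.complete ℝ Y
  let q : ℝ → Y →L[ℝ] Y := IccExtend zero_le_one (domRestrict (Icc 0 1) Q)
  have hq : Continuous q := Continuous.Icc_extend' hQ.domRestrict
  have hqQ : ∀ t ∈ Icc (0 : ℝ) 1, q t = Q t := fun t ht => IccExtend_of_mem _ _ ht
  let R : C(TimeInterval, Y →L[ℝ] Y) := ⟨fun s => -q s, by fun_prop⟩
  let R' : C(TimeInterval, (Y →L[ℝ] Y)ᵐᵒᵖ) :=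
    ⟨fun s => MulOpposite.op (q s), by fun_prop⟩
  let Φ : ℝ → Y →L[ℝ] Y := extendCurve (resolvent R)
  let Ψ : ℝ → Y →L[ℝ] Y := fun t => MulOpposite.unop (extendCurve (resolvent R') t)
  have hmem : ∀ t ∈ Icc (0 : ℝ) 1, t ∈ Ioo (-2 : ℝ) 2 := fun t ht =>
    ⟨by linarith [ht.1], by linarith [ht.2]⟩
  have hΦ : ∀ t ∈ Icc (0 : ℝ) 1, HasDerivAt Φ (-(Q t * Φ t)) t := fun t ht => by
    have h := hasDerivAt_resolvent R (hmem t ht)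
    rw [extendCurve_of_mem R (Ioo_subset_Icc_self (hmem t ht))] at h
    refine h.congr_deriv ?_
    change -q t * _ = _
    rw [hqQ t ht, neg_mul]
  have hΨ : ∀ t ∈ Icc (0 : ℝ) 1, HasDerivAt Ψ (Ψ t * Q t) t := fun t ht => by
    have h := hasDerivAt_resolvent R' (hmem t ht)
    rw [extendCurve_of_mem R' (Ioo_subset_Icc_self (hmem t ht))] at h
    have h1 := ((MulOpposite.opContinuousLinearEquiv ℝ
      (M := Y →L[ℝ] Y)).symm.hasFDerivAt).comp_hasDerivAt t h
    refine h1.congr_deriv ?_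
    change MulOpposite.unop (MulOpposite.op (q t) * _) = _
    rw [hqQ t ht, MulOpposite.unop_mul]
    rfl
  have h1 : ∀ t ∈ Icc (0 : ℝ) 1, Ψ t * Φ t = 1 := by
    intro t ht
    have h2 : ∀ r ∈ Icc (0 : ℝ) 1, HasDerivAt (fun r => Ψ r * Φ r) 0 r := fun r hr =>
      ((hΨ r hr).mul (hΦ r hr)).congr_deriv (by rw [mul_neg, mul_assoc, add_neg_cancel])
    have h3 := constant_of_has_deriv_right_zero
      (fun r hr => (h2 r hr).continuousAt.continuousWithinAt)
      (fun r hr => (h2 r (Ico_subset_Icc_self hr)).hasDerivWithinAt) t ht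
    rw [h3]
    simp only [Φ, Ψ, resolvent_zero]
    rfl
  refine ⟨Φ, Ψ, fun t ht => ⟨hΦ t ht, hΨ t ht, ?_, h1 t ht⟩⟩
  have h4 : (Ψ t : Y →ₗ[ℝ] Y) * (Φ t : Y →ₗ[ℝ] Y) = 1 :=
    congrArg (fun A : Y →L[ℝ] Y => (A : Y →ₗ[ℝ] Y)) (h1 t ht)
  ext v
  exact congrArg (fun A : Y →ₗ[ℝ] Y => A v) (mul_eq_one_comm.1 h4)

lemma eq_zero_of_linear_ode {A : ℝ → Y →L[ℝ] Y} (hA : ContinuousOn A (Icc 0 1)) {y : ℝ → Y}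
    (hy : ∀ t ∈ Icc (0 : ℝ) 1, HasDerivAt y (A t (y t)) t) {t₀ : ℝ} (ht₀ : t₀ ∈ Icc (0 : ℝ) 1)
    (h0 : y t₀ = 0) {t : ℝ} (ht : t ∈ Icc (0 : ℝ) 1) : y t = 0 := by
  obtain ⟨Φ, Ψ, h⟩ := exists_fundamental_solution hA.neg
  have h2 : ∀ r ∈ Icc (0 : ℝ) 1, HasDerivAt (fun r => Ψ r (y r)) 0 r := fun r hr =>
    ((h r hr).2.1.clm_apply (hy r hr)).congr_deriv (by simp)
  have h3 := constant_of_has_deriv_right_zero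
    (fun r hr => (h2 r hr).continuousAt.continuousWithinAt)
    (fun r hr => (h2 r (Ico_subset_Icc_self hr)).hasDerivWithinAt)
  have h4 : Ψ t (y t) = 0 := by rw [h3 t ht, ← h3 t₀ ht₀, h0, map_zero]
  have h5 := congrArg (fun A : Y →L[ℝ] Y => A (y t)) (h t ht).2.2.1
  simpa [h4] using h5.symm

end LinearODE

section Existence

variable {EM : Type*} [NormedAddCommGroup EM] [NormedSpace ℝ EM]
  {M : Type*} [TopologicalSpace M] [ChartedSpace EM M] [IsManifold 𝓘(ℝ, EM) ∞ M]
  {F : Type*} [NormedAddCommGroup F] [NormedSpace ℝ F]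
  {E : M → Type*} [TopologicalSpace (TotalSpace F E)]
  [∀ x, AddCommGroup (E x)] [∀ x, Module ℝ (E x)] [∀ x, TopologicalSpace (E x)]
  [∀ x, IsTopologicalAddGroup (E x)] [∀ x, ContinuousSMul ℝ (E x)]
  [FiberBundle F E] [VectorBundle ℝ F E]
  [FiniteDimensional ℝ EM] [FiniteDimensional ℝ F] [T2Space M] [SigmaCompactSpace M]
  [ContMDiffVectorBundle ∞ F E 𝓘(ℝ, EM)]
  {L : PreLieAlgebroid EM F E} (C : AConnection L) {ι : Type} [Fintype ι]

namespace AConnection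

lemma exists_frame_baseCurve {a : TotalSpace F E} (ha : 1 ∈ C.geodesicDomain a) :
    ∃ (N : ℕ) (P : PartialFrame EM F E (Fin N)), ∀ t ∈ Icc (0 : ℝ) 1,
      C.baseCurve a t ∈ P.domain := by
  obtain ⟨N, P, hP⟩ := exists_partialFrame_of_isCompact EM F E (isCompact_Icc.image_of_continuousOn
    (IsGeodesicExtension.contMDiffOn_baseCurve ha).continuousOn)
  exact ⟨N, P, fun t ht => hP (mem_image_of_mem _ ht)⟩

/-- The combinations of the sections of a partial frame, with the coordinates of `g_{a+εb}(t)` as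
coefficients, extend the geodesics for small `ε`. -/
theorem exists_isGeodesicExtension {A₀ : Set (TotalSpace F E)} (hA₀ : C.IsExpDomain A₀)
    {a : TotalSpace F E} (ha : a ∈ A₀) (b : E a.1) :
    ∃ δ ξ, C.IsGeodesicExtension A₀ a b δ ξ := by
  have ha1 := hA₀.one_mem a ha
  obtain ⟨N, P, hP⟩ := C.exists_frame_baseCurve ha1
  have hG := C.isAPathFamily_geodesicFamily ha1 b
  have hline : ContMDiff 𝓘(ℝ, ℝ) (𝓘(ℝ, EM).prod 𝓘(ℝ, F)) ∞
      (fun ε : ℝ => (⟨a.1, a.2 + ε • b⟩ : TotalSpace F E)) := contMDiff_line a b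
  set Ω : Set (ℝ × ℝ) := C.familyDomain a b ∩ (fun p => (C.geodesicFamily a b p).1) ⁻¹' P.domain
  have hΩ : IsOpen Ω := hG.contMDiffOn_base.continuousOn.isOpen_inter_preimage hG.isOpen
    P.isOpen_domain
  have hsub : Icc (0 : ℝ) 1 ×ˢ {(0 : ℝ)} ⊆ Ω := by
    rintro ⟨t, ε⟩ ⟨ht, rfl⟩
    refine ⟨hG.mem t ht, ?_⟩
    change (C.geodesicFamily a b (t, 0)).1 ∈ P.domain
    rw [C.geodesicFamily_zero]
    exact hP t ht
  have h1 := hΩ.mem_nhdsSet.2 hsub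
  rw [isCompact_Icc.nhdsSet_prod_eq isCompact_singleton, nhdsSet_singleton] at h1
  obtain ⟨S, hS, T, hT, hST⟩ := mem_prod_iff.1 h1
  have h2 : (fun ε : ℝ => (⟨a.1, a.2 + ε • b⟩ : TotalSpace F E)) ⁻¹' A₀ ∈ 𝓝 (0 : ℝ) :=
    hline.continuous.continuousAt.preimage_mem_nhds (hA₀.isOpen.mem_nhds (by simpa using ha))
  obtain ⟨δ, hδ, hball⟩ := Metric.mem_nhds_iff.1 (inter_mem hT h2)
  rw [Real.ball_eq_Ioo, zero_sub, zero_add] at hball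
  have hmem : ∀ t ∈ Icc (0 : ℝ) 1, ∀ ε ∈ Ioo (-δ) δ, (t, ε) ∈ Ω := fun t ht ε hε =>
    hST ⟨subset_of_mem_nhdsSet hS ht, (hball hε).1⟩
  refine ⟨δ, fun t ε => ∑ k, P.coord k (C.geodesicFamily a b (t, ε)).1
    (C.geodesicFamily a b (t, ε)).2 • P.sec k, hδ, fun ε hε => (hball hε).2, ?_, ?_⟩
  · have h3 : ∀ k, ContMDiffOn (𝓘(ℝ, ℝ).prod (𝓘(ℝ, ℝ).prod 𝓘(ℝ, EM))) 𝓘(ℝ, ℝ) ∞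
        (fun p : ℝ × ℝ × M => P.coord k (C.geodesicFamily a b (p.1, p.2.1)).1
          (C.geodesicFamily a b (p.1, p.2.1)).2) (Icc 0 1 ×ˢ Ioo (-δ) δ ×ˢ univ) := fun k =>
      (hG.contDiffOn_coord P k).contMDiffOn.comp
        (contMDiff_fst.prodMk_space (contMDiff_fst.comp contMDiff_snd)).contMDiffOn
        fun p hp => (hmem _ hp.1 _ hp.2.1).1
    have h4 := contMDiffOn_sum_smul (I := 𝓘(ℝ, ℝ).prod (𝓘(ℝ, ℝ).prod 𝓘(ℝ, EM)))
      (N := ℝ × ℝ × M) (f := fun p => p.2.2) (contMDiff_snd.comp contMDiff_snd).contMDiffOn h3 P.sec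
    refine h4.congr fun p _ => ?_
    rw [section_sum_smul_apply]
  · intro t ht ε hε
    rw [section_sum_smul_apply]
    exact P.sum_coord_smul (hmem t ht ε hε).2 _

namespace IsGeodesicExtension

variable {C} {A₀ : Set (TotalSpace F E)} {a : TotalSpace F E} {b : E a.1} {δ : ℝ}
  {ξ : ℝ → ℝ → Cₛ^∞⟮𝓘(ℝ, EM); F, E⟯}

lemma apply_zero (hξ : C.IsGeodesicExtension A₀ a b δ ξ) {t : ℝ} (ht : t ∈ Icc (0 : ℝ) 1) :
    ξ t 0 (C.baseCurve a t) = (C.geodesic a t).2 := by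
  have h1 := hξ.extends_geodesic t ht 0 hξ.zero_mem
  have h2 : (⟨a.1, a.2 + (0 : ℝ) • b⟩ : TotalSpace F E) = a := by simp
  rwa [h2] at h1

lemma hasVelocityAt_baseCurve (hξ : C.IsGeodesicExtension A₀ a b δ ξ)
    (ha : 1 ∈ C.geodesicDomain a) {t : ℝ} (ht : t ∈ Icc (0 : ℝ) 1) :
    HasVelocityAt (C.baseCurve a) t (L.anchor (C.baseCurve a t) (ξ t 0 (C.baseCurve a t))) := by
  rw [hξ.apply_zero ht]
  exact (C.isGeodesicOn_geodesic a).1.hasVelocityAt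
    ((C.ordConnected_geodesicDomain a).out (C.zero_mem_geodesicDomain a) ha ht)

/-- Brackets of the extension with sections are continuous along the central curve. -/
lemma continuousOn_bracket (hξ : C.IsGeodesicExtension A₀ a b δ ξ)
    (ha : 1 ∈ C.geodesicDomain a) (P : PartialFrame EM F E ι)
    (hP : ∀ t ∈ Icc (0 : ℝ) 1, C.baseCurve a t ∈ P.domain) (β : Cₛ^∞⟮𝓘(ℝ, EM); F, E⟯) (k : ι) :
    ContinuousOn (fun t => P.coord k (C.baseCurve a t) (L.bracket (ξ t 0) β (C.baseCurve a t)))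
      (Icc 0 1) := by
  have hγ := (contMDiffOn_baseCurve ha).continuousOn
  have hf : ∀ f : C^∞⟮𝓘(ℝ, EM), M; ℝ⟯, ContinuousOn (fun t => f (C.baseCurve a t)) (Icc 0 1) :=
    fun f => f.contMDiff.continuous.comp_continuousOn hγ
  set h : ι → ℝ × M → ℝ := fun i p => P.coord i p.2 (ξ p.1 0 p.2) with hh
  have hhs : ∀ i, ContMDiffOn (𝓘(ℝ, ℝ).prod 𝓘(ℝ, EM)) 𝓘(ℝ, ℝ) ∞ (h i) (Icc 0 1 ×ˢ univ) :=
    fun i => (P.contMDiff_coord i).comp_contMDiffOn (hξ.contMDiffOn.comp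
      (contMDiff_fst.prodMk (contMDiff_const.prodMk contMDiff_snd)).contMDiffOn
      fun p hp => ⟨hp.1, hξ.zero_mem, mem_univ _⟩)
  have h1 : ∀ i, ContinuousOn (fun t => h i (t, C.baseCurve a t)) (Icc 0 1) := fun i =>
    (hhs i).continuousOn.comp (continuousOn_id.prodMk hγ) fun t ht => ⟨ht, mem_univ _⟩
  have h2 : ∀ i, ContinuousOn (fun t => L.anchorDeriv β (P.coeff i (ξ t 0)) (C.baseCurve a t))
      (Icc 0 1) := by
    intro i t₀ ht₀
    obtain ⟨B, hB⟩ := BundleChart.exists_mem_source EM F E (C.baseCurve a t₀)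
    set w : M → EM := fun x => mvfderiv 𝓘(ℝ, EM) B.base x (L.anchor x (β x)) with hw
    have hwc : Continuous w :=
      (contMDiff_mvfderiv_apply B.contMDiff_base (L.contMDiff_anchor_section β)).continuous
    have hS : Icc (0 : ℝ) 1 ∩ C.baseCurve a ⁻¹' B.source ∈ 𝓝[Icc 0 1] t₀ :=
      inter_mem self_mem_nhdsWithin
        ((hγ t₀ ht₀).preimage_mem_nhdsWithin (B.isOpen_source.mem_nhds hB))
    refine ContinuousWithinAt.mono_of_mem_nhdsWithin (t := Icc (0 : ℝ) 1 ∩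
      C.baseCurve a ⁻¹' B.source) ?_ hS
    have h3 : ContinuousOn (fun t => fderivWithin ℝ (B.localRep (h i)) (Icc 0 1 ×ˢ B.baseTarget)
        (t, B.base (C.baseCurve a t)) (0, w (C.baseCurve a t)))
        (Icc (0 : ℝ) 1 ∩ C.baseCurve a ⁻¹' B.source) := by
      refine ContinuousOn.clm_apply (((B.contDiffOn_localRep (hhs i)).continuousOn_fderivWithin
        ((uniqueDiffOn_Icc zero_lt_one).prod B.isOpen_baseTarget.uniqueDiffOn) (by simp)).comp
        (continuousOn_id.prodMk (B.contMDiff_base.continuous.comp_continuousOn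
          (hγ.mono inter_subset_left))) fun t ht => ⟨ht.1, B.base_mem ht.2⟩) ?_
      exact continuousOn_const.prodMk (hwc.comp_continuousOn (hγ.mono inter_subset_left))
    refine (h3.congr fun t ht => ?_) t₀ ⟨ht₀, hB⟩
    exact B.mvfderiv_eq_fderivWithin (hhs i) ht.1 ht.2 _
  have h4 : ∀ t ∈ Icc (0 : ℝ) 1,
      P.coord k (C.baseCurve a t) (L.bracket (ξ t 0) β (C.baseCurve a t)) =
      ∑ i, (h i (t, C.baseCurve a t) * P.coeff k (L.bracket (P.sec i) β) (C.baseCurve a t) -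
        L.anchorDeriv β (P.coeff i (ξ t 0)) (C.baseCurve a t) *
          P.coeff k (P.sec i) (C.baseCurve a t)) := fun t ht => by
    have h5 := (L.isDerivationAt_bracket_left β _).eq_sum P (hP t ht) (ξ t 0)
    rw [h5, map_sum]
    refine Finset.sum_congr rfl fun i _ => ?_
    rw [map_add, map_smul, map_smul, dirDeriv_neg, smul_eq_mul, smul_eq_mul, neg_mul,
      ← sub_eq_add_neg]
    rfl
  refine ContinuousOn.congr ?_ h4
  exact continuousOn_finsetSum _ fun i _ => ((h1 i).mul (hf _)).sub ((h2 i).mul (hf _))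

/-- The matrix of the operator `[ξ₀, ·]` in a partial frame along the central curve. -/
noncomputable def _root_.PreLie.bracketMatrix (L : PreLieAlgebroid EM F E)
    (P : PartialFrame EM F E ι) (γ : ℝ → M) (ξ : ℝ → Cₛ^∞⟮𝓘(ℝ, EM); F, E⟯) (t : ℝ) :
    (ι → ℝ) →L[ℝ] (ι → ℝ) :=
  ContinuousLinearMap.pi fun k => ∑ j,
    P.coord k (γ t) (L.bracket (ξ t) (P.sec j) (γ t)) • ContinuousLinearMap.proj j

lemma _root_.PreLie.bracketMatrix_apply (L : PreLieAlgebroid EM F E)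
    (P : PartialFrame EM F E ι) (γ : ℝ → M) (ξ : ℝ → Cₛ^∞⟮𝓘(ℝ, EM); F, E⟯) (t : ℝ) (z : ι → ℝ)
    (k : ι) : bracketMatrix L P γ ξ t z k =
      P.coord k (γ t) (∑ j, z j • L.bracket (ξ t) (P.sec j) (γ t)) := by
  simp [bracketMatrix, map_sum, mul_comm]

lemma continuousOn_bracketMatrix (hξ : C.IsGeodesicExtension A₀ a b δ ξ)
    (ha : 1 ∈ C.geodesicDomain a) (P : PartialFrame EM F E ι)
    (hP : ∀ t ∈ Icc (0 : ℝ) 1, C.baseCurve a t ∈ P.domain) :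
    ContinuousOn (bracketMatrix L P (C.baseCurve a) (fun t => ξ t 0)) (Icc 0 1) := by
  refine continuousOn_clm_apply.2 fun z => continuousOn_pi.2 fun k => ?_
  simp only [bracketMatrix_apply, map_sum, map_smul, smul_eq_mul]
  exact continuousOn_finsetSum _ fun j _ =>
    continuousOn_const.mul (hξ.continuousOn_bracket ha P hP _ k)

/-- If coordinates `z` with respect to a (possibly overcomplete) frame solve the equation
`ż + [ξ₀, z] = 0` and represent the zero vector at one time, then they do so at all times. -/
lemma sum_eq_zero (hξ : C.IsGeodesicExtension A₀ a b δ ξ)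
    (ha : 1 ∈ C.geodesicDomain a) (P : PartialFrame EM F E ι)
    (hP : ∀ t ∈ Icc (0 : ℝ) 1, C.baseCurve a t ∈ P.domain) {z : ℝ → ι → ℝ}
    (hz : ∀ t ∈ Icc (0 : ℝ) 1,
      HasDerivAt z (-bracketMatrix L P (C.baseCurve a) (fun t => ξ t 0) t (z t)) t) {t₀ : ℝ}
    (ht₀ : t₀ ∈ Icc (0 : ℝ) 1) (h0 : ∑ k, z t₀ k • P.sec k (C.baseCurve a t₀) = 0) {t : ℝ}
    (ht : t ∈ Icc (0 : ℝ) 1) : ∑ k, z t k • P.sec k (C.baseCurve a t) = 0 := by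
  set γ := C.baseCurve a with hγ
  set ζ : ℝ → ι → ℝ := fun t k => P.coord k (γ t) (∑ j, z t j • P.sec j (γ t)) with hζ
  -- the derivative of the matrix of the projection to the coordinates
  set Θ' : ℝ → (ι → ℝ) →L[ℝ] (ι → ℝ) := fun t => ContinuousLinearMap.pi fun k => ∑ j,
    dirDeriv (P.coeff k (P.sec j)) (L.anchor (γ t) (ξ t 0 (γ t))) • ContinuousLinearMap.proj j
    with hΘ
  have hΘa : ∀ t y k, Θ' t y k =
      ∑ j, y j * dirDeriv (P.coeff k (P.sec j)) (L.anchor (γ t) (ξ t 0 (γ t))) := fun t y k => by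
    simp [hΘ, mul_comm]
  have hsum : ∀ t ∈ Icc (0 : ℝ) 1,
      ∑ k, ζ t k • P.sec k (γ t) = ∑ k, z t k • P.sec k (γ t) := fun t ht =>
    P.sum_coord_smul (hP t ht) _
  have hdir : ∀ f : C^∞⟮𝓘(ℝ, EM), M; ℝ⟯, ∀ t ∈ Icc (0 : ℝ) 1,
      HasDerivAt (fun r => f (γ r)) (dirDeriv f (L.anchor (γ t) (ξ t 0 (γ t)))) t := fun f t ht =>
    (hξ.hasVelocityAt_baseCurve ha ht).hasDerivAt_dirDeriv f
  have hd : ∀ t ∈ Icc (0 : ℝ) 1, HasDerivAt ζ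
      ((Θ' t - bracketMatrix L P γ (fun t => ξ t 0) t) (ζ t)) t := by
    intro t ht
    obtain ⟨ζ', hζ', he⟩ := (L.isDerivationAt_bracket (ξ t 0) (γ t)).sum_deriv_coord_eq
      (hξ.hasVelocityAt_baseCurve ha ht) P (hP t ht) P.sec (fun j => hasDerivAt_pi.1 (hz t ht) j)
      (u := fun r => ∑ j, z r j • P.sec j (γ r)) (Eventually.of_forall fun _ => rfl)
    -- the right hand side of `he` vanishes
    have h1 : ∑ j, ((-bracketMatrix L P γ (fun t => ξ t 0) t (z t)) j • P.sec j (γ t) +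
        z t j • L.bracket (ξ t 0) (P.sec j) (γ t)) = 0 := by
      simp only [Pi.neg_apply, bracketMatrix_apply, neg_smul]
      rw [Finset.sum_add_distrib, Finset.sum_neg_distrib, P.sum_coord_smul (hP t ht),
        neg_add_cancel]
    have h2 : ∑ k, ζ' k • P.sec k (γ t) = -∑ k, ζ t k • L.bracket (ξ t 0) (P.sec k) (γ t) := by
      rw [h1, Finset.sum_add_distrib] at he
      exact eq_neg_of_add_eq_zero_left he
    refine hasDerivAt_pi.2 fun k => ?_
    have h3 : HasDerivAt (fun r => ∑ j, ζ r j * P.coeff k (P.sec j) (γ r))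
        (∑ j, (ζ' j * P.coeff k (P.sec j) (γ t) +
          ζ t j * dirDeriv (P.coeff k (P.sec j)) (L.anchor (γ t) (ξ t 0 (γ t))))) t :=
      HasDerivAt.fun_sum fun j _ => (hζ' j).mul (hdir _ t ht)
    have h4 : (fun r => ζ r k) =ᶠ[𝓝 t] fun r => ∑ j, ζ r j * P.coeff k (P.sec j) (γ r) := by
      have hc : ContinuousAt γ t := (hξ.hasVelocityAt_baseCurve ha ht).continuousAt
      filter_upwards [hc.preimage_mem_nhds (P.isOpen_domain.mem_nhds (hP t ht))] with r hr
      have h5 : ζ r k = P.coord k (γ r) (∑ j, ζ r j • P.sec j (γ r)) :=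
        congrArg (P.coord k (γ r)) (P.sum_coord_smul hr (∑ j, z r j • P.sec j (γ r))).symm
      rw [h5]
      simp only [map_sum, map_smul, smul_eq_mul]
      rfl
    refine (h3.congr_of_eventuallyEq h4).congr_deriv ?_
    have h6 := congrArg (P.coord k (γ t)) h2
    rw [map_neg, ← bracketMatrix_apply L P γ (fun t => ξ t 0)] at h6
    simp only [map_sum, map_smul, smul_eq_mul] at h6
    rw [Finset.sum_add_distrib, _root_.sub_apply, Pi.sub_apply, hΘa, sub_eq_neg_add, ← h6]
    rfl
  have hc : ContinuousOn (fun t => Θ' t - bracketMatrix L P γ (fun t => ξ t 0) t) (Icc 0 1) := by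
    refine ContinuousOn.sub ?_ (hξ.continuousOn_bracketMatrix ha P hP)
    refine continuousOn_clm_apply.2 fun y => continuousOn_pi.2 fun k => ?_
    simp only [hΘa]
    refine continuousOn_finsetSum _ fun j _ => continuousOn_const.mul ?_
    have h1 : ∀ t ∈ Icc (0 : ℝ) 1,
        dirDeriv (P.coeff k (P.sec j)) (L.anchor (γ t) (ξ t 0 (γ t))) =
        ∑ i, P.coord i (γ t) (C.geodesic a t).2 *
          L.anchorDeriv (P.sec i) (P.coeff k (P.sec j)) (γ t) := fun t ht => by
      rw [hξ.apply_zero ht]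
      refine (congrArg (dirDeriv _) (L.anchor_eq_sum P (hP t ht) (C.geodesic a t).2)).trans ?_
      rw [dirDeriv_sum]
      simp only [dirDeriv_smul, PreLieAlgebroid.anchorDeriv_apply]
    refine ContinuousOn.congr ?_ h1
    exact continuousOn_finsetSum _ fun i _ =>
      (((C.isGeodesicOn_geodesic a).1.contDiffOn_coord P i).continuousOn.mono
        ((C.ordConnected_geodesicDomain a).out (C.zero_mem_geodesicDomain a) ha)).mul
      ((L.anchorDeriv (P.sec i) _).contMDiff.continuous.comp_continuousOn
        (contMDiffOn_baseCurve ha).continuousOn)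
  have h7 : ζ t₀ = 0 := by
    funext k
    simp only [hζ, h0, map_zero, Pi.zero_apply]
  have h8 := eq_zero_of_linear_ode hc hd ht₀ h7 ht
  rw [← hsum t ht, h8]
  simp

/-- The infinitesimal flow of a geodesic extension along the central curve exists. -/
theorem exists_isInfinitesimalFlow (hξ : C.IsGeodesicExtension A₀ a b δ ξ)
    (ha : 1 ∈ C.geodesicDomain a) :
    ∃ ψ, IsInfinitesimalFlow L (fun t => ξ t 0) (Icc 0 1) (C.baseCurve a) ψ := by
  obtain ⟨N, P, hP⟩ := C.exists_frame_baseCurve ha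
  set γ := C.baseCurve a with hγ
  set Q := bracketMatrix L P γ (fun t => ξ t 0) with hQ
  obtain ⟨Φ, Ψ, h⟩ := exists_fundamental_solution (hξ.continuousOn_bracketMatrix ha P hP)
  let θ : (s : ℝ) → E (γ s) →ₗ[ℝ] (Fin N → ℝ) := fun s => LinearMap.pi fun k => P.coord k (γ s)
  let e : (s : ℝ) → (Fin N → ℝ) →ₗ[ℝ] E (γ s) := fun s =>
    Fintype.linearCombination ℝ (fun k => P.sec k (γ s))
  have he : ∀ s z, e s z = ∑ k, z k • P.sec k (γ s) := fun s z =>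
    Fintype.linearCombination_apply ℝ _ _
  have heθ : ∀ s ∈ Icc (0 : ℝ) 1, ∀ v, e s (θ s v) = v := fun s hs v => by
    rw [he]
    exact P.sum_coord_smul (hP s hs) v
  have hinv : ∀ s ∈ Icc (0 : ℝ) 1, ∀ z, Φ s (Ψ s z) = z := fun s hs z =>
    congrArg (fun A : (Fin N → ℝ) →L[ℝ] (Fin N → ℝ) => A z) (h s hs).2.2.1
  have hinv' : ∀ s ∈ Icc (0 : ℝ) 1, ∀ z, Ψ s (Φ s z) = z := fun s hs z =>
    congrArg (fun A : (Fin N → ℝ) →L[ℝ] (Fin N → ℝ) => A z) (h s hs).2.2.2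
  refine ⟨fun t s => e t ∘ₗ (Φ t : (Fin N → ℝ) →ₗ[ℝ] (Fin N → ℝ)) ∘ₗ
    (Ψ s : (Fin N → ℝ) →ₗ[ℝ] (Fin N → ℝ)) ∘ₗ θ s, fun t ht => ?_, fun s hs => ?_,
    fun s hs t ht u hu => ?_, fun s hs α => ?_⟩
  · exact (hξ.hasVelocityAt_baseCurve ha ht).hasMFDerivWithinAt
  · ext v
    change e s (Φ s (Ψ s (θ s v))) = v
    rw [hinv s hs, heθ s hs]
  · ext v
    change e u (Φ u (Ψ t (θ t (e t (Φ t (Ψ s (θ s v))))))) = e u (Φ u (Ψ s (θ s v)))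
    set y := Φ t (Ψ s (θ s v)) with hy
    have h1 : Ψ s (θ s v) = Ψ t y := (hinv' t ht _).symm
    rw [h1, ← sub_eq_zero, ← map_sub, ← map_sub, ← map_sub]
    set κ := θ t (e t y) - y with hκ
    rw [he]
    refine hξ.sum_eq_zero ha P hP (z := fun r => Φ r (Ψ t κ)) (fun r hr => ?_) ht ?_ hu
    · exact ((h r hr).1.clm_apply (hasDerivAt_const r _)).congr_deriv (by simp)
    · rw [hinv t ht, ← he, hκ, map_sub, heθ t ht, sub_self]
  · have h1 : HasDerivAt (fun t => θ t (α (γ t)))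
        (fun k => dirDeriv (P.coeff k α) (L.anchor (γ s) (ξ s 0 (γ s)))) s :=
      hasDerivAt_pi.2 fun k => (hξ.hasVelocityAt_baseCurve ha hs).hasDerivAt_dirDeriv (P.coeff k α)
    have h2 : HasDerivAt (fun t => Φ s (Ψ t (θ t (α (γ t)))))
        (Q s (θ s (α (γ s))) +
          fun k => dirDeriv (P.coeff k α) (L.anchor (γ s) (ξ s 0 (γ s)))) s := by
      refine ((Φ s).hasFDerivAt.comp_hasDerivAt s ((h s hs).2.1.clm_apply h1)).congr_deriv ?_
      rw [map_add, hinv s hs]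
      congr 1
      exact hinv s hs _
    have h3 := hasDerivWithinAt_sum_smul_of_equiv (fiberEquiv F E (γ s)) (s := Finset.univ)
      (fun k _ => (hasDerivAt_pi.1 h2 k).hasDerivWithinAt (s := Icc 0 1)) fun k => P.sec k (γ s)
    have h4 : ∑ k, (Q s (θ s (α (γ s))) +
        fun k => dirDeriv (P.coeff k α) (L.anchor (γ s) (ξ s 0 (γ s)))) k • P.sec k (γ s) =
        L.bracket (ξ s 0) α (γ s) := by
      have h5 := (L.isDerivationAt_bracket (ξ s 0) (γ s)).eq_sum P (hP s hs) α
      rw [h5]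
      simp only [Pi.add_apply, add_smul, Finset.sum_add_distrib, hQ, bracketMatrix_apply]
      rw [P.sum_coord_smul (hP s hs)]
      rfl
    rw [h4] at h3
    have h6 : (fun t => e s (Φ s (Ψ t (θ t (α (γ t)))))) =
        fun t => ∑ k, Φ s (Ψ t (θ t (α (γ t)))) k • P.sec k (γ s) := funext fun t => he _ _
    change HasDerivWithinAt (fun t => e s (Φ s (Ψ t (θ t (α (γ t)))))) _ _ _
    rw [h6]
    exact h3

end IsGeodesicExtension

end AConnection

end Existence

/-! ### The one-form defined by the variation equation -/

section ExpForm

variable {EM : Type*} [NormedAddCommGroup EM] [NormedSpace ℝ EM]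
  {M : Type*} [TopologicalSpace M] [ChartedSpace EM M] [IsManifold 𝓘(ℝ, EM) ∞ M]
  {F : Type*} [NormedAddCommGroup F] [NormedSpace ℝ F]
  {E : M → Type*} [TopologicalSpace (TotalSpace F E)]
  [∀ x, AddCommGroup (E x)] [∀ x, Module ℝ (E x)] [∀ x, TopologicalSpace (E x)]
  [∀ x, IsTopologicalAddGroup (E x)] [∀ x, ContinuousSMul ℝ (E x)]
  [FiberBundle F E] [VectorBundle ℝ F E]
  [FiniteDimensional ℝ EM] [FiniteDimensional ℝ F] [T2Space M] [SigmaCompactSpace M]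
  [ContMDiffVectorBundle ∞ F E 𝓘(ℝ, EM)]
  {L : PreLieAlgebroid EM F E} (C : AConnection L) {ι : Type} [Fintype ι]

namespace AConnection

lemma isVariationSolution_iff (P : PartialFrame EM F E ι) (a : TotalSpace F E) (b : E a.1)
    (V : ι → ℝ → ℝ) : IsVariationSolution L P (C.geodesicFamily a b) V ↔ (∀ k, V k 0 = 0) ∧
      ∀ t ∈ Icc (0 : ℝ) 1, ∀ k, HasDerivAt (V k) (C.paramDeriv P a b k t -
        ∑ i, ∑ j, P.coord i (C.geodesic a t).1 (C.geodesic a t).2 * V j t *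
          P.coeff k (L.bracket (P.sec i) (P.sec j)) (C.geodesic a t).1) t := by
  have h : ∀ k t, (fun y : TotalSpace F E => ∑ i, ∑ j, P.coord i y.1 y.2 * V j t *
      P.coeff k (L.bracket (P.sec i) (P.sec j)) y.1) (C.geodesicFamily a b (t, 0)) =
      (fun y : TotalSpace F E => ∑ i, ∑ j, P.coord i y.1 y.2 * V j t *
      P.coeff k (L.bracket (P.sec i) (P.sec j)) y.1) (C.geodesic a t) := fun k t => by
    rw [C.geodesicFamily_zero]
  refine ⟨fun hV => ⟨hV.zero, fun t ht k => ?_⟩, fun hV => ⟨hV.1, fun t ht k => ?_⟩⟩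
  · exact (hV.hasDerivAt t ht k).congr_deriv (congrArg (fun y => C.paramDeriv P a b k t - y) (h k t))
  · exact (hV.2 t ht k).congr_deriv
      (congrArg (fun y => C.paramDeriv P a b k t - y) (h k t).symm)

/-- The variation equation is the transport equation with the bracket terms expanded in the frame. -/
lemma _root_.PreLie.IsVariationSolution.isTransport {P : PartialFrame EM F E ι}
    {a : TotalSpace F E} (ha : 1 ∈ C.geodesicDomain a)
    (hP : ∀ t ∈ Icc (0 : ℝ) 1, C.baseCurve a t ∈ P.domain) {b : E a.1}
    {V : ι → ℝ → ℝ} (hV : IsVariationSolution L P (C.geodesicFamily a b) V) :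
    C.IsTransport P a b V := by
  obtain ⟨hV0, hVd⟩ := (C.isVariationSolution_iff P a b V).1 hV
  refine ⟨fun k t ht => (hVd t ht k).continuousAt.continuousWithinAt, hV0, fun t ht =>
    ⟨_, hVd t (Ioo_subset_Icc_self ht), ?_⟩, fun t ht f => ?_⟩
  · have hx := hP t (Ioo_subset_Icc_self ht)
    have h1 : ∑ i, ∑ j, (P.coord i (C.baseCurve a t) (C.geodesic a t).2 * V j t) •
        L.bracket (P.sec i) (P.sec j) (C.baseCurve a t) =
        ∑ k, (∑ i, ∑ j, P.coord i (C.baseCurve a t) (C.geodesic a t).2 * V j t *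
          P.coeff k (L.bracket (P.sec i) (P.sec j)) (C.baseCurve a t)) •
            P.sec k (C.baseCurve a t) := by
      simp only [Finset.sum_smul]
      have h2 : ∀ i, ∑ k, ∑ j, (P.coord i (C.baseCurve a t) (C.geodesic a t).2 * V j t *
          P.coeff k (L.bracket (P.sec i) (P.sec j)) (C.baseCurve a t)) •
            P.sec k (C.baseCurve a t) =
          ∑ j, (P.coord i (C.baseCurve a t) (C.geodesic a t).2 * V j t) •
            L.bracket (P.sec i) (P.sec j) (C.baseCurve a t) := fun i => by
        rw [Finset.sum_comm]
        refine Finset.sum_congr rfl fun j _ => ?_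
        simp only [mul_smul, ← Finset.smul_sum]
        rw [← P.sum_coord_smul hx (L.bracket (P.sec i) (P.sec j) (C.baseCurve a t))]
        simp [P.sum_coord_smul hx]
      exact (Finset.sum_congr rfl fun i _ => (h2 i).symm).trans Finset.sum_comm
    rw [h1, ← Finset.sum_add_distrib]
    refine Finset.sum_congr rfl fun k _ => ?_
    rw [← add_smul]
    exact congrArg (· • P.sec k (C.baseCurve a t)) (sub_add_cancel _ _)
  · have hG := C.isAPathFamily_geodesicFamily ha b
    have h1 : ∀ t, (C.geodesicFamily a b (t, 0)).1 = C.baseCurve a t := fun t =>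
      congrArg TotalSpace.proj (C.geodesicFamily_zero a b t)
    have h2 := hG.anchorDefect_eq_zero hV (fun r hr => by rw [h1]; exact hP r hr)
      (Ioo_subset_Icc_self ht) f
    unfold anchorDefect at h2
    rw [h1] at h2
    exact sub_eq_zero.1 h2

/-- `w` is the value at time `1` of the solution of the variation equation for the variation of the
geodesic `g_a` in the direction `b`. -/
def IsExpForm (a : TotalSpace F E) (b : E a.1) (w : E (C.target a)) : Prop :=
  ∃ (N : ℕ) (P : PartialFrame EM F E (Fin N)) (V : Fin N → ℝ → ℝ),
    (∀ t ∈ Icc (0 : ℝ) 1, C.baseCurve a t ∈ P.domain) ∧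
    IsVariationSolution L P (C.geodesicFamily a b) V ∧
    w = ∑ k, V k 1 • P.sec k (C.target a)

/-- The direction `b` is the value of a section, so that the solution is one of a smooth family. -/
lemma exists_isVariationSolution {a : TotalSpace F E} (ha : 1 ∈ C.geodesicDomain a)
    (P : PartialFrame EM F E ι) (hP : ∀ t ∈ Icc (0 : ℝ) 1, C.baseCurve a t ∈ P.domain) (b : E a.1) :
    ∃ V, IsVariationSolution L P (C.geodesicFamily a b) V := by
  obtain ⟨β, hβ⟩ := exists_section_apply_eq (EM := EM) (F := F) b
  obtain ⟨W, V, -, haW, -, hV⟩ := C.exists_variationSolution ha P hP β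
  have h := (hV a haW).2
  rw [hβ] at h
  exact ⟨_, h⟩

lemma eq_of_forall_dual {x : M} {v w : E x} (h : ∀ l : E x →ₗ[ℝ] ℝ, l v = l w) : v = w := by
  rw [← sub_eq_zero]
  refine (Module.forall_dual_apply_eq_zero_iff ℝ _).1 fun l => ?_
  rw [map_sub, h l, sub_self]

variable {C} {A₀ : Set (TotalSpace F E)} (hA₀ : C.IsExpDomain A₀)

/-- A solution of the transport equation determines the value of the one-form. -/
lemma IsExpForm.eq_sum (hA₀ : C.IsExpDomain A₀) {a : TotalSpace F E} (ha : a ∈ A₀) {b : E a.1}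
    {w : E (C.target a)} (hw : C.IsExpForm a b w) {P : PartialFrame EM F E ι}
    (hP : ∀ t ∈ Icc (0 : ℝ) 1, C.baseCurve a t ∈ P.domain) {z : ι → ℝ → ℝ}
    (hz : C.IsTransport P a b z) : w = ∑ k, z k 1 • P.sec k (C.target a) := by
  obtain ⟨N, Q, V, hQ, hV, rfl⟩ := hw
  have ha1 := hA₀.one_mem a ha
  obtain ⟨δ, ξ, hξ⟩ := C.exists_isGeodesicExtension hA₀ ha b
  obtain ⟨ψ, hψ⟩ := hξ.exists_isInfinitesimalFlow ha1
  refine eq_of_forall_dual fun l => ?_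
  exact (hξ.hasIntegral ha1 Q hQ (hV.isTransport C ha1 hQ) hψ l).2.symm.trans
    (hξ.hasIntegral ha1 P hP hz hψ l).2

lemma IsExpForm.unique (hA₀ : C.IsExpDomain A₀) {a : TotalSpace F E} (ha : a ∈ A₀) {b : E a.1}
    {w w' : E (C.target a)} (hw : C.IsExpForm a b w) (hw' : C.IsExpForm a b w') : w = w' := by
  obtain ⟨N, Q, V, hQ, hV, rfl⟩ := hw'
  exact hw.eq_sum hA₀ ha hQ (hV.isTransport C (hA₀.one_mem a ha) hQ)

/-- Derivatives along the family of geodesics depend linearly on the direction. -/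
lemma exists_linear_partialSnd {a : TotalSpace F E} (ha : 1 ∈ C.geodesicDomain a)
    {f : TotalSpace F E → ℝ} (hf : ContMDiff (𝓘(ℝ, EM).prod 𝓘(ℝ, F)) 𝓘(ℝ, ℝ) ∞ f) {t : ℝ}
    (ht : t ∈ Icc (0 : ℝ) 1) :
    ∃ D : E a.1 →ₗ[ℝ] ℝ, ∀ b, partialSnd (fun p => f (C.geodesicFamily a b p)) (t, 0) = D b := by
  obtain ⟨n, P, hP⟩ : ∃ (n : ℕ) (P : PartialFrame EM F E (Fin n)), a.1 ∈ P.domain :=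
    let ⟨P, hP, _⟩ := exists_partialFrame_isFree EM F E a.1
    ⟨_, P, hP⟩
  have htd : t ∈ C.geodesicDomain a :=
    (C.ordConnected_geodesicDomain a).out (C.zero_mem_geodesicDomain a) ha ht
  let κ : (Fin n → ℝ) → TotalSpace F E := fun c =>
    ⟨a.1, ∑ k, (P.coord k a.1 a.2 + c k) • P.sec k a.1⟩
  have hκ : ContMDiff 𝓘(ℝ, Fin n → ℝ) (𝓘(ℝ, EM).prod 𝓘(ℝ, F)) ∞ κ := by
    rw [← contMDiffOn_univ]
    exact contMDiffOn_sum_smul contMDiffOn_const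
      (fun k => ContMDiff.contMDiffOn (ContDiff.contMDiff (by fun_prop))) P.sec
  have hκε : ∀ (b : E a.1) (ε : ℝ), κ (ε • fun k => P.coord k a.1 b) = ⟨a.1, a.2 + ε • b⟩ := by
    intro b ε
    change (⟨a.1, ∑ k, (P.coord k a.1 a.2 + ε * P.coord k a.1 b) • P.sec k a.1⟩ :
      TotalSpace F E) = _
    congr 1
    rw [← P.sum_coord_smul hP (a.2 + ε • b)]
    simp
  have hκ0 : κ 0 = a := by
    change (⟨a.1, ∑ k, (P.coord k a.1 a.2 + 0) • P.sec k a.1⟩ : TotalSpace F E) = _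
    simp only [add_zero, P.sum_coord_smul hP]
  have hH : DifferentiableAt ℝ (fun c => f (C.geodesic (κ c) t)) 0 := by
    have h1 : ContMDiffAt 𝓘(ℝ, Fin n → ℝ) (𝓘(ℝ, ℝ).prod (𝓘(ℝ, EM).prod 𝓘(ℝ, F))) ∞
        (fun c => (t, κ c)) 0 := contMDiffAt_const.prodMk (hκ 0)
    have h2 : ContMDiffAt (𝓘(ℝ, ℝ).prod (𝓘(ℝ, EM).prod 𝓘(ℝ, F))) (𝓘(ℝ, EM).prod 𝓘(ℝ, F)) ∞
        (fun p : ℝ × TotalSpace F E => C.geodesic p.2 p.1) (t, κ 0) :=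
      C.contMDiffAt_geodesic (by rw [hκ0]; exact htd)
    have h3 : ContMDiffAt 𝓘(ℝ, Fin n → ℝ) 𝓘(ℝ, ℝ) ∞ (fun c => f (C.geodesic (κ c) t)) 0 :=
      hf.contMDiffAt.comp 0 (ContMDiffAt.comp (f := fun c => (t, κ c)) 0 h2 h1)
    exact h3.contDiffAt.differentiableAt (by simp)
  refine ⟨(fderiv ℝ (fun c => f (C.geodesic (κ c) t)) 0 : (Fin n → ℝ) →ₗ[ℝ] ℝ) ∘ₗ
    LinearMap.pi fun k => P.coord k a.1, fun b => ?_⟩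
  have hG := C.isAPathFamily_geodesicFamily ha b
  have h4 := hasDerivAt_partialSnd hG.isOpen
    ((hf.comp_contMDiffOn hG.smooth).contDiffOn) (hG.mem t ht)
  set v : Fin n → ℝ := fun k => P.coord k a.1 b with hv
  have h5 : HasDerivAt (fun ε : ℝ => ε • v) v 0 := by
    simpa using (hasDerivAt_id (0 : ℝ)).smul_const v
  have h6 : HasDerivAt (fun ε : ℝ => f (C.geodesic (κ (ε • v)) t))
      (fderiv ℝ (fun c => f (C.geodesic (κ c) t)) 0 v) 0 :=
    HasFDerivAt.comp_hasDerivAt (0 : ℝ) (l := fun c => f (C.geodesic (κ c) t))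
      (f := fun ε : ℝ => ε • v) (by rw [zero_smul]; exact hH.hasFDerivAt) h5
  simp only [hv, hκε] at h6
  exact h4.unique h6

/-- The coordinate derivatives of the family of geodesics depend linearly on the direction. -/
lemma exists_linear_paramDeriv {a : TotalSpace F E} (ha : 1 ∈ C.geodesicDomain a)
    (P : PartialFrame EM F E ι) (k : ι) {t : ℝ} (ht : t ∈ Icc (0 : ℝ) 1) :
    ∃ D : E a.1 →ₗ[ℝ] ℝ, ∀ b, C.paramDeriv P a b k t = D b :=
  exists_linear_partialSnd ha (P.contMDiff_coord k) ht

lemma IsExpForm.smul_add (hA₀ : C.IsExpDomain A₀) {a : TotalSpace F E} (ha : a ∈ A₀) {b c : E a.1}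
    {w w' : E (C.target a)} (hw : C.IsExpForm a b w) (hw' : C.IsExpForm a c w') (r : ℝ) :
    C.IsExpForm a (r • b + c) (r • w + w') := by
  have ha1 := hA₀.one_mem a ha
  obtain ⟨N, P, V', hP, hV', rfl⟩ := hw'
  obtain ⟨V, hV⟩ := C.exists_isVariationSolution ha1 P hP b
  obtain rfl := hw.eq_sum hA₀ ha hP (hV.isTransport C ha1 hP)
  refine ⟨N, P, fun k t => r * V k t + V' k t, hP, ?_, ?_⟩
  · rw [isVariationSolution_iff] at hV hV' ⊢
    refine ⟨fun k => by rw [hV.1, hV'.1, mul_zero, add_zero], fun t ht k => ?_⟩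
    obtain ⟨D, hD⟩ := exists_linear_paramDeriv ha1 P k ht
    refine (((hV.2 t ht k).const_mul r).add (hV'.2 t ht k)).congr_deriv ?_
    rw [hD, hD, hD, map_add, map_smul]
    simp only [mul_add, add_mul, Finset.sum_add_distrib, smul_eq_mul, mul_sub, Finset.mul_sum]
    have h1 : ∀ i j, r * (P.coord i (C.geodesic a t).1 (C.geodesic a t).2 * V j t *
        P.coeff k (L.bracket (P.sec i) (P.sec j)) (C.geodesic a t).1) =
        P.coord i (C.geodesic a t).1 (C.geodesic a t).2 * (r * V j t) *
        P.coeff k (L.bracket (P.sec i) (P.sec j)) (C.geodesic a t).1 := fun i j => by ring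
    simp only [h1]
    ring
  · simp only [add_smul, mul_smul, Finset.sum_add_distrib, Finset.smul_sum]

/-- The one-form whose values are given by the solutions of the variation equation. -/
lemma exists_expForm (hA₀ : C.IsExpDomain A₀) :
    ∃ φ : (a : TotalSpace F E) → E a.1 →ₗ[ℝ] E (C.target a),
      ∀ a ∈ A₀, ∀ b, C.IsExpForm a b (φ a b) := by
  have h1 : ∀ a : TotalSpace F E, ∃ f : E a.1 →ₗ[ℝ] E (C.target a),
      a ∈ A₀ → ∀ b, C.IsExpForm a b (f b) := by
    intro a
    by_cases ha : a ∈ A₀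
    · have ha1 := hA₀.one_mem a ha
      obtain ⟨N, P, hP⟩ := C.exists_frame_baseCurve ha1
      have h2 : ∀ b, ∃ w, C.IsExpForm a b w := fun b => by
        obtain ⟨V, hV⟩ := C.exists_isVariationSolution ha1 P hP b
        exact ⟨_, N, P, V, hP, hV, rfl⟩
      choose f hf using h2
      have h3 : ∀ (r : ℝ) b c, f (r • b + c) = r • f b + f c := fun r b c =>
        (hf _).unique hA₀ ha ((hf b).smul_add hA₀ ha (hf c) r)
      have h0 : f 0 = 0 := by
        have h4 := h3 1 0 0
        rw [one_smul, one_smul, add_zero] at h4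
        exact left_eq_add.1 h4
      refine ⟨⟨⟨f, fun b c => ?_⟩, fun r b => ?_⟩, fun _ => hf⟩
      · simpa using h3 1 b c
      · simpa [h0] using h3 r b 0
    · exact ⟨0, fun h => absurd h ha⟩
  choose φ hφ using h1
  exact ⟨φ, hφ⟩

end AConnection

end ExpForm

/-! ### Properties of the one-form -/

section Properties

variable {EM : Type*} [NormedAddCommGroup EM] [NormedSpace ℝ EM]
  {M : Type*} [TopologicalSpace M] [ChartedSpace EM M] [IsManifold 𝓘(ℝ, EM) ∞ M]
  {F : Type*} [NormedAddCommGroup F] [NormedSpace ℝ F]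
  {E : M → Type*} [TopologicalSpace (TotalSpace F E)]
  [∀ x, AddCommGroup (E x)] [∀ x, Module ℝ (E x)] [∀ x, TopologicalSpace (E x)]
  [∀ x, IsTopologicalAddGroup (E x)] [∀ x, ContinuousSMul ℝ (E x)]
  [FiberBundle F E] [VectorBundle ℝ F E]
  [FiniteDimensional ℝ EM] [FiniteDimensional ℝ F] [T2Space M] [SigmaCompactSpace M]
  [ContMDiffVectorBundle ∞ F E 𝓘(ℝ, EM)]
  {L : PreLieAlgebroid EM F E} {C : AConnection L} {ι : Type} [Fintype ι]
  {A₀ : Set (TotalSpace F E)}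

namespace AConnection

/-- The vertical derivative of the target map is the variation of the base curves at time `1`. -/
lemma dirDeriv_vertDeriv {a : TotalSpace F E} (ha : 1 ∈ C.geodesicDomain a) (b : E a.1)
    (f : C^∞⟮𝓘(ℝ, EM), M; ℝ⟯) : dirDeriv f (vertDeriv (EM := EM) C.target a b) =
      partialSnd (fun p => f (C.geodesicFamily a b p).1) (1, 0) := by
  have hG := C.isAPathFamily_geodesicFamily ha b
  rw [← hG.dirDeriv_variationField (hG.mem 1 ⟨zero_le_one, le_rfl⟩)]
  have h : ∀ (x y : M) (_ : x = y) (v : EM), dirDeriv (x := x) f v = dirDeriv (x := y) f v := by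
    rintro x _ rfl v
    rfl
  exact h _ _ (congrArg TotalSpace.proj (C.geodesicFamily_zero a b 1)).symm _

lemma contMDiffOn_exp (hA₀ : C.IsExpDomain A₀) :
    ContMDiffOn (𝓘(ℝ, EM).prod 𝓘(ℝ, F)) (𝓘(ℝ, EM).prod 𝓘(ℝ, F)) ∞ C.exp A₀ := fun a ha =>
  (ContMDiffAt.comp a (f := fun a : TotalSpace F E => ((1 : ℝ), a))
    (C.contMDiffAt_geodesic (p := (1, a)) (hA₀.one_mem a ha))
    (contMDiffAt_const.prodMk contMDiffAt_id)).contMDiffWithinAt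

lemma contMDiffOn_target (hA₀ : C.IsExpDomain A₀) :
    ContMDiffOn (𝓘(ℝ, EM).prod 𝓘(ℝ, F)) 𝓘(ℝ, EM) ∞ C.target A₀ :=
  (contMDiff_proj E).comp_contMDiffOn (contMDiffOn_exp hA₀)

variable {φ : (a : TotalSpace F E) → E a.1 →ₗ[ℝ] E (C.target a)}

/-- The vanishing of the anchor defect at time `1`. -/
lemma isAnchored_expForm (hA₀ : C.IsExpDomain A₀)
    (hφ : ∀ a ∈ A₀, ∀ b, C.IsExpForm a b (φ a b)) : IsAnchored L A₀ C.target φ := by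
  intro a ha b
  obtain ⟨N, P, V, hP, hV, hw⟩ := hφ a ha b
  have ha1 := hA₀.one_mem a ha
  have hG := C.isAPathFamily_geodesicFamily ha1 b
  refine tangent_ext fun f => ?_
  have h1 : ∀ t, (C.geodesicFamily a b (t, 0)).1 = C.baseCurve a t := fun t =>
    congrArg TotalSpace.proj (C.geodesicFamily_zero a b t)
  have h2 := hG.anchorDefect_eq_zero hV (fun r hr => by rw [h1]; exact hP r hr)
    (t := 1) ⟨zero_le_one, le_rfl⟩ f
  unfold anchorDefect at h2
  rw [h1] at h2
  rw [dirDeriv_vertDeriv ha1, ← sub_eq_zero.1 h2, hw, map_sum, dirDeriv_sum]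
  simp only [map_smul, dirDeriv_smul]
  rfl

/-- Smoothness of the one-form is smooth dependence of solutions of the variation equation. -/
lemma isFoliatedOneForm_expForm (hA₀ : C.IsExpDomain A₀)
    (hφ : ∀ a ∈ A₀, ∀ b, C.IsExpForm a b (φ a b)) :
    IsFoliatedOneForm (EM := EM) A₀ C.target φ := by
  intro β a₀ ha₀
  have ha1 := hA₀.one_mem a₀ ha₀
  obtain ⟨N, P, hP⟩ := C.exists_frame_baseCurve ha1
  obtain ⟨W, V, hW, haW, hVs, hV⟩ := C.exists_variationSolution ha1 P hP β
  have h1 : ContMDiffOn (𝓘(ℝ, EM).prod 𝓘(ℝ, F)) (𝓘(ℝ, EM).prod 𝓘(ℝ, F)) ∞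
      (fun a => (⟨C.target a, ∑ k, V k 1 a • P.sec k (C.target a)⟩ : TotalSpace F E)) (A₀ ∩ W) :=
    contMDiffOn_sum_smul ((contMDiffOn_target hA₀).mono inter_subset_left)
      (fun k => (hVs k).mono inter_subset_right) P.sec
  have h2 : ∀ a ∈ A₀ ∩ W, (⟨C.target a, φ a (β a.1)⟩ : TotalSpace F E) =
      ⟨C.target a, ∑ k, V k 1 a • P.sec k (C.target a)⟩ := fun a ha => by
    have h3 : ∀ t ∈ Icc (0 : ℝ) 1, C.baseCurve a t ∈ P.domain := fun t ht =>
      ((hV a ha.2).1 t ht).2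
    congr 1
    exact (hφ a ha.1 (β a.1)).eq_sum hA₀ ha.1 h3
      ((hV a ha.2).2.isTransport C (hA₀.one_mem a ha.1) h3)
  exact ((h1.congr h2).contMDiffAt ((hA₀.isOpen.inter hW).mem_nhds ⟨ha₀, haW⟩)).contMDiffWithinAt

/-- Scaling of geodesics, in a partial frame. -/
lemma coord_geodesic_smul {a : TotalSpace F E} {c r : ℝ} (h : c * r ∈ C.geodesicDomain a)
    (P : PartialFrame EM F E ι) (k : ι) :
    P.coord k (C.geodesic ⟨a.1, c • a.2⟩ r).1 (C.geodesic ⟨a.1, c • a.2⟩ r).2 =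
      c * P.coord k (C.geodesic a (c * r)).1 (C.geodesic a (c * r)).2 := by
  have h1 := congrArg (fun y : TotalSpace F E => P.coord k y.1 y.2) (C.geodesic_smul h).2
  simpa using h1

lemma hasDerivAt_coord_geodesic {a : TotalSpace F E} {t : ℝ} (ht : t ∈ C.geodesicDomain a)
    (P : PartialFrame EM F E ι) (k : ι) :
    HasDerivAt (fun r => P.coord k (C.geodesic a r).1 (C.geodesic a r).2)
      (deriv (fun r => P.coord k (C.geodesic a r).1 (C.geodesic a r).2) t) t :=
  ((((C.isGeodesicOn_geodesic a).1.contDiffOn_coord P k).contDiffAt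
    ((C.isOpen_geodesicDomain a).mem_nhds ht)).differentiableAt (by simp)).hasDerivAt

lemma mem_geodesicDomain {a : TotalSpace F E} (ha : 1 ∈ C.geodesicDomain a) {t : ℝ}
    (ht : t ∈ Icc (0 : ℝ) 1) : t ∈ C.geodesicDomain a :=
  (C.ordConnected_geodesicDomain a).out (C.zero_mem_geodesicDomain a) ha ht

lemma hasDerivAt_paramDeriv {a : TotalSpace F E} (ha : 1 ∈ C.geodesicDomain a) (b : E a.1)
    (P : PartialFrame EM F E ι) (k : ι) {t : ℝ} (ht : t ∈ Icc (0 : ℝ) 1) :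
    HasDerivAt (fun ε => P.coord k (C.geodesicFamily a b (t, ε)).1
      (C.geodesicFamily a b (t, ε)).2) (C.paramDeriv P a b k t) 0 :=
  let hG := C.isAPathFamily_geodesicFamily ha b
  hasDerivAt_partialSnd hG.isOpen (hG.contDiffOn_coord P k) (hG.mem t ht)

/-- In the direction of `a` itself, the variation of `g_a` comes from rescaling time. -/
lemma paramDeriv_self {a : TotalSpace F E} (ha : 1 ∈ C.geodesicDomain a)
    (P : PartialFrame EM F E ι) (k : ι) {t : ℝ} (ht : t ∈ Icc (0 : ℝ) 1) :
    C.paramDeriv P a a.2 k t = P.coord k (C.geodesic a t).1 (C.geodesic a t).2 +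
      t * deriv (fun r => P.coord k (C.geodesic a r).1 (C.geodesic a r).2) t := by
  have htd := mem_geodesicDomain ha ht
  refine (hasDerivAt_paramDeriv ha a.2 P k ht).unique ?_
  have h0 : (1 + (0 : ℝ)) * t = t := by ring
  have h1 : HasDerivAt (fun ε : ℝ => (1 + ε) * t) t 0 := by
    simpa using ((hasDerivAt_id (0 : ℝ)).const_add 1).mul_const t
  have h2 : HasDerivAt (fun ε : ℝ => P.coord k (C.geodesic a ((1 + ε) * t)).1
      (C.geodesic a ((1 + ε) * t)).2)
      (deriv (fun r => P.coord k (C.geodesic a r).1 (C.geodesic a r).2) t * t) 0 :=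
    HasDerivAt.comp (h := fun ε : ℝ => (1 + ε) * t) (0 : ℝ)
      (h₂ := fun r => P.coord k (C.geodesic a r).1 (C.geodesic a r).2)
      (by rw [h0]; exact hasDerivAt_coord_geodesic htd P k) h1
  have h3 := ((hasDerivAt_id (0 : ℝ)).const_add 1).mul h2
  have h4 : (fun ε => P.coord k (C.geodesicFamily a a.2 (t, ε)).1
      (C.geodesicFamily a a.2 (t, ε)).2) =ᶠ[𝓝 0] fun ε => (1 + ε) *
        P.coord k (C.geodesic a ((1 + ε) * t)).1 (C.geodesic a ((1 + ε) * t)).2 := by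
    have h5 : (fun ε : ℝ => (1 + ε) * t) ⁻¹' C.geodesicDomain a ∈ 𝓝 (0 : ℝ) :=
      h1.continuousAt.preimage_mem_nhds
        ((C.isOpen_geodesicDomain a).mem_nhds (by rw [h0]; exact htd))
    filter_upwards [h5] with ε hε
    rw [← coord_geodesic_smul hε, add_smul, one_smul]
    rfl
  refine (h3.congr_of_eventuallyEq h4).congr_deriv ?_
  rw [h0]
  simp only [id, add_zero, one_mul]
  ring

lemma sum_bracket_antisymm (L : PreLieAlgebroid EM F E) (P : PartialFrame EM F E ι) (u : ι → ℝ)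
    (k : ι) (x : M) :
    ∑ i, ∑ j, u i * u j * P.coeff k (L.bracket (P.sec i) (P.sec j)) x = 0 := by
  have h1 : ∀ i j, P.coeff k (L.bracket (P.sec i) (P.sec j)) x =
      -P.coeff k (L.bracket (P.sec j) (P.sec i)) x := fun i j => by
    rw [L.antisymm]
    exact map_neg (P.coord k x) _
  have h2 : ∑ i, ∑ j, u i * u j * P.coeff k (L.bracket (P.sec i) (P.sec j)) x =
      -∑ i, ∑ j, u i * u j * P.coeff k (L.bracket (P.sec i) (P.sec j)) x := by
    conv_lhs => rw [Finset.sum_comm]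
    simp only [← Finset.sum_neg_distrib]
    refine Finset.sum_congr rfl fun i _ => Finset.sum_congr rfl fun j _ => ?_
    rw [h1 j i]
    ring
  linarith

/-- In the direction of `a` itself, `t ↦ t g_a(t)` solves the variation equation, since the bracket
term vanishes by antisymmetry. -/
lemma expForm_apply_self (hA₀ : C.IsExpDomain A₀)
    (hφ : ∀ a ∈ A₀, ∀ b, C.IsExpForm a b (φ a b)) {a : TotalSpace F E} (ha : a ∈ A₀) :
    φ a a.2 = (C.exp a).2 := by
  have ha1 := hA₀.one_mem a ha
  obtain ⟨N, P, hP⟩ := C.exists_frame_baseCurve ha1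
  set U : Fin N → ℝ → ℝ := fun k t => P.coord k (C.geodesic a t).1 (C.geodesic a t).2 with hU
  have hV : IsVariationSolution L P (C.geodesicFamily a a.2) (fun k t => t * U k t) := by
    rw [isVariationSolution_iff]
    refine ⟨fun k => zero_mul _, fun t ht k => ?_⟩
    refine ((hasDerivAt_id t).mul
      (hasDerivAt_coord_geodesic (mem_geodesicDomain ha1 ht) P k)).congr_deriv ?_
    have h1 := sum_bracket_antisymm L P (fun i => U i t) k (C.geodesic a t).1
    have h2 : ∑ i, ∑ j, U i t * (t * U j t) *
        P.coeff k (L.bracket (P.sec i) (P.sec j)) (C.geodesic a t).1 = 0 := by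
      rw [← mul_zero t, ← h1]
      simp only [Finset.mul_sum]
      exact Finset.sum_congr rfl fun i _ => Finset.sum_congr rfl fun j _ => by ring
    rw [h2, paramDeriv_self ha1 P k ht, sub_zero, one_mul]
    rfl
  have h3 := (hφ a ha a.2).eq_sum hA₀ ha hP (hV.isTransport C ha1 hP)
  rw [h3]
  simp only [one_mul]
  exact P.sum_coord_smul (hP 1 ⟨zero_le_one, le_rfl⟩) _

lemma geodesic_zeroSection (x : M) (t : ℝ) :
    t ∈ C.geodesicDomain ⟨x, 0⟩ ∧ C.geodesic ⟨x, 0⟩ t = ⟨x, 0⟩ := by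
  have h := C.geodesic_smul (a := ⟨x, 0⟩) (c := 0) (r := t)
    (by rw [zero_mul]; exact C.zero_mem_geodesicDomain _)
  simp only [smul_zero] at h
  have h2 : ∀ y : TotalSpace F E, y = ⟨x, 0⟩ →
      (⟨y.1, (0 : ℝ) • y.2⟩ : TotalSpace F E) = ⟨x, 0⟩ := by
    rintro _ rfl
    simp
  exact ⟨h.1, h.2.trans (h2 _ (by rw [zero_mul, geodesic_zero]))⟩

lemma target_zeroSection (x : M) : C.target ⟨x, 0⟩ = x :=
  congrArg TotalSpace.proj (geodesic_zeroSection (C := C) x 1).2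

/-- At the zero section, the one-form is the identity. -/
lemma expForm_zeroSection (hA₀ : C.IsExpDomain A₀)
    (hφ : ∀ a ∈ A₀, ∀ b, C.IsExpForm a b (φ a b)) {x : M} (P : PartialFrame EM F E ι)
    (hP : x ∈ P.domain) (b : E x) :
    φ ⟨x, 0⟩ b = ∑ k, P.coord k x b • P.sec k (C.target ⟨x, 0⟩) := by
  have ha := hA₀.zero_mem x
  have ha1 := hA₀.one_mem _ ha
  have hg : ∀ t, C.geodesic ⟨x, 0⟩ t = ⟨x, 0⟩ := fun t => (geodesic_zeroSection x t).2
  have hP' : ∀ t ∈ Icc (0 : ℝ) 1, C.baseCurve ⟨x, 0⟩ t ∈ P.domain := fun t _ => by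
    unfold baseCurve
    rw [hg t]
    exact hP
  have hV : IsVariationSolution L P (C.geodesicFamily ⟨x, 0⟩ b) (fun k t => P.coord k x b * t) := by
    rw [isVariationSolution_iff]
    refine ⟨fun k => mul_zero _, fun t ht k => ?_⟩
    have h1 : C.paramDeriv P ⟨x, 0⟩ b k t = P.coord k x b := by
      refine (hasDerivAt_paramDeriv ha1 b P k ht).unique ?_
      set h : ℝ → ℝ := fun r => P.coord k (C.geodesic ⟨x, b⟩ r).1 (C.geodesic ⟨x, b⟩ r).2 with hh
      have h2 : HasDerivAt (fun ε : ℝ => ε * t) t 0 := by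
        simpa using (hasDerivAt_id (0 : ℝ)).mul_const t
      have h3 : HasDerivAt (fun ε : ℝ => h (ε * t)) (deriv h 0 * t) 0 :=
        HasDerivAt.comp (h := fun ε : ℝ => ε * t) (0 : ℝ) (h₂ := h) (by
          rw [zero_mul]
          exact hasDerivAt_coord_geodesic (C.zero_mem_geodesicDomain _) P k) h2
      have h4 := (hasDerivAt_id (0 : ℝ)).mul h3
      have h5 : (fun ε => P.coord k (C.geodesicFamily ⟨x, 0⟩ b (t, ε)).1
          (C.geodesicFamily ⟨x, 0⟩ b (t, ε)).2) =ᶠ[𝓝 0] fun ε => ε * h (ε * t) := by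
        have h6 : (fun ε : ℝ => ε * t) ⁻¹' C.geodesicDomain ⟨x, b⟩ ∈ 𝓝 (0 : ℝ) :=
          h2.continuousAt.preimage_mem_nhds
            ((C.isOpen_geodesicDomain _).mem_nhds (by
              rw [zero_mul]
              exact C.zero_mem_geodesicDomain _))
        filter_upwards [h6] with ε hε
        rw [hh, ← coord_geodesic_smul (a := ⟨x, b⟩) hε]
        exact congrArg (fun y : TotalSpace F E => P.coord k (C.geodesic y t).1 (C.geodesic y t).2)
          (by simp only [zero_add])
      refine (h4.congr_of_eventuallyEq h5).congr_deriv ?_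
      have h7 : h 0 = P.coord k x b :=
        congrArg (fun y : TotalSpace F E => P.coord k y.1 y.2) (C.geodesic_zero ⟨x, b⟩)
      simp [h7]
    rw [h1]
    refine ((hasDerivAt_id t).const_mul _).congr_deriv ?_
    rw [hg t]
    simp
  have h7 := (hφ _ ha b).eq_sum hA₀ ha hP' (hV.isTransport C ha1 hP')
  simpa only [mul_one] using h7

/-- The one-form is pointwise an isomorphism near the zero section. -/
lemma exists_bijective_expForm (hA₀ : C.IsExpDomain A₀)
    (hφ : ∀ a ∈ A₀, ∀ b, C.IsExpForm a b (φ a b)) :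
    ∃ U : Set (TotalSpace F E), IsOpen U ∧ U ⊆ A₀ ∧
      (∀ x : M, (⟨x, 0⟩ : TotalSpace F E) ∈ U) ∧ ∀ a ∈ U, Function.Bijective (φ a) := by
  refine ⟨interior {a ∈ A₀ | Function.Bijective (φ a)}, isOpen_interior,
    fun a ha => (interior_subset ha).1, fun x => ?_, fun a ha => (interior_subset ha).2⟩
  obtain ⟨P, hP, hfree⟩ := exists_partialFrame_isFree EM F E x
  set D : TotalSpace F E → Matrix (Fin (Module.finrank ℝ F)) (Fin (Module.finrank ℝ F)) ℝ :=
    fun a => Matrix.of fun k j => P.coord k (C.target a) (φ a (P.sec j a.1)) with hD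
  have hDc : ContinuousOn (fun a => (D a).det) A₀ := by
    refine (continuous_id.matrix_det).comp_continuousOn
      (continuousOn_pi.2 fun k => continuousOn_pi.2 fun j => ?_)
    exact (P.contMDiff_coord k).continuous.comp_continuousOn
      (isFoliatedOneForm_expForm hA₀ hφ (P.sec j)).continuousOn
  have hD0 : D ⟨x, 0⟩ = 1 := by
    ext k j
    have hx : C.target ⟨x, 0⟩ ∈ P.domain := by rw [target_zeroSection]; exact hP
    change P.coord k (C.target ⟨x, 0⟩) (φ ⟨x, 0⟩ (P.sec j x)) = _
    rw [expForm_zeroSection hA₀ hφ P hP, hfree _ hx]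
    have h1 := hfree x hP (Pi.single j 1) k
    simp only [Pi.single_apply, ite_smul, one_smul, zero_smul, Finset.sum_ite_eq',
      Finset.mem_univ, if_true] at h1
    rw [h1, Matrix.one_apply]
  have hS : IsOpen (A₀ ∩ (fun a => (D a).det) ⁻¹' {0}ᶜ) :=
    hDc.isOpen_inter_preimage hA₀.isOpen isOpen_compl_singleton
  have hT : IsOpen {a : TotalSpace F E | a.1 ∈ P.domain} :=
    P.isOpen_domain.preimage (contMDiff_proj E (n := ∞) (IB := 𝓘(ℝ, EM))).continuous
  refine mem_interior.2 ⟨_, ?_, hS.inter hT, ⟨⟨hA₀.zero_mem x, by simp [hD0]⟩, hP⟩⟩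
  rintro a ⟨⟨ha, hdet⟩, haP⟩
  refine ⟨ha, ?_⟩
  have hinj : Function.Injective (φ a) := by
    refine (injective_iff_map_eq_zero _).2 fun b hb => ?_
    have h1 : (D a).mulVec (fun j => P.coord j a.1 b) = 0 := by
      funext k
      have h2 := congrArg (P.coord k (C.target a)) hb
      rw [← P.sum_coord_smul haP b] at h2
      simp only [map_sum, map_smul, smul_eq_mul, map_zero] at h2
      rw [Pi.zero_apply, ← h2]
      simp only [Matrix.mulVec, dotProduct]
      exact Finset.sum_congr rfl fun j _ => mul_comm (D a k j) (P.coord j a.1 b)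
    have h3 := Matrix.eq_zero_of_mulVec_eq_zero hdet h1
    rw [← P.sum_coord_smul haP b]
    exact Finset.sum_eq_zero fun j _ => by rw [congrFun h3 j, Pi.zero_apply, zero_smul]
  have hfd : ∀ y : M, FiniteDimensional ℝ (E y) := fun y =>
    (fiberEquiv F E y).symm.toLinearEquiv.finiteDimensional
  have hfr : Module.finrank ℝ (E a.1) = Module.finrank ℝ (E (C.target a)) :=
    (fiberEquiv F E a.1).toLinearEquiv.finrank_eq.trans
      (fiberEquiv F E (C.target a)).toLinearEquiv.finrank_eq.symm
  have := hfd a.1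
  have := hfd (C.target a)
  exact ⟨hinj, (LinearMap.injective_iff_surjective_of_finrank_eq_finrank hfr).1 hinj⟩

end AConnection

end Properties

/-! ### The Maurer-Cartan form in a partial frame -/

section MaurerCartan

variable {EM : Type*} [NormedAddCommGroup EM] [NormedSpace ℝ EM]
  {M : Type*} [TopologicalSpace M] [ChartedSpace EM M] [IsManifold 𝓘(ℝ, EM) ∞ M]
  {F : Type*} [NormedAddCommGroup F] [NormedSpace ℝ F]
  {E : M → Type*} [TopologicalSpace (TotalSpace F E)]
  [∀ x, AddCommGroup (E x)] [∀ x, Module ℝ (E x)] [∀ x, TopologicalSpace (E x)]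
  [∀ x, IsTopologicalAddGroup (E x)] [∀ x, ContinuousSMul ℝ (E x)]
  [FiberBundle F E] [VectorBundle ℝ F E]
  [FiniteDimensional ℝ EM] [FiniteDimensional ℝ F] [T2Space M] [SigmaCompactSpace M]
  [ContMDiffVectorBundle ∞ F E 𝓘(ℝ, EM)]
  {L : PreLieAlgebroid EM F E} {C : AConnection L} {ι : Type} [Fintype ι]

/-- The torsion of a connection on sections. -/
noncomputable def sectionTorsion (L : PreLieAlgebroid EM F E)
    (nab : CovariantDerivative 𝓘(ℝ, EM) F E) (x : M) (α β : Cₛ^∞⟮𝓘(ℝ, EM); F, E⟯) : E x :=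
  L.bracket α β x - nab β x (L.anchor x (α x)) + nab α x (L.anchor x (β x))

lemma sectionTorsion_antisymm (nab : CovariantDerivative 𝓘(ℝ, EM) F E) (x : M)
    (α β : Cₛ^∞⟮𝓘(ℝ, EM); F, E⟯) :
    sectionTorsion L nab x β α = -sectionTorsion L nab x α β := by
  unfold sectionTorsion
  rw [L.antisymm β α]
  change -(L.bracket α β x) - _ + _ = _
  abel

/-- The torsion is tensorial. -/
lemma isDerivationAt_sectionTorsion (nab : CovariantDerivative 𝓘(ℝ, EM) F E) (x : M)
    (α : Cₛ^∞⟮𝓘(ℝ, EM); F, E⟯) :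
    IsDerivationAt (0 : TangentSpace 𝓘(ℝ, EM) x) (sectionTorsion L nab x α) := by
  have h1 := L.isDerivationAt_bracket α x
  have h2 := isDerivationAt_covariantDerivative nab (L.anchor x (α x))
  refine ⟨fun σ τ => ?_, fun f σ => ?_⟩
  · have h3 : (σ + τ) x = σ x + τ x := rfl
    have h4 := h1.add σ τ
    have h5 := h2.add σ τ
    unfold sectionTorsion
    rw [h4, h5, h3, map_add, map_add]
    abel
  · have h4 := h1.leibniz f σ
    have h5 := h2.leibniz f σ
    unfold sectionTorsion
    rw [h4, h5, smulSection_apply, map_smul, map_smul, dirDeriv_zero]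
    module

lemma sectionTorsion_eq_sum (nab : CovariantDerivative 𝓘(ℝ, EM) F E) (P : PartialFrame EM F E ι)
    {x : M} (hx : x ∈ P.domain) (α β : Cₛ^∞⟮𝓘(ℝ, EM); F, E⟯) :
    sectionTorsion L nab x α β = ∑ i, ∑ j, (P.coord i x (α x) * P.coord j x (β x)) •
      sectionTorsion L nab x (P.sec i) (P.sec j) := by
  rw [(isDerivationAt_sectionTorsion nab x α).eq_sum_of_symbol_eq_zero P hx β, Finset.sum_comm]
  refine Finset.sum_congr rfl fun j _ => ?_
  rw [sectionTorsion_antisymm,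
    (isDerivationAt_sectionTorsion nab x (P.sec j)).eq_sum_of_symbol_eq_zero P hx α,
    ← Finset.sum_neg_distrib, Finset.smul_sum]
  refine Finset.sum_congr rfl fun i _ => ?_
  rw [sectionTorsion_antisymm nab x (P.sec i)]
  module

lemma torsion_eq_sectionTorsion (nab : CovariantDerivative 𝓘(ℝ, EM) F E) {x : M} (b c : E x) :
    torsion L nab b c = sectionTorsion L nab x (sectionThrough b) (sectionThrough c) := by
  unfold torsion sectionTorsion
  rw [sectionThrough_apply, sectionThrough_apply]

/-- Half of the antisymmetrized torsion is the torsion, and it is expanded in a partial frame. -/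
lemma half_smul_torsion_sub (nab : CovariantDerivative 𝓘(ℝ, EM) F E) (P : PartialFrame EM F E ι)
    {x : M} (hx : x ∈ P.domain) (b c : E x) :
    (1 / 2 : ℝ) • (torsion L nab b c - torsion L nab c b) =
      ∑ i, ∑ j, (P.coord i x b * P.coord j x c) • sectionTorsion L nab x (P.sec i) (P.sec j) := by
  rw [torsion_eq_sectionTorsion, torsion_eq_sectionTorsion,
    sectionTorsion_antisymm nab x (sectionThrough b) (sectionThrough c), sub_neg_eq_add, ← two_smul ℝ,
    smul_smul, one_div, inv_mul_cancel₀ two_ne_zero, one_smul, sectionTorsion_eq_sum nab P hx,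
    sectionThrough_apply, sectionThrough_apply]

/-- Covariant derivatives along curves exist, are unique, and are computed in a partial frame. -/
lemma hasCovDerivAlong_iff {γ : ℝ → M} {t δ : ℝ} (hδ : 0 < δ) {x : M} (hx : γ t = x) {w : EM}
    {K : Cₛ^∞⟮𝓘(ℝ, EM); F, E⟯ → E x}
    (hK : IsDerivationAt (w : TangentSpace 𝓘(ℝ, EM) x) K)
    (hγ : HasMFDerivAt 𝓘(ℝ, ℝ) 𝓘(ℝ, EM) γ t ((1 : ℝ →L[ℝ] ℝ).smulRight w : ℝ →L[ℝ] EM))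
    (P : PartialFrame EM F E ι) (hP : x ∈ P.domain) {c : ι → ℝ → ℝ}
    (hc : ∀ k, ContDiffOn ℝ ∞ (c k) (Ioo (t - δ) (t + δ))) {u : (r : ℝ) → E (γ r)}
    (hu : ∀ r ∈ Ioo (t - δ) (t + δ), u r = ∑ k, c k r • P.sec k (γ r)) (y : E x) :
    HasCovDerivAlong γ u t x K y ↔
      y = ∑ k, (deriv (c k) t • P.sec k x + c k t • K (P.sec k)) := by
  subst hx
  have h1 := hasCovDerivAlong_sum_smul hδ hK P.sec hc hu
  refine ⟨fun h => ?_, fun h => by rw [h]; exact h1⟩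
  obtain ⟨z, hz, hy⟩ := h.eq_sum (w := w) hγ hK P hP
  obtain ⟨z', hz', hy'⟩ := h1.eq_sum (w := w) hγ hK P hP
  have h2 : z = z' := funext fun k => (hz k).unique (hz' k)
  rw [hy, hy', h2]

/-- The junk value in the definition of the pulled back covariant derivative does not occur for curves
with smooth coordinates. -/
lemma pullbackCovDeriv_eq (nab : CovariantDerivative 𝓘(ℝ, EM) F E) {x : M} {f : E x → M}
    {s : (v : E x) → E (f v)} {v b : E x} {δ : ℝ} (hδ : 0 < δ)
    (hf : MDifferentiableAt 𝓘(ℝ, ℝ) 𝓘(ℝ, EM) (fun ε : ℝ => f (v + ε • b)) 0)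
    (P : PartialFrame EM F E ι) (hP : f v ∈ P.domain) {c : ι → ℝ → ℝ}
    (hc : ∀ k, ContDiffOn ℝ ∞ (c k) (Ioo (-δ) δ))
    (hs : ∀ r ∈ Ioo (-δ) δ, s (v + r • b) = ∑ k, c k r • P.sec k (f (v + r • b))) :
    pullbackCovDeriv nab f s v b = ∑ k, (deriv (c k) 0 • P.sec k (f v) +
      c k 0 • nab (P.sec k) (f v) (fiberDeriv f v b)) := by
  have hI : Ioo (0 - δ) (0 + δ) = Ioo (-δ) δ := by rw [zero_sub, zero_add]
  have h1 := fun y => hasCovDerivAlong_iff (EM := EM) (γ := fun ε : ℝ => f (v + ε • b)) (t := 0)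
    hδ (x := f v) (by simp) (w := (fiberDeriv (EM := EM) f v b : EM))
    (isDerivationAt_covariantDerivative nab (fiberDeriv f v b)) (hasVelocityAt_mfderiv hf) P hP
    (by rw [hI]; exact hc) (u := fun ε => s (v + ε • b)) (by rw [hI]; exact hs) y
  have h2 : ∃ y, HasCovDerivAlong (EM := EM) (F := F) (fun ε : ℝ => f (v + ε • b))
      (fun ε => s (v + ε • b)) 0 (f v) (fun σ => nab σ (f v) (fiberDeriv f v b)) y :=
    ⟨_, (h1 _).2 rfl⟩
  unfold pullbackCovDeriv
  rw [dif_pos h2]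
  exact (h1 _).1 h2.choose_spec

namespace AConnection

variable {A₀ : Set (TotalSpace F E)} {φ : (a : TotalSpace F E) → E a.1 →ₗ[ℝ] E (C.target a)}

/-- Along a line in a fibre, the coordinates of a foliated one-form are smooth. -/
lemma exists_contDiffOn_line (hA₀ : C.IsExpDomain A₀)
    (hfol : IsFoliatedOneForm (EM := EM) A₀ C.target φ) {a : TotalSpace F E} (ha : a ∈ A₀)
    (P : PartialFrame EM F E ι) (hP : C.target a ∈ P.domain) (b : E a.1) :
    ∃ δ : ℝ, 0 < δ ∧ (∀ ε ∈ Ioo (-δ) δ, (⟨a.1, a.2 + ε • b⟩ : TotalSpace F E) ∈ A₀ ∧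
        C.target ⟨a.1, a.2 + ε • b⟩ ∈ P.domain) ∧
      MDifferentiableAt 𝓘(ℝ, ℝ) 𝓘(ℝ, EM) (fun ε : ℝ => C.target ⟨a.1, a.2 + ε • b⟩) 0 ∧
      ∀ (c : E a.1) (k : ι), ContDiffOn ℝ ∞ (fun ε => P.coord k (C.target ⟨a.1, a.2 + ε • b⟩)
        (φ ⟨a.1, a.2 + ε • b⟩ c)) (Ioo (-δ) δ) := by
  have hl : ContMDiff 𝓘(ℝ, ℝ) (𝓘(ℝ, EM).prod 𝓘(ℝ, F)) ∞
      (fun ε : ℝ => (⟨a.1, a.2 + ε • b⟩ : TotalSpace F E)) := contMDiff_line a b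
  have h0 : (⟨a.1, a.2 + (0 : ℝ) • b⟩ : TotalSpace F E) = a := by simp
  have hS : IsOpen (A₀ ∩ C.target ⁻¹' P.domain) :=
    (contMDiffOn_target hA₀).continuousOn.isOpen_inter_preimage hA₀.isOpen P.isOpen_domain
  obtain ⟨δ, hδ, hball⟩ := Metric.mem_nhds_iff.1 (hl.continuous.continuousAt.preimage_mem_nhds
    (hS.mem_nhds (show (⟨a.1, a.2 + (0 : ℝ) • b⟩ : TotalSpace F E) ∈ _ by
      rw [h0]; exact ⟨ha, hP⟩)))
  rw [Real.ball_eq_Ioo, zero_sub, zero_add] at hball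
  refine ⟨δ, hδ, fun ε hε => hball hε, ?_, fun c k => ?_⟩
  · have h1 : ContMDiffOn 𝓘(ℝ, ℝ) 𝓘(ℝ, EM) ∞ (fun ε : ℝ => C.target ⟨a.1, a.2 + ε • b⟩)
        (Ioo (-δ) δ) :=
      (contMDiffOn_target hA₀).comp hl.contMDiffOn fun ε hε => (hball hε).1
    exact (h1.contMDiffAt (isOpen_Ioo.mem_nhds ⟨by linarith, hδ⟩)).mdifferentiableAt (by simp)
  · obtain ⟨β, hβ⟩ := exists_section_apply_eq (EM := EM) (F := F) c
    have h1 := (P.contMDiff_coord k).comp_contMDiffOn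
      ((hfol β).comp hl.contMDiffOn fun ε (hε : ε ∈ Ioo (-δ) δ) => (hball hε).1)
    refine h1.contDiffOn.congr fun ε _ => ?_
    exact congrArg (fun c => P.coord k _ (φ ⟨a.1, a.2 + ε • b⟩ c)) hβ.symm

/-- The Maurer-Cartan form of an anchored one-form `φ` with `φ_a(a) = exp a`, contracted with the
Euler vector field. The derivative of the curve `s ↦ φ_{sa}(sb)` comes from the Koszul formula, and
the terms that involve the auxiliary connection cancel against the torsion. -/
theorem maurerCartan_eq (hA₀ : C.IsExpDomain A₀)
    (hfol : IsFoliatedOneForm (EM := EM) A₀ C.target φ) (hanc : IsAnchored L A₀ C.target φ)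
    (hself : ∀ a ∈ A₀, φ a a.2 = (C.exp a).2) (nab : CovariantDerivative 𝓘(ℝ, EM) F E)
    {a : TotalSpace F E} (ha : a ∈ A₀) (b : E a.1) (P : PartialFrame EM F E ι)
    (hP : C.target a ∈ P.domain) :
    ∃ z' : ι → ℝ, (∀ k, HasDerivAt (fun s : ℝ => P.coord k (C.target ⟨a.1, s • a.2⟩)
        (φ ⟨a.1, s • a.2⟩ (s • b))) (z' k) 1) ∧
      maurerCartan L nab C.target φ a a.2 b = ∑ k, z' k • P.sec k (C.target a) -
        ∑ k, C.paramDeriv P a b k 1 • P.sec k (C.target a) +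
        ∑ i, ∑ j, (P.coord i (C.target a) (C.exp a).2 * P.coord j (C.target a) (φ a b)) •
          L.bracket (P.sec i) (P.sec j) (C.target a) := by
  have ha1 := hA₀.one_mem a ha
  have h0 : ∀ c : E a.1, (⟨a.1, a.2 + (0 : ℝ) • c⟩ : TotalSpace F E) = a := fun c => by simp
  have hval0 : ∀ (v : E a.1) (c : E a.1) (k : ι), v = a.2 →
      P.coord k (C.target ⟨a.1, v⟩) (φ ⟨a.1, v⟩ c) = P.coord k (C.target a) (φ a c) := by
    rintro _ c k rfl
    rfl
  set x := C.target a with hx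
  set y : ι → ℝ := fun k => P.coord k x (φ a b) with hy
  set U : ι → ℝ := fun k => P.coord k x (C.exp a).2 with hU
  -- the covariant derivative of `φ(b)` in the direction `a`
  obtain ⟨δ₁, hδ₁, hm₁, hd₁, hc₁⟩ := exists_contDiffOn_line hA₀ hfol ha P hP a.2
  set c : ι → ℝ → ℝ := fun k ε => P.coord k (C.target ⟨a.1, a.2 + ε • a.2⟩)
    (φ ⟨a.1, a.2 + ε • a.2⟩ b) with hc
  have hc0 : ∀ k, c k 0 = y k := fun k => hval0 _ b k (by simp)
  have e₁ : pullbackCovDeriv nab (fun v : E a.1 => C.target ⟨a.1, v⟩) (fun v => φ ⟨a.1, v⟩ b) a.2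
      a.2 = ∑ k, (deriv (c k) 0 • P.sec k x + y k • nab (P.sec k) x
        (vertDeriv (EM := EM) C.target a a.2)) := by
    rw [pullbackCovDeriv_eq nab (f := fun v : E a.1 => C.target ⟨a.1, v⟩)
      (s := fun v => φ ⟨a.1, v⟩ b) hδ₁ hd₁ P hP (c := c) (fun k => hc₁ b k)
      fun r hr => (P.sum_coord_smul (hm₁ r hr).2 _).symm]
    simp only [hc0]
    rfl
  -- the covariant derivative of `φ(a)` in the direction `b`
  obtain ⟨δ₂, hδ₂, hm₂, hd₂, hc₂⟩ := exists_contDiffOn_line hA₀ hfol ha P hP b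
  set d : ι → ℝ → ℝ := fun k ε => P.coord k (C.target ⟨a.1, a.2 + ε • b⟩)
    (φ ⟨a.1, a.2 + ε • b⟩ a.2) with hd
  set h : ι → ℝ → ℝ := fun k ε => P.coord k (C.target ⟨a.1, a.2 + ε • b⟩)
    (φ ⟨a.1, a.2 + ε • b⟩ b) with hh
  have hd0 : ∀ k, d k 0 = U k := fun k => by
    refine (hval0 _ a.2 k (by simp)).trans ?_
    rw [hself a ha]
  have hh0 : ∀ k, h k 0 = y k := fun k => hval0 _ b k (by simp)
  have h0I : (0 : ℝ) ∈ Ioo (-δ₂) δ₂ := ⟨by linarith, hδ₂⟩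
  have hdd : ∀ k, deriv (d k) 0 = C.paramDeriv P a b k 1 - y k := fun k => by
    have h1 : HasDerivAt (h k) (deriv (h k) 0) 0 :=
      (((hc₂ b k).contDiffAt (isOpen_Ioo.mem_nhds h0I)).differentiableAt (by simp)).hasDerivAt
    have h2 := hasDerivAt_paramDeriv ha1 b P k (t := 1) ⟨zero_le_one, le_rfl⟩
    have h3 := h2.sub ((hasDerivAt_id (0 : ℝ)).mul h1)
    have h4 : d k =ᶠ[𝓝 0] fun ε => P.coord k (C.geodesicFamily a b (1, ε)).1
        (C.geodesicFamily a b (1, ε)).2 - ε * h k ε := by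
      filter_upwards [isOpen_Ioo.mem_nhds h0I] with ε hε
      have h5 : φ ⟨a.1, a.2 + ε • b⟩ (a.2 + ε • b) = (C.exp ⟨a.1, a.2 + ε • b⟩).2 :=
        hself _ (hm₂ ε hε).1
      have h6 : φ ⟨a.1, a.2 + ε • b⟩ (a.2 + ε • b) =
          φ ⟨a.1, a.2 + ε • b⟩ a.2 + ε • φ ⟨a.1, a.2 + ε • b⟩ b := by
        rw [map_add, map_smul]
      have h7 := congrArg (P.coord k (C.target ⟨a.1, a.2 + ε • b⟩)) (h6.symm.trans h5)
      rw [map_add, map_smul, smul_eq_mul] at h7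
      exact eq_sub_of_add_eq h7
    refine (h3.congr_of_eventuallyEq h4).deriv.trans ?_
    simp [hh0]
  have e₂ : pullbackCovDeriv nab (fun v : E a.1 => C.target ⟨a.1, v⟩) (fun v => φ ⟨a.1, v⟩ a.2) a.2
      b = ∑ k, ((C.paramDeriv P a b k 1 - y k) • P.sec k x + U k • nab (P.sec k) x
        (vertDeriv (EM := EM) C.target a b)) := by
    rw [pullbackCovDeriv_eq nab (f := fun v : E a.1 => C.target ⟨a.1, v⟩)
      (s := fun v => φ ⟨a.1, v⟩ a.2) hδ₂ hd₂ P hP (c := d) (fun k => hc₂ a.2 k)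
      fun r hr => (P.sum_coord_smul (hm₂ r hr).2 _).symm]
    simp only [hd0, hdd]
    rfl
  refine ⟨fun k => y k + deriv (c k) 0, fun k => ?_, ?_⟩
  · have h1 : HasDerivAt (c k) (deriv (c k) 0) 0 :=
      (((hc₁ b k).contDiffAt (isOpen_Ioo.mem_nhds ⟨by linarith, hδ₁⟩)).differentiableAt
        (by simp)).hasDerivAt
    have h2 : HasDerivAt (fun s : ℝ => c k (s - 1)) (deriv (c k) 0) 1 := by
      have h3 := HasDerivAt.comp (h := fun s : ℝ => s - 1) (1 : ℝ) (h₂ := c k)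
        (by rw [sub_self]; exact h1)
        ((hasDerivAt_id (1 : ℝ)).sub_const 1)
      rw [mul_one] at h3
      exact h3
    have h4 := (hasDerivAt_id (1 : ℝ)).mul h2
    have h5 : (fun s : ℝ => P.coord k (C.target ⟨a.1, s • a.2⟩) (φ ⟨a.1, s • a.2⟩ (s • b))) =
        id * fun s => c k (s - 1) := by
      funext s
      have h6 : a.2 + (s - 1) • a.2 = s • a.2 := by module
      have h7 : ∀ v w : E a.1, v = w → P.coord k (C.target ⟨a.1, v⟩) (φ ⟨a.1, v⟩ b) =
          P.coord k (C.target ⟨a.1, w⟩) (φ ⟨a.1, w⟩ b) := by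
        rintro v _ rfl
        rfl
      rw [map_smul, map_smul, smul_eq_mul]
      exact congrArg (fun r => s * r) (h7 _ _ h6.symm)
    rw [h5]
    refine h4.congr_deriv ?_
    simp [hc0]
  · have hcoe : ∀ k, P.coord k x (φ a a.2) = U k := fun k => by rw [hself a ha]
    have w₁ : ∀ k, nab (P.sec k) x (vertDeriv (EM := EM) C.target a a.2) =
        ∑ i, U i • nab (P.sec k) x (L.anchor x (P.sec i x)) := fun k => by
      rw [← hanc a ha a.2, L.anchor_eq_sum P hP, map_sum]
      simp only [map_smul, hcoe]
    have w₂ : ∀ k, nab (P.sec k) x (vertDeriv (EM := EM) C.target a b) =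
        ∑ j, y j • nab (P.sec k) x (L.anchor x (P.sec j x)) := fun k => by
      rw [← hanc a ha b, L.anchor_eq_sum P hP, map_sum]
      simp only [map_smul, hy]
    unfold maurerCartan foliatedDiff
    rw [half_smul_torsion_sub nab P hP, e₁, e₂]
    simp only [w₁, w₂, hcoe, sectionTorsion, add_smul, sub_smul, Finset.sum_add_distrib,
      Finset.sum_sub_distrib, Finset.smul_sum, smul_add, smul_sub, smul_smul]
    have s₁ : ∑ k, ∑ i, (y k * U i) • nab (P.sec k) x (L.anchor x (P.sec i x)) =
        ∑ i, ∑ j, (U i * y j) • nab (P.sec j) x (L.anchor x (P.sec i x)) := by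
      rw [Finset.sum_comm]
      exact Finset.sum_congr rfl fun i _ => Finset.sum_congr rfl fun j _ => by rw [mul_comm]
    rw [s₁]
    simp only [hy, hU]
    abel

end AConnection

end MaurerCartan

/-! ### The Maurer-Cartan equation along rays -/

section Rays

variable {EM : Type*} [NormedAddCommGroup EM] [NormedSpace ℝ EM]
  {M : Type*} [TopologicalSpace M] [ChartedSpace EM M] [IsManifold 𝓘(ℝ, EM) ∞ M]
  {F : Type*} [NormedAddCommGroup F] [NormedSpace ℝ F]
  {E : M → Type*} [TopologicalSpace (TotalSpace F E)]
  [∀ x, AddCommGroup (E x)] [∀ x, Module ℝ (E x)] [∀ x, TopologicalSpace (E x)]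
  [∀ x, IsTopologicalAddGroup (E x)] [∀ x, ContinuousSMul ℝ (E x)]
  [FiberBundle F E] [VectorBundle ℝ F E]
  [FiniteDimensional ℝ EM] [FiniteDimensional ℝ F] [T2Space M] [SigmaCompactSpace M]
  [ContMDiffVectorBundle ∞ F E 𝓘(ℝ, EM)]
  {L : PreLieAlgebroid EM F E} {C : AConnection L} {ι : Type} [Fintype ι]

namespace AConnection

lemma one_mem_geodesicDomain_smul {a : TotalSpace F E} (ha : 1 ∈ C.geodesicDomain a) {s : ℝ}
    (hs : s ∈ Icc (0 : ℝ) 1) : 1 ∈ C.geodesicDomain ⟨a.1, s • a.2⟩ :=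
  (C.geodesic_smul (by rw [mul_one]; exact mem_geodesicDomain ha hs)).1

lemma target_smul {a : TotalSpace F E} (ha : 1 ∈ C.geodesicDomain a) {s : ℝ}
    (hs : s ∈ Icc (0 : ℝ) 1) : C.target ⟨a.1, s • a.2⟩ = C.baseCurve a s := by
  have h := (C.geodesic_smul (a := a) (c := s) (r := 1)
    (by rw [mul_one]; exact mem_geodesicDomain ha hs)).2
  rw [mul_one] at h
  have h2 := congrArg TotalSpace.proj h
  exact h2

/-- Derivatives of the family of geodesics in the direction `s b` at `s a`. -/
lemma partialSnd_geodesicFamily_smul {a : TotalSpace F E} (ha : 1 ∈ C.geodesicDomain a) (b : E a.1)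
    {f g : TotalSpace F E → ℝ} (hf : ContMDiff (𝓘(ℝ, EM).prod 𝓘(ℝ, F)) 𝓘(ℝ, ℝ) ∞ f)
    (hg : ContMDiff (𝓘(ℝ, EM).prod 𝓘(ℝ, F)) 𝓘(ℝ, ℝ) ∞ g) {c s t : ℝ}
    (hfg : ∀ y, f ⟨y.1, s • y.2⟩ = c * g y) (hs : s ∈ Icc (0 : ℝ) 1) (ht : t ∈ Icc (0 : ℝ) 1) :
    partialSnd (fun p => f (C.geodesicFamily ⟨a.1, s • a.2⟩ (s • b) p)) (t, 0) =
      c * partialSnd (fun p => g (C.geodesicFamily a b p)) (s * t, 0) := by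
  have hst : s * t ∈ Icc (0 : ℝ) 1 := ⟨mul_nonneg hs.1 ht.1, mul_le_one₀ hs.2 ht.1 ht.2⟩
  have hG := C.isAPathFamily_geodesicFamily ha b
  have hG' := C.isAPathFamily_geodesicFamily (one_mem_geodesicDomain_smul ha hs) (s • b)
  have h1 := hasDerivAt_partialSnd hG.isOpen
    ((hg.comp_contMDiffOn hG.smooth).contDiffOn) (hG.mem _ hst)
  have h2 := hasDerivAt_partialSnd hG'.isOpen
    ((hf.comp_contMDiffOn hG'.smooth).contDiffOn) (hG'.mem t ht)
  refine h2.unique ((h1.const_mul c).congr_of_eventuallyEq ?_)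
  have h3 : (fun ε : ℝ => (s * t, ε)) ⁻¹' C.familyDomain a b ∈ 𝓝 (0 : ℝ) :=
    (Continuous.prodMk_right (s * t)).continuousAt.preimage_mem_nhds
      (hG.isOpen.mem_nhds (hG.mem _ hst))
  filter_upwards [h3] with ε hε
  have h4 := (C.geodesic_smul (a := ⟨a.1, a.2 + ε • b⟩) (c := s) (r := t) hε).2
  have h5 : s • a.2 + ε • s • b = s • (a.2 + ε • b) := by module
  change f (C.geodesic ⟨a.1, s • a.2 + ε • s • b⟩ t) = _
  rw [h5, h4, hfg]
  rfl

lemma paramDeriv_smul {a : TotalSpace F E} (ha : 1 ∈ C.geodesicDomain a) (b : E a.1)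
    (P : PartialFrame EM F E ι) (k : ι) {s t : ℝ} (hs : s ∈ Icc (0 : ℝ) 1)
    (ht : t ∈ Icc (0 : ℝ) 1) :
    C.paramDeriv P ⟨a.1, s • a.2⟩ (s • b) k t = s * C.paramDeriv P a b k (s * t) :=
  partialSnd_geodesicFamily_smul ha b (P.contMDiff_coord k) (P.contMDiff_coord k)
    (fun y => by rw [map_smul, smul_eq_mul]) hs ht

/-- Solutions of the variation equation scale along rays. -/
lemma _root_.PreLie.IsVariationSolution.smul {a : TotalSpace F E} (ha : 1 ∈ C.geodesicDomain a)
    {b : E a.1} {P : PartialFrame EM F E ι} {V : ι → ℝ → ℝ}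
    (hV : IsVariationSolution L P (C.geodesicFamily a b) V) {s : ℝ} (hs : s ∈ Icc (0 : ℝ) 1) :
    IsVariationSolution L P (C.geodesicFamily ⟨a.1, s • a.2⟩ (s • b)) fun k t => V k (s * t) := by
  rw [isVariationSolution_iff] at hV ⊢
  refine ⟨fun k => by rw [mul_zero, hV.1], fun t ht k => ?_⟩
  have hst : s * t ∈ Icc (0 : ℝ) 1 := ⟨mul_nonneg hs.1 ht.1, mul_le_one₀ hs.2 ht.1 ht.2⟩
  have h1 : HasDerivAt (fun t => s * t) s t := by
    simpa using (hasDerivAt_id t).const_mul s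
  refine (HasDerivAt.comp (h := fun t => s * t) t (h₂ := V k) (hV.2 _ hst k) h1).congr_deriv ?_
  have hd := mem_geodesicDomain ha hst
  have h2 : ∀ i j, P.coeff k (L.bracket (P.sec i) (P.sec j)) (C.geodesic ⟨a.1, s • a.2⟩ t).1 =
      P.coeff k (L.bracket (P.sec i) (P.sec j)) (C.geodesic a (s * t)).1 := fun i j => by
    rw [(C.geodesic_smul hd).2]
  rw [paramDeriv_smul ha b P k hs ht]
  simp only [h2, coord_geodesic_smul hd, sub_mul, Finset.sum_mul]
  rw [mul_comm (C.paramDeriv P a b k (s * t))]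
  refine congrArg _ (Finset.sum_congr rfl fun i _ => Finset.sum_congr rfl fun j _ => ?_)
  ring

variable {A₀ : Set (TotalSpace F E)} {φ : (a : TotalSpace F E) → E a.1 →ₗ[ℝ] E (C.target a)}

/-- Along the ray through `a`, the contraction of the Maurer-Cartan form with the Euler vector field
vanishes if and only if the curve `s ↦ φ_{sa}(sb)` solves the transport equation. -/
theorem maurerCartan_smul_eq_zero_iff (hA₀ : C.IsExpDomain A₀)
    (hfol : IsFoliatedOneForm (EM := EM) A₀ C.target φ) (hanc : IsAnchored L A₀ C.target φ)
    (hself : ∀ a ∈ A₀, φ a a.2 = (C.exp a).2) (nab : CovariantDerivative 𝓘(ℝ, EM) F E)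
    {a : TotalSpace F E} (ha : a ∈ A₀) (b : E a.1) (P : PartialFrame EM F E ι) {r : ℝ}
    (hr : r ∈ Ioc (0 : ℝ) 1) (hP : C.baseCurve a r ∈ P.domain) :
    ∃ z' : ι → ℝ, (∀ k, HasDerivAt (fun s : ℝ => P.coord k (C.target ⟨a.1, s • a.2⟩)
        (φ ⟨a.1, s • a.2⟩ (s • b))) (z' k) r) ∧
      (maurerCartan L nab C.target φ ⟨a.1, r • a.2⟩ (r • a.2) (r • b) = 0 ↔
        ∑ k, z' k • P.sec k (C.baseCurve a r) +
          ∑ i, ∑ j, (P.coord i (C.baseCurve a r) (C.geodesic a r).2 *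
            P.coord j (C.target ⟨a.1, r • a.2⟩) (φ ⟨a.1, r • a.2⟩ (r • b))) •
              L.bracket (P.sec i) (P.sec j) (C.baseCurve a r) =
        ∑ k, C.paramDeriv P a b k r • P.sec k (C.baseCurve a r)) := by
  have ha1 := hA₀.one_mem a ha
  have hrI : r ∈ Icc (0 : ℝ) 1 := Ioc_subset_Icc_self hr
  have hr0 : r ≠ 0 := hr.1.ne'
  have hx := target_smul ha1 hrI
  obtain ⟨z, hz, he⟩ := maurerCartan_eq (a := ⟨a.1, r • a.2⟩) hA₀ hfol hanc hself nab
    (hA₀.smul_mem a ha r hrI) (r • b) P (by rw [hx]; exact hP)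
  refine ⟨fun k => z k * r⁻¹, fun k => ?_, ?_⟩
  · have h1 : HasDerivAt (fun s : ℝ => s * r⁻¹) r⁻¹ r := by
      simpa using (hasDerivAt_id r).mul_const r⁻¹
    have h2 := HasDerivAt.comp (h := fun s : ℝ => s * r⁻¹) r
      (h₂ := fun s : ℝ => P.coord k (C.target ⟨a.1, s • r • a.2⟩)
        (φ ⟨a.1, s • r • a.2⟩ (s • r • b))) (by rw [mul_inv_cancel₀ hr0]; exact hz k) h1
    refine h2.congr_of_eventuallyEq (Eventually.of_forall fun s => ?_)
    have h3 : ∀ v : E a.1, (s * r⁻¹) • r • v = s • v := fun v => by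
      rw [smul_smul, mul_assoc, inv_mul_cancel₀ hr0, mul_one]
    have h4 : ∀ v w : E a.1, v = w → ∀ c, P.coord k (C.target ⟨a.1, v⟩) (φ ⟨a.1, v⟩ c) =
        P.coord k (C.target ⟨a.1, w⟩) (φ ⟨a.1, w⟩ c) := by
      rintro v _ rfl c
      rfl
    simp only [Function.comp_apply, h3 b]
    exact h4 _ _ (h3 a.2).symm _
  · have hU : ∀ i, P.coord i (C.target ⟨a.1, r • a.2⟩) (C.exp ⟨a.1, r • a.2⟩).2 =
        r * P.coord i (C.baseCurve a r) (C.geodesic a r).2 := fun i => by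
      have h := coord_geodesic_smul (C := C) (a := a) (c := r) (r := 1)
        (by rw [mul_one]; exact mem_geodesicDomain ha1 hrI) P i
      rwa [mul_one] at h
    have hD : ∀ k, C.paramDeriv P ⟨a.1, r • a.2⟩ (r • b) k 1 = r * C.paramDeriv P a b k r :=
      fun k => by
        rw [paramDeriv_smul ha1 b P k hrI ⟨zero_le_one, le_rfl⟩, mul_one]
    simp only [hU, hD] at he
    rw [he]
    generalize hy : (fun j => P.coord j (C.target ⟨a.1, r • a.2⟩)
      (φ ⟨a.1, r • a.2⟩ (r • b))) = y
    have hy' : ∀ j, P.coord j (C.target ⟨a.1, r • a.2⟩) (φ ⟨a.1, r • a.2⟩ (r • b)) = y j :=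
      congrFun hy
    simp only [hy']
    have h4 : ∀ x₁ x₂ : M, x₁ = x₂ → ∀ (U D : ι → ℝ),
        (∑ k, z k • P.sec k x₁ - ∑ k, (r * D k) • P.sec k x₁ +
          ∑ i, ∑ j, (r * U i * y j) • L.bracket (P.sec i) (P.sec j) x₁ = 0 ↔
        ∑ k, (z k * r⁻¹) • P.sec k x₂ + ∑ i, ∑ j, (U i * y j) • L.bracket (P.sec i) (P.sec j) x₂ =
          ∑ k, D k • P.sec k x₂) := by
      rintro x₁ _ rfl U D
      have h5 : ∑ k, z k • P.sec k x₁ - ∑ k, (r * D k) • P.sec k x₁ +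
          ∑ i, ∑ j, (r * U i * y j) • L.bracket (P.sec i) (P.sec j) x₁ =
          r • (∑ k, (z k * r⁻¹) • P.sec k x₁ +
            ∑ i, ∑ j, (U i * y j) • L.bracket (P.sec i) (P.sec j) x₁ -
              ∑ k, D k • P.sec k x₁) := by
        have h6 : ∀ k, r * (z k * r⁻¹) = z k := fun k => by field_simp
        simp only [smul_sub, smul_add, Finset.smul_sum, smul_smul, h6, mul_assoc]
        abel
      rw [h5, smul_eq_zero_iff_right hr0, sub_eq_zero]
    exact h4 _ _ hx _ _

end AConnection

end Rays

/-! ### Existence and uniqueness -/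

section Existence

variable {EM : Type*} [NormedAddCommGroup EM] [NormedSpace ℝ EM]
  {M : Type*} [TopologicalSpace M] [ChartedSpace EM M] [IsManifold 𝓘(ℝ, EM) ∞ M]
  {F : Type*} [NormedAddCommGroup F] [NormedSpace ℝ F]
  {E : M → Type*} [TopologicalSpace (TotalSpace F E)]
  [∀ x, AddCommGroup (E x)] [∀ x, Module ℝ (E x)] [∀ x, TopologicalSpace (E x)]
  [∀ x, IsTopologicalAddGroup (E x)] [∀ x, ContinuousSMul ℝ (E x)]
  [FiberBundle F E] [VectorBundle ℝ F E]
  [FiniteDimensional ℝ EM] [FiniteDimensional ℝ F] [T2Space M] [SigmaCompactSpace M]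
  [ContMDiffVectorBundle ∞ F E 𝓘(ℝ, EM)]
  {L : PreLieAlgebroid EM F E} {C : AConnection L} {ι : Type} [Fintype ι]

namespace AConnection

variable {A₀ : Set (TotalSpace F E)} {φ : (a : TotalSpace F E) → E a.1 →ₗ[ℝ] E (C.target a)}

/-- Along rays, every solution of the three equations solves the transport equation. -/
lemma isTransport_of_maurerCartan_eq_zero (hA₀ : C.IsExpDomain A₀)
    (hfol : IsFoliatedOneForm (EM := EM) A₀ C.target φ) (hanc : IsAnchored L A₀ C.target φ)
    (hself : ∀ a ∈ A₀, φ a a.2 = (C.exp a).2) (nab : CovariantDerivative 𝓘(ℝ, EM) F E)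
    (hMC : ∀ a ∈ A₀, ∀ b, maurerCartan L nab C.target φ a a.2 b = 0)
    {a : TotalSpace F E} (ha : a ∈ A₀) (b : E a.1) (P : PartialFrame EM F E ι)
    (hP : ∀ t ∈ Icc (0 : ℝ) 1, C.baseCurve a t ∈ P.domain) :
    C.IsTransport P a b fun k s =>
      P.coord k (C.target ⟨a.1, s • a.2⟩) (φ ⟨a.1, s • a.2⟩ (s • b)) := by
  have ha1 := hA₀.one_mem a ha
  refine ⟨fun k => ?_, fun k => ?_, fun t ht => ?_, fun t ht f => ?_⟩
  · obtain ⟨β, rfl⟩ := exists_section_apply_eq (EM := EM) (F := F) b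
    have hl : ContMDiff 𝓘(ℝ, ℝ) (𝓘(ℝ, EM).prod 𝓘(ℝ, F)) ∞
        (fun s : ℝ => (⟨a.1, s • a.2⟩ : TotalSpace F E)) := by
      simpa only [zero_add] using contMDiff_line (EM := EM) (⟨a.1, 0⟩ : TotalSpace F E) a.2
    have h1 := (P.contMDiff_coord k).comp_contMDiffOn
      ((hfol β).comp hl.contMDiffOn fun s (hs : s ∈ Icc (0 : ℝ) 1) => hA₀.smul_mem a ha s hs)
    refine (continuousOn_id.mul h1.continuousOn).congr fun s _ => ?_
    simp only [map_smul, smul_eq_mul]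
    rfl
  · simp only [zero_smul, map_zero]
  · obtain ⟨z', hz', he⟩ := maurerCartan_smul_eq_zero_iff hA₀ hfol hanc hself nab ha b P
      ⟨ht.1, ht.2.le⟩ (hP t (Ioo_subset_Icc_self ht))
    exact ⟨z', hz', he.1 (hMC ⟨a.1, t • a.2⟩ (hA₀.smul_mem a ha t (Ioo_subset_Icc_self ht)) _)⟩
  · have htI := Ioo_subset_Icc_self ht
    have hx := target_smul ha1 htI
    have h1 := congrArg (dirDeriv f) (hanc _ (hA₀.smul_mem a ha t htI) (t • b))
    rw [dirDeriv_vertDeriv (one_mem_geodesicDomain_smul ha1 htI),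
      L.anchor_eq_sum P (by rw [hx]; exact hP t htI), dirDeriv_sum] at h1
    have h2 := partialSnd_geodesicFamily_smul (c := 1) (t := 1) ha1 b
      (f.contMDiff.comp (contMDiff_proj E)) (f.contMDiff.comp (contMDiff_proj E))
      (fun y => (one_mul _).symm) htI ⟨zero_le_one, le_rfl⟩
    rw [one_mul, mul_one] at h2
    simp only [dirDeriv_smul] at h1
    refine Eq.trans ?_ (h1.trans h2)
    refine Finset.sum_congr rfl fun k _ => ?_
    rw [← hx]
    rfl

/-- The one-form given by the variation equation solves the Maurer-Cartan equation. Since `A₀` is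
open, `a` lies in the interior of a ray in `A₀`, and the values of the one-form along this ray are
a solution of the variation equation. -/
lemma maurerCartan_expForm_eq_zero (hA₀ : C.IsExpDomain A₀)
    (hφ : ∀ a ∈ A₀, ∀ b, C.IsExpForm a b (φ a b)) (nab : CovariantDerivative 𝓘(ℝ, EM) F E)
    {a : TotalSpace F E} (ha : a ∈ A₀) (b : E a.1) :
    maurerCartan L nab C.target φ a a.2 b = 0 := by
  obtain ⟨r, hr, har⟩ : ∃ r : ℝ, r ∈ Ioo (0 : ℝ) 1 ∧
      (⟨a.1, r⁻¹ • a.2⟩ : TotalSpace F E) ∈ A₀ := by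
    have h1 : ContinuousAt (fun r : ℝ => (⟨a.1, a.2 + (r⁻¹ - 1) • a.2⟩ : TotalSpace F E)) 1 :=
      ContinuousAt.comp (f := fun r : ℝ => r⁻¹ - 1)
        (g := fun ε : ℝ => (⟨a.1, a.2 + ε • a.2⟩ : TotalSpace F E))
        (contMDiff_line (EM := EM) a a.2).continuous.continuousAt
        ((continuousAt_inv₀ one_ne_zero).sub_const 1)
    have h2 : ∀ r : ℝ, a.2 + (r⁻¹ - 1) • a.2 = r⁻¹ • a.2 := fun r => by module
    simp only [h2] at h1
    have h3 := h1.preimage_mem_nhds (hA₀.isOpen.mem_nhds (by simpa using ha))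
    obtain ⟨r, hr, hr1⟩ := Filter.nonempty_of_mem (inter_mem (mem_nhdsWithin_of_mem_nhds h3)
      (Ioo_mem_nhdsLT (zero_lt_one' ℝ)))
    exact ⟨r, hr1, hr⟩
  have hr0 : r ≠ 0 := hr.1.ne'
  suffices h : ∀ a' ∈ A₀, ∀ b' : E a'.1,
      maurerCartan L nab C.target φ ⟨a'.1, r • a'.2⟩ (r • a'.2) (r • b') = 0 by
    have h1 := h _ har (r⁻¹ • b)
    have h3 : ∀ c : E a.1, r • r⁻¹ • c = c := fun c => smul_inv_smul₀ hr0 c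
    rw [h3, h3] at h1
    exact h1
  clear b har ha a
  intro a ha b
  have ha1 := hA₀.one_mem a ha
  obtain ⟨N, P, V, hP, hV, -⟩ := hφ a ha b
  have hrI := Ioo_subset_Icc_self hr
  obtain ⟨z', hz', he⟩ := maurerCartan_smul_eq_zero_iff hA₀ (isFoliatedOneForm_expForm hA₀ hφ)
    (isAnchored_expForm hA₀ hφ) (fun a ha => expForm_apply_self hA₀ hφ ha) nab ha b P
    ⟨hr.1, hr.2.le⟩ (hP r hrI)
  refine he.2 ?_
  -- the values of the one-form along the ray
  have hval : ∀ s ∈ Icc (0 : ℝ) 1, φ ⟨a.1, s • a.2⟩ (s • b) =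
      ∑ k, V k s • P.sec k (C.target ⟨a.1, s • a.2⟩) := fun s hs => by
    have has := hA₀.smul_mem a ha s hs
    have hPs : ∀ t ∈ Icc (0 : ℝ) 1, C.baseCurve ⟨a.1, s • a.2⟩ t ∈ P.domain := fun t ht => by
      have hst : s * t ∈ Icc (0 : ℝ) 1 := ⟨mul_nonneg hs.1 ht.1, mul_le_one₀ hs.2 ht.1 ht.2⟩
      have h1 := congrArg TotalSpace.proj (C.geodesic_smul (mem_geodesicDomain ha1 hst)).2
      have h2 : C.baseCurve ⟨a.1, s • a.2⟩ t = C.baseCurve a (s * t) := h1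
      rw [h2]
      exact hP _ hst
    have h3 := (hφ _ has (s • b)).eq_sum hA₀ has hPs
      ((hV.smul ha1 hs).isTransport C (hA₀.one_mem _ has) hPs)
    simpa only [mul_one] using h3
  have hZ : ∀ k, ∀ s ∈ Icc (0 : ℝ) 1,
      P.coord k (C.target ⟨a.1, s • a.2⟩) (φ ⟨a.1, s • a.2⟩ (s • b)) =
        P.coord k (C.baseCurve a s) (∑ j, V j s • P.sec j (C.baseCurve a s)) := fun k s hs => by
    rw [hval s hs, target_smul ha1 hs]
  obtain ⟨-, -, htr, -⟩ := hV.isTransport C ha1 hP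
  obtain ⟨V', hV', heV⟩ := htr r hr
  set α : Cₛ^∞⟮𝓘(ℝ, EM); F, E⟯ :=
    ∑ i, P.coord i (C.baseCurve a r) (C.geodesic a r).2 • P.sec i with hα
  have hαr : α (C.baseCurve a r) = (C.geodesic a r).2 := by
    rw [hα, section_sum_smul_apply]
    exact P.sum_coord_smul (hP r hrI) _
  have hK : ∀ j, L.bracket α (P.sec j) (C.baseCurve a r) =
      ∑ i, P.coord i (C.baseCurve a r) (C.geodesic a r).2 •
        L.bracket (P.sec i) (P.sec j) (C.baseCurve a r) := fun j => by
    rw [hα, map_sum, LinearMap.sum_apply]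
    simp only [map_smul, LinearMap.smul_apply]
    rw [section_sum_smul_apply]
  have hγ : HasVelocityAt (C.baseCurve a) r
      (L.anchor (C.baseCurve a r) (α (C.baseCurve a r))) := by
    rw [hαr]
    exact (C.isGeodesicOn_geodesic a).1.hasVelocityAt (mem_geodesicDomain ha1 hrI)
  obtain ⟨z, hz, hez⟩ := (L.isDerivationAt_bracket α (C.baseCurve a r)).sum_deriv_coord_eq hγ P
    (hP r hrI) P.sec hV' (u := fun s => ∑ j, V j s • P.sec j (C.baseCurve a s))
    (Eventually.of_forall fun _ => rfl)
  have hzz : z' = z := funext fun k => by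
    refine (hz' k).unique ((hz k).congr_of_eventuallyEq ?_)
    filter_upwards [Icc_mem_nhds hr.1 hr.2] with s hs using hZ k s hs
  subst hzz
  have hswap : ∀ y : Fin N → ℝ, ∑ j, y j • L.bracket α (P.sec j) (C.baseCurve a r) =
      ∑ i, ∑ j, (P.coord i (C.baseCurve a r) (C.geodesic a r).2 * y j) •
        L.bracket (P.sec i) (P.sec j) (C.baseCurve a r) := fun y => by
    rw [Finset.sum_comm]
    refine Finset.sum_congr rfl fun j _ => ?_
    rw [hK, Finset.smul_sum]
    exact Finset.sum_congr rfl fun i _ => by rw [smul_smul, mul_comm]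
  rw [Finset.sum_add_distrib, Finset.sum_add_distrib, hswap, hswap, heV] at hez
  simp only [hZ _ r hrI]
  exact hez

end AConnection

end Existence

end PreLie

theorem mainTheorem3
    {EM : Type*} [NormedAddCommGroup EM] [NormedSpace ℝ EM] [FiniteDimensional ℝ EM]
    {M : Type*} [TopologicalSpace M] [T2Space M] [SigmaCompactSpace M]
    [ChartedSpace EM M] [IsManifold 𝓘(ℝ, EM) ∞ M]
    {F : Type*} [NormedAddCommGroup F] [NormedSpace ℝ F] [FiniteDimensional ℝ F]
    {E : M → Type*} [TopologicalSpace (TotalSpace F E)]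
    [∀ x, AddCommGroup (E x)] [∀ x, Module ℝ (E x)] [∀ x, TopologicalSpace (E x)]
    [∀ x, IsTopologicalAddGroup (E x)] [∀ x, ContinuousSMul ℝ (E x)]
    [FiberBundle F E] [VectorBundle ℝ F E] [ContMDiffVectorBundle ∞ F E 𝓘(ℝ, EM)]
    (L : PreLie.PreLieAlgebroid EM F E) (C : PreLie.AConnection L)
    (A₀ : Set (TotalSpace F E)) (hA₀ : C.IsExpDomain A₀) :
    ∃ φ : (a : TotalSpace F E) → E a.1 →ₗ[ℝ] E (C.target a),
      -- existence; the auxiliary connection is arbitrary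
      PreLie.IsFoliatedOneForm (EM := EM) A₀ C.target φ ∧
      (∀ nab : CovariantDerivative 𝓘(ℝ, EM) F E,
        CovariantDerivative.ContMDiffCovariantDerivative nab ∞ →
        ∀ a ∈ A₀, ∀ b : E a.1, PreLie.maurerCartan L nab C.target φ a a.2 b = 0) ∧
      PreLie.IsAnchored L A₀ C.target φ ∧
      (∀ a ∈ A₀, φ a a.2 = (C.exp a).2) ∧
      -- uniqueness, for each choice of the auxiliary connection
      (∀ nab : CovariantDerivative 𝓘(ℝ, EM) F E,
        CovariantDerivative.ContMDiffCovariantDerivative nab ∞ →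
        ∀ φ' : (a : TotalSpace F E) → E a.1 →ₗ[ℝ] E (C.target a),
          PreLie.IsFoliatedOneForm (EM := EM) A₀ C.target φ' →
          (∀ a ∈ A₀, ∀ b : E a.1, PreLie.maurerCartan L nab C.target φ' a a.2 b = 0) →
          PreLie.IsAnchored L A₀ C.target φ' →
          (∀ a ∈ A₀, φ' a a.2 = (C.exp a).2) →
          ∀ a ∈ A₀, φ' a = φ a) ∧
      -- the solution is pointwise an isomorphism near the zero section
      (∃ U : Set (TotalSpace F E), IsOpen U ∧ U ⊆ A₀ ∧
        (∀ x : M, (⟨x, 0⟩ : TotalSpace F E) ∈ U) ∧ ∀ a ∈ U, Function.Bijective (φ a)) ∧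
      -- the explicit formula
      (∀ a ∈ A₀, ∀ b : E a.1,
        (∃ δ ξ, C.IsGeodesicExtension A₀ a b δ ξ) ∧
        ∀ δ ξ, C.IsGeodesicExtension A₀ a b δ ξ →
          (∃ ψ, PreLie.IsInfinitesimalFlow L (fun t => ξ t 0) (Icc 0 1) (C.baseCurve a) ψ) ∧
          ∀ ψ, PreLie.IsInfinitesimalFlow L (fun t => ξ t 0) (Icc 0 1) (C.baseCurve a) ψ →
            PreLie.HasIntegral
              (fun t => ψ 1 t (deriv (fun ε => ξ t ε (C.baseCurve a t)) 0)) (φ a b)) := by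
  obtain ⟨φ, hφ⟩ := PreLie.AConnection.exists_expForm hA₀
  refine ⟨φ, PreLie.AConnection.isFoliatedOneForm_expForm hA₀ hφ,
    fun nab _ a ha b => PreLie.AConnection.maurerCartan_expForm_eq_zero hA₀ hφ nab ha b,
    PreLie.AConnection.isAnchored_expForm hA₀ hφ,
    fun a ha => PreLie.AConnection.expForm_apply_self hA₀ hφ ha,
    fun nab _ φ' hfol hMC hanc hself a ha => ?_,
    PreLie.AConnection.exists_bijective_expForm hA₀ hφ, fun a ha b => ?_⟩
  · have ha1 := hA₀.one_mem a ha
    obtain ⟨N, P, hP⟩ := C.exists_frame_baseCurve ha1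
    ext b
    rw [(hφ a ha b).eq_sum hA₀ ha hP (PreLie.AConnection.isTransport_of_maurerCartan_eq_zero hA₀
      hfol hanc hself nab hMC ha b P hP)]
    have h : ∀ v : E a.1, v = a.2 → ∀ k,
        P.coord k (C.target ⟨a.1, v⟩) (φ' ⟨a.1, v⟩ ((1 : ℝ) • b)) =
          P.coord k (C.target a) (φ' a b) := by
      rintro _ rfl k
      rw [one_smul]
    simp only [h _ (one_smul ℝ a.2)]
    exact (P.sum_coord_smul (hP 1 ⟨zero_le_one, le_rfl⟩) _).symm
  · have ha1 := hA₀.one_mem a ha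
    refine ⟨C.exists_isGeodesicExtension hA₀ ha b, fun δ ξ hξ =>
      ⟨hξ.exists_isInfinitesimalFlow ha1, fun ψ hψ => ?_⟩⟩
    obtain ⟨N, P, V, hP, hV, hw⟩ := hφ a ha b
    rw [hw]
    exact hξ.hasIntegral ha1 P hP (hV.isTransport C ha1 hP) hψ
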